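/- Let $1\le d\le 3$, $T>0$, let $\Omega\subset\mathbb R^d$ be a bounded domain with smooth boundary and outward unit normal $n$, let $V,W,\psi:\mathbb R^d\to\mathbb R$ be smooth, with $W,\psi$ even. **System.** For $\rho\ge 0$, $u$, $\Phi_\rho$ on $(0,T)\times\Omega$ consider $$\partial_t\rho+\operatorname{div}(\rho u)=0,\qquad -\Delta\Phi_\rho=\rho-M_\rho,\qquad M_\rho=\frac1{|\Omega|}\int_\Omega\rho\,dx,$$ $$\partial_t(\rho u)+\operatorname{div}(\rho u\otimes u)=-\rho\nabla\Phi_\rho-\rho\nabla V-\rho\nabla(W\star\rho)+\rho\int_\Omega\psi(x-y)\rho(t,y)\big(u(t,y)-u(t,x)\big)\,dy,$$ with $u\cdot n=\nabla\Phi_\rho\cdot n=0$ on $(0,T)\times\partial\Omega$, where $(W\star\rho)(x)=\int_\Omega W(x-y)\rho(y)\,dy$. A strong solution is a triple $(r,U,\Phi_r)$ with $r\in C^1([0,T)\times\overline\Omega;(0,\infty))$, $U\in C^1([0,T)\times\overline\Omega;\mathbb R^d)$, $\Phi_r\in C^2([0,T)\times\overline\Omega)$ that satisfies the system and the boundary conditions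 pointwise. **Measure-valued states.** Let $Y=[0,\infty)\times\mathbb R^d\times\mathbb R^d\ni(s,v,F)$. Let $\nu=(\nu_{t,x})$ be a weakly-$*$ measurable family of non-negative measures on $Y$ with $\nu_{t,x}(Y)\le1$, and let $m^\rho,m^{\rho|u|^2},m^{|\nabla\Phi|^2}\in L^\infty(0,T;\mathcal M^+(\overline\Omega))$, $m^{\rho u}\in L^\infty(0,T;\mathcal M(\overline\Omega)^d)$, $m^{\rho u\otimes u},m^{\nabla\Phi\otimes\nabla\Phi}\in L^\infty(0,T;\mathcal M(\overline\Omega)^{d\times d})$. It is required that there are measurable $z_k:(0,T)\times\Omega\to Y$ such that $s+s|v|^2+|F|^2$ evaluated along $z_k$ is bounded in $L^1((0,T)\times\Omega)$ uniformly in $k$; that $z_k$ generates $\nu$, i.e. $f(z_k)\rightharpoonup^*\langle\nu_{t,x};f\rangle$ in $L^\infty((0,T)\times\Omega)$ for all $f\in C_0(Y)$; and that for $f=s,\ sv,\ sv\otimes v,\ s|v|^2,\ |F|^2,\ F\otimes F$ the corresponding measure $m^f=m^f_t\otimes dt$ is the concentration measure $$m^f=\Big(\lim_{k}f(z_k)\Big)-\langle\nu;f\rangle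 ,$$ the limit being weak-$*$ against $C([0,T]\times\overline\Omega)$. For these $f$ write $\overline f(t)=\langle\nu_{t,x};f\rangle\,dx+m^f_t$, a measure on $\overline\Omega$ for a.e. $t$ (thus $\overline\rho,\overline{\rho u},\overline{\rho u\otimes u},\overline{\rho|u|^2},\overline{|\nabla\Phi|^2},\overline{\nabla\Phi\otimes\nabla\Phi}$). An initial state $(\nu_{0,x},m_0)$ gives $\overline f(0)$ likewise, and $M=\overline\rho(0)(\overline\Omega)/|\Omega|$. Below, spatial integrals of barred quantities are integrals over $\overline\Omega$ against these measures. **Dissipative measure-valued solution.** Such a family is a dissipative measure-valued solution with the given initial state if for a.e. $\tau\in(0,T)$: 1. for all $\eta\in C^1([0,T]\times\overline\Omega)$: $\int\overline\rho(\tau)\eta(\tau)-\int\overline\rho(0)\eta(0)=\int_0^\tau\!\int[\overline\rho\,\partial_t\eta+\overline{\rho u}\cdot\nabla\eta]\,dt$; 2. for all $\varphi\in C^1([0,T]\times\overline\Omega;\mathbb R^d)$ with $\varphi\cdot n=0$ on $\partial\Omega$: $$\int\overline{\rho u}(\tau)\cdot\varphi(\tau)-\int\overline{\rho u}(0)\cdot\varphi(0)=\int_0^\tau\!\!\int\Big[\overline{\rho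 u}\cdot\partial_t\varphi+\overline{\rho u\otimes u}:\nabla\varphi-\overline\rho\,\nabla V\cdot\varphi+\tfrac12\overline{|\nabla\Phi|^2}\operatorname{div}\varphi-\overline{\nabla\Phi\otimes\nabla\Phi}:\nabla\varphi\Big]dt$$ $$-M\int_0^\tau\!\!\int_\Omega\langle\nu;F\rangle\cdot\varphi\,dx\,dt+\int_0^\tau\!\!\int\Big[-\overline\rho\,(\nabla W\star\overline\rho)+\overline\rho\,(\psi\star\overline{\rho u})-\overline{\rho u}\,(\psi\star\overline\rho)\Big]\cdot\varphi\,dt;$$ 3. for all $\theta\in C^1(\overline\Omega)$: $\int_\Omega\langle\nu_{\tau,x};F\rangle\cdot\nabla\theta\,dx=\int\overline\rho(\tau)\,\theta-M\int_\Omega\theta\,dx$; moreover $\langle\nu;F\rangle=\nabla\Psi$ a.e. for some $\Psi\in L^2(0,T;W^{1,2}(\Omega))$; 4. $\mathcal E(\tau)\le\mathcal E(0)-\int_0^\tau\!\iint\psi(x-y)\big[\overline{\rho|u|^2}(t,x)\,\overline\rho(t,y)-\overline{\rho u}(t,x)\cdot\overline{\rho u}(t,y)\big]dt$, where $\mathcal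 E=\int\tfrac12\overline{\rho|u|^2}+\tfrac12\overline{|\nabla\Phi|^2}+\overline\rho V+\tfrac12\overline\rho\,(W\star\overline\rho)$. **Theorem.** Let $(r,U,\Phi_r)$ be a strong solution and let $(\nu,m)$ be a dissipative measure-valued solution whose initial state has no concentrations ($m_0=0$) and satisfies $\nu_{0,x}=\delta_{(r(0,x),U(0,x),\nabla\Phi_r(0,x))}$ for a.e. $x\in\Omega$. Then $m^{\nabla\Phi\otimes\nabla\Phi}=0$ and $m^{|\nabla\Phi|^2}=0$, and, as measures on $\overline\Omega$ for a.e. $t\in(0,T)$, $$\overline\rho=r\,dx,\qquad\overline{\rho u}=rU\,dx,\qquad\overline{\rho u\otimes u}=rU\otimes U\,dx,\qquad\overline{\rho|u|^2}=r|U|^2\,dx .$$ Furthermore there is a weakly-$*$ measurable family $\bar\nu_{t,x}$ of non-negative measures on $[0,\infty)\times\mathbb R^d$ of mass at most one with $$\nu_{t,x}=\bar\nu_{t,x}\otimes\delta_{\nabla\Phi_r(t,x)}\quad\text{for a.e. }(t,x)\in(0,T)\times\Omega,$$ and a weakly-$*$ measurable family $\bar{\bar\nu}_{t,x}$ of non-negative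 measures on $(0,\infty)$ of mass at most one with $$\bar\nu_{t,x}\llcorner\big((0,\infty)\times\mathbb R^d\big)=\bar{\bar\nu}_{t,x}\otimes\delta_{U(t,x)}\quad\text{for a.e. }(t,x)\in(0,T)\times\Omega.$$ Finally, for a.e. $t$ the measures $m^\rho_t,\ m^{\rho u}_t,\ m^{\rho u\otimes u}_t,\ m^{\rho|u|^2}_t$ are absolutely continuous with respect to Lebesgue measure. -/

import Mathlib

open MeasureTheory Set Filter Topology
open scoped NNReal ENNReal ContDiff ZeroAtInfty

noncomputable section

namespace EulerAlignment

/-- The physical space `ℝᵈ` with its Euclidean norm. -/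
abbrev Sp (d : ℕ) : Type := EuclideanSpace ℝ (Fin d)

/-- The phase space `[0,∞) × ℝᵈ × ℝᵈ`; its points `((s, v), F)` stand for the values of
density, velocity and gradient of the potential. -/
abbrev Phase (d : ℕ) : Type := (ℝ≥0 × Sp d) × Sp d

section Domain

variable {d : ℕ}

/-- `g` is a smooth defining function of `Ω` near the boundary point `x`. -/
def IsDefiningFunction (Ω : Set (Sp d)) (x : Sp d) (g : Sp d → ℝ) : Prop :=
  ContDiff ℝ ∞ g ∧ g x = 0 ∧ gradient g x ≠ 0 ∧ ∀ᶠ y in 𝓝 x, (y ∈ Ω ↔ g y < 0)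

/-- Bounded domain with smooth boundary, lying locally on one side of its boundary. -/
structure IsBoundedSmoothDomain (Ω : Set (Sp d)) : Prop where
  isOpen : IsOpen Ω
  isConnected : IsConnected Ω
  isBounded : Bornology.IsBounded Ω
  smooth_boundary : ∀ x ∈ frontier Ω, ∃ g, IsDefiningFunction Ω x g

/-- `n` is the outward unit normal to `∂Ω` at `x`. -/
def IsOuterNormal (Ω : Set (Sp d)) (x n : Sp d) : Prop :=
  ∃ g, IsDefiningFunction Ω x g ∧ n = ‖gradient g x‖⁻¹ • gradient g x

/-- The vector field `w` satisfies `w · n = 0` on `∂Ω`. -/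
def IsTangential (Ω : Set (Sp d)) (w : Sp d → Sp d) : Prop :=
  ∀ x ∈ frontier Ω, ∀ n, IsOuterNormal Ω x n → inner ℝ (w x) n = 0

/-- Partial derivative `∂ᵢ f (x)` of a function on `ℝᵈ`. -/
def pd (f : Sp d → ℝ) (i : Fin d) (x : Sp d) : ℝ :=
  fderiv ℝ f x (EuclideanSpace.single i 1)

/-- Partial derivative `∂ᵢ f (x)` of a function on `closure Ω`; it is the classical one in `Ω`
and its continuous extension on `∂Ω` when `f` is `C¹` up to the boundary. -/
def pdOn (Ω : Set (Sp d)) (f : Sp d → ℝ) (i : Fin d) (x : Sp d) : ℝ :=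
  fderivWithin ℝ f (closure Ω) x (EuclideanSpace.single i 1)

/-- Gradient of a function on `closure Ω`. -/
def gradOn (Ω : Set (Sp d)) (f : Sp d → ℝ) (x : Sp d) : Sp d :=
  WithLp.toLp 2 fun i => pdOn Ω f i x

/-- The space-time cylinder `(0,T) × Ω`. -/
def cyl (T : ℝ) (Ω : Set (Sp d)) : Set (ℝ × Sp d) := Ioo 0 T ×ˢ Ω

end Domain

section Strong

variable {d : ℕ}

/-- `(r, U, Φ)` is a strong solution with positive density, `C¹` (`C²` for the potential) on
`[0,T) × closure Ω`, of the system
`∂ₜr + div(rU) = 0`,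
`∂ₜ(rU) + div(rU ⊗ U) = - r∇Φ - r∇V - r∇(W ⋆ r) + r ∫_Ω ψ(x-y) r(y) (U(y) - U(x)) dy`,
`-ΔΦ = r - M_r`, with `U · n = ∇Φ · n = 0` on `∂Ω`, where `M_r` is the space average of `r`. -/
structure IsStrongSolution (T : ℝ) (Ω : Set (Sp d)) (V W ψ : Sp d → ℝ)
    (r : ℝ → Sp d → ℝ) (U : ℝ → Sp d → Sp d) (Φ : ℝ → Sp d → ℝ) : Prop where
  density_C1 : ContDiffOn ℝ 1 (fun p : ℝ × Sp d => r p.1 p.2) (Ico 0 T ×ˢ closure Ω)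
  velocity_C1 : ContDiffOn ℝ 1 (fun p : ℝ × Sp d => U p.1 p.2) (Ico 0 T ×ˢ closure Ω)
  potential_C2 : ContDiffOn ℝ 2 (fun p : ℝ × Sp d => Φ p.1 p.2) (Ico 0 T ×ˢ closure Ω)
  density_pos : ∀ t ∈ Ico 0 T, ∀ x ∈ closure Ω, 0 < r t x
  continuity : ∀ t ∈ Ioo 0 T, ∀ x ∈ Ω,
    deriv (fun s => r s x) t + ∑ j, pd (fun y => r t y * U t y j) j x = 0
  momentum : ∀ t ∈ Ioo 0 T, ∀ x ∈ Ω, ∀ i,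
    deriv (fun s => r s x * U s x i) t + ∑ j, pd (fun y => r t y * U t y i * U t y j) j x
      = - r t x * pd (Φ t) i x - r t x * pd V i x
        - r t x * pd (fun z => ∫ y in Ω, W (z - y) * r t y) i x
        + r t x * ∫ y in Ω, ψ (x - y) * r t y * (U t y i - U t x i)
  poisson : ∀ t ∈ Ioo 0 T, ∀ x ∈ Ω,
    - ∑ i, pd (pd (Φ t) i) i x = r t x - (∫ y in Ω, r t y) / volume.real Ω
  velocity_tangential : ∀ t ∈ Ioo 0 T, IsTangential Ω (U t)
  field_tangential : ∀ t ∈ Ioo 0 T, IsTangential Ω (gradOn Ω (Φ t))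

end Strong

section Measures

variable {d : ℕ}

/-- Parameterised measures in `L^∞_weak((0,T) × Ω; M⁺(Z))` with total mass at most one: weakly-*
measurable families of non-negative measures (Young measures, possibly with loss of mass). -/
structure IsParamMeasure {Z : Type*} [TopologicalSpace Z] [MeasurableSpace Z]
    (T : ℝ) (Ω : Set (Sp d)) (ν : ℝ → Sp d → Measure Z) : Prop where
  measurable : ∀ f : C₀(Z, ℝ),
    AEStronglyMeasurable (fun p : ℝ × Sp d => ∫ z, f z ∂(ν p.1 p.2)) (volume.restrict (cyl T Ω))
  mass_le : ∀ᵐ p ∂(volume.restrict (cyl T Ω)), ν p.1 p.2 univ ≤ 1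

/-- The space `L^∞(0,T; M(closure Ω))`: weakly-* measurable, essentially bounded families of finite
signed measures carried by `closure Ω`. -/
structure IsMeasureFamily (T : ℝ) (Ω : Set (Sp d)) (m : ℝ → SignedMeasure (Sp d)) : Prop where
  carried : ∀ᵐ t ∂(volume.restrict (Ioo 0 T)), (m t).totalVariation (closure Ω)ᶜ = 0
  measurable : ∀ φ : C(Sp d, ℝ),
    AEStronglyMeasurable (fun t => ∫ᵛ x, φ x ∂•(m t)) (volume.restrict (Ioo 0 T))
  bounded : ∃ C : ℝ≥0, ∀ᵐ t ∂(volume.restrict (Ioo 0 T)), (m t).totalVariation univ ≤ C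

/-- The space `L^∞(0,T; M⁺(closure Ω))`. -/
def IsNonnegMeasureFamily (T : ℝ) (Ω : Set (Sp d)) (m : ℝ → SignedMeasure (Sp d)) : Prop :=
  IsMeasureFamily T Ω m ∧ ∀ᵐ t ∂(volume.restrict (Ioo 0 T)), 0 ≤ m t

/-- The sequence `z` generates the Young measure `ν`: `f(zₙ) ⇀* ⟨ν; f⟩` in `L^∞((0,T) × Ω)` for
every `f ∈ C₀`. -/
def GeneratesYoung (T : ℝ) (Ω : Set (Sp d)) (z : ℕ → ℝ × Sp d → Phase d)
    (ν : ℝ → Sp d → Measure (Phase d)) : Prop :=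
  ∀ f : C₀(Phase d, ℝ), ∀ g : ℝ × Sp d → ℝ, IntegrableOn g (cyl T Ω) →
    Tendsto (fun n => ∫ p in cyl T Ω, g p * f (z n p)) atTop
      (𝓝 (∫ p in cyl T Ω, g p * ∫ y, f y ∂(ν p.1 p.2)))

/-- `m` (as the space-time measure `m_t ⊗ dt`) is the concentration measure
`m^f = (weak-* limit of f(zₙ)) - ⟨ν; f⟩` of the nonlinearity `f`. -/
def IsConcentrationMeasure (T : ℝ) (Ω : Set (Sp d)) (z : ℕ → ℝ × Sp d → Phase d)
    (ν : ℝ → Sp d → Measure (Phase d)) (f : Phase d → ℝ) (m : ℝ → SignedMeasure (Sp d)) : Prop :=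
  ∀ φ : C(ℝ × Sp d, ℝ),
    Tendsto (fun n => ∫ p in cyl T Ω, φ p * f (z n p)) atTop
      (𝓝 ((∫ p in cyl T Ω, φ p * ∫ y, f y ∂(ν p.1 p.2))
        + ∫ t in Ioo 0 T, ∫ᵛ x, φ (t, x) ∂•(m t)))

/-- `s` -/
def fRho (y : Phase d) : ℝ := y.1.1
/-- `s vᵢ` -/
def fMom (i : Fin d) (y : Phase d) : ℝ := y.1.1 * y.1.2 i
/-- `s vᵢ vⱼ` -/
def fConv (i j : Fin d) (y : Phase d) : ℝ := y.1.1 * (y.1.2 i * y.1.2 j)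
/-- `s |v|²` -/
def fKin (y : Phase d) : ℝ := y.1.1 * ‖y.1.2‖ ^ 2
/-- `|F|²` -/
def fPot (y : Phase d) : ℝ := ‖y.2‖ ^ 2
/-- `Fᵢ Fⱼ` -/
def fStress (i j : Fin d) (y : Phase d) : ℝ := y.2 i * y.2 j

/-- A measure-valued state at a fixed time: a Young measure `ν` in the phase variables and the
concentration measures of `ρ`, `ρu`, `ρu ⊗ u`, `ρ|u|²`, `|∇Φ|²`, `∇Φ ⊗ ∇Φ`. -/
structure MVState (d : ℕ) where
  ν : Sp d → Measure (Phase d)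
  mRho : SignedMeasure (Sp d)
  mMom : Fin d → SignedMeasure (Sp d)
  mConv : Fin d → Fin d → SignedMeasure (Sp d)
  mKin : SignedMeasure (Sp d)
  mPot : SignedMeasure (Sp d)
  mStress : Fin d → Fin d → SignedMeasure (Sp d)

/-- The barred quantity `⟨ν_x; f⟩ dx + m`, a signed measure. -/
def bar (Ω : Set (Sp d)) (ν : Sp d → Measure (Phase d)) (f : Phase d → ℝ)
    (m : SignedMeasure (Sp d)) : SignedMeasure (Sp d) :=
  (volume.restrict Ω).withDensityᵥ (fun x => ∫ y, f y ∂(ν x)) + m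

namespace MVState

variable (S : MVState d) (Ω : Set (Sp d))

def rho : SignedMeasure (Sp d) := bar Ω S.ν fRho S.mRho
def mom (i : Fin d) : SignedMeasure (Sp d) := bar Ω S.ν (fMom i) (S.mMom i)
def conv (i j : Fin d) : SignedMeasure (Sp d) := bar Ω S.ν (fConv i j) (S.mConv i j)
def kin : SignedMeasure (Sp d) := bar Ω S.ν fKin S.mKin
def pot : SignedMeasure (Sp d) := bar Ω S.ν fPot S.mPot
def stress (i j : Fin d) : SignedMeasure (Sp d) := bar Ω S.ν (fStress i j) (S.mStress i j)

/-- The mean field `⟨ν_x; Fᵢ⟩`. -/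
def field (i : Fin d) (x : Sp d) : ℝ := ∫ y, y.2 i ∂(S.ν x)

/-- All concentration measures vanish. -/
def NoConcentration : Prop :=
  S.mRho = 0 ∧ S.mMom = 0 ∧ S.mConv = 0 ∧ S.mKin = 0 ∧ S.mPot = 0 ∧ S.mStress = 0

/-- Space average of the density. -/
def avg : ℝ := S.rho Ω univ / volume.real Ω

/-- Total energy `∫ ½ ρ|u|² + ½ |∇Φ|² + ρ V + ½ ρ (W ⋆ ρ)` of the barred quantities. -/
def energy (V W : Sp d → ℝ) : ℝ :=
  S.kin Ω univ / 2 + S.pot Ω univ / 2 + (∫ᵛ x, V x ∂•(S.rho Ω))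
    + (∫ᵛ x, (∫ᵛ y, W (x - y) ∂•(S.rho Ω)) ∂•(S.rho Ω)) / 2

/-- Alignment dissipation
`∬ ψ(x-y) [ρ|u|²(x) ρ(y) - ρu(x) · ρu(y)]` of the barred quantities. -/
def dissipation (ψ : Sp d → ℝ) : ℝ :=
  (∫ᵛ x, (∫ᵛ y, ψ (x - y) ∂•(S.rho Ω)) ∂•(S.kin Ω))
    - ∑ i, ∫ᵛ x, (∫ᵛ y, ψ (x - y) ∂•(S.mom Ω i)) ∂•(S.mom Ω i)

/-- The right-hand side at a fixed time of the weak momentum equation with test field `φ`, whose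
time derivative is `φ'`; `M` is the average of the density. -/
def momentumRHS (V W ψ : Sp d → ℝ) (M : ℝ) (φ φ' : Sp d → Sp d) : ℝ :=
  (∑ i, ∫ᵛ x, φ' x i ∂•(S.mom Ω i))
    + (∑ i, ∑ j, ∫ᵛ x, pdOn Ω (fun y => φ y i) j x ∂•(S.conv Ω i j))
    - (∫ᵛ x, (∑ i, pd V i x * φ x i) ∂•(S.rho Ω))
    + (∫ᵛ x, (∑ i, pdOn Ω (fun y => φ y i) i x) ∂•(S.pot Ω)) / 2
    - (∑ i, ∑ j, ∫ᵛ x, pdOn Ω (fun y => φ y i) j x ∂•(S.stress Ω i j))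
    - M * (∫ x in Ω, ∑ i, S.field i x * φ x i)
    - (∑ i, ∫ᵛ x, ((∫ᵛ y, pd W i (x - y) ∂•(S.rho Ω)) * φ x i) ∂•(S.rho Ω))
    + (∑ i, ∫ᵛ x, ((∫ᵛ y, ψ (x - y) ∂•(S.mom Ω i)) * φ x i) ∂•(S.rho Ω))
    - (∑ i, ∫ᵛ x, ((∫ᵛ y, ψ (x - y) ∂•(S.rho Ω)) * φ x i) ∂•(S.mom Ω i))

end MVState

/-- `G` is the weak gradient of `Ψ`: `G = ∇Ψ` in the sense of distributions on `Ω`. -/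
def IsWeakGradient (Ω : Set (Sp d)) (Ψ : Sp d → ℝ) (G : Fin d → Sp d → ℝ) : Prop :=
  ∀ χ : Sp d → ℝ, ContDiff ℝ ∞ χ → HasCompactSupport χ → tsupport χ ⊆ Ω →
    ∀ i, ∫ x in Ω, Ψ x * pd χ i x = - ∫ x in Ω, G i x * χ x

/-- `S` consists of a Young measure and of the concentration measures of the relevant
nonlinearities, all generated by one sequence `z` of measurable functions with values in phase
space, along which `ρ`, `ρ|u|²` and `|∇Φ|²` are bounded in `L¹((0,T) × Ω)`. -/
def IsGenerated (T : ℝ) (Ω : Set (Sp d)) (S : ℝ → MVState d) : Prop :=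
  ∃ z : ℕ → ℝ × Sp d → Phase d,
    (∀ n, AEMeasurable (z n) (volume.restrict (cyl T Ω))) ∧
    (∃ C : ℝ≥0, ∀ n, ∫⁻ p in cyl T Ω,
      ENNReal.ofReal (fRho (z n p) + fKin (z n p) + fPot (z n p)) ≤ C) ∧
    GeneratesYoung T Ω z (fun t => (S t).ν) ∧
    IsConcentrationMeasure T Ω z (fun t => (S t).ν) fRho (fun t => (S t).mRho) ∧
    (∀ i, IsConcentrationMeasure T Ω z (fun t => (S t).ν) (fMom i) (fun t => (S t).mMom i)) ∧
    (∀ i j, IsConcentrationMeasure T Ω z (fun t => (S t).ν) (fConv i j)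
      (fun t => (S t).mConv i j)) ∧
    IsConcentrationMeasure T Ω z (fun t => (S t).ν) fKin (fun t => (S t).mKin) ∧
    IsConcentrationMeasure T Ω z (fun t => (S t).ν) fPot (fun t => (S t).mPot) ∧
    (∀ i j, IsConcentrationMeasure T Ω z (fun t => (S t).ν) (fStress i j)
      (fun t => (S t).mStress i j))

/-- Dissipative measure-valued solution on `(0,T) × Ω` with initial state `S₀`. The test fields in
the momentum equation only have to be tangential on `∂Ω`, as befits the impermeability
condition; admitting all `C¹` fields would give fewer solutions. -/
structure IsDissipativeMVSolution (T : ℝ) (Ω : Set (Sp d)) (V W ψ : Sp d → ℝ)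
    (S₀ : MVState d) (S : ℝ → MVState d) : Prop where
  young : IsParamMeasure T Ω (fun t => (S t).ν)
  mRho_mem : IsNonnegMeasureFamily T Ω (fun t => (S t).mRho)
  mMom_mem : ∀ i, IsMeasureFamily T Ω (fun t => (S t).mMom i)
  mConv_mem : ∀ i j, IsMeasureFamily T Ω (fun t => (S t).mConv i j)
  mKin_mem : IsNonnegMeasureFamily T Ω (fun t => (S t).mKin)
  mPot_mem : IsNonnegMeasureFamily T Ω (fun t => (S t).mPot)
  mStress_mem : ∀ i j, IsMeasureFamily T Ω (fun t => (S t).mStress i j)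
  generated : IsGenerated T Ω S
  continuity : ∀ᵐ τ ∂(volume.restrict (Ioo 0 T)), ∀ η : ℝ → Sp d → ℝ,
    ContDiffOn ℝ 1 (fun p : ℝ × Sp d => η p.1 p.2) (Icc 0 T ×ˢ closure Ω) →
    (∫ᵛ x, η τ x ∂•((S τ).rho Ω)) - (∫ᵛ x, η 0 x ∂•(S₀.rho Ω))
      = ∫ t in Ioo 0 τ,
          ((∫ᵛ x, derivWithin (fun s => η s x) (Icc 0 T) t ∂•((S t).rho Ω))
            + ∑ i, ∫ᵛ x, pdOn Ω (η t) i x ∂•((S t).mom Ω i))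
  momentum : ∀ᵐ τ ∂(volume.restrict (Ioo 0 T)), ∀ φ : ℝ → Sp d → Sp d,
    ContDiffOn ℝ 1 (fun p : ℝ × Sp d => φ p.1 p.2) (Icc 0 T ×ˢ closure Ω) →
    (∀ t ∈ Icc 0 T, IsTangential Ω (φ t)) →
    (∑ i, ∫ᵛ x, φ τ x i ∂•((S τ).mom Ω i)) - (∑ i, ∫ᵛ x, φ 0 x i ∂•(S₀.mom Ω i))
      = ∫ t in Ioo 0 τ, (S t).momentumRHS Ω V W ψ (S₀.avg Ω) (φ t)
          (fun x => derivWithin (fun s => φ s x) (Icc 0 T) t)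
  poisson : ∀ᵐ τ ∂(volume.restrict (Ioo 0 T)), ∀ θ : Sp d → ℝ,
    ContDiffOn ℝ 1 θ (closure Ω) →
    ∫ x in Ω, ∑ i, (S τ).field i x * pdOn Ω θ i x
      = (∫ᵛ x, θ x ∂•((S τ).rho Ω)) - S₀.avg Ω * ∫ x in Ω, θ x
  field_gradient : ∃ Ψ : ℝ → Sp d → ℝ,
    MemLp (fun p : ℝ × Sp d => Ψ p.1 p.2) 2 (volume.restrict (cyl T Ω)) ∧
    (∀ i, MemLp (fun p : ℝ × Sp d => (S p.1).field i p.2) 2 (volume.restrict (cyl T Ω))) ∧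
    ∀ᵐ t ∂(volume.restrict (Ioo 0 T)), IsWeakGradient Ω (Ψ t) ((S t).field)
  energy_inequality : ∀ᵐ τ ∂(volume.restrict (Ioo 0 T)),
    (S τ).energy Ω V W ≤ S₀.energy Ω V W - ∫ t in Ioo 0 τ, (S t).dissipation Ω ψ

end Measures

end EulerAlignment

end

open EulerAlignment

/-!
The proof is a relative energy argument. The relative energy `relEnergy` of the measure-valued
solution with respect to the strong solution is the integral of `|v - U|²` against the density plus
that of `|F - ∇Φ|²`, both including concentration measures. It vanishes initially, and the claim
is that it stays zero.

*Relative energy inequality* (`IsStrongSolution.relEnergy_le`). Expand the squares. The energy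
inequality bounds the quadratic part; the momentum equation tested with `U` and the continuity
equation tested with `½|U|² - V - Φ` give the parts that are linear in the solution. The
interaction energy is quadratic in the density, and its balance (`interaction_balance`) is derived
from the continuity equation: the error made over a short time interval is quadratic in the
increment of a continuous monotone function, and such errors do not accumulate
(`eq_of_abs_sub_le_sq`). The result bounds `relEnergy` by the time integral of `relRate`.

*Estimate of the rate* (`relRate_le`). The convective terms are quadratic in `v - U`. The field
terms become quadratic in `F - ∇Φ` (`fieldRate_le`) after two integrations by parts that use only
that the mean field is a weak gradient and that `∇Φ` and `U` are tangential to the boundary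
(`IsWeakGradient.integral_tangential`, `IsWeakGradient.integral_div_antisymm`); these are justified
with cutoffs near the boundary (`exists_cutoff`). The alignment and interaction terms contain the
convolution of a smooth kernel with the difference of the densities. By the Poisson equation that
difference is a divergence, so that the convolution is bounded by the square root of the field
part of the relative energy (`IsSnapshot.sq_relDensity_le`, `sq_relForce_le`). As the total mass is
bounded, no sign of the kernel `ψ` is needed. Grönwall's inequality (`ae_nonpos_of_le_integral`)
gives `ae_relEnergy_eq_zero`.

*Positivity.* Both estimates use that quadratic polynomials which are non-negative in `v` (or `F`)
have a non-negative integral against the concentration measures. For almost every time this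
follows from the generation by a sequence of bounded energy (`IsRegularState`, `kin_bar_nonneg`,
`pot_bar_nonneg`).

*Identification.* If the field part vanishes, the field concentrations vanish and the Young measure
lives on `F = ∇Φ` (`IsRegularState.of_relField_eq_zero`); the Poisson equation then determines the
density. If the kinetic part vanishes, the Young measure lives on `v = U` wherever `s > 0`, and
Cauchy-Schwarz yields the momentum and the convective stress (`velocity_eq_of_relKinetic_eq_zero`,
`IsSnapshot.bar_eq`). The barred measures are then absolutely continuous, hence so are the
concentration measures (`absolutelyContinuous_of_bar_eq`). A measure on a product whose second
marginal lives on one point is a product with a Dirac measure (`eq_prod_dirac_of_ae`), which gives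
the two factorizations of the Young measure.
-/

set_option linter.unusedSectionVars false

noncomputable section

open Finset (sum_congr mul_sum sum_sub_distrib sum_add_distrib sum_const_zero sum_mul)

namespace EulerAlignment

/-! ### Integration of continuous functions against signed measures carried by a compact set -/

section SignedIntegral

variable {X : Type*} [MetricSpace X] [MeasurableSpace X] [BorelSpace X]
  {K : Set X} {μ ν : SignedMeasure X} {f g : X → ℝ}

instance isFiniteMeasure_totalVariation (μ : SignedMeasure X) :
    IsFiniteMeasure μ.totalVariation := by
  unfold SignedMeasure.totalVariation; infer_instance

instance isFiniteMeasure_variation (μ : SignedMeasure X) : IsFiniteMeasure μ.variation := by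
  rw [← SignedMeasure.totalVariation_eq_variation]; infer_instance

lemma ae_mem_of_carried (hμ : μ.totalVariation Kᶜ = 0) : ∀ᵐ x ∂μ.variation, x ∈ K := by
  rw [← SignedMeasure.totalVariation_eq_variation]; exact hμ

lemma integrable_of_carried (hK : IsCompact K) (hμ : μ.totalVariation Kᶜ = 0)
    (hf : ContinuousOn f K) : μ.Integrable f := by
  have h : μ.variation.restrict K = μ.variation :=
    Measure.restrict_eq_self_of_ae_mem (ae_mem_of_carried hμ)
  rw [VectorMeasure.Integrable, ← h]
  exact hf.integrableOn_compact hK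

lemma signedIntegral_congr (hμ : μ.totalVariation Kᶜ = 0) (h : EqOn f g K) :
    ∫ᵛ x, f x ∂•μ = ∫ᵛ x, g x ∂•μ := by
  apply VectorMeasure.integral_congr_ae
  filter_upwards [ae_mem_of_carried hμ] with x hx using h hx

lemma abs_signedIntegral_le (hμ : μ.totalVariation Kᶜ = 0) {c : ℝ}
    (h : ∀ x ∈ K, |f x| ≤ c) : |∫ᵛ x, f x ∂•μ| ≤ (μ.totalVariation univ).toReal * c := by
  have := VectorMeasure.norm_integral_le_of_norm_le_const (μ := μ) (f := f)
    (B := ContinuousLinearMap.lsmul ℝ ℝ) (C := c)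
    (by filter_upwards [ae_mem_of_carried hμ] with x hx using h x hx)
  rw [Real.norm_eq_abs] at this
  refine this.trans (le_of_eq ?_)
  rw [ContinuousLinearMap.opNorm_lsmul, SignedMeasure.totalVariation_eq_variation, Measure.real]
  ring

lemma signedIntegral_eq_sub (hf : μ.Integrable f) :
    ∫ᵛ x, f x ∂•μ = (∫ x, f x ∂μ.toJordanDecomposition.posPart)
      - ∫ x, f x ∂μ.toJordanDecomposition.negPart := by
  have hf' : Integrable f μ.totalVariation := by
    rw [SignedMeasure.totalVariation_eq_variation]; exact hf
  have h1 : Integrable f μ.toJordanDecomposition.posPart :=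
    hf'.mono_measure (Measure.le_add_right le_rfl)
  have h2 : Integrable f μ.toJordanDecomposition.negPart :=
    hf'.mono_measure (Measure.le_add_left le_rfl)
  have hB : (ContinuousLinearMap.lsmul ℝ ℝ : ℝ →L[ℝ] ℝ →L[ℝ] ℝ)
      = (ContinuousLinearMap.lsmul ℝ ℝ : ℝ →L[ℝ] ℝ →L[ℝ] ℝ).flip := by
    ext; simp
  conv_lhs => rw [← μ.toSignedMeasure_toJordanDecomposition, JordanDecomposition.toSignedMeasure]
  rw [VectorMeasure.integral_sub_vectorMeasure, hB,
    VectorMeasure.integral_toSignedMeasure, VectorMeasure.integral_toSignedMeasure]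
  · rw [VectorMeasure.Integrable, Measure.variation_toSignedMeasure]; exact h1
  · rw [VectorMeasure.Integrable, Measure.variation_toSignedMeasure]; exact h2

lemma signedIntegral_toSignedMeasure (m : Measure X) [IsFiniteMeasure m] (f : X → ℝ) :
    ∫ᵛ x, f x ∂•m.toSignedMeasure = ∫ x, f x ∂m := by
  have hB : (ContinuousLinearMap.lsmul ℝ ℝ : ℝ →L[ℝ] ℝ →L[ℝ] ℝ)
      = (ContinuousLinearMap.lsmul ℝ ℝ : ℝ →L[ℝ] ℝ →L[ℝ] ℝ).flip := by
    ext; simp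
  rw [hB, VectorMeasure.integral_toSignedMeasure]

lemma signedIntegral_one (μ : SignedMeasure X) : ∫ᵛ _, (1 : ℝ) ∂•μ = μ univ := by
  rw [VectorMeasure.integral_const]; simp

lemma signedIntegral_add (hK : IsCompact K) (hμ : μ.totalVariation Kᶜ = 0)
    (hf : ContinuousOn f K) (hg : ContinuousOn g K) :
    ∫ᵛ x, (f x + g x) ∂•μ = (∫ᵛ x, f x ∂•μ) + ∫ᵛ x, g x ∂•μ :=
  VectorMeasure.integral_fun_add (integrable_of_carried hK hμ hf) (integrable_of_carried hK hμ hg)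

lemma signedIntegral_sub (hK : IsCompact K) (hμ : μ.totalVariation Kᶜ = 0)
    (hf : ContinuousOn f K) (hg : ContinuousOn g K) :
    ∫ᵛ x, (f x - g x) ∂•μ = (∫ᵛ x, f x ∂•μ) - ∫ᵛ x, g x ∂•μ :=
  VectorMeasure.integral_fun_sub (integrable_of_carried hK hμ hf) (integrable_of_carried hK hμ hg)

lemma signedIntegral_const_mul (c : ℝ) (f : X → ℝ) (μ : SignedMeasure X) :
    ∫ᵛ x, c * f x ∂•μ = c * ∫ᵛ x, f x ∂•μ :=
  VectorMeasure.integral_fun_smul μ (ContinuousLinearMap.lsmul ℝ ℝ) c f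

lemma signedIntegral_mul_const (c : ℝ) (f : X → ℝ) (μ : SignedMeasure X) :
    ∫ᵛ x, f x * c ∂•μ = (∫ᵛ x, f x ∂•μ) * c := by
  simp_rw [mul_comm _ c]; exact signedIntegral_const_mul c f μ

lemma signedIntegral_finsetSum {ι : Type*} (s : Finset ι) {F : ι → X → ℝ} (hK : IsCompact K)
    (hμ : μ.totalVariation Kᶜ = 0) (hF : ∀ i ∈ s, ContinuousOn (F i) K) :
    ∫ᵛ x, (∑ i ∈ s, F i x) ∂•μ = ∑ i ∈ s, ∫ᵛ x, F i x ∂•μ :=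
  VectorMeasure.integral_finsetSum s fun i hi => integrable_of_carried hK hμ (hF i hi)

lemma totalVariation_add_compl (hμ : μ.totalVariation Kᶜ = 0) (hν : ν.totalVariation Kᶜ = 0) :
    (μ + ν).totalVariation Kᶜ = 0 := by
  rw [SignedMeasure.totalVariation_eq_variation] at *
  refine le_antisymm ?_ bot_le
  have := VectorMeasure.variation_add_le (μ := μ) (ν := ν) Kᶜ
  simpa [hμ, hν] using this

lemma signedIntegral_add_measure (hK : IsCompact K) (hμ : μ.totalVariation Kᶜ = 0)
    (hν : ν.totalVariation Kᶜ = 0) (hf : ContinuousOn f K) :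
    ∫ᵛ x, f x ∂•(μ + ν) = (∫ᵛ x, f x ∂•μ) + ∫ᵛ x, f x ∂•ν :=
  VectorMeasure.integral_add_vectorMeasure (integrable_of_carried hK hμ hf)
    (integrable_of_carried hK hν hf)

/-- Two signed measures that integrate all bounded continuous functions alike are equal. -/
lemma signedMeasure_ext (h : ∀ f : X → ℝ, Continuous f → (∃ c, ∀ x, |f x| ≤ c) →
    ∫ᵛ x, f x ∂•μ = ∫ᵛ x, f x ∂•ν) : μ = ν := by
  have key : μ.toJordanDecomposition.posPart + ν.toJordanDecomposition.negPart
      = ν.toJordanDecomposition.posPart + μ.toJordanDecomposition.negPart := by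
    apply ext_of_forall_integral_eq_of_IsFiniteMeasure
    intro f
    have hint : ∀ m : Measure X, IsFiniteMeasure m → Integrable f m := fun m _ =>
      f.integrable m
    rw [integral_add_measure (hint _ inferInstance) (hint _ inferInstance),
      integral_add_measure (hint _ inferInstance) (hint _ inferInstance)]
    have := h f f.continuous ⟨‖f‖, fun x => f.norm_coe_le_norm x⟩
    rw [signedIntegral_eq_sub (hint _ inferInstance),
      signedIntegral_eq_sub (hint _ inferInstance)] at this
    linarith
  rw [← μ.toSignedMeasure_toJordanDecomposition, ← ν.toSignedMeasure_toJordanDecomposition]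
  ext s hs
  have := congrArg (fun m : Measure X => m.real s) key
  rw [measureReal_add_apply, measureReal_add_apply] at this
  rw [JordanDecomposition.toSignedMeasure, JordanDecomposition.toSignedMeasure,
    Measure.toSignedMeasure_sub_apply hs, Measure.toSignedMeasure_sub_apply hs]
  linarith

lemma totalVariation_withDensityᵥ_compl {m : Measure X} (hm : ∀ᵐ x ∂m, x ∈ K)
    (hK : MeasurableSet K) (f : X → ℝ) : SignedMeasure.totalVariation (m.withDensityᵥ f) Kᶜ = 0 := by
  by_cases hf : Integrable f m
  · rw [SignedMeasure.totalVariation_eq_variation, Measure.variation_withDensityᵥ hf,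
      withDensity_apply _ hK.compl, Measure.restrict_eq_zero.2 (by exact hm)]
    simp
  · rw [show m.withDensityᵥ f = 0 from dif_neg hf, SignedMeasure.totalVariation_zero]; simp

lemma signedIntegral_withDensityᵥ {m : Measure X} (hf : Integrable f m)
    (hφ : AEStronglyMeasurable g m) (hφb : ∃ c, ∀ᵐ x ∂m, |g x| ≤ c) :
    ∫ᵛ x, g x ∂•(m.withDensityᵥ f) = ∫ x, g x * f x ∂m := by
  have hfin1 : ∫⁻ x, ENNReal.ofReal (f x) ∂m ≠ ⊤ := hf.lintegral_lt_top.ne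
  have hfin2 : ∫⁻ x, ENNReal.ofReal (-f x) ∂m ≠ ⊤ := hf.neg.lintegral_lt_top.ne
  have := isFiniteMeasure_withDensity hfin1
  have := isFiniteMeasure_withDensity hfin2
  obtain ⟨c, hc⟩ := hφb
  have hint : ∀ h : X → ℝ≥0∞, IsFiniteMeasure (m.withDensity h) → Integrable g (m.withDensity h) :=
    fun h _ => Integrable.of_bound (hφ.mono_ac (withDensity_absolutelyContinuous _ _)) c
      ((withDensity_absolutelyContinuous m h).ae_le hc)
  have hmul : Integrable (fun x => g x * f x) m := hf.bdd_mul hφ hc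
  rw [withDensityᵥ_eq_withDensity_pos_part_sub_withDensity_neg_part hf,
    VectorMeasure.integral_sub_vectorMeasure, signedIntegral_toSignedMeasure,
    signedIntegral_toSignedMeasure,
    integral_withDensity_eq_integral_toReal_smul₀ hf.1.aemeasurable.ennreal_ofReal (by simp),
    integral_withDensity_eq_integral_toReal_smul₀ (f := fun x => ENNReal.ofReal (-f x))
      hf.neg.1.aemeasurable.ennreal_ofReal (by simp),
    ← integral_sub]
  · refine integral_congr_ae (ae_of_all _ fun x => ?_)
    simp only [smul_eq_mul, ENNReal.toReal_ofReal']
    rcases le_total 0 (f x) with h | h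
    · rw [max_eq_left h, max_eq_right (by simpa using h)]; ring
    · rw [max_eq_right h, max_eq_left (by simpa using h)]; ring
  · refine (hf.pos_part.bdd_mul hφ hc).congr (ae_of_all _ fun x => ?_)
    simp [ENNReal.toReal_ofReal', mul_comm]
  · refine (hf.neg_part.bdd_mul hφ hc).congr (ae_of_all _ fun x => ?_)
    simp [ENNReal.toReal_ofReal', mul_comm]
  · rw [VectorMeasure.Integrable, Measure.variation_toSignedMeasure]; exact hint _ inferInstance
  · rw [VectorMeasure.Integrable, Measure.variation_toSignedMeasure]; exact hint _ inferInstance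

end SignedIntegral

/-! ### Measurable families of signed measures and iterated integrals -/

section Families

variable {X : Type*} [MetricSpace X] [MeasurableSpace X] [BorelSpace X] {K : Set X}

lemma exists_partition_of_isCompact (hK : IsCompact K) {δ : ℝ} (hδ : 0 < δ) :
    ∃ (s : Finset X) (χ : X → X → ℝ), (∀ k ∈ s, k ∈ K) ∧ (∀ k ∈ s, ContinuousOn (χ k) K) ∧
      (∀ k ∈ s, ∀ x ∈ K, 0 ≤ χ k x) ∧ (∀ x ∈ K, ∑ k ∈ s, χ k x = 1) ∧
      ∀ k ∈ s, ∀ x ∈ K, δ ≤ dist x k → χ k x = 0 := by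
  obtain ⟨s, hsK, hs⟩ := hK.elim_nhds_subcover (fun x => Metric.ball x δ)
    fun x _ => Metric.ball_mem_nhds x hδ
  have hpos : ∀ x ∈ K, 0 < ∑ j ∈ s, max 0 (δ - dist x j) := by
    intro x hx
    obtain ⟨j, hj, hxj⟩ := mem_iUnion₂.1 (hs hx)
    refine Finset.sum_pos' (fun _ _ => le_max_left _ _) ⟨j, hj, ?_⟩
    rw [Metric.mem_ball] at hxj
    exact lt_max_of_lt_right (by linarith)
  refine ⟨s, fun k x => max 0 (δ - dist x k) / ∑ j ∈ s, max 0 (δ - dist x j), hsK, ?_, ?_, ?_, ?_⟩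
  · intro k _
    refine ContinuousOn.div (by fun_prop) (by fun_prop) fun x hx => (hpos x hx).ne'
  · intro k _ x hx
    exact div_nonneg (le_max_left _ _) (hpos x hx).le
  · intro x hx
    rw [← Finset.sum_div, div_self (hpos x hx).ne']
  · intro k _ x _ hd
    show max 0 (δ - dist x k) / _ = 0
    rw [max_eq_left (by linarith), zero_div]

lemma abs_sub_partition_sum_le {s : Finset X} {χ : X → X → ℝ} {F : X → ℝ} {δ ε : ℝ}
    (hsK : ∀ k ∈ s, k ∈ K) (h0 : ∀ k ∈ s, ∀ x ∈ K, 0 ≤ χ k x)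
    (h1 : ∀ x ∈ K, ∑ k ∈ s, χ k x = 1) (hfar : ∀ k ∈ s, ∀ x ∈ K, δ ≤ dist x k → χ k x = 0)
    (hF : ∀ x ∈ K, ∀ y ∈ K, dist x y < δ → |F x - F y| ≤ ε) {x : X} (hx : x ∈ K) :
    |F x - ∑ k ∈ s, χ k x * F k| ≤ ε := by
  have : F x - ∑ k ∈ s, χ k x * F k = ∑ k ∈ s, χ k x * (F x - F k) := by
    simp_rw [mul_sub, sum_sub_distrib, ← sum_mul, h1 x hx, one_mul]
  rw [this]
  calc |∑ k ∈ s, χ k x * (F x - F k)| ≤ ∑ k ∈ s, |χ k x * (F x - F k)| :=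
        Finset.abs_sum_le_sum_abs _ _
    _ ≤ ∑ k ∈ s, χ k x * ε := by
        refine Finset.sum_le_sum fun k hk => ?_
        rw [abs_mul, abs_of_nonneg (h0 k hk x hx)]
        rcases lt_or_ge (dist x k) δ with h | h
        · exact mul_le_mul_of_nonneg_left (hF x hx k (hsK k hk) h) (h0 k hk x hx)
        · simp [hfar k hk x hx h]
    _ = ε := by rw [← sum_mul, h1 x hx, one_mul]

/-- Equicontinuity on `K` of a family of functions, up to a factor depending on the member. -/
def EquicontOn {A : Type*} [MeasurableSpace A] (l : Measure A) (K : Set X) (F : A → X → ℝ) : Prop :=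
  ∃ b : A → ℝ, ∀ ε > 0, ∃ δ > 0, ∀ᵐ a ∂l, ∀ x ∈ K, ∀ y ∈ K, dist x y < δ →
    |F a x - F a y| ≤ b a * ε

/-- Families of signed measures carried by `K` that depend measurably on a parameter, in the weak
sense. -/
structure IsCarriedFamily {A : Type*} [MeasurableSpace A] (l : Measure A) (K : Set X)
    (μ : A → SignedMeasure X) : Prop where
  carried : ∀ᵐ a ∂l, (μ a).totalVariation Kᶜ = 0
  measurable : ∀ φ : X → ℝ, ContinuousOn φ K → AEStronglyMeasurable (fun a => ∫ᵛ x, φ x ∂•(μ a)) l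

variable {A : Type*} [MeasurableSpace A] {l : Measure A}

lemma continuousOn_of_modulus {F : X → ℝ} {b : ℝ}
    (h : ∀ ε > 0, ∃ δ > 0, ∀ x ∈ K, ∀ y ∈ K, dist x y < δ → |F x - F y| ≤ b * ε) :
    ContinuousOn F K := by
  rw [Metric.continuousOn_iff]
  intro x hx ε hε
  obtain ⟨δ, hδ, H⟩ := h (ε / (2 * (|b| + 1))) (by positivity)
  refine ⟨δ, hδ, fun y hy hyx => ?_⟩
  rw [Real.dist_eq]
  refine (H y hy x hx hyx).trans_lt ?_
  have h1 : b * (ε / (2 * (|b| + 1))) ≤ (|b| + 1) * (ε / (2 * (|b| + 1))) := by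
    gcongr; linarith [le_abs_self b]
  have h2 : (|b| + 1) * (ε / (2 * (|b| + 1))) = ε / 2 := by field_simp
  linarith

lemma EquicontOn.ae_exists {F : A → X → ℝ} (hF : EquicontOn l K F) : ∀ᵐ a ∂l, ∃ b : ℝ,
    ∀ ε > 0, ∃ δ > 0, ∀ x ∈ K, ∀ y ∈ K, dist x y < δ → |F a x - F a y| ≤ b * ε := by
  obtain ⟨b, hb⟩ := hF
  have : ∀ n : ℕ, ∃ δ > 0, ∀ᵐ a ∂l, ∀ x ∈ K, ∀ y ∈ K, dist x y < δ →
    |F a x - F a y| ≤ b a * (1 / ((n : ℝ) + 1)) := fun n => hb _ (by positivity)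
  choose δ hδ h using this
  filter_upwards [ae_all_iff.2 h] with a ha
  refine ⟨|b a|, fun ε hε => ?_⟩
  obtain ⟨n, hn⟩ := exists_nat_one_div_lt hε
  refine ⟨δ n, hδ n, fun x hx y hy hxy => (ha n x hx y hy hxy).trans ?_⟩
  exact (mul_le_mul_of_nonneg_right (le_abs_self _) (by positivity)).trans
    (mul_le_mul_of_nonneg_left hn.le (abs_nonneg _))

lemma EquicontOn.ae_continuousOn {F : A → X → ℝ} (hF : EquicontOn l K F) :
    ∀ᵐ a ∂l, ContinuousOn (F a) K := by
  filter_upwards [hF.ae_exists] with a ⟨b, hb⟩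
  exact continuousOn_of_modulus hb

lemma IsCarriedFamily.aestronglyMeasurable_integral {μ : A → SignedMeasure X}
    (hμ : IsCarriedFamily l K μ) (hK : IsCompact K) {F : A → X → ℝ} (hF : EquicontOn l K F)
    (hm : ∀ x ∈ K, AEStronglyMeasurable (fun a => F a x) l) :
    AEStronglyMeasurable (fun a => ∫ᵛ x, F a x ∂•(μ a)) l := by
  have hcont := hF.ae_continuousOn
  obtain ⟨b, hb⟩ := hF
  have : ∀ n : ℕ, ∃ δ > 0, ∀ᵐ a ∂l, ∀ x ∈ K, ∀ y ∈ K, dist x y < δ →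
    |F a x - F a y| ≤ b a * (1 / ((n : ℝ) + 1)) := fun n => hb _ (by positivity)
  choose δ hδ h using this
  choose s χ hsK hχc hχ0 hχ1 hfar using fun n => exists_partition_of_isCompact hK (hδ n)
  refine aestronglyMeasurable_of_tendsto_ae atTop
    (f := fun n a => ∑ k ∈ s n, (∫ᵛ x, χ n k x ∂•(μ a)) * F a k) (fun n => ?_) ?_
  · refine Finset.aestronglyMeasurable_fun_sum _ fun k hk => ?_
    exact (hμ.measurable _ (hχc n k hk)).mul (hm k (hsK n k hk))
  · filter_upwards [ae_all_iff.2 h, hμ.carried, hcont] with a ha hca hFa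
    rw [tendsto_iff_norm_sub_tendsto_zero]
    have hz : Tendsto (fun n : ℕ => ((μ a).totalVariation univ).toReal
        * (b a * (1 / ((n : ℝ) + 1)))) atTop (𝓝 0) := by
      simpa using (tendsto_one_div_add_atTop_nhds_zero_nat (𝕜 := ℝ)).const_mul (b a)
        |>.const_mul ((μ a).totalVariation univ).toReal
    refine squeeze_zero (fun _ => norm_nonneg _) (fun n => ?_) hz
    have e : ∑ k ∈ s n, (∫ᵛ x, χ n k x ∂•(μ a)) * F a k
        = ∫ᵛ x, (∑ k ∈ s n, χ n k x * F a k) ∂•(μ a) := by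
      rw [signedIntegral_finsetSum _ hK hca fun k hk => (hχc n k hk).fun_mul continuousOn_const]
      exact sum_congr rfl fun k _ => (signedIntegral_mul_const _ _ _).symm
    rw [e, norm_sub_rev, Real.norm_eq_abs, ← signedIntegral_sub hK hca hFa
      (continuousOn_finsetSum _ fun k hk => (hχc n k hk).fun_mul continuousOn_const)]
    exact abs_signedIntegral_le hca fun x hx =>
      abs_sub_partition_sum_le (hsK n) (hχ0 n) (hχ1 n) (hfar n) (ha n) hx

/-- Iterated integrals of an equicontinuous kernel are again equicontinuous. -/
lemma IsCarriedFamily.equicontOn_integral {ν : A → SignedMeasure X}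
    (hν : IsCarriedFamily l K ν) (hK : IsCompact K) {F : A → X → X → ℝ}
    (h1 : ∀ ε > 0, ∃ δ > 0, ∀ᵐ a ∂l, ∀ x ∈ K, ∀ x' ∈ K, dist x x' < δ → ∀ y ∈ K,
      |F a x y - F a x' y| ≤ ε)
    (h2 : ∀ᵐ a ∂l, ∀ x ∈ K, ContinuousOn (F a x) K) :
    EquicontOn l K fun a x => ∫ᵛ y, F a x y ∂•(ν a) := by
  refine ⟨fun a => ((ν a).totalVariation univ).toReal, fun ε hε => ?_⟩
  obtain ⟨δ, hδ, h⟩ := h1 ε hε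
  refine ⟨δ, hδ, ?_⟩
  filter_upwards [h, h2, hν.carried] with a ha ha2 hca x hx y hy hxy
  rw [← signedIntegral_sub hK hca (ha2 x hx) (ha2 y hy)]
  exact abs_signedIntegral_le hca fun z hz => ha x hx y hy hxy z hz

lemma continuousOn_signedIntegral {ν : SignedMeasure X} (hν : ν.totalVariation Kᶜ = 0)
    (hK : IsCompact K) {F : X → X → ℝ} (hF : ContinuousOn (fun p : X × X => F p.1 p.2) (K ×ˢ K)) :
    ContinuousOn (fun x => ∫ᵛ y, F x y ∂•ν) K := by
  have huc := (hK.prod hK).uniformContinuousOn_of_continuous hF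
  rw [Metric.uniformContinuousOn_iff] at huc
  refine continuousOn_of_modulus (b := (ν.totalVariation univ).toReal) fun ε hε => ?_
  obtain ⟨δ, hδ, h⟩ := huc ε hε
  refine ⟨δ, hδ, fun x hx y hy hxy => ?_⟩
  have hs : ∀ z ∈ K, ContinuousOn (F z) K := fun z hz =>
    hF.comp (Continuous.prodMk_right z).continuousOn fun w hw => ⟨hz, hw⟩
  rw [← signedIntegral_sub hK hν (hs x hx) (hs y hy)]
  refine abs_signedIntegral_le hν fun z hz => ?_
  have := h (x, z) ⟨hx, hz⟩ (y, z) ⟨hy, hz⟩ (by simp [Prod.dist_eq, hxy])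
  rw [Real.dist_eq] at this
  exact this.le

/-- Fubini's theorem for continuous kernels and signed measures carried by a compact set. -/
lemma signedIntegral_comm {μ ν : SignedMeasure X} (hμ : μ.totalVariation Kᶜ = 0)
    (hν : ν.totalVariation Kᶜ = 0) (hK : IsCompact K) {F : X → X → ℝ}
    (hF : ContinuousOn (fun p : X × X => F p.1 p.2) (K ×ˢ K)) :
    ∫ᵛ x, (∫ᵛ y, F x y ∂•ν) ∂•μ = ∫ᵛ y, (∫ᵛ x, F x y ∂•μ) ∂•ν := by
  have hF' : ContinuousOn (fun p : X × X => F p.2 p.1) (K ×ˢ K) :=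
    hF.comp continuous_swap.continuousOn fun p hp => ⟨hp.2, hp.1⟩
  have hc1 : ∀ x ∈ K, ContinuousOn (fun y => F x y) K := fun z hz =>
    hF.comp (Continuous.prodMk_right z).continuousOn fun w hw => ⟨hz, hw⟩
  have hc2 : ∀ y ∈ K, ContinuousOn (fun x => F x y) K := fun z hz =>
    hF.comp (Continuous.prodMk_left z).continuousOn fun w hw => ⟨hw, hz⟩
  have huc := (hK.prod hK).uniformContinuousOn_of_continuous hF
  rw [Metric.uniformContinuousOn_iff] at huc
  set a := (μ.totalVariation univ).toReal
  set b := (ν.totalVariation univ).toReal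
  suffices h : ∀ ε > 0, |∫ᵛ x, (∫ᵛ y, F x y ∂•ν) ∂•μ - ∫ᵛ y, (∫ᵛ x, F x y ∂•μ) ∂•ν|
      ≤ 2 * a * b * ε by
    rw [← sub_eq_zero, ← abs_eq_zero]
    refine le_antisymm (le_of_forall_pos_le_add fun ε hε => ?_) (abs_nonneg _)
    have hab : 0 ≤ 2 * a * b := by positivity
    refine (h (ε / (2 * a * b + 1)) (by positivity)).trans ?_
    rw [mul_div_assoc', div_le_iff₀ (by positivity)]
    nlinarith
  intro ε hε
  obtain ⟨δ, hδ, h⟩ := huc ε hε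
  obtain ⟨s, χ, hsK, hχc, hχ0, hχ1, hfar⟩ := exists_partition_of_isCompact hK hδ
  have happ : ∀ y ∈ K, ∀ x ∈ K, |F x y - ∑ k ∈ s, χ k x * F k y| ≤ ε := fun y hy x hx =>
    abs_sub_partition_sum_le (F := fun x => F x y) hsK hχ0 hχ1 hfar (fun x hx x' hx' hd => by
      have := h (x, y) ⟨hx, hy⟩ (x', y) ⟨hx', hy⟩ (by simp [Prod.dist_eq, hd])
      rw [Real.dist_eq] at this
      exact this.le) hx
  have hcν := continuousOn_signedIntegral hν hK hF
  have hcμ := continuousOn_signedIntegral (F := fun y x => F x y) hμ hK hF'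
  have e1 : |∫ᵛ x, (∫ᵛ y, F x y ∂•ν) ∂•μ - ∑ k ∈ s, (∫ᵛ x, χ k x ∂•μ) * ∫ᵛ y, F k y ∂•ν|
      ≤ a * (b * ε) := by
    have : ∑ k ∈ s, (∫ᵛ x, χ k x ∂•μ) * ∫ᵛ y, F k y ∂•ν
        = ∫ᵛ x, (∑ k ∈ s, χ k x * ∫ᵛ y, F k y ∂•ν) ∂•μ := by
      rw [signedIntegral_finsetSum _ hK hμ fun k hk => (hχc k hk).fun_mul continuousOn_const]
      exact sum_congr rfl fun k _ => (signedIntegral_mul_const _ _ _).symm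
    rw [this, ← signedIntegral_sub hK hμ hcν
      (continuousOn_finsetSum _ fun k hk => (hχc k hk).fun_mul continuousOn_const)]
    refine abs_signedIntegral_le hμ fun x hx => ?_
    have : ∑ k ∈ s, χ k x * ∫ᵛ y, F k y ∂•ν = ∫ᵛ y, (∑ k ∈ s, χ k x * F k y) ∂•ν := by
      rw [signedIntegral_finsetSum _ hK hν fun k hk =>
        continuousOn_const.fun_mul (hc1 k (hsK k hk))]
      exact sum_congr rfl fun k _ => (signedIntegral_const_mul _ _ _).symm
    rw [this, ← signedIntegral_sub hK hν (hc1 x hx)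
      (continuousOn_finsetSum _ fun k hk => continuousOn_const.fun_mul (hc1 k (hsK k hk)))]
    exact abs_signedIntegral_le hν fun y hy => happ y hy x hx
  have e2 : |∫ᵛ y, (∫ᵛ x, F x y ∂•μ) ∂•ν - ∑ k ∈ s, (∫ᵛ x, χ k x ∂•μ) * ∫ᵛ y, F k y ∂•ν|
      ≤ b * (a * ε) := by
    have : ∑ k ∈ s, (∫ᵛ x, χ k x ∂•μ) * ∫ᵛ y, F k y ∂•ν
        = ∫ᵛ y, (∑ k ∈ s, (∫ᵛ x, χ k x ∂•μ) * F k y) ∂•ν := by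
      rw [signedIntegral_finsetSum _ hK hν fun k hk =>
        continuousOn_const.fun_mul (hc1 k (hsK k hk))]
      exact sum_congr rfl fun k _ => (signedIntegral_const_mul _ _ _).symm
    rw [this, ← signedIntegral_sub hK hν hcμ
      (continuousOn_finsetSum _ fun k hk => continuousOn_const.fun_mul (hc1 k (hsK k hk)))]
    refine abs_signedIntegral_le hν fun y hy => ?_
    have : ∑ k ∈ s, (∫ᵛ x, χ k x ∂•μ) * F k y = ∫ᵛ x, (∑ k ∈ s, χ k x * F k y) ∂•μ := by
      rw [signedIntegral_finsetSum _ hK hμ fun k hk => (hχc k hk).fun_mul continuousOn_const]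
      exact sum_congr rfl fun k _ => (signedIntegral_mul_const _ _ _).symm
    rw [this, ← signedIntegral_sub hK hμ (hc2 y hy)
      (continuousOn_finsetSum _ fun k hk => (hχc k hk).fun_mul continuousOn_const)]
    exact abs_signedIntegral_le hμ fun x hx => happ y hy x hx
  rw [abs_sub_comm] at e2
  refine (abs_sub_le _ _ _).trans ((add_le_add e1 e2).trans (le_of_eq (by ring)))

end Families

/-! ### Defining functions and boundary cutoffs -/

section DomainGeometry

variable {d : ℕ} {Ω : Set (Sp d)}

lemma inner_gradient_eq (g : Sp d → ℝ) (x v : Sp d) :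
    inner ℝ (gradient g x) v = fderiv ℝ g x v := by
  rw [gradient, InnerProductSpace.toDual_symm_apply]

lemma IsBoundedSmoothDomain.isCompact_closure (hΩ : IsBoundedSmoothDomain Ω) :
    IsCompact (closure Ω) := hΩ.isBounded.isCompact_closure

lemma closure_eq_union_frontier (hΩ : IsBoundedSmoothDomain Ω) {x : Sp d}
    (hx : x ∈ closure Ω) : x ∈ Ω ∨ x ∈ frontier Ω := by
  by_cases h : x ∈ Ω
  · exact Or.inl h
  · right; rw [hΩ.isOpen.frontier_eq]; exact ⟨hx, h⟩

lemma closure_mem_nhds (hΩ : IsBoundedSmoothDomain Ω) {x : Sp d} (hx : x ∈ Ω) : closure Ω ∈ 𝓝 x :=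
  mem_of_superset (hΩ.isOpen.mem_nhds hx) subset_closure

lemma IsDefiningFunction.differentiable {x : Sp d} {g : Sp d → ℝ}
    (hg : IsDefiningFunction Ω x g) : Differentiable ℝ g := hg.1.differentiable (by simp)

lemma IsDefiningFunction.fderiv_gradient_pos {x : Sp d} {g : Sp d → ℝ}
    (hg : IsDefiningFunction Ω x g) : 0 < fderiv ℝ g x (gradient g x) := by
  rw [← inner_gradient_eq, real_inner_self_eq_norm_sq]
  have := norm_pos_iff.2 hg.2.2.1
  positivity

lemma IsDefiningFunction.eventually_mem {x v : Sp d} {g : Sp d → ℝ}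
    (hg : IsDefiningFunction Ω x g) (hv : fderiv ℝ g x v < 0) :
    ∀ᶠ s in 𝓝[>] (0 : ℝ), x + s • v ∈ Ω := by
  have hline : HasDerivAt (fun s : ℝ => x + s • v) v 0 := by
    simpa using ((hasDerivAt_id (0 : ℝ)).smul_const v).const_add x
  have hd : HasDerivAt (fun s : ℝ => g (x + s • v)) (fderiv ℝ g x v) 0 := by
    have hgd : HasFDerivAt g (fderiv ℝ g x) (x + (0 : ℝ) • v) := by
      simpa using (hg.differentiable x).hasFDerivAt
    exact hgd.comp_hasDerivAt 0 hline
  have hsl := (hasDerivAt_iff_tendsto_slope.1 hd).mono_left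
    (nhdsWithin_mono 0 (fun s (hs : s ∈ Ioi (0 : ℝ)) => ne_of_gt hs))
  have hcont : Tendsto (fun s : ℝ => x + s • v) (𝓝[>] 0) (𝓝 x) := by
    have := hline.continuousAt.tendsto
    simp only [zero_smul, add_zero] at this
    exact this.mono_left nhdsWithin_le_nhds
  filter_upwards [hsl.eventually (gt_mem_nhds hv), hcont.eventually hg.2.2.2,
    self_mem_nhdsWithin] with s hs hmem hs0
  rw [hmem]
  rw [slope_def_field] at hs
  simp only [zero_smul, add_zero, hg.2.1, sub_zero] at hs
  have hs0' : (0 : ℝ) < s := hs0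
  exact (div_neg_iff.1 hs).elim (fun h => absurd h.2 (not_lt.2 hs0'.le)) fun h => h.1

/-- The closure of a smooth domain contains, at each boundary point, a truncated open cone. -/
lemma uniqueDiffOn_closure (hΩ : IsBoundedSmoothDomain Ω) : UniqueDiffOn ℝ (closure Ω) := by
  intro x hx
  rcases closure_eq_union_frontier hΩ hx with hx | hx
  · exact (uniqueDiffWithinAt_of_mem_nhds (closure_mem_nhds hΩ hx))
  obtain ⟨g, hg⟩ := hΩ.smooth_boundary x hx
  set N := gradient g x
  have hN : 0 < ‖N‖ := norm_pos_iff.2 hg.2.2.1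
  have hlo := (hg.differentiable x).hasFDerivAt.isLittleO.bound (show 0 < ‖N‖ / 4 by positivity)
  obtain ⟨δ, hδ, H⟩ := Metric.eventually_nhds_iff.1 (hlo.and hg.2.2.2)
  set C : Set (Sp d) := Metric.ball x δ ∩ {y | ‖N‖ / 2 * ‖y - x‖ + inner ℝ N (y - x) < 0}
  have hCΩ : C ⊆ Ω := by
    rintro y ⟨hy1, hy2⟩
    obtain ⟨h1, h2⟩ := H hy1
    rw [h2]
    rw [hg.2.1, sub_zero, ← inner_gradient_eq, Real.norm_eq_abs] at h1
    have h3 := (abs_le.1 h1).2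
    have h4 : ‖N‖ / 2 * ‖y - x‖ + inner ℝ N (y - x) < 0 := hy2
    have h5 : 0 ≤ ‖N‖ * ‖y - x‖ := by positivity
    have h6 : g y - inner ℝ N (y - x) ≤ ‖N‖ / 4 * ‖y - x‖ := h3
    linarith
  have hCconv : Convex ℝ C := by
    refine (convex_ball x δ).inter ?_
    have hc : ConvexOn ℝ univ fun y : Sp d => ‖N‖ / 2 * ‖y - x‖ + inner ℝ N (y - x) := by
      refine ConvexOn.add ?_ ?_
      · have := (convexOn_univ_norm (E := Sp d)).translate_left (-x)
        simp only [preimage_univ] at this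
        have h2 := this.smul (show 0 ≤ ‖N‖ / 2 by positivity)
        refine h2.congr fun y _ => ?_
        simp [sub_eq_neg_add, add_comm]
      · refine ⟨convex_univ, fun y _ z _ a b _ _ hab => le_of_eq ?_⟩
        have : a • y + b • z - x = a • (y - x) + b • (z - x) := by
          have hx' : x = (a + b) • x := by rw [hab, one_smul]
          nth_rewrite 1 [hx']
          module
        show inner ℝ N (a • y + b • z - x) = a • inner ℝ N (y - x) + b • inner ℝ N (z - x)
        rw [this, inner_add_right, inner_smul_right, inner_smul_right, smul_eq_mul, smul_eq_mul]
    simpa using hc.convex_lt 0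
  have hCopen : IsOpen C := by
    refine Metric.isOpen_ball.inter (isOpen_lt (by fun_prop) continuous_const)
  -- Points `x - s N` with small `s > 0` lie in the cone.
  have hray : ∀ᶠ s in 𝓝[>] (0 : ℝ), x + s • (-N) ∈ C := by
    have hc : Tendsto (fun s : ℝ => x + s • (-N)) (𝓝[>] 0) (𝓝 x) := by
      have : Continuous fun s : ℝ => x + s • (-N) := by fun_prop
      have := this.tendsto 0
      simp only [zero_smul, add_zero] at this
      exact this.mono_left nhdsWithin_le_nhds
    filter_upwards [hc.eventually (Metric.ball_mem_nhds x hδ), self_mem_nhdsWithin] with s hs hs0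
    refine ⟨hs, ?_⟩
    have hs0' : (0 : ℝ) < s := hs0
    simp only [mem_ofPred_eq, add_sub_cancel_left, norm_smul, norm_neg, Real.norm_eq_abs,
      abs_of_pos hs0', smul_neg, inner_neg_right, inner_smul_right, real_inner_self_eq_norm_sq]
    have : 0 < s * ‖N‖ ^ 2 := by positivity
    nlinarith
  have hxC : x ∈ closure C := by
    refine mem_closure_of_tendsto (f := fun s : ℝ => x + s • (-N)) (b := 𝓝[>] (0 : ℝ)) ?_ hray
    have : Continuous fun s : ℝ => x + s • (-N) := by fun_prop
    have := this.tendsto 0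
    simp only [zero_smul, add_zero] at this
    exact this.mono_left nhdsWithin_le_nhds
  obtain ⟨s, hs⟩ := hray.exists
  refine (uniqueDiffWithinAt_convex hCconv ?_ hxC).mono (hCΩ.trans subset_closure)
  rw [hCopen.interior_eq]
  exact ⟨_, hs⟩

/-- A bounded smooth domain has a global defining function: local ones are glued by cutoffs. At a
boundary point the local gradients are positive multiples of each other, so that the gradient of
the sum does not vanish. -/
lemma exists_global_definingFunction (hΩ : IsBoundedSmoothDomain Ω) :
    ∃ G : Sp d → ℝ, ContDiff ℝ ∞ G ∧ (∀ x, x ∈ Ω ↔ G x < 0) ∧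
      ∀ x ∈ frontier Ω, IsDefiningFunction Ω x G := by
  have hcf : IsCompact (frontier Ω) :=
    hΩ.isCompact_closure.of_isClosed_subset isClosed_frontier frontier_subset_closure
  have h1 : ∀ x : Sp d, ∃ (g : Sp d → ℝ) (ρ : ℝ), 0 < ρ ∧ ContDiff ℝ ∞ g ∧
      (x ∈ frontier Ω → IsDefiningFunction Ω x g ∧
        ∀ y, dist y x < 2 * ρ → (y ∈ Ω ↔ g y < 0) ∧ gradient g y ≠ 0) := by
    intro x
    by_cases hx : x ∈ frontier Ω
    · obtain ⟨g, hg⟩ := hΩ.smooth_boundary x hx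
      have hgc : Continuous (gradient g) :=
        (InnerProductSpace.toDual ℝ (Sp d)).symm.continuous.comp
          (hg.1.continuous_fderiv (by simp))
      obtain ⟨δ, hδ, H⟩ := Metric.eventually_nhds_iff.1
        (hg.2.2.2.and (hgc.continuousAt.eventually_ne hg.2.2.1))
      refine ⟨g, δ / 2, by positivity, hg.1, fun _ => ⟨hg, fun y hy => H (by linarith)⟩⟩
    · exact ⟨0, 1, one_pos, contDiff_const, fun h => absurd h hx⟩
  choose g ρ hρ hgs hg using h1
  obtain ⟨s, hsF, hs⟩ := hcf.elim_nhds_subcover (fun x => Metric.ball x (ρ x))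
    fun x _ => Metric.ball_mem_nhds x (hρ x)
  let χ : ∀ x : Sp d, ContDiffBump x := fun x => ⟨ρ x, 2 * ρ x, hρ x, by linarith [hρ x]⟩
  obtain ⟨χ₀, hχ₀s, hχ₀c, hχ₀r⟩ := hΩ.isOpen.exists_contDiff_support_eq (n := ⊤)
  have hχ₀n : ∀ x, 0 ≤ χ₀ x := fun x => (hχ₀r ⟨x, rfl⟩).1
  set G : Sp d → ℝ := fun x => -χ₀ x + ∑ k ∈ s, χ k x * g k x with hG
  have hGs : ContDiff ℝ ∞ G := by
    refine hχ₀c.neg.add (ContDiff.sum fun k _ => ?_)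
    exact (χ k).contDiff.mul (hgs k)
  have hsupp : ∀ k y, χ k y ≠ 0 → dist y k < 2 * ρ k := by
    intro k y hy
    have : y ∈ Function.support (χ k) := hy
    rw [(χ k).support_eq] at this
    exact this
  have hin : ∀ y ∈ Ω, ∀ k ∈ s, χ k y * g k y ≤ 0 := by
    intro y hy k hk
    by_cases h : χ k y = 0
    · simp [h]
    · exact mul_nonpos_of_nonneg_of_nonpos (χ k).nonneg
        (((hg k (hsF k hk)).2 y (hsupp k y h)).1.1 hy).le
  have hout : ∀ y, y ∉ Ω → ∀ k ∈ s, 0 ≤ χ k y * g k y := by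
    intro y hy k hk
    by_cases h : χ k y = 0
    · simp [h]
    · exact mul_nonneg (χ k).nonneg
        (not_lt.1 fun hlt => hy (((hg k (hsF k hk)).2 y (hsupp k y h)).1.2 hlt))
  have hiff : ∀ x, x ∈ Ω ↔ G x < 0 := by
    intro x
    constructor
    · intro hx
      have h0 : 0 < χ₀ x := lt_of_le_of_ne (hχ₀n x) (Ne.symm (by
        have : x ∈ Function.support χ₀ := by rw [hχ₀s]; exact hx
        exact this))
      have := Finset.sum_nonpos (hin x hx)
      show -χ₀ x + _ < 0
      linarith
    · intro hx
      by_contra hn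
      have h0 : χ₀ x = 0 := by
        by_contra h
        exact hn (hχ₀s ▸ (h : x ∈ Function.support χ₀))
      have := Finset.sum_nonneg (hout x hn)
      have hx' : -χ₀ x + ∑ k ∈ s, χ k x * g k x < 0 := hx
      linarith
  refine ⟨G, hGs, hiff, fun x hx => ⟨hGs, ?_, ?_, Eventually.of_forall hiff⟩⟩
  · refine le_antisymm ?_ (not_lt.1 fun h => ?_)
    · have hxc : x ∈ closure Ω := frontier_subset_closure hx
      exact closure_minimal (t := {y | G y ≤ 0}) (fun y hy => ((hiff y).1 hy).le)
        (isClosed_le hGs.continuous continuous_const) hxc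
    · have : x ∈ interior Ω := by rw [hΩ.isOpen.interior_eq]; exact (hiff x).2 h
      exact hx.2 this
  · have hxn : x ∉ Ω := fun h => hx.2 (by rwa [hΩ.isOpen.interior_eq])
    have hGx : G x ≤ 0 := closure_minimal (t := {y | G y ≤ 0}) (fun y hy => ((hiff y).1 hy).le)
        (isClosed_le hGs.continuous continuous_const) (frontier_subset_closure hx)
    obtain ⟨k, hk, hxk⟩ := mem_iUnion₂.1 (hs hx)
    have hχk : χ k x = 1 := (χ k).one_of_mem_closedBall (Metric.ball_subset_closedBall hxk)
    have hkd : dist x k < 2 * ρ k := by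
      have : dist x k < ρ k := hxk
      linarith [hρ k]
    have hkx := (hg k (hsF k hk)).2 x hkd
    have hgk0 : g k x = 0 := by
      have hcl : x ∈ closure Ω := frontier_subset_closure hx
      refine le_antisymm ?_ (not_lt.1 fun h => hxn (hkx.1.2 h))
      by_contra hpos
      obtain ⟨y, hy1, hy2⟩ := mem_closure_iff_nhds.1 hcl _ (inter_mem
        (Metric.isOpen_ball.mem_nhds (Metric.mem_ball.2 hkd))
        ((isOpen_lt continuous_const (hgs k).continuous).mem_nhds (not_le.1 hpos)))
      exact absurd (((hg k (hsF k hk)).2 y hy1.1).1.1 hy2) (not_lt.2 (le_of_lt hy1.2))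
    have hdef : IsDefiningFunction Ω x (g k) := by
      refine ⟨hgs k, hgk0, hkx.2, ?_⟩
      filter_upwards [Metric.isOpen_ball.mem_nhds (Metric.mem_ball.2 hkd)] with y hy
      exact ((hg k (hsF k hk)).2 y hy).1
    intro hzero
    -- Compare `G` with its summand `χ k * g k` along the inner normal of `g k`.
    set v := -gradient (g k) x
    have hv : fderiv ℝ (g k) x v < 0 := by
      rw [map_neg, neg_lt_zero]; exact hdef.fderiv_gradient_pos
    have hline : HasDerivAt (fun t : ℝ => x + t • v) v 0 := by
      simpa using ((hasDerivAt_id (0 : ℝ)).smul_const v).const_add x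
    have hGd : HasDerivAt (fun t : ℝ => G (x + t • v)) 0 0 := by
      have h0 : HasFDerivAt G (fderiv ℝ G x) (x + (0 : ℝ) • v) := by
        simpa using (hGs.differentiable (by simp) x).hasFDerivAt
      have := h0.comp_hasDerivAt 0 hline
      rwa [← inner_gradient_eq, hzero, inner_zero_left] at this
    have hkd' : HasDerivAt (fun t : ℝ => χ k (x + t • v) * g k (x + t • v))
        (fderiv ℝ (g k) x v) 0 := by
      have h0 : HasFDerivAt (g k) (fderiv ℝ (g k) x) (x + (0 : ℝ) • v) := by
        simpa using ((hgs k).differentiable (by simp) x).hasFDerivAt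
      have h1 : HasFDerivAt (χ k) (fderiv ℝ (χ k) x) (x + (0 : ℝ) • v) := by
        simpa using ((χ k).contDiff.differentiable (n := 1) (by simp) x).hasFDerivAt
      have := (h1.comp_hasDerivAt 0 hline).mul (h0.comp_hasDerivAt 0 hline)
      have h2 : fderiv ℝ (g k) x v = fderiv ℝ (χ k) x v * g k (x + (0 : ℝ) • v)
          + χ k (x + (0 : ℝ) • v) * fderiv ℝ (g k) x v := by
        simp [hχk, hgk0]
      rw [h2]; exact this
    have hdiff := hGd.sub hkd'
    have hsl := (hasDerivAt_iff_tendsto_slope.1 hdiff).mono_left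
      (nhdsWithin_mono 0 (fun t (ht : t ∈ Ioi (0 : ℝ)) => ne_of_gt ht))
    have hle : 0 - fderiv ℝ (g k) x v ≤ 0 := by
      refine le_of_tendsto hsl ?_
      filter_upwards [hdef.eventually_mem hv, self_mem_nhdsWithin] with t ht ht0
      have ht0' : (0 : ℝ) < t := ht0
      have hGx0 : G x = 0 := le_antisymm hGx (not_lt.1 fun h => hxn ((hiff x).2 h))
      rw [slope_def_field]
      refine div_nonpos_of_nonpos_of_nonneg ?_ (by linarith)
      simp only [Pi.sub_apply, zero_smul, add_zero, hGx0, hgk0, mul_zero, sub_zero]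
      rw [sub_nonpos, hG]
      dsimp only
      rw [← Finset.add_sum_erase s _ hk]
      have h1 := Finset.sum_nonpos (s := s.erase k)
        fun j hj => hin _ ht j (Finset.mem_of_mem_erase hj)
      linarith [hχ₀n (x + t • v)]
    linarith

end DomainGeometry

section Cutoff

variable {d : ℕ} {Ω : Set (Sp d)}

lemma exists_bound_fderivWithin (hΩ : IsBoundedSmoothDomain Ω) {f : Sp d → ℝ}
    (hf : ContDiffOn ℝ 1 f (closure Ω)) :
    ∃ L, 0 ≤ L ∧ ∀ x ∈ closure Ω, ‖fderivWithin ℝ f (closure Ω) x‖ ≤ L := by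
  obtain ⟨L, hL⟩ := hΩ.isCompact_closure.exists_bound_of_continuousOn
    (hf.continuousOn_fderivWithin (uniqueDiffOn_closure hΩ) le_rfl)
  exact ⟨max L 0, le_max_right _ _, fun x hx => (hL x hx).trans (le_max_left _ _)⟩

/-- A function that is `C¹` up to the boundary and vanishes on `∂Ω` is dominated by any defining
function. Near the boundary, follow the normal direction until `∂Ω` is hit. -/
lemma exists_abs_le_mul_of_eq_zero_on_frontier (hΩ : IsBoundedSmoothDomain Ω) {f G : Sp d → ℝ}
    (hf : ContDiffOn ℝ 1 f (closure Ω)) (hf0 : ∀ x ∈ frontier Ω, f x = 0)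
    (hG : ContDiff ℝ ∞ G) (hiff : ∀ x, x ∈ Ω ↔ G x < 0)
    (hGd : ∀ x ∈ frontier Ω, IsDefiningFunction Ω x G) :
    ∃ C, 0 ≤ C ∧ ∀ x ∈ Ω, |f x| ≤ C * |G x| := by
  obtain ⟨L, hL0, hL⟩ := exists_bound_fderivWithin hΩ hf
  suffices h : ∃ C, ∀ x ∈ closure Ω, x ∈ Ω → |f x| ≤ C * |G x| by
    obtain ⟨C, hC⟩ := h
    refine ⟨max C 0, le_max_right _ _, fun x hx => (hC x (subset_closure hx) hx).trans ?_⟩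
    gcongr; exact le_max_left _ _
  refine hΩ.isCompact_closure.induction_on
    (p := fun s => ∃ C, ∀ x ∈ s, x ∈ Ω → |f x| ≤ C * |G x|) ?_ ?_ ?_ ?_
  · exact ⟨0, by simp⟩
  · rintro s t hst ⟨C, hC⟩
    exact ⟨C, fun x hx => hC x (hst hx)⟩
  · rintro s t ⟨C, hC⟩ ⟨C', hC'⟩
    refine ⟨max C C', fun x hx hxΩ => ?_⟩
    rcases hx with hx | hx
    · refine (hC x hx hxΩ).trans ?_
      gcongr; exact le_max_left _ _
    · refine (hC' x hx hxΩ).trans ?_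
      gcongr; exact le_max_right _ _
  intro x₀ hx₀
  rcases closure_eq_union_frontier hΩ hx₀ with hx₀ | hx₀
  · have hGx : G x₀ < 0 := (hiff x₀).1 hx₀
    have hfc : ContinuousAt f x₀ := hf.continuousOn.continuousAt (closure_mem_nhds hΩ hx₀)
    have hq : ContinuousAt (fun x => |f x| / |G x|) x₀ :=
      hfc.abs.div hG.continuous.continuousAt.abs (abs_ne_zero.2 hGx.ne)
    obtain ⟨c, hc⟩ : ∃ c, |f x₀| / |G x₀| < c := exists_gt _
    have hev := (hq.eventually (gt_mem_nhds hc)).and (hΩ.isOpen.mem_nhds hx₀)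
    refine ⟨_, mem_nhdsWithin_of_mem_nhds hev, c, fun x hx _ => ?_⟩
    have hGx' : 0 < |G x| := abs_pos.2 ((hiff x).1 hx.2).ne
    exact ((div_le_iff₀ hGx').1 hx.1.le)
  · have hdef := hGd x₀ hx₀
    set N := gradient G x₀
    have hN : 0 < ‖N‖ := norm_pos_iff.2 hdef.2.2.1
    have hcont : Continuous fun y => fderiv ℝ G y N :=
      (hG.continuous_fderiv (by simp)).clm_apply continuous_const
    have hN2 : fderiv ℝ G x₀ N = ‖N‖ ^ 2 := by
      rw [← inner_gradient_eq, real_inner_self_eq_norm_sq]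
    have hpos : 0 < ‖N‖ ^ 2 := by positivity
    obtain ⟨δ, hδ, H⟩ := Metric.eventually_nhds_iff.1 (hcont.continuousAt.eventually
      (lt_mem_nhds (show ‖N‖ ^ 2 / 2 < fderiv ℝ G x₀ N by rw [hN2]; linarith)))
    -- `s₁` is the length of the normal segment that stays in the ball of radius `δ`.
    set s₁ := δ / (2 * ‖N‖)
    have hs₁ : 0 < s₁ := by positivity
    have hGs : ContinuousAt G x₀ := hG.continuous.continuousAt
    have hev : ∀ᶠ y in 𝓝 x₀, dist y x₀ < δ / 2 ∧ |G y| < ‖N‖ ^ 2 / 2 * s₁ := by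
      have h0 : |G x₀| < ‖N‖ ^ 2 / 2 * s₁ := by rw [hdef.2.1, abs_zero]; positivity
      exact Filter.Eventually.and (Metric.ball_mem_nhds x₀ (half_pos hδ))
        (hGs.abs.eventually (gt_mem_nhds h0))
    refine ⟨_, mem_nhdsWithin_of_mem_nhds hev, L * (2 / ‖N‖), fun y hy hyΩ => ?_⟩
    obtain ⟨hy1, hy2⟩ := hy
    have hGy : G y < 0 := (hiff y).1 hyΩ
    have hball : ∀ s ∈ Icc 0 s₁, dist (y + s • N) x₀ < δ := by
      intro s hs
      have h1 : dist (y + s • N) x₀ ≤ dist (y + s • N) y + dist y x₀ := dist_triangle _ _ _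
      have h2 : dist (y + s • N) y ≤ δ / 2 := by
        rw [dist_self_add_left, norm_smul, Real.norm_eq_abs, abs_of_nonneg hs.1]
        calc s * ‖N‖ ≤ s₁ * ‖N‖ := by gcongr; exact hs.2
          _ = δ / 2 := by simp only [s₁]; field_simp
      linarith
    set h : ℝ → ℝ := fun s => G (y + s • N)
    have hhd : ∀ s, HasDerivAt h (fderiv ℝ G (y + s • N) N) s := by
      intro s
      have hline : HasDerivAt (fun s : ℝ => y + s • N) N s := by
        simpa using ((hasDerivAt_id s).smul_const N).const_add y
      exact ((hG.differentiable (by simp) _).hasFDerivAt).comp_hasDerivAt s hline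
    have hmono := (convex_Icc 0 s₁).mul_sub_le_image_sub_of_le_deriv (f := h)
      (fun s _ => (hhd s).continuousAt.continuousWithinAt)
      (fun s _ => (hhd s).differentiableAt.differentiableWithinAt) (C := ‖N‖ ^ 2 / 2)
      (fun s hs => by rw [(hhd s).deriv]; exact (H (hball s (interior_subset hs))).le)
    have h00 : h 0 = G y := by simp [h]
    have hh1 : 0 < h s₁ := by
      have := hmono 0 ⟨le_rfl, hs₁.le⟩ s₁ ⟨hs₁.le, le_rfl⟩ hs₁.le
      rw [h00, sub_zero] at this
      have h3 := (abs_lt.1 hy2).1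
      linarith
    obtain ⟨s, hs, hs0⟩ := intermediate_value_Icc hs₁.le
      (fun s _ => (hhd s).continuousAt.continuousWithinAt : ContinuousOn h (Icc 0 s₁))
      (show (0 : ℝ) ∈ Icc (h 0) (h s₁) from ⟨by rw [h00]; exact hGy.le, hh1.le⟩)
    have hsle : ‖N‖ ^ 2 / 2 * s ≤ |G y| := by
      have := hmono 0 ⟨le_rfl, hs₁.le⟩ s hs hs.1
      rw [h00, hs0, sub_zero, zero_sub] at this
      rwa [abs_of_neg hGy]
    have hbefore : ∀ t ∈ Ico 0 s, y + t • N ∈ Ω := by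
      intro t ht
      rw [hiff]
      have := hmono t ⟨ht.1, ht.2.le.trans hs.2⟩ s hs ht.2.le
      rw [hs0] at this
      have h4 : 0 < ‖N‖ ^ 2 / 2 * (s - t) := by
        have : 0 < s - t := by linarith [ht.2]
        positivity
      show h t < 0
      linarith
    have hspos : 0 < s := by
      rcases hs.1.eq_or_lt with h5 | h5
      · rw [← h5, h00] at hs0; exact absurd hs0 hGy.ne
      · exact h5
    have hseg : ∀ t ∈ Icc 0 s, y + t • N ∈ closure Ω := by
      intro t ht
      have hc : Continuous fun t : ℝ => y + t • N := by fun_prop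
      have h6 : t ∈ closure (Ico 0 s) := by rw [closure_Ico hspos.ne]; exact ht
      exact closure_mono (image_subset_iff.2 hbefore) (image_closure_subset_closure_image hc
        ⟨t, h6, rfl⟩)
    have hend : y + s • N ∈ frontier Ω := by
      rw [hΩ.isOpen.frontier_eq]
      exact ⟨hseg s ⟨hspos.le, le_rfl⟩, fun hh => absurd ((hiff _).1 hh) (by
        show ¬ h s < 0
        rw [hs0]; exact lt_irrefl 0)⟩
    have hmv : ‖f y - f (y + s • N)‖ ≤ L * ‖y - (y + s • N)‖ := by
      have hsub : segment ℝ (y + s • N) y ⊆ closure Ω := by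
        intro z hz
        rw [segment_symm, segment_eq_image'] at hz
        obtain ⟨θ, hθ, rfl⟩ := hz
        have := hseg (θ * s) ⟨by have := hθ.1; positivity, by nlinarith [hθ.2]⟩
        simpa [smul_smul] using this
      refine Convex.norm_image_sub_le_of_norm_hasFDerivWithin_le (𝕜 := ℝ)
        (f' := fderivWithin ℝ f (closure Ω)) (s := segment ℝ (y + s • N) y)
        (fun z hz => ?_) (fun z hz => hL z (hsub hz)) (convex_segment _ _)
        (left_mem_segment _ _ _) (right_mem_segment _ _ _)
      exact (((hf.differentiableOn (by simp)) z (hsub hz)).hasFDerivWithinAt).mono hsub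
    rw [hf0 _ hend, sub_zero, sub_add_cancel_left, norm_neg, norm_smul, Real.norm_eq_abs,
      Real.norm_eq_abs, abs_of_pos hspos] at hmv
    refine hmv.trans ?_
    have h7 : s * ‖N‖ ≤ 2 / ‖N‖ * |G y| := by
      rw [div_mul_eq_mul_div, le_div_iff₀ hN]
      nlinarith
    calc L * (s * ‖N‖) ≤ L * (2 / ‖N‖ * |G y|) := by gcongr
      _ = L * (2 / ‖N‖) * |G y| := by ring

lemma exists_bound_deriv_smoothTransition :
    ∃ C, 0 ≤ C ∧ ∀ s, |deriv Real.smoothTransition s| ≤ C := by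
  have hc : Continuous (deriv Real.smoothTransition) :=
    (Real.smoothTransition.contDiff (n := 1)).continuous_deriv le_rfl
  obtain ⟨C, hC⟩ := isCompact_Icc.exists_bound_of_continuousOn (s := Icc (0 : ℝ) 1) hc.continuousOn
  refine ⟨max C 0, le_max_right _ _, fun s => ?_⟩
  by_cases hs : s ∈ Icc (0 : ℝ) 1
  · exact (hC s hs).trans (le_max_left _ _)
  · have : deriv Real.smoothTransition s = 0 := by
      rw [mem_Icc, not_and_or, not_le, not_le] at hs
      rcases hs with hs | hs
      · have : Real.smoothTransition =ᶠ[𝓝 s] fun _ => 0 := by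
          filter_upwards [gt_mem_nhds hs] with t ht
          exact Real.smoothTransition.zero_of_nonpos ht.le
        rw [this.deriv_eq, deriv_const]
      · have : Real.smoothTransition =ᶠ[𝓝 s] fun _ => 1 := by
          filter_upwards [lt_mem_nhds hs] with t ht
          exact Real.smoothTransition.one_of_one_le ht.le
        rw [this.deriv_eq, deriv_const]
    rw [this, abs_zero]; exact le_max_right _ _

lemma deriv_smoothTransition_eq_zero {s : ℝ} (hs : 1 < s) :
    deriv Real.smoothTransition s = 0 := by
  have : Real.smoothTransition =ᶠ[𝓝 s] fun _ => 1 := by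
    filter_upwards [lt_mem_nhds hs] with t ht
    exact Real.smoothTransition.one_of_one_le ht.le
  rw [this.deriv_eq, deriv_const]

/-- Cutoffs `χₙ ↑ 1` of `Ω` whose derivatives along tangential `C¹` fields stay bounded, although
their gradients blow up like the inverse width of the boundary layer: the normal component of
such a field vanishes linearly at the boundary. -/
lemma exists_cutoff (hΩ : IsBoundedSmoothDomain Ω) :
    ∃ χ : ℕ → Sp d → ℝ, (∀ n, ContDiff ℝ ∞ (χ n)) ∧ (∀ n, HasCompactSupport (χ n)) ∧
      (∀ n, tsupport (χ n) ⊆ Ω) ∧ (∀ n x, |χ n x| ≤ 1) ∧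
      (∀ x ∈ Ω, ∀ᶠ n in atTop, χ n =ᶠ[𝓝 x] fun _ => 1) ∧
      ∀ X : Sp d → Sp d, ContDiffOn ℝ 1 X (closure Ω) → IsTangential Ω X →
        ∃ C, ∀ n, ∀ x ∈ Ω, |fderiv ℝ (χ n) x (X x)| ≤ C := by
  obtain ⟨G, hG, hiff, hdef⟩ := exists_global_definingFunction hΩ
  obtain ⟨C₁, hC₁0, hC₁⟩ := exists_bound_deriv_smoothTransition
  set χ : ℕ → Sp d → ℝ := fun n x => Real.smoothTransition (-((n : ℝ) + 1) * G x - 1)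
  have hχs : ∀ n, ContDiff ℝ ∞ (χ n) := fun n =>
    Real.smoothTransition.contDiff.comp ((contDiff_const.mul hG).sub contDiff_const)
  have hsupp : ∀ n, tsupport (χ n) ⊆ {x | G x ≤ -(1 / ((n : ℝ) + 1))} := by
    intro n
    refine closure_minimal (fun x hx => ?_) (isClosed_le hG.continuous continuous_const)
    have h1 : ¬ (-((n : ℝ) + 1) * G x - 1 ≤ 0) := fun h =>
      hx (Real.smoothTransition.zero_of_nonpos h)
    have hn : (0 : ℝ) < n + 1 := by positivity
    show G x ≤ -(1 / ((n : ℝ) + 1))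
    rw [le_neg, div_le_iff₀ hn]
    nlinarith
  have hsuppΩ : ∀ n, tsupport (χ n) ⊆ Ω := fun n x hx => (hiff x).2
    (lt_of_le_of_lt (hsupp n hx) (by
      have : (0 : ℝ) < 1 / ((n : ℝ) + 1) := by positivity
      linarith))
  refine ⟨χ, hχs, fun n => ?_, hsuppΩ, fun n x => ?_, fun x hx => ?_, fun X hX hXt => ?_⟩
  · exact hΩ.isCompact_closure.of_isClosed_subset (isClosed_tsupport _)
      ((hsuppΩ n).trans subset_closure)
  · rw [abs_of_nonneg (Real.smoothTransition.nonneg _)]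
    exact Real.smoothTransition.le_one _
  · have hGx := (hiff x).1 hx
    obtain ⟨m, hm⟩ := exists_nat_gt (2 / (-G x / 2))
    filter_upwards [eventually_ge_atTop m] with n hn
    have hlt : G x < G x / 2 := by linarith
    filter_upwards [hG.continuous.continuousAt.eventually (gt_mem_nhds hlt)] with y hy
    refine Real.smoothTransition.one_of_one_le ?_
    have h2 : (0 : ℝ) < -G x / 2 := by linarith
    have h3 : 2 < m * (-G x / 2) := by rwa [div_lt_iff₀ h2] at hm
    have h4 : (m : ℝ) ≤ n := by exact_mod_cast hn
    nlinarith
  · have hgradG : ContDiff ℝ 1 (fderiv ℝ G) :=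
      hG.fderiv_right (m := 1) (by
      rw [one_add_one_eq_two]; exact ENat.LEInfty.out)
    have hf : ContDiffOn ℝ 1 (fun x => fderiv ℝ G x (X x)) (closure Ω) :=
      hgradG.contDiffOn.clm_apply hX
    obtain ⟨C, hC0, hC⟩ := exists_abs_le_mul_of_eq_zero_on_frontier hΩ hf (fun x hx => by
      have hd := hdef x hx
      have h1 := hXt x hx _ ⟨G, hd, rfl⟩
      rw [inner_smul_right, mul_eq_zero] at h1
      rw [← inner_gradient_eq, real_inner_comm]
      exact h1.resolve_left (inv_ne_zero (norm_ne_zero_iff.2 hd.2.2.1))) hG hiff hdef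
    refine ⟨C₁ * (2 * C), fun n x hx => ?_⟩
    have hn : (0 : ℝ) < n + 1 := by positivity
    have hd : fderiv ℝ (χ n) x (X x) = deriv Real.smoothTransition (-((n : ℝ) + 1) * G x - 1)
        * (-((n : ℝ) + 1) * fderiv ℝ G x (X x)) := by
      have h1 : HasFDerivAt (fun x => -((n : ℝ) + 1) * G x - 1)
          (-((n : ℝ) + 1) • fderiv ℝ G x) x :=
        ((hG.differentiable (by simp) x).hasFDerivAt.const_mul _).sub_const _
      have h2 := ((Real.smoothTransition.contDiff (n := 1)).differentiable (by simp)
        (-((n : ℝ) + 1) * G x - 1)).hasDerivAt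
      have h3 := h2.comp_hasFDerivAt x h1
      rw [show χ n = Real.smoothTransition ∘ fun x => -((n : ℝ) + 1) * G x - 1 from rfl, h3.fderiv]
      simp
    rw [hd, abs_mul]
    by_cases hle : -((n : ℝ) + 1) * G x - 1 ≤ 1
    · refine mul_le_mul (hC₁ _) ?_ (abs_nonneg _) hC₁0
      rw [abs_mul, abs_neg, abs_of_pos hn]
      have h5 := hC x hx
      rw [abs_of_neg ((hiff x).1 hx)] at h5
      calc ((n : ℝ) + 1) * |fderiv ℝ G x (X x)| ≤ ((n : ℝ) + 1) * (C * -G x) := by gcongr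
        _ = C * (-((n : ℝ) + 1) * G x) := by ring
        _ ≤ C * 2 := by gcongr; linarith
        _ = 2 * C := by ring
    · rw [deriv_smoothTransition_eq_zero (not_le.1 hle), abs_zero, zero_mul]
      positivity

end Cutoff

/-! ### Weak gradients against tangential fields -/

section WeakGradient

variable {d : ℕ} {Ω : Set (Sp d)}

variable {G : Fin d → Sp d → ℝ} {f : Sp d → ℝ} {χ : Sp d → ℝ} {Ψ : Sp d → ℝ} {x : Sp d}
  {X : Sp d → Sp d} {ε : ℝ}

variable (hΩ : IsBoundedSmoothDomain Ω) (h : IsWeakGradient Ω Ψ G) (hΨ : IntegrableOn Ψ Ω)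
  (hG : ∀ i, IntegrableOn (G i) Ω) (hχ : ContDiff ℝ 1 χ) (hc : HasCompactSupport χ)

include hΩ h hΨ hG hχ hc

omit h hΨ hG hχ hc in
lemma pdOn_eq_pd (f : Sp d → ℝ) (i : Fin d)
    (hx : x ∈ Ω) : pdOn Ω f i x = pd f i x := by
  rw [pdOn, pd, fderivWithin_of_mem_nhds (closure_mem_nhds hΩ hx)]

omit hΩ h hΨ hG hχ hc in
lemma fderiv_apply_eq_sum (f : Sp d → ℝ) (x v : Sp d) :
    fderiv ℝ f x v = ∑ i, v i * pd f i x := by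
  conv_lhs => rw [← (EuclideanSpace.basisFun (Fin d) ℝ).sum_repr v]
  simp [map_sum, pd]

omit h hΨ hG hχ hc in
lemma continuousOn_pdOn
    (hf : ContDiffOn ℝ 1 f (closure Ω)) (i : Fin d) :
    ContinuousOn (pdOn Ω f i) (closure Ω) :=
  (hf.continuousOn_fderivWithin (uniqueDiffOn_closure hΩ) le_rfl).clm_apply continuousOn_const

omit h hΨ hG hχ hc in
lemma differentiableAt_of_contDiffOn
    (hf : ContDiffOn ℝ 1 f (closure Ω)) (hx : x ∈ Ω) : DifferentiableAt ℝ f x :=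
  (hf.differentiableOn (by simp) x (subset_closure hx)).differentiableAt (closure_mem_nhds hΩ hx)

omit h hΨ hG hχ hc in
lemma contDiff_mul_of_tsupport_subset {χ f : Sp d → ℝ}
    (hχ : ContDiff ℝ 1 χ) (hs : tsupport χ ⊆ Ω) (hf : ContDiffOn ℝ 1 f (closure Ω)) :
    ContDiff ℝ 1 fun x => χ x * f x := by
  rw [contDiff_iff_contDiffAt]
  intro x
  by_cases hx : x ∈ tsupport χ
  · exact hχ.contDiffAt.mul (hf.contDiffAt (closure_mem_nhds hΩ (hs hx)))
  · refine (contDiffAt_const (c := (0 : ℝ))).congr_of_eventuallyEq ?_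
    filter_upwards [notMem_tsupport_iff_eventuallyEq.1 hx] with y hy
    rw [hy]; simp

omit hΩ h hΨ hG hχ hc in
lemma tsupport_mul_subset_left' (χ f : Sp d → ℝ) : tsupport (fun x => χ x * f x) ⊆ tsupport χ :=
  closure_mono fun x hx h => hx (by simp [h])

omit hΩ h hΨ hG hχ hc in
lemma continuous_pd (hf : ContDiff ℝ 1 f) (i : Fin d) : Continuous (pd f i) :=
  (hf.continuous_fderiv (by simp)).clm_apply continuous_const

omit hΩ h hΨ hG hχ hc in
lemma pd_eq_zero_of_notMem (hx : x ∉ tsupport χ) (i : Fin d) :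
    pd χ i x = 0 := by
  rw [pd, (notMem_tsupport_iff_eventuallyEq.1 hx).fderiv_eq]
  simp

omit hΩ h hΨ hG hχ in
lemma hasCompactSupport_pd (i : Fin d) : HasCompactSupport (pd χ i) :=
  HasCompactSupport.intro hc fun _ hx => pd_eq_zero_of_notMem hx i

omit h hΨ hG in
/-- Smooth approximation in `C¹` of a compactly supported `C¹` function. -/
lemma exists_smooth_approx (hs : tsupport χ ⊆ Ω) (hε : 0 < ε) :
    ∃ η : Sp d → ℝ, ContDiff ℝ ∞ η ∧ HasCompactSupport η ∧ tsupport η ⊆ Ω ∧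
      (∀ x, |η x - χ x| ≤ ε) ∧ ∀ i x, |pd η i x - pd χ i x| ≤ ε := by
  obtain ⟨δ₀, hδ₀, hth⟩ := hc.isCompact.exists_cthickening_subset_open hΩ.isOpen hs
  have huc : ∀ f : Sp d → ℝ, Continuous f → HasCompactSupport f →
      ∃ δ > 0, ∀ x y, dist x y < δ → dist (f x) (f y) ≤ ε := by
    intro f hf hfc
    have := Metric.uniformContinuous_iff.1 (hfc.uniformContinuous_of_continuous hf) ε hε
    obtain ⟨δ, hδ, H⟩ := this
    exact ⟨δ, hδ, fun x y h => (H h).le⟩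
  obtain ⟨δ₁, hδ₁, H₁⟩ := huc χ hχ.continuous hc
  choose δ₂ hδ₂ H₂ using fun i => huc (pd χ i) (continuous_pd hχ i) (hasCompactSupport_pd hc i)
  obtain ⟨δ, hδ, hδ0, hδ1, hδ2⟩ : ∃ δ > 0, δ ≤ δ₀ ∧ δ ≤ δ₁ ∧ ∀ i, δ ≤ δ₂ i := by
    obtain ⟨m, hm, hm'⟩ : ∃ m > 0, ∀ i, m ≤ δ₂ i := by
      rcases isEmpty_or_nonempty (Fin d) with h | h
      · exact ⟨1, one_pos, fun i => h.elim i⟩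
      · obtain ⟨j, hj⟩ := Finite.exists_min δ₂
        exact ⟨δ₂ j, hδ₂ j, hj⟩
    exact ⟨min δ₀ (min δ₁ m), by positivity, min_le_left _ _,
      (min_le_right _ _).trans (min_le_left _ _),
      fun i => ((min_le_right _ _).trans (min_le_right _ _)).trans (hm' i)⟩
  let φ : ContDiffBump (0 : Sp d) := ⟨δ / 2, δ, by positivity, by linarith⟩
  set L := ContinuousLinearMap.lsmul ℝ ℝ (E := ℝ)
  set η : Sp d → ℝ := convolution (φ.normed volume) χ L volume
  have hφc : Continuous (φ.normed (volume : Measure (Sp d))) := φ.continuous_normed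
  have hφl : LocallyIntegrable (φ.normed (volume : Measure (Sp d))) volume := hφc.locallyIntegrable
  have hηt : tsupport η ⊆ Metric.cthickening δ (tsupport χ) := by
    refine closure_minimal (fun x hx => ?_) Metric.isClosed_cthickening
    obtain ⟨y, hy, z, hz, rfl⟩ := support_convolution_subset L hx
    rw [φ.support_normed_eq, Metric.mem_ball, dist_zero_right] at hy
    refine Metric.mem_cthickening_of_dist_le _ z δ _ (subset_tsupport _ hz) ?_
    simpa [dist_eq_norm] using hy.le
  refine ⟨η, ?_, ?_, (hηt.trans (Metric.cthickening_mono hδ0 _)).trans hth, ?_, ?_⟩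
  · exact φ.hasCompactSupport_normed.contDiff_convolution_left L φ.contDiff_normed
      hχ.continuous.locallyIntegrable
  · exact hc.isCompact.cthickening.of_isClosed_subset (isClosed_tsupport _) hηt
  · intro x
    rw [← Real.dist_eq]
    exact φ.dist_normed_convolution_le hχ.continuous.aestronglyMeasurable
      fun y hy => H₁ y x (lt_of_lt_of_le hy hδ1)
  · intro i x
    have h1 : pd η i x = convolution (φ.normed volume) (pd χ i) L volume x := by
      rw [pd, (hc.hasFDerivAt_convolution_right L hφl hχ x).fderiv,
        convolution_precompR_apply L hφl (hc.fderiv ℝ) (hχ.continuous_fderiv (by simp))]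
      rfl
    rw [h1, ← Real.dist_eq]
    exact φ.dist_normed_convolution_le (continuous_pd hχ i).aestronglyMeasurable
      fun y hy => H₂ i y x (lt_of_lt_of_le hy (hδ2 i))

omit hΩ h hΨ hG hχ hc in
lemma abs_setIntegral_mul_sub_le {w f g : Sp d → ℝ} (hw : IntegrableOn w Ω)
    (hf : IntegrableOn (fun x => w x * f x) Ω) (hg : IntegrableOn (fun x => w x * g x) Ω)
    (h : ∀ x, |f x - g x| ≤ ε) :
    |(∫ x in Ω, w x * f x) - ∫ x in Ω, w x * g x| ≤ (∫ x in Ω, |w x|) * ε := by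
  rw [← integral_sub hf hg, ← integral_mul_const]
  refine (abs_integral_le_integral_abs).trans (integral_mono ?_ (hw.abs.mul_const ε) fun x => ?_)
  · exact (hf.sub hg).abs
  · show |w x * f x - w x * g x| ≤ |w x| * ε
    rw [← mul_sub, abs_mul]
    exact mul_le_mul_of_nonneg_left (h x) (abs_nonneg _)

omit hΩ h hΨ hG hχ hc in
lemma integrableOn_mul_of_continuous {w f : Sp d → ℝ} (hw : IntegrableOn w Ω)
    (hf : Continuous f) (hc : HasCompactSupport f) : IntegrableOn (fun x => w x * f x) Ω := by
  obtain ⟨C, hC⟩ := hc.exists_bound_of_continuous hf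
  exact hw.mul_bdd hf.aestronglyMeasurable (ae_of_all _ hC)

omit hΩ h hΨ hG hχ hc in
lemma eq_of_forall_abs_sub_le {a b C : ℝ} (h : ∀ ε > 0, |a - b| ≤ C * ε) : a = b := by
  rw [← sub_eq_zero, ← abs_eq_zero]
  refine le_antisymm (le_of_forall_pos_le_add fun ε hε => ?_) (abs_nonneg _)
  refine (h (ε / (|C| + 1)) (by positivity)).trans ?_
  rw [zero_add, mul_div_assoc', div_le_iff₀ (by positivity)]
  nlinarith [le_abs_self C]

/-- The defining identity of weak gradients extends to `C¹` test functions. -/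
lemma IsWeakGradient.integral_pd (hs : tsupport χ ⊆ Ω) (i : Fin d) :
    ∫ x in Ω, Ψ x * pd χ i x = - ∫ x in Ω, G i x * χ x := by
  refine eq_of_forall_abs_sub_le (C := (∫ x in Ω, |Ψ x|) + ∫ x in Ω, |G i x|) fun ε hε => ?_
  obtain ⟨η, hη, hηc, hηs, h1, h2⟩ := exists_smooth_approx hΩ hχ hc hs hε
  have hη1 : ContDiff ℝ 1 η := hη.of_le (by simp)
  have e1 := abs_setIntegral_mul_sub_le hΨ
    (integrableOn_mul_of_continuous hΨ (continuous_pd hη1 i) (hasCompactSupport_pd hηc i))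
    (integrableOn_mul_of_continuous hΨ (continuous_pd hχ i) (hasCompactSupport_pd hc i)) (h2 i)
  have e2 := abs_setIntegral_mul_sub_le (hG i)
    (integrableOn_mul_of_continuous (hG i) hη.continuous hηc)
    (integrableOn_mul_of_continuous (hG i) hχ.continuous hc) h1
  rw [h η hη hηc hηs i] at e1
  rw [abs_le] at *
  constructor <;> linarith [e1.1, e1.2, e2.1, e2.2]

omit hΨ in
/-- Weak gradients are curl free, tested with `C¹` functions. -/
lemma IsWeakGradient.integral_curl (hs : tsupport χ ⊆ Ω) (i j : Fin d) :
    ∫ x in Ω, G i x * pd χ j x = ∫ x in Ω, G j x * pd χ i x := by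
  refine eq_of_forall_abs_sub_le (C := (∫ x in Ω, |G i x|) + ∫ x in Ω, |G j x|) fun ε hε => ?_
  obtain ⟨η, hη, hηc, hηs, h1, h2⟩ := exists_smooth_approx hΩ hχ hc hs hε
  have hη1 : ContDiff ℝ 1 η := hη.of_le (by simp)
  have e : ∀ i j, |(∫ x in Ω, G i x * pd η j x) - ∫ x in Ω, G i x * pd χ j x|
      ≤ (∫ x in Ω, |G i x|) * ε := fun i j => abs_setIntegral_mul_sub_le (hG i)
    (integrableOn_mul_of_continuous (hG i) (continuous_pd hη1 j) (hasCompactSupport_pd hηc j))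
    (integrableOn_mul_of_continuous (hG i) (continuous_pd hχ j) (hasCompactSupport_pd hc j)) (h2 j)
  have hpd : ∀ k, ContDiff ℝ ∞ (pd η k) := fun k =>
    (hη.fderiv_right (m := ∞) le_rfl).clm_apply contDiff_const
  have hts : ∀ k, tsupport (pd η k) ⊆ Ω := fun k => (closure_minimal (fun x hx => by
    by_contra hx'
    exact hx (pd_eq_zero_of_notMem hx' k)) (isClosed_tsupport η)).trans hηs
  have hsymm : ∀ x, pd (pd η j) i x = pd (pd η i) j x := by
    intro x
    have hd : DifferentiableAt ℝ (fderiv ℝ η) x :=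
      (hη.fderiv_right (m := ∞) le_rfl).differentiable (by simp) x
    have hpp : ∀ k l, pd (pd η k) l x
        = fderiv ℝ (fderiv ℝ η) x (EuclideanSpace.single l 1) (EuclideanSpace.single k 1) := by
      intro k l
      rw [pd]
      have : pd η k = fun y => fderiv ℝ η y (EuclideanSpace.single k 1) := rfl
      rw [this, fderiv_clm_apply hd (differentiableAt_const _)]
      simp
    rw [hpp, hpp]
    exact (hη.contDiffAt.isSymmSndFDerivAt (by simp; exact ENat.LEInfty.out)) _ _
  have e0 : ∫ x in Ω, G i x * pd η j x = ∫ x in Ω, G j x * pd η i x := by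
    have h3 := h (pd η j) (hpd j) (hasCompactSupport_pd hηc j) (hts j) i
    have h4 := h (pd η i) (hpd i) (hasCompactSupport_pd hηc i) (hts i) j
    simp_rw [hsymm] at h3
    linarith
  have e1 := e i j
  have e2 := e j i
  rw [abs_le] at *
  constructor <;> linarith [e1.1, e1.2, e2.1, e2.2]

omit h hΨ hG hχ hc in
lemma IsBoundedSmoothDomain.integrableOn_mul {w f : Sp d → ℝ}
    (hw : IntegrableOn w Ω) (hf : ContinuousOn f (closure Ω)) :
    IntegrableOn (fun x => w x * f x) Ω := by
  obtain ⟨C, hC⟩ := hΩ.isCompact_closure.exists_bound_of_continuousOn hf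
  refine hw.mul_bdd (c := C) ((hf.mono subset_closure).aestronglyMeasurable
    hΩ.isOpen.measurableSet) ?_
  filter_upwards [ae_restrict_mem hΩ.isOpen.measurableSet] with x hx using hC x (subset_closure hx)

omit h hΨ hG hχ hc in
lemma IsBoundedSmoothDomain.integrableOn
    (hf : ContinuousOn f (closure Ω)) : IntegrableOn f Ω :=
  (hf.integrableOn_compact hΩ.isCompact_closure).mono_set subset_closure

omit h hΨ hG hχ hc in
lemma tendsto_setIntegral_mul_cutoff {w : Sp d → ℝ}
    (hw : IntegrableOn w Ω) {f : ℕ → Sp d → ℝ} {f₀ : Sp d → ℝ} {C : ℝ}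
    (hm : ∀ n, ContinuousOn (f n) Ω) (hb : ∀ n, ∀ x ∈ Ω, |f n x| ≤ C)
    (hlim : ∀ x ∈ Ω, ∀ᶠ n in atTop, f n x = f₀ x) :
    Tendsto (fun n => ∫ x in Ω, w x * f n x) atTop (𝓝 (∫ x in Ω, w x * f₀ x)) := by
  refine tendsto_integral_of_dominated_convergence (fun x => |w x| * C) (fun n => ?_)
    (hw.abs.mul_const C) (fun n => ?_) ?_
  · exact hw.aestronglyMeasurable.mul ((hm n).aestronglyMeasurable hΩ.isOpen.measurableSet)
  · filter_upwards [ae_restrict_mem hΩ.isOpen.measurableSet] with x hx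
    rw [Real.norm_eq_abs, abs_mul]
    exact mul_le_mul_of_nonneg_left (hb n x hx) (abs_nonneg _)
  · filter_upwards [ae_restrict_mem hΩ.isOpen.measurableSet] with x hx
    refine tendsto_const_nhds.congr' ?_
    filter_upwards [hlim x hx] with n hn
    rw [hn]

omit hΩ h hΨ hG hχ hc in
lemma pd_mul {f g : Sp d → ℝ} (hf : DifferentiableAt ℝ f x)
    (hg : DifferentiableAt ℝ g x) (i : Fin d) :
    pd (fun y => f y * g y) i x = pd f i x * g x + f x * pd g i x := by
  rw [pd, fderiv_fun_mul hf hg]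
  simp [pd]; ring

omit hΩ h hΨ hG hχ hc in
lemma contDiffOn_coord {s : Set (Sp d)} {n : ℕ∞ω} (hX : ContDiffOn ℝ n X s)
    (i : Fin d) : ContDiffOn ℝ n (fun x => X x i) s := by
  have := (EuclideanSpace.proj (𝕜 := ℝ) i : Sp d →L[ℝ] ℝ).contDiff (n := n)
  exact this.comp_contDiffOn hX

omit h hΨ hG hχ hc in
lemma IsBoundedSmoothDomain.exists_bound
    (hf : ContinuousOn f (closure Ω)) : ∃ C, 0 ≤ C ∧ ∀ x ∈ closure Ω, |f x| ≤ C := by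
  obtain ⟨C, hC⟩ := hΩ.isCompact_closure.exists_bound_of_continuousOn hf
  exact ⟨max C 0, le_max_right _ _, fun x hx => (hC x hx).trans (le_max_left _ _)⟩

omit hχ hc in
/-- Integration by parts without boundary term: a weak gradient against a tangential `C¹` field. -/
lemma IsWeakGradient.integral_tangential (hX : ContDiffOn ℝ 1 X (closure Ω))
    (hXt : IsTangential Ω X) :
    ∑ i, ∫ x in Ω, G i x * X x i = - ∫ x in Ω, Ψ x * ∑ i, pdOn Ω (fun y => X y i) i x := by
  obtain ⟨χ, hχs, hχc, hχΩ, hχ1, hχe, hχX⟩ := exists_cutoff hΩ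
  obtain ⟨C, hC⟩ := hχX X hX hXt
  have hXi := contDiffOn_coord hX
  have hXc : ∀ i, ContinuousOn (fun x => X x i) (closure Ω) := fun i => (hXi i).continuousOn
  have hχ1s : ∀ n, ContDiff ℝ 1 (χ n) := fun n => (hχs n).of_le (by simp)
  have hdiv : ContinuousOn (fun x => ∑ i, pdOn Ω (fun y => X y i) i x) (closure Ω) :=
    continuousOn_finsetSum _ fun i _ => continuousOn_pdOn hΩ (hXi i) i
  have hn : ∀ n, ∑ i, ∫ x in Ω, G i x * (χ n x * X x i)
      = -((∫ x in Ω, Ψ x * fderiv ℝ (χ n) x (X x))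
        + ∫ x in Ω, Ψ x * (χ n x * ∑ i, pdOn Ω (fun y => X y i) i x)) := by
    intro n
    have hi : ∀ i, ∫ x in Ω, Ψ x * pd (fun y => χ n y * X y i) i x
        = - ∫ x in Ω, G i x * (χ n x * X x i) := fun i =>
      h.integral_pd hΩ hΨ hG (contDiff_mul_of_tsupport_subset hΩ (hχ1s n) (hχΩ n) (hXi i))
        ((hχc n).mul_right (f' := fun x => X x i)) ((tsupport_mul_subset_left' _ _).trans (hχΩ n)) i
    have hcs : ∀ i, IntegrableOn (fun x => Ψ x * pd (fun y => χ n y * X y i) i x) Ω := fun i =>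
      integrableOn_mul_of_continuous hΨ (continuous_pd (contDiff_mul_of_tsupport_subset hΩ (hχ1s n)
        (hχΩ n) (hXi i)) i) (hasCompactSupport_pd ((hχc n).mul_right (f' := fun x => X x i)) i)
    have hA : IntegrableOn (fun x => Ψ x * fderiv ℝ (χ n) x (X x)) Ω :=
      hΩ.integrableOn_mul hΨ
        (((hχ1s n).continuous_fderiv (by simp)).continuousOn.clm_apply hX.continuousOn)
    have hB : IntegrableOn (fun x => Ψ x * (χ n x * ∑ i, pdOn Ω (fun y => X y i) i x)) Ω :=
      hΩ.integrableOn_mul hΨ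
        ((hχ1s n).continuous.continuousOn.mul hdiv)
    rw [← integral_add hA hB, ← neg_inj, neg_neg, ← Finset.sum_neg_distrib]
    simp_rw [← hi]
    rw [← integral_finsetSum _ fun i _ => hcs i]
    refine setIntegral_congr_fun hΩ.isOpen.measurableSet fun x hx => ?_
    simp only
    rw [← mul_sum, ← mul_add, fderiv_apply_eq_sum]
    congr 1
    rw [mul_sum, ← sum_add_distrib]
    refine sum_congr rfl fun i _ => ?_
    rw [pd_mul ((hχ1s n).differentiable (by simp) x) (differentiableAt_of_contDiffOn hΩ (hXi i) hx),
      pdOn_eq_pd hΩ _ _ hx, mul_comm (X x i)]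
  have l1 : Tendsto (fun n => ∑ i, ∫ x in Ω, G i x * (χ n x * X x i)) atTop
      (𝓝 (∑ i, ∫ x in Ω, G i x * X x i)) := by
    refine tendsto_finsetSum _ fun i _ => ?_
    obtain ⟨c, hc0, hc⟩ := hΩ.exists_bound (hXc i)
    refine tendsto_setIntegral_mul_cutoff hΩ (hG i) (C := c)
      (fun n => (hχ1s n).continuous.continuousOn.mul ((hXc i).mono subset_closure))
      (fun n x hx => ?_) fun x hx => ?_
    · rw [abs_mul]
      calc |χ n x| * |X x i| ≤ 1 * c :=
            mul_le_mul (hχ1 n x) (hc x (subset_closure hx)) (abs_nonneg _) zero_le_one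
        _ = c := one_mul c
    · filter_upwards [hχe x hx] with n hn'
      rw [hn'.eq_of_nhds, one_mul]
  have l2 : Tendsto (fun n => ∫ x in Ω, Ψ x * fderiv ℝ (χ n) x (X x)) atTop
      (𝓝 (∫ x in Ω, Ψ x * 0)) := by
    refine tendsto_setIntegral_mul_cutoff hΩ hΨ (C := C) (fun n => ?_) hC fun x hx => ?_
    · exact (((hχ1s n).continuous_fderiv (by simp)).continuousOn.clm_apply
        (hX.continuousOn.mono subset_closure))
    · filter_upwards [hχe x hx] with n hn'
      rw [hn'.fderiv_eq]; simp
  have l3 : Tendsto (fun n => ∫ x in Ω, Ψ x * (χ n x * ∑ i, pdOn Ω (fun y => X y i) i x)) atTop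
      (𝓝 (∫ x in Ω, Ψ x * ∑ i, pdOn Ω (fun y => X y i) i x)) := by
    obtain ⟨c, hc0, hc⟩ := hΩ.exists_bound hdiv
    refine tendsto_setIntegral_mul_cutoff hΩ hΨ (C := c)
      (fun n => (hχ1s n).continuous.continuousOn.mul (hdiv.mono subset_closure))
      (fun n x hx => ?_) fun x hx => ?_
    · rw [abs_mul]
      calc _ ≤ 1 * c := mul_le_mul (hχ1 n x) (hc x (subset_closure hx)) (abs_nonneg _) zero_le_one
        _ = c := one_mul c
    · filter_upwards [hχe x hx] with n hn'
      rw [hn'.eq_of_nhds, one_mul]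
  have l4 := (l2.add l3).neg
  simp_rw [← hn] at l4
  simpa using tendsto_nhds_unique l1 l4

omit hΨ hχ hc in
/-- The field `div (a ⊗ b - b ⊗ a)` is orthogonal to weak gradients when `a` and `b` are tangential:
cutting off the antisymmetric matrix only creates terms with tangential derivatives of the
cutoff. -/
lemma IsWeakGradient.integral_div_antisymm {a b : Sp d → Sp d} (ha : ContDiffOn ℝ 1 a (closure Ω))
    (hb : ContDiffOn ℝ 1 b (closure Ω)) (hat : IsTangential Ω a) (hbt : IsTangential Ω b) :
    ∑ i, ∑ j, ∫ x in Ω, G i x * pdOn Ω (fun y => a y j * b y i - b y j * a y i) j x = 0 := by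
  obtain ⟨χ, hχs, hχc, hχΩ, hχ1, hχe, hχX⟩ := exists_cutoff hΩ
  obtain ⟨Ca, hCa⟩ := hχX a ha hat
  obtain ⟨Cb, hCb⟩ := hχX b hb hbt
  have hai := contDiffOn_coord ha
  have hbi := contDiffOn_coord hb
  have hχ1s : ∀ n, ContDiff ℝ 1 (χ n) := fun n => (hχs n).of_le (by simp)
  have hAs : ∀ i j, ContDiffOn ℝ 1 (fun y => a y j * b y i - b y j * a y i) (closure Ω) :=
    fun i j => ((hai j).mul (hbi i)).sub ((hbi j).mul (hai i))
  have hab : ∀ i j, ContDiffOn ℝ 1 (fun y => a y j * b y i) (closure Ω) :=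
    fun i j => (hai j).mul (hbi i)
  have hBs : ∀ n i j, ContDiff ℝ 1 (fun y => χ n y * (a y j * b y i)) := fun n i j =>
    contDiff_mul_of_tsupport_subset hΩ (hχ1s n) (hχΩ n) (hab i j)
  have hBc : ∀ n i j, HasCompactSupport (fun y => χ n y * (a y j * b y i)) := fun n i j =>
    (hχc n).mul_right (f' := fun y => a y j * b y i)
  have hint : ∀ n i j k l, IntegrableOn
      (fun x => G k x * pd (fun y => χ n y * (a y j * b y i)) l x) Ω := fun n i j k l =>
    integrableOn_mul_of_continuous (hG k) (continuous_pd (hBs n i j) l)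
      (hasCompactSupport_pd (hBc n i j) l)
  have hcd : ∀ n, Continuous (fderiv ℝ (χ n)) := fun n => (hχ1s n).continuous_fderiv (by simp)
  have hcu : ∀ n (X : Sp d → Sp d) (f : Sp d → ℝ), ContinuousOn X (closure Ω) →
      ContinuousOn f (closure Ω) →
      ContinuousOn (fun x => fderiv ℝ (χ n) x (X x) * f x) (closure Ω) := fun n X f hX hf =>
    ((hcd n).continuousOn.clm_apply hX).mul hf
  have hdA : ∀ i, ContinuousOn (fun x => ∑ j, pdOn Ω (fun y => a y j * b y i - b y j * a y i) j x)
      (closure Ω) := fun i =>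
    continuousOn_finsetSum _ fun j _ => continuousOn_pdOn hΩ (hAs i j) j
  have hn : ∀ n, ∑ i, (((∫ x in Ω, G i x * (fderiv ℝ (χ n) x (a x) * b x i))
      - ∫ x in Ω, G i x * (fderiv ℝ (χ n) x (b x) * a x i))
      + ∫ x in Ω, G i x * (χ n x * ∑ j, pdOn Ω (fun y => a y j * b y i - b y j * a y i) j x))
      = 0 := by
    intro n
    have h1 : ∑ i, ∑ j, ((∫ x in Ω, G i x * pd (fun y => χ n y * (a y j * b y i)) j x)
        - ∫ x in Ω, G i x * pd (fun y => χ n y * (a y i * b y j)) j x) = 0 := by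
      simp_rw [sum_sub_distrib]
      rw [sub_eq_zero]
      conv_rhs => rw [Finset.sum_comm]
      refine sum_congr rfl fun i _ => sum_congr rfl fun j _ => ?_
      exact h.integral_curl hΩ hG (hBs n i j) (hBc n i j)
        ((tsupport_mul_subset_left' _ _).trans (hχΩ n)) i j
    rw [← h1]
    refine sum_congr rfl fun i _ => ?_
    rw [← integral_sub, ← integral_add]
    · simp_rw [← integral_sub (hint n _ _ _ _) (hint n _ _ _ _)]
      have hI : ∀ j ∈ Finset.univ, IntegrableOn (fun x =>
          G i x * pd (fun y => χ n y * (a y j * b y i)) j x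
            - G i x * pd (fun y => χ n y * (a y i * b y j)) j x) Ω := fun j _ =>
        (hint n _ _ _ _).sub (hint n _ _ _ _)
      rw [← integral_finsetSum _ hI]
      refine setIntegral_congr_fun hΩ.isOpen.measurableSet fun x hx => ?_
      simp only
      have hda : ∀ i, DifferentiableAt ℝ (fun y => a y i) x := fun i =>
        differentiableAt_of_contDiffOn hΩ (hai i) hx
      have hdb : ∀ i, DifferentiableAt ℝ (fun y => b y i) x := fun i =>
        differentiableAt_of_contDiffOn hΩ (hbi i) hx
      have hdχ : DifferentiableAt ℝ (χ n) x := (hχ1s n).differentiable (by simp) x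
      have hab' : ∀ i j, DifferentiableAt ℝ (fun y => a y j * b y i) x := fun i j =>
        differentiableAt_of_contDiffOn hΩ (hab i j) hx
      have hsub : ∀ j, pdOn Ω (fun y => a y j * b y i - b y j * a y i) j x
          = pd (fun y => a y j * b y i) j x - pd (fun y => a y i * b y j) j x := by
        intro j
        rw [pdOn_eq_pd hΩ _ _ hx]
        have : (fun y => a y j * b y i - b y j * a y i)
            = fun y => a y j * b y i - a y i * b y j := by ext y; ring
        rw [this, pd, fderiv_fun_sub (hab' i j) (hab' j i)]
        rfl
      simp_rw [hsub, pd_mul hdχ (hab' _ _), fderiv_apply_eq_sum]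
      simp only [sum_mul, mul_sum]
      rw [← sum_sub_distrib, ← sum_add_distrib]
      refine sum_congr rfl fun j _ => ?_
      ring
    · exact (hΩ.integrableOn_mul (hG i)
        (hcu n a _ ha.continuousOn (hbi i).continuousOn)).sub
        (hΩ.integrableOn_mul (hG i)
        (hcu n b _ hb.continuousOn (hai i).continuousOn))
    · exact hΩ.integrableOn_mul (hG i)
        ((hχ1s n).continuous.continuousOn.mul (hdA i))
    · exact hΩ.integrableOn_mul (hG i)
        (hcu n a _ ha.continuousOn (hbi i).continuousOn)
    · exact hΩ.integrableOn_mul (hG i)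
        (hcu n b _ hb.continuousOn (hai i).continuousOn)
  have l1 : ∀ (X : Sp d → Sp d) (f : Sp d → ℝ) (C : ℝ), ContinuousOn X (closure Ω) →
      ContinuousOn f (closure Ω) → (∀ n, ∀ x ∈ Ω, |fderiv ℝ (χ n) x (X x)| ≤ C) → ∀ i,
      Tendsto (fun n => ∫ x in Ω, G i x * (fderiv ℝ (χ n) x (X x) * f x)) atTop
      (𝓝 (∫ x in Ω, G i x * 0)) := by
    intro X f C hX hf hC i
    obtain ⟨c, hc0, hc⟩ := hΩ.exists_bound hf
    refine tendsto_setIntegral_mul_cutoff hΩ (hG i) (C := C * c)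
      (fun n => (hcu n X f hX hf).mono subset_closure) (fun n x hx => ?_) fun x hx => ?_
    · rw [abs_mul]
      exact mul_le_mul (hC n x hx) (hc x (subset_closure hx)) (abs_nonneg _)
        ((abs_nonneg _).trans (hC n x hx))
    · filter_upwards [hχe x hx] with n hn'
      rw [hn'.fderiv_eq]; simp
  have l3 : ∀ i, Tendsto (fun n => ∫ x in Ω, G i x *
      (χ n x * ∑ j, pdOn Ω (fun y => a y j * b y i - b y j * a y i) j x)) atTop
      (𝓝 (∫ x in Ω, G i x * ∑ j, pdOn Ω (fun y => a y j * b y i - b y j * a y i) j x)) := by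
    intro i
    obtain ⟨c, hc0, hc⟩ := hΩ.exists_bound (hdA i)
    refine tendsto_setIntegral_mul_cutoff hΩ (hG i) (C := c)
      (fun n => (hχ1s n).continuous.continuousOn.mul ((hdA i).mono subset_closure))
      (fun n x hx => ?_) fun x hx => ?_
    · rw [abs_mul]
      calc _ ≤ 1 * c := mul_le_mul (hχ1 n x) (hc x (subset_closure hx)) (abs_nonneg _) zero_le_one
        _ = c := one_mul c
    · filter_upwards [hχe x hx] with n hn'
      rw [hn'.eq_of_nhds, one_mul]
  have l4i := fun i => ((l1 a _ Ca ha.continuousOn (hbi i).continuousOn hCa i).sub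
    (l1 b _ Cb hb.continuousOn (hai i).continuousOn hCb i)).add (l3 i)
  have l4 := tendsto_finsetSum Finset.univ fun i (_ : i ∈ Finset.univ) => l4i i
  simp_rw [hn] at l4
  have l5 := tendsto_nhds_unique l4 tendsto_const_nhds
  rw [← l5]
  refine sum_congr rfl fun i _ => ?_
  simp_rw [mul_sum]
  rw [integral_finsetSum _ fun j _ => hΩ.integrableOn_mul (hG i)
    (continuousOn_pdOn hΩ (hAs i j) j)]
  simp

omit h hΨ hG hχ hc in
/-- Functions that are `C¹` up to the boundary have their classical gradient as weak gradient. -/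
lemma isWeakGradient_pdOn {θ : Sp d → ℝ}
    (hθ : ContDiffOn ℝ 1 θ (closure Ω)) : IsWeakGradient Ω θ (pdOn Ω θ) := by
  intro χ hχ hc hs i
  have hχ1 : ContDiff ℝ 1 χ := hχ.of_le (by simp)
  have hint : ∀ f g : Sp d → ℝ, ContinuousOn f (closure Ω) → Continuous g →
      (∀ x, x ∉ tsupport χ → g x = 0) → Integrable (fun x => f x * g x) := by
    intro f g hf hg h0
    have hsub : Function.support (fun x => f x * g x) ⊆ tsupport χ := fun x hx => by
      by_contra hx'
      exact hx (by simp [h0 x hx'])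
    rw [← integrableOn_iff_integrable_of_support_subset hsub]
    exact ((hf.mono (hs.trans subset_closure)).mul hg.continuousOn).integrableOn_compact hc
  have hχ0 : ∀ x, x ∉ tsupport χ → χ x = 0 := fun x hx => image_eq_zero_of_notMem_tsupport hx
  have hpd0 : ∀ x, x ∉ tsupport χ → pd χ i x = 0 := fun x hx => pd_eq_zero_of_notMem hx i
  have e1 : ∀ x, fderiv ℝ θ x (EuclideanSpace.single i 1) * χ x = pdOn Ω θ i x * χ x := by
    intro x
    by_cases hx : x ∈ tsupport χ
    · rw [pdOn_eq_pd hΩ _ _ (hs hx), pd]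
    · rw [hχ0 x hx, mul_zero, mul_zero]
  have := integral_mul_fderiv_eq_neg_fderiv_mul_of_integrable (μ := volume) (f := θ) (g := χ)
    (v := EuclideanSpace.single i 1) (by
      simp_rw [e1]
      exact hint _ _ (continuousOn_pdOn hΩ hθ i) hχ.continuous hχ0)
    (hint _ _ hθ.continuousOn (continuous_pd hχ1 i) hpd0)
    (hint _ _ hθ.continuousOn hχ.continuous hχ0)
    (fun x hx => differentiableAt_of_contDiffOn hΩ hθ (hs hx))
    (fun x _ => hχ1.differentiable (by simp) x)
  simp_rw [e1] at this
  rw [setIntegral_eq_integral_of_forall_compl_eq_zero fun x hx => by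
      rw [hpd0 x fun h => hx (hs h), mul_zero],
    setIntegral_eq_integral_of_forall_compl_eq_zero fun x hx => by
      rw [hχ0 x fun h => hx (hs h), mul_zero]]
  exact this

end WeakGradient

/-! ### Young measures and nonlinearities of energy growth -/

section Young

variable {d : ℕ} {Ω : Set (Sp d)} {T : ℝ} {ν : ℝ → Sp d → Measure (Phase d)}

/-- The energy density `s + s|v|² + |F|²`. -/
def fEnergy (y : Phase d) : ℝ := fRho y + fKin y + fPot y

lemma continuous_fRho : Continuous (fRho : Phase d → ℝ) := by unfold fRho; fun_prop
lemma continuous_fMom (i : Fin d) : Continuous (fMom i : Phase d → ℝ) := by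
  unfold fMom; fun_prop
lemma continuous_fConv (i j : Fin d) : Continuous (fConv i j : Phase d → ℝ) := by
  unfold fConv; fun_prop
lemma continuous_fKin : Continuous (fKin : Phase d → ℝ) := by unfold fKin; fun_prop
lemma continuous_fPot : Continuous (fPot : Phase d → ℝ) := by unfold fPot; fun_prop
lemma continuous_fStress (i j : Fin d) : Continuous (fStress i j : Phase d → ℝ) := by
  unfold fStress; fun_prop
lemma continuous_fEnergy : Continuous (fEnergy : Phase d → ℝ) :=
  (continuous_fRho.add continuous_fKin).add continuous_fPot

lemma fRho_nonneg (y : Phase d) : 0 ≤ fRho y := y.1.1.2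
lemma fKin_nonneg (y : Phase d) : 0 ≤ fKin y := mul_nonneg y.1.1.2 (sq_nonneg _)
lemma fPot_nonneg (y : Phase d) : 0 ≤ fPot y := sq_nonneg _
lemma fEnergy_nonneg (y : Phase d) : 0 ≤ fEnergy y :=
  add_nonneg (add_nonneg (fRho_nonneg y) (fKin_nonneg y)) (fPot_nonneg y)

lemma sq_coord_le (v : Sp d) (i : Fin d) : v i ^ 2 ≤ ‖v‖ ^ 2 := by
  rw [EuclideanSpace.real_norm_sq_eq]
  exact Finset.single_le_sum (f := fun j => v j ^ 2) (fun j _ => sq_nonneg _) (Finset.mem_univ i)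

lemma abs_mul_coord_le (v : Sp d) (i j : Fin d) : |v i * v j| ≤ ‖v‖ ^ 2 := by
  have h1 := sq_coord_le v i
  have h2 := sq_coord_le v j
  rw [abs_le]; constructor <;> nlinarith [sq_nonneg (v i + v j), sq_nonneg (v i - v j)]

lemma abs_fRho_le (y : Phase d) : |fRho y| ≤ fEnergy y := by
  rw [abs_of_nonneg (fRho_nonneg y), fEnergy]
  linarith [fKin_nonneg y, fPot_nonneg y]
lemma abs_fKin_le (y : Phase d) : |fKin y| ≤ fEnergy y := by
  rw [abs_of_nonneg (fKin_nonneg y), fEnergy]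
  linarith [fRho_nonneg y, fPot_nonneg y]
lemma abs_fPot_le (y : Phase d) : |fPot y| ≤ fEnergy y := by
  rw [abs_of_nonneg (fPot_nonneg y), fEnergy]
  linarith [fRho_nonneg y, fKin_nonneg y]
lemma abs_fMom_le (i : Fin d) (y : Phase d) : |fMom i y| ≤ fEnergy y := by
  have h0 : (0 : ℝ) ≤ y.1.1 := y.1.1.2
  have h1 : |y.1.2 i| ≤ 1 + ‖y.1.2‖ ^ 2 := by
    have := sq_coord_le y.1.2 i
    rw [abs_le]; constructor <;> nlinarith [sq_nonneg (y.1.2 i + 1), sq_nonneg (y.1.2 i - 1)]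
  have h2 : |fMom i y| = y.1.1 * |y.1.2 i| := by rw [fMom, abs_mul, abs_of_nonneg h0]
  have h3 : fRho y + fKin y = y.1.1 * (1 + ‖y.1.2‖ ^ 2) := by rw [fRho, fKin]; ring
  rw [h2, fEnergy, h3]
  linarith [mul_le_mul_of_nonneg_left h1 h0, fPot_nonneg y]
lemma abs_fConv_le (i j : Fin d) (y : Phase d) : |fConv i j y| ≤ fEnergy y := by
  have h0 : (0 : ℝ) ≤ y.1.1 := y.1.1.2
  have h2 : |fConv i j y| ≤ fKin y := by
    rw [fConv, fKin, abs_mul, abs_of_nonneg h0]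
    exact mul_le_mul_of_nonneg_left (abs_mul_coord_le _ i j) h0
  rw [fEnergy]
  linarith [fRho_nonneg y, fPot_nonneg y]
lemma abs_fStress_le (i j : Fin d) (y : Phase d) : |fStress i j y| ≤ fEnergy y := by
  have := abs_mul_coord_le y.2 i j
  rw [fEnergy, fPot, fStress]
  linarith [fRho_nonneg y, fKin_nonneg y]

/-- Continuous cutoffs in phase space, increasing to `1`. -/
def phaseCutoff {Z : Type*} [PseudoMetricSpace Z] [Zero Z] (k : ℕ) (y : Z) : ℝ :=
  max 0 (min 1 (k + 1 - dist y 0))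

section PhaseCutoff

variable {Z : Type*} [PseudoMetricSpace Z] [Zero Z]

lemma continuous_phaseCutoff (k : ℕ) : Continuous (phaseCutoff k : Z → ℝ) := by
  unfold phaseCutoff; fun_prop

lemma phaseCutoff_nonneg (k : ℕ) (y : Z) : 0 ≤ phaseCutoff k y := le_max_left _ _

lemma phaseCutoff_le_one (k : ℕ) (y : Z) : phaseCutoff k y ≤ 1 :=
  max_le zero_le_one (min_le_left _ _)

lemma phaseCutoff_eq_one {k : ℕ} {y : Z} (h : dist y 0 ≤ k) : phaseCutoff k y = 1 := by
  rw [phaseCutoff, min_eq_left (by linarith), max_eq_right zero_le_one]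

lemma eventually_phaseCutoff_eq_one (y : Z) : ∀ᶠ k in atTop, phaseCutoff k y = 1 := by
  obtain ⟨m, hm⟩ := exists_nat_ge (dist y 0)
  filter_upwards [eventually_ge_atTop m] with k hk
  exact phaseCutoff_eq_one (hm.trans (by exact_mod_cast hk))

lemma hasCompactSupport_phaseCutoff [ProperSpace Z] (k : ℕ) :
    HasCompactSupport (phaseCutoff k : Z → ℝ) := by
  refine HasCompactSupport.intro (isCompact_closedBall (0 : Z) (k + 1)) fun y hy => ?_
  rw [Metric.mem_closedBall, not_le] at hy
  rw [phaseCutoff, max_eq_left]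
  exact (min_le_right _ _).trans (by linarith)

/-- The truncation `f · phaseCutoff k` as an element of `C₀`. -/
def truncate [ProperSpace Z] {f : Z → ℝ} (hf : Continuous f) (k : ℕ) : C₀(Z, ℝ) where
  toFun y := f y * phaseCutoff k y
  continuous_toFun := hf.mul (continuous_phaseCutoff k)
  zero_at_infty' := ((hasCompactSupport_phaseCutoff k).mul_left (f := f)).is_zero_at_infty

lemma truncate_apply [ProperSpace Z] {f : Z → ℝ} (hf : Continuous f) (k : ℕ) (y : Z) :
    truncate hf k y = f y * phaseCutoff k y := rfl

lemma abs_truncate_le [ProperSpace Z] {f : Z → ℝ} (hf : Continuous f) (k : ℕ) (y : Z) :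
    |truncate hf k y| ≤ |f y| := by
  rw [truncate_apply, abs_mul, abs_of_nonneg (phaseCutoff_nonneg k y)]
  exact mul_le_of_le_one_right (abs_nonneg _) (phaseCutoff_le_one k y)

end PhaseCutoff

lemma integrable_zeroAtInfty {Z : Type*} [TopologicalSpace Z] [MeasurableSpace Z]
    [OpensMeasurableSpace Z] (m : Measure Z) [IsFiniteMeasure m] (f : C₀(Z, ℝ)) :
    Integrable f m :=
  f.toBCF.integrable m

lemma volume_cyl_lt_top (hΩ : IsBoundedSmoothDomain Ω) : volume (cyl T Ω) < ⊤ := by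
  have : Bornology.IsBounded (cyl T Ω) := (Metric.isBounded_Ioo 0 T).prod hΩ.isBounded
  exact this.measure_lt_top

lemma measurableSet_cyl (hΩ : IsBoundedSmoothDomain Ω) : MeasurableSet (cyl T Ω) :=
  measurableSet_Ioo.prod hΩ.isOpen.measurableSet

lemma exists_bound_on_cyl (hΩ : IsBoundedSmoothDomain Ω) {φ : ℝ × Sp d → ℝ}
    (hφ : ContinuousOn φ (Icc 0 T ×ˢ closure Ω)) :
    ∃ C, 0 ≤ C ∧ ∀ p ∈ Icc 0 T ×ˢ closure Ω, |φ p| ≤ C := by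
  obtain ⟨C, hC⟩ := (isCompact_Icc.prod hΩ.isCompact_closure).exists_bound_of_continuousOn hφ
  exact ⟨max C 0, le_max_right _ _, fun p hp => (hC p hp).trans (le_max_left _ _)⟩

lemma cyl_subset : cyl T Ω ⊆ Icc 0 T ×ˢ closure Ω := prod_mono Ioo_subset_Icc_self subset_closure

lemma IsParamMeasure.ae_isFiniteMeasure {Z : Type*} [TopologicalSpace Z] [MeasurableSpace Z]
    {ν : ℝ → Sp d → Measure Z} (h : IsParamMeasure T Ω ν) :
    ∀ᵐ p ∂(volume.restrict (cyl T Ω)), IsFiniteMeasure (ν p.1 p.2) := by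
  filter_upwards [h.mass_le] with p hp
  exact ⟨hp.trans_lt ENNReal.one_lt_top⟩

/-- The sequence `z` has energy bounded by `C`. -/
def EnergyBounded (T : ℝ) (Ω : Set (Sp d)) (z : ℕ → ℝ × Sp d → Phase d) (C : ℝ≥0) : Prop :=
  ∀ n, ∫⁻ p in cyl T Ω, ENNReal.ofReal (fRho (z n p) + fKin (z n p) + fPot (z n p)) ≤ C

lemma EnergyBounded.integrable {z : ℕ → ℝ × Sp d → Phase d} {C : ℝ≥0}
    (h : EnergyBounded T Ω z C) (hz : ∀ n, AEMeasurable (z n) (volume.restrict (cyl T Ω)))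
    {f : Phase d → ℝ} (hf : Continuous f) (hb : ∀ y, |f y| ≤ fEnergy y) (n : ℕ) :
    Integrable (fun p => f (z n p)) (volume.restrict (cyl T Ω)) := by
  have he : Integrable (fun p => fEnergy (z n p)) (volume.restrict (cyl T Ω)) := by
    refine ⟨(continuous_fEnergy.measurable.comp_aemeasurable (hz n)).aestronglyMeasurable, ?_⟩
    rw [hasFiniteIntegral_iff_ofReal (ae_of_all _ fun p => fEnergy_nonneg _)]
    exact (h n).trans_lt ENNReal.coe_lt_top
  exact he.mono' (hf.measurable.comp_aemeasurable (hz n)).aestronglyMeasurable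
    (ae_of_all _ fun p => hb _)

lemma EnergyBounded.integral_le {z : ℕ → ℝ × Sp d → Phase d} {C : ℝ≥0}
    (h : EnergyBounded T Ω z C) (hz : ∀ n, AEMeasurable (z n) (volume.restrict (cyl T Ω))) (n : ℕ) :
    ∫ p in cyl T Ω, fEnergy (z n p) ≤ C := by
  rw [integral_eq_lintegral_of_nonneg_ae (ae_of_all _ fun p => fEnergy_nonneg _)
    (continuous_fEnergy.measurable.comp_aemeasurable (hz n)).aestronglyMeasurable]
  refine ENNReal.toReal_le_of_le_ofReal C.2 ?_
  rw [ENNReal.ofReal_coe_nnreal]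
  exact h n

/-- The Young measure inherits the energy bound of the generating sequence. -/
lemma lintegral_fEnergy_lt_top (hΩ : IsBoundedSmoothDomain Ω) (hν : IsParamMeasure T Ω ν)
    {z : ℕ → ℝ × Sp d → Phase d} {C : ℝ≥0} (h : EnergyBounded T Ω z C)
    (hz : ∀ n, AEMeasurable (z n) (volume.restrict (cyl T Ω))) (hgen : GeneratesYoung T Ω z ν) :
    ∫⁻ p in cyl T Ω, ∫⁻ y, ENNReal.ofReal (fEnergy y) ∂(ν p.1 p.2) ≤ C := by
  have hfin := hν.ae_isFiniteMeasure
  set F : ℕ → C₀(Phase d, ℝ) := fun k => truncate continuous_fEnergy k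
  have hF0 : ∀ k y, 0 ≤ F k y := fun k y => mul_nonneg (fEnergy_nonneg y) (phaseCutoff_nonneg k y)
  have hle : ∀ k, ∫ p in cyl T Ω, ∫ y, F k y ∂(ν p.1 p.2) ≤ C := by
    intro k
    have hone : IntegrableOn (fun _ : ℝ × Sp d => (1 : ℝ)) (cyl T Ω) :=
      integrableOn_const (volume_cyl_lt_top hΩ).ne
    have := hgen (F k) (fun _ => 1) hone
    simp only [one_mul] at this
    refine le_of_tendsto this (Eventually.of_forall fun n => ?_)
    refine le_trans (integral_mono_of_nonneg (ae_of_all _ fun p => hF0 k _)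
      (h.integrable hz continuous_fEnergy (fun y => (abs_of_nonneg (fEnergy_nonneg y)).le) n)
      (ae_of_all _ fun p => ?_)) (h.integral_le hz n)
    exact (le_abs_self _).trans ((abs_truncate_le _ _ _).trans
      (abs_of_nonneg (fEnergy_nonneg _)).le)
  have hle' : ∀ k, ∫⁻ p in cyl T Ω, ENNReal.ofReal (∫ y, F k y ∂(ν p.1 p.2)) ≤ C := by
    intro k
    have hint : Integrable (fun p : ℝ × Sp d => ∫ y, F k y ∂(ν p.1 p.2))
        (volume.restrict (cyl T Ω)) := by
      have : IsFiniteMeasure (volume.restrict (cyl T Ω)) :=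
        ⟨by rw [Measure.restrict_apply_univ]; exact volume_cyl_lt_top hΩ⟩
      refine Integrable.of_bound (hν.measurable (F k)) ‖(F k).toBCF‖ ?_
      filter_upwards [hν.mass_le, hfin] with p hp hpf
      refine (norm_integral_le_of_norm_le_const
        (ae_of_all _ fun y => (F k).toBCF.norm_coe_le_norm y)).trans ?_
      refine mul_le_of_le_one_right (norm_nonneg _) ?_
      exact ENNReal.toReal_le_of_le_ofReal zero_le_one (by simpa using hp)
    rw [← ofReal_integral_eq_lintegral_ofReal hint
      (ae_of_all _ fun p => integral_nonneg (hF0 k))]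
    exact ENNReal.ofReal_le_of_le_toReal (by simpa using hle k)
  have hlim : ∀ᵐ p ∂(volume.restrict (cyl T Ω)),
      ∫⁻ y, ENNReal.ofReal (fEnergy y) ∂(ν p.1 p.2)
        ≤ liminf (fun k => ENNReal.ofReal (∫ y, F k y ∂(ν p.1 p.2))) atTop := by
    filter_upwards [hfin] with p hp
    have e : ∀ k, ENNReal.ofReal (∫ y, F k y ∂(ν p.1 p.2))
        = ∫⁻ y, ENNReal.ofReal (F k y) ∂(ν p.1 p.2) := fun k =>
      ofReal_integral_eq_lintegral_ofReal (integrable_zeroAtInfty _ _)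
        (ae_of_all _ fun y => hF0 k y)
    simp_rw [e]
    refine le_trans (le_of_eq ?_) (lintegral_liminf_le fun k =>
      ((F k).continuous.measurable.ennreal_ofReal))
    refine lintegral_congr fun y => ?_
    refine (Tendsto.liminf_eq (tendsto_const_nhds.congr' ?_)).symm
    filter_upwards [eventually_phaseCutoff_eq_one y] with k hk
    rw [truncate_apply, hk, mul_one]
  calc ∫⁻ p in cyl T Ω, ∫⁻ y, ENNReal.ofReal (fEnergy y) ∂(ν p.1 p.2)
      ≤ ∫⁻ p in cyl T Ω, liminf (fun k => ENNReal.ofReal (∫ y, F k y ∂(ν p.1 p.2))) atTop :=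
        lintegral_mono_ae hlim
    _ ≤ liminf (fun k => ∫⁻ p in cyl T Ω, ENNReal.ofReal (∫ y, F k y ∂(ν p.1 p.2))) atTop :=
        lintegral_liminf_le' fun k => (hν.measurable (F k)).aemeasurable.ennreal_ofReal
    _ ≤ C := by
        refine liminf_le_of_le (by isBoundedDefault) fun b hb => ?_
        obtain ⟨k, hk⟩ := hb.exists
        exact hk.trans (hle' k)

/-- Young measures of finite energy, as generated by sequences with bounded energy. -/
structure IsFiniteEnergyYoung (T : ℝ) (Ω : Set (Sp d)) (ν : ℝ → Sp d → Measure (Phase d)) :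
    Prop where
  param : IsParamMeasure T Ω ν
  integrable_energy : ∀ᵐ p ∂(volume.restrict (cyl T Ω)), Integrable fEnergy (ν p.1 p.2)
  energy : Integrable (fun p : ℝ × Sp d => ∫ y, fEnergy y ∂(ν p.1 p.2))
    (volume.restrict (cyl T Ω))

lemma IsParamMeasure.aestronglyMeasurable_integral (hν : IsParamMeasure T Ω ν)
    {f : Phase d → ℝ} (hf : Continuous f)
    (hi : ∀ᵐ p ∂(volume.restrict (cyl T Ω)), Integrable f (ν p.1 p.2)) :
    AEStronglyMeasurable (fun p : ℝ × Sp d => ∫ y, f y ∂(ν p.1 p.2))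
      (volume.restrict (cyl T Ω)) := by
  refine aestronglyMeasurable_of_tendsto_ae atTop (fun k => hν.measurable (truncate hf k)) ?_
  filter_upwards [hi] with p hp
  refine tendsto_integral_of_dominated_convergence (fun y => |f y|)
    (fun k => (truncate hf k).continuous.aestronglyMeasurable) hp.abs
    (fun k => ae_of_all _ fun y => abs_truncate_le hf k y) (ae_of_all _ fun y => ?_)
  refine tendsto_const_nhds.congr' ?_
  filter_upwards [eventually_phaseCutoff_eq_one y] with k hk
  rw [truncate_apply, hk, mul_one]

lemma isFiniteEnergyYoung_of_generates (hΩ : IsBoundedSmoothDomain Ω)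
    (hν : IsParamMeasure T Ω ν) {z : ℕ → ℝ × Sp d → Phase d} {C : ℝ≥0}
    (h : EnergyBounded T Ω z C) (hz : ∀ n, AEMeasurable (z n) (volume.restrict (cyl T Ω)))
    (hgen : GeneratesYoung T Ω z ν) : IsFiniteEnergyYoung T Ω ν := by
  have hC := lintegral_fEnergy_lt_top hΩ hν h hz hgen
  -- The inner integral is almost everywhere the limit of measurable truncations.
  have hmeas : AEMeasurable
      (fun p : ℝ × Sp d => ∫⁻ y, ENNReal.ofReal (fEnergy y) ∂(ν p.1 p.2))
      (volume.restrict (cyl T Ω)) := by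
    refine aemeasurable_of_tendsto_metrizable_ae atTop (f := fun k (p : ℝ × Sp d) =>
      ENNReal.ofReal (∫ y, truncate continuous_fEnergy k y ∂(ν p.1 p.2)))
      (fun k => (hν.measurable _).aemeasurable.ennreal_ofReal) ?_
    filter_upwards [hν.ae_isFiniteMeasure] with p hp
    have e : ∀ k, ENNReal.ofReal (∫ y, truncate continuous_fEnergy k y ∂(ν p.1 p.2))
        = ∫⁻ y, ENNReal.ofReal (truncate continuous_fEnergy k y) ∂(ν p.1 p.2) := fun k =>
      ofReal_integral_eq_lintegral_ofReal (integrable_zeroAtInfty _ _)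
        (ae_of_all _ fun y => mul_nonneg (fEnergy_nonneg y) (phaseCutoff_nonneg k y))
    simp_rw [e]
    refine lintegral_tendsto_of_tendsto_of_monotone (fun k =>
      ((truncate continuous_fEnergy k).continuous.measurable.ennreal_ofReal).aemeasurable)
      (ae_of_all _ fun y k l hkl => ?_) (ae_of_all _ fun y => ?_)
    · refine ENNReal.ofReal_le_ofReal (mul_le_mul_of_nonneg_left ?_ (fEnergy_nonneg y))
      refine max_le_max le_rfl (min_le_min le_rfl ?_)
      have : (k : ℝ) ≤ l := by exact_mod_cast hkl
      linarith
    · refine tendsto_const_nhds.congr' ?_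
      filter_upwards [eventually_phaseCutoff_eq_one y] with k hk
      rw [truncate_apply, hk, mul_one]
  have hae := ae_lt_top' hmeas (hC.trans_lt ENNReal.coe_lt_top).ne
  have hint : ∀ᵐ p ∂(volume.restrict (cyl T Ω)), Integrable fEnergy (ν p.1 p.2) := by
    filter_upwards [hae] with p hp
    refine ⟨continuous_fEnergy.aestronglyMeasurable, ?_⟩
    rwa [hasFiniteIntegral_iff_ofReal (ae_of_all _ fun p => fEnergy_nonneg _)]
  refine ⟨hν, hint, hν.aestronglyMeasurable_integral continuous_fEnergy hint, ?_⟩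
  rw [hasFiniteIntegral_iff_ofReal (ae_of_all _ fun p => integral_nonneg fEnergy_nonneg)]
  refine lt_of_le_of_lt (le_of_eq (lintegral_congr_ae ?_)) (hC.trans_lt ENNReal.coe_lt_top)
  filter_upwards [hint] with p hp
  rw [ofReal_integral_eq_lintegral_ofReal hp (ae_of_all _ fun y => fEnergy_nonneg y)]

variable {f : Phase d → ℝ}

lemma IsFiniteEnergyYoung.ae_integrable (h : IsFiniteEnergyYoung T Ω ν) (hf : Continuous f)
    (hb : ∀ y, |f y| ≤ fEnergy y) :
    ∀ᵐ p ∂(volume.restrict (cyl T Ω)), Integrable f (ν p.1 p.2) := by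
  filter_upwards [h.integrable_energy] with p hp
  exact hp.mono' hf.aestronglyMeasurable (ae_of_all _ hb)

lemma IsFiniteEnergyYoung.integrable (h : IsFiniteEnergyYoung T Ω ν) (hf : Continuous f)
    (hb : ∀ y, |f y| ≤ fEnergy y) :
    Integrable (fun p : ℝ × Sp d => ∫ y, f y ∂(ν p.1 p.2)) (volume.restrict (cyl T Ω)) := by
  refine h.energy.mono' (h.param.aestronglyMeasurable_integral hf (h.ae_integrable hf hb)) ?_
  filter_upwards [h.integrable_energy, h.ae_integrable hf hb] with p hp hpf
  refine (abs_integral_le_integral_abs).trans (integral_mono hpf.abs hp hb)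

lemma IsFiniteEnergyYoung.tendsto_truncate (hΩ : IsBoundedSmoothDomain Ω)
    (h : IsFiniteEnergyYoung T Ω ν) (hf : Continuous f)
    (hb : ∀ y, |f y| ≤ fEnergy y) {φ : ℝ × Sp d → ℝ}
    (hφ : ContinuousOn φ (Icc 0 T ×ˢ closure Ω)) :
    Tendsto (fun k => ∫ p in cyl T Ω, φ p * ∫ y, truncate hf k y ∂(ν p.1 p.2)) atTop
      (𝓝 (∫ p in cyl T Ω, φ p * ∫ y, f y ∂(ν p.1 p.2))) := by
  obtain ⟨C, hC0, hC⟩ := exists_bound_on_cyl hΩ hφ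
  have hφm : AEStronglyMeasurable φ (volume.restrict (cyl T Ω)) :=
    (hφ.mono cyl_subset).aestronglyMeasurable (measurableSet_cyl hΩ)
  refine tendsto_integral_of_dominated_convergence
    (fun p => C * ∫ y, fEnergy y ∂(ν p.1 p.2)) (fun k => hφm.mul (h.param.measurable _))
    (h.energy.const_mul C) (fun k => ?_) ?_
  · filter_upwards [h.integrable_energy, h.param.ae_isFiniteMeasure,
      ae_restrict_mem (measurableSet_cyl hΩ)] with p hp hpf hpc
    rw [Real.norm_eq_abs, abs_mul]
    refine mul_le_mul (hC p (cyl_subset hpc)) ?_ (abs_nonneg _) hC0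
    refine (abs_integral_le_integral_abs).trans
      (integral_mono (integrable_zeroAtInfty _ _).abs hp fun y => ?_)
    exact (abs_truncate_le hf k y).trans (hb y)
  · filter_upwards [h.ae_integrable hf hb] with p hp
    refine Tendsto.const_mul _ ?_
    refine tendsto_integral_of_dominated_convergence (fun y => |f y|)
      (fun k => (truncate hf k).continuous.aestronglyMeasurable) hp.abs
      (fun k => ae_of_all _ fun y => abs_truncate_le hf k y) (ae_of_all _ fun y => ?_)
    refine tendsto_const_nhds.congr' ?_
    filter_upwards [eventually_phaseCutoff_eq_one y] with k hk
    rw [truncate_apply, hk, mul_one]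

end Young

/-! ### Positivity of concentration measures -/

/-- The fundamental lemma of the calculus of variations for inequalities. -/
lemma ae_nonneg_of_forall_continuous {μ : Measure ℝ} {h : ℝ → ℝ} (hh : Integrable h μ)
    (H : ∀ χ : ℝ → ℝ, Continuous χ → (∀ t, 0 ≤ χ t) → (∀ t, χ t ≤ 1) → 0 ≤ ∫ t, χ t * h t ∂μ) :
    ∀ᵐ t ∂μ, 0 ≤ h t := by
  have hfin1 : ∫⁻ x, ENNReal.ofReal (h x) ∂μ ≠ ⊤ := hh.lintegral_lt_top.ne
  have hfin2 : ∫⁻ x, ENNReal.ofReal (-h x) ∂μ ≠ ⊤ := hh.neg.lintegral_lt_top.ne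
  have i1 := isFiniteMeasure_withDensity hfin1
  have i2 := isFiniteMeasure_withDensity hfin2
  set μp := μ.withDensity fun x => ENNReal.ofReal (h x)
  set μn := μ.withDensity fun x => ENNReal.ofReal (-h x)
  have hclosed : ∀ F : Set ℝ, IsClosed F → μn F ≤ μp F := by
    intro F hF
    have hle : ∀ n : ℕ, ∫⁻ x, thickenedIndicator (Nat.one_div_pos_of_nat (α := ℝ) (n := n)) F x ∂μn
        ≤ ∫⁻ x, thickenedIndicator (Nat.one_div_pos_of_nat (α := ℝ) (n := n)) F x ∂μp := by
      intro n
      set χ := thickenedIndicator (Nat.one_div_pos_of_nat (α := ℝ) (n := n)) F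
      have hχc : Continuous fun t => (χ t : ℝ) := NNReal.continuous_coe.comp χ.continuous
      have hχ1 : ∀ t, (χ t : ℝ) ≤ 1 := fun t => thickenedIndicator_le_one _ _ _
      have hb : ∀ᵐ t ∂μ, ‖(χ t : ℝ)‖ ≤ 1 := ae_of_all _ fun t => by
        rw [Real.norm_of_nonneg (NNReal.coe_nonneg _)]; exact hχ1 t
      have h0 := H (fun t => χ t) hχc (fun t => (χ t).2) hχ1
      have i3 : Integrable (fun t => (χ t : ℝ) * max (h t) 0) μ :=
        hh.pos_part.bdd_mul hχc.aestronglyMeasurable hb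
      have i4 : Integrable (fun t => (χ t : ℝ) * max (-h t) 0) μ :=
        hh.neg_part.bdd_mul hχc.aestronglyMeasurable hb
      have h1 : ∫ t, (χ t : ℝ) * max (-h t) 0 ∂μ ≤ ∫ t, (χ t : ℝ) * max (h t) 0 ∂μ := by
        rw [← sub_nonneg, ← integral_sub i3 i4]
        refine h0.trans_eq (integral_congr_ae (ae_of_all _ fun t => ?_))
        show (χ t : ℝ) * h t = χ t * max (h t) 0 - χ t * max (-h t) 0
        rw [← mul_sub]
        congr 1
        rcases le_total 0 (h t) with h | h
        · rw [max_eq_left h, max_eq_right (by simpa using h)]; ring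
        · rw [max_eq_right h, max_eq_left (by simpa using h)]; ring
      have e : ∀ g : ℝ → ℝ, Integrable g μ → ∫⁻ x, χ x ∂(μ.withDensity fun x => ENNReal.ofReal (g x))
          = ENNReal.ofReal (∫ t, (χ t : ℝ) * max (g t) 0 ∂μ) := by
        intro g hg
        rw [lintegral_withDensity_eq_lintegral_mul_non_measurable₀ _
          hg.1.aemeasurable.ennreal_ofReal (ae_of_all _ fun _ => ENNReal.ofReal_lt_top),
          ofReal_integral_eq_lintegral_ofReal (hg.pos_part.bdd_mul hχc.aestronglyMeasurable hb)
          (ae_of_all _ fun t => mul_nonneg (χ t).2 (le_max_right _ _))]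
        refine lintegral_congr fun t => ?_
        rw [ENNReal.ofReal_mul (NNReal.coe_nonneg _), Pi.mul_apply, mul_comm, ENNReal.ofReal_coe_nnreal]
        congr 1
        rcases le_total 0 (g t) with h | h
        · rw [max_eq_left h]
        · rw [max_eq_right h, ENNReal.ofReal_of_nonpos h, ENNReal.ofReal_zero]
      rw [e h hh, e (fun x => -h x) hh.neg]
      exact ENNReal.ofReal_le_ofReal h1
    have hl : ∀ m : Measure ℝ, IsFiniteMeasure m → Tendsto (fun n : ℕ =>
        ∫⁻ x, thickenedIndicator (Nat.one_div_pos_of_nat (α := ℝ) (n := n)) F x ∂m) atTop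
        (𝓝 (m F)) := fun m _ => tendsto_lintegral_thickenedIndicator_of_isClosed m hF _
      tendsto_one_div_add_atTop_nhds_zero_nat
    exact le_of_tendsto_of_tendsto' (hl μn i2) (hl μp i1) hle
  have hall : μn ≤ μp := by
    refine Measure.le_iff.2 fun A hA => ?_
    rw [hA.measure_eq_iSup_isClosed_of_ne_top (measure_ne_top μn A)]
    exact iSup₂_le fun F hF => iSup_le fun hFc => (hclosed F hFc).trans (measure_mono hF)
  obtain ⟨h', hm', hh'⟩ := hh.1
  have hA : MeasurableSet {t | h' t < 0} := measurableSet_lt hm'.measurable measurable_const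
  have h1 : μp {t | h' t < 0} = 0 := by
    rw [withDensity_apply _ hA, lintegral_eq_zero_iff' hh.1.aemeasurable.ennreal_ofReal.restrict]
    filter_upwards [ae_restrict_of_ae hh', ae_restrict_mem hA] with t ht htA
    rw [ht]; exact ENNReal.ofReal_of_nonpos (le_of_lt htA)
  have h2 : μn {t | h' t < 0} = 0 := le_antisymm ((hall _).trans h1.le) bot_le
  rw [withDensity_apply _ hA, lintegral_eq_zero_iff' (by
    exact hh.neg.1.aemeasurable.ennreal_ofReal.restrict), EventuallyEq,
    ae_restrict_iff' hA] at h2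
  filter_upwards [hh', h2] with t ht h2t
  by_contra hneg
  rw [not_le] at hneg
  have := h2t (by show h' t < 0; rw [← ht]; exact hneg)
  simp only [Pi.zero_apply, ENNReal.ofReal_eq_zero] at this
  linarith

section Positivity

variable {d : ℕ} {Ω : Set (Sp d)} {T : ℝ} {ν : ℝ → Sp d → Measure (Phase d)}

lemma IsMeasureFamily.isCarriedFamily {m : ℝ → SignedMeasure (Sp d)}
    (h : IsMeasureFamily T Ω m) :
    IsCarriedFamily (volume.restrict (Ioo 0 T)) (closure Ω) m where
  carried := h.carried
  measurable φ hφ := by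
    obtain ⟨g, hg⟩ := ContinuousMap.exists_restrict_eq isClosed_closure
      ⟨(closure Ω).domRestrict φ, hφ.domRestrict⟩
    refine (h.measurable g).congr ?_
    filter_upwards [h.carried] with t ht
    refine signedIntegral_congr ht fun x hx => ?_
    exact DFunLike.congr_fun hg ⟨x, hx⟩

lemma IsMeasureFamily.ae_abs_integral_le {m : ℝ → SignedMeasure (Sp d)}
    (h : IsMeasureFamily T Ω m) : ∃ C : ℝ, 0 ≤ C ∧ ∀ᵐ t ∂(volume.restrict (Ioo 0 T)),
      ∀ (φ : Sp d → ℝ) (c : ℝ), 0 ≤ c → (∀ x ∈ closure Ω, |φ x| ≤ c) →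
        |∫ᵛ x, φ x ∂•(m t)| ≤ C * c := by
  obtain ⟨C, hC⟩ := h.bounded
  refine ⟨C, C.2, ?_⟩
  filter_upwards [hC, h.carried] with t ht hc φ c hc0 hφ
  refine (abs_signedIntegral_le hc hφ).trans (mul_le_mul_of_nonneg_right ?_ hc0)
  exact ENNReal.toReal_le_of_le_ofReal C.2 (by rw [ENNReal.ofReal_coe_nnreal]; exact ht)

/-- Concentration can only add mass: an expression `∑ₖ cₖ(x) fₖ(y)` that is non-negative on phase
space has a non-negative concentration measure, at almost every time and for all coefficients at
once. -/
lemma ae_forall_sum_concentration_nonneg {ι : Type*} [Fintype ι]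
    (hΩ : IsBoundedSmoothDomain Ω) (hν : IsFiniteEnergyYoung T Ω ν)
    {z : ℕ → ℝ × Sp d → Phase d} {C : ℝ≥0} (h : EnergyBounded T Ω z C)
    (hz : ∀ n, AEMeasurable (z n) (volume.restrict (cyl T Ω))) (hgen : GeneratesYoung T Ω z ν)
    {f : ι → Phase d → ℝ} (hf : ∀ k, Continuous (f k)) (hb : ∀ k y, |f k y| ≤ fEnergy y)
    {m : ι → ℝ → SignedMeasure (Sp d)} (hm : ∀ k, IsMeasureFamily T Ω (m k))
    (hc : ∀ k, IsConcentrationMeasure T Ω z ν (f k) (m k)) :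
    ∀ᵐ t ∂(volume.restrict (Ioo 0 T)), ∀ c : ι → Sp d → ℝ,
      (∀ k, ContinuousOn (c k) (closure Ω)) →
      (∀ x ∈ closure Ω, ∀ y, 0 ≤ ∑ k, c k x * f k y) → 0 ≤ ∑ k, ∫ᵛ x, c k x ∂•(m k t) := by
  have hK := hΩ.isCompact_closure
  have hcyl := measurableSet_cyl (T := T) hΩ
  have hfincyl : IsFiniteMeasure (volume.restrict (cyl T Ω)) :=
    ⟨by rw [Measure.restrict_apply_univ]; exact volume_cyl_lt_top hΩ⟩
  have hmul : ∀ (φ : ℝ × Sp d → ℝ), Continuous φ → ∀ g : ℝ × Sp d → ℝ,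
      Integrable g (volume.restrict (cyl T Ω)) →
      Integrable (fun p => φ p * g p) (volume.restrict (cyl T Ω)) := by
    intro φ hφ g hg
    obtain ⟨B, -, hB⟩ := exists_bound_on_cyl (T := T) hΩ hφ.continuousOn
    refine hg.bdd_mul (c := B) hφ.aestronglyMeasurable ?_
    filter_upwards [ae_restrict_mem hcyl] with p hp using hB p (cyl_subset hp)
  -- A fixed family of coefficients.
  have step : ∀ c : ι → C(Sp d, ℝ), (∀ x ∈ closure Ω, ∀ y, 0 ≤ ∑ k, c k x * f k y) →
      ∀ᵐ t ∂(volume.restrict (Ioo 0 T)), 0 ≤ ∑ k, ∫ᵛ x, c k x ∂•(m k t) := by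
    intro c hpos
    have hint : ∀ k, Integrable (fun t => ∫ᵛ x, c k x ∂•(m k t)) (volume.restrict (Ioo 0 T)) := by
      intro k
      obtain ⟨B, hB0, hB⟩ := hΩ.exists_bound (c k).continuous.continuousOn
      obtain ⟨A, hA0, hA⟩ := (hm k).ae_abs_integral_le
      refine Integrable.of_bound ((hm k).measurable (c k)) (A * B) ?_
      filter_upwards [hA] with t ht using ht _ _ hB0 hB
    refine ae_nonneg_of_forall_continuous (integrable_finsetSum _ fun k _ => hint k) ?_
    intro χ hχ hχ0 hχ1
    let φ : ι → C(ℝ × Sp d, ℝ) := fun k => ⟨fun p => χ p.1 * c k p.2, by fun_prop⟩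
    have hφ : ∀ k p, φ k p = χ p.1 * c k p.2 := fun _ _ => rfl
    have hL : Tendsto (fun n => ∑ k, ∫ p in cyl T Ω, φ k p * f k (z n p)) atTop
        (𝓝 (∑ k, ((∫ p in cyl T Ω, φ k p * ∫ y, f k y ∂(ν p.1 p.2))
          + ∫ t in Ioo 0 T, ∫ᵛ x, φ k (t, x) ∂•(m k t)))) :=
      tendsto_finsetSum _ fun k _ => hc k (φ k)
    have hR : ∀ j, Tendsto (fun n => ∑ k, ∫ p in cyl T Ω, φ k p * truncate (hf k) j (z n p)) atTop
        (𝓝 (∑ k, ∫ p in cyl T Ω, φ k p * ∫ y, truncate (hf k) j y ∂(ν p.1 p.2))) := by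
      intro j
      refine tendsto_finsetSum _ fun k _ => hgen _ _ ?_
      have := hmul (φ k) (φ k).continuous (fun _ => 1) (integrable_const 1)
      simp only [mul_one] at this
      exact this
    have hle : ∀ j n, ∑ k, ∫ p in cyl T Ω, φ k p * truncate (hf k) j (z n p)
        ≤ ∑ k, ∫ p in cyl T Ω, φ k p * f k (z n p) := by
      intro j n
      have i1 : ∀ k, Integrable (fun p => φ k p * f k (z n p)) (volume.restrict (cyl T Ω)) :=
        fun k => hmul _ (φ k).continuous _ (h.integrable hz (hf k) (hb k) n)
      have i2 : ∀ k, Integrable (fun p => φ k p * truncate (hf k) j (z n p))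
          (volume.restrict (cyl T Ω)) := fun k => hmul _ (φ k).continuous _
        (h.integrable hz (truncate (hf k) j).continuous
          (fun y => (abs_truncate_le (hf k) j y).trans (hb k y)) n)
      rw [← integral_finsetSum _ fun k _ => i1 k, ← integral_finsetSum _ fun k _ => i2 k]
      refine setIntegral_mono_on (integrable_finsetSum _ fun k _ => i2 k)
        (integrable_finsetSum _ fun k _ => i1 k) hcyl fun p hp => ?_
      have e1 : ∑ k, φ k p * truncate (hf k) j (z n p)
          = (χ p.1 * ∑ k, c k p.2 * f k (z n p)) * phaseCutoff j (z n p) := by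
        rw [mul_sum, sum_mul]
        refine sum_congr rfl fun k _ => ?_
        rw [hφ, truncate_apply]; ring
      have e2 : ∑ k, φ k p * f k (z n p) = χ p.1 * ∑ k, c k p.2 * f k (z n p) := by
        rw [mul_sum]
        refine sum_congr rfl fun k _ => ?_
        rw [hφ]; ring
      rw [e1, e2]
      exact mul_le_of_le_one_right (mul_nonneg (hχ0 _) (hpos _ (subset_closure hp.2) _))
        (phaseCutoff_le_one _ _)
    have hj : ∀ j, _ := fun j => le_of_tendsto_of_tendsto' (hR j) hL (hle j)
    have hlim : Tendsto (fun j => ∑ k, ∫ p in cyl T Ω,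
        φ k p * ∫ y, truncate (hf k) j y ∂(ν p.1 p.2)) atTop
        (𝓝 (∑ k, ∫ p in cyl T Ω, φ k p * ∫ y, f k y ∂(ν p.1 p.2))) :=
      tendsto_finsetSum _ fun k _ =>
        hν.tendsto_truncate hΩ (hf k) (hb k) (φ k).continuous.continuousOn
    have := le_of_tendsto' hlim hj
    rw [sum_add_distrib] at this
    have hfinal : 0 ≤ ∑ k, ∫ t in Ioo 0 T, ∫ᵛ x, φ k (t, x) ∂•(m k t) := by linarith
    refine hfinal.trans_eq ?_
    simp_rw [mul_sum]
    rw [integral_finsetSum]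
    · refine sum_congr rfl fun k _ => ?_
      refine integral_congr_ae (ae_of_all _ fun t => ?_)
      exact signedIntegral_const_mul (χ t) (fun x => c k x) (m k t)
    · intro k _
      refine (hint k).bdd_mul (c := 1) hχ.aestronglyMeasurable (ae_of_all _ fun t => ?_)
      rw [Real.norm_of_nonneg (hχ0 t)]; exact hχ1 t
  -- Countably many families of coefficients suffice.
  have hKc : CompactSpace (closure Ω) := isCompact_iff_compactSpace.1 hK
  let D : Set C(closure Ω, ι → ℝ) := {c | ∀ x y, 0 ≤ ∑ k, c x k * f k y}
  have hne : Nonempty D := ⟨⟨0, fun x y => by simp⟩⟩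
  have hext : ∀ n : ℕ, ∃ c : ι → C(Sp d, ℝ), ∀ k (x : closure Ω),
      c k x = (TopologicalSpace.denseSeq D n : C(closure Ω, ι → ℝ)) x k := by
    intro n
    have : ∀ k, ∃ g : C(Sp d, ℝ), ∀ x : closure Ω,
        g x = (TopologicalSpace.denseSeq D n : C(closure Ω, ι → ℝ)) x k := by
      intro k
      obtain ⟨g, hg⟩ := ContinuousMap.exists_restrict_eq isClosed_closure
        (⟨fun x => (TopologicalSpace.denseSeq D n : C(closure Ω, ι → ℝ)) x k, by fun_prop⟩ :
          C(closure Ω, ℝ))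
      exact ⟨g, fun x => DFunLike.congr_fun hg x⟩
    choose g hg using this
    exact ⟨g, hg⟩
  choose e he using hext
  have hall := ae_all_iff.2 fun n => step (e n) fun x hx y => by
    have := (TopologicalSpace.denseSeq D n).2 ⟨x, hx⟩ y
    convert this using 3 with k
    exact he n k ⟨x, hx⟩
  filter_upwards [hall, ae_all_iff.2 fun k => (hm k).carried] with t ht htc c hcc hpos
  let c' : D := ⟨⟨fun x k => c k x, continuous_pi fun k => (hcc k).domRestrict⟩,
    fun x y => hpos x x.2 y⟩
  refine le_of_forall_pos_le_add fun ε hε => ?_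
  set A := ∑ k, ((m k t).totalVariation univ).toReal
  have hA : 0 ≤ A := Finset.sum_nonneg fun _ _ => ENNReal.toReal_nonneg
  obtain ⟨n, hn⟩ := (TopologicalSpace.denseRange_denseSeq D).exists_dist_lt c'
    (show 0 < ε / (A + 1) by positivity)
  have hdist : ∀ k, ∀ x ∈ closure Ω, |e n k x - c k x| ≤ ε / (A + 1) := by
    intro k x hx
    rw [he n k ⟨x, hx⟩, abs_sub_comm]
    refine le_trans ?_ hn.le
    refine le_trans ?_ (ContinuousMap.dist_apply_le_dist (f := c'.1)
      (g := (TopologicalSpace.denseSeq D n).1) ⟨x, hx⟩)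
    exact dist_le_pi_dist (c'.1 ⟨x, hx⟩) _ k
  have hterm : ∀ k, ∫ᵛ x, e n k x ∂•(m k t)
      ≤ (∫ᵛ x, c k x ∂•(m k t)) + ((m k t).totalVariation univ).toReal * (ε / (A + 1)) := by
    intro k
    have := abs_signedIntegral_le (htc k) (hdist k)
    rw [signedIntegral_sub hK (htc k) (e n k).continuous.continuousOn (hcc k)] at this
    linarith [le_abs_self ((∫ᵛ x, e n k x ∂•(m k t)) - ∫ᵛ x, c k x ∂•(m k t))]
  refine (ht n).trans ((Finset.sum_le_sum fun k _ => hterm k).trans ?_)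
  rw [sum_add_distrib, ← sum_mul]
  have : A * (ε / (A + 1)) ≤ ε := by
    rw [mul_div_assoc', div_le_iff₀ (by positivity)]; nlinarith
  linarith

end Positivity

/-! ### Measure-valued states at a fixed time -/

section RegularState

variable {d : ℕ} {Ω : Set (Sp d)} {T : ℝ}

/-- The properties of `S t` at almost every time `t` that follow from the generation by a sequence
of bounded energy: integrability, and positivity of the concentration measures of the
non-negative quadratic expressions in `v` (weighted by the density) and in `F`. -/
structure IsRegularState (Ω : Set (Sp d)) (S : MVState d) : Prop where
  mass_le : ∀ᵐ x ∂(volume.restrict Ω), S.ν x univ ≤ 1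
  integrable_energy : ∀ᵐ x ∂(volume.restrict Ω), Integrable fEnergy (S.ν x)
  integrableOn : ∀ f : Phase d → ℝ, (f = fRho ∨ (∃ i, f = fMom i) ∨ (∃ i j, f = fConv i j) ∨
    f = fKin ∨ f = fPot ∨ ∃ i j, f = fStress i j) → IntegrableOn (fun x => ∫ y, f y ∂(S.ν x)) Ω
  integrableOn_field : ∀ i, IntegrableOn (S.field i) Ω
  carried_mRho : S.mRho.totalVariation (closure Ω)ᶜ = 0
  carried_mMom : ∀ i, (S.mMom i).totalVariation (closure Ω)ᶜ = 0
  carried_mConv : ∀ i j, (S.mConv i j).totalVariation (closure Ω)ᶜ = 0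
  carried_mKin : S.mKin.totalVariation (closure Ω)ᶜ = 0
  carried_mPot : S.mPot.totalVariation (closure Ω)ᶜ = 0
  carried_mStress : ∀ i j, (S.mStress i j).totalVariation (closure Ω)ᶜ = 0
  kin_nonneg : ∀ (c₀ : Sp d → ℝ) (c₁ : Fin d → Sp d → ℝ) (c₂ : Fin d → Fin d → Sp d → ℝ)
    (c₃ : Sp d → ℝ), ContinuousOn c₀ (closure Ω) → (∀ i, ContinuousOn (c₁ i) (closure Ω)) →
    (∀ i j, ContinuousOn (c₂ i j) (closure Ω)) → ContinuousOn c₃ (closure Ω) →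
    (∀ x ∈ closure Ω, ∀ v : Sp d, 0 ≤ c₀ x + (∑ i, c₁ i x * v i)
      + (∑ i, ∑ j, c₂ i j x * (v i * v j)) + c₃ x * ‖v‖ ^ 2) →
    0 ≤ (∫ᵛ x, c₀ x ∂•S.mRho) + (∑ i, ∫ᵛ x, c₁ i x ∂•(S.mMom i))
      + (∑ i, ∑ j, ∫ᵛ x, c₂ i j x ∂•(S.mConv i j)) + ∫ᵛ x, c₃ x ∂•S.mKin
  pot_nonneg : ∀ (c₂ : Fin d → Fin d → Sp d → ℝ) (c₃ : Sp d → ℝ),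
    (∀ i j, ContinuousOn (c₂ i j) (closure Ω)) → ContinuousOn c₃ (closure Ω) →
    (∀ x ∈ closure Ω, ∀ F : Sp d, 0 ≤ (∑ i, ∑ j, c₂ i j x * (F i * F j)) + c₃ x * ‖F‖ ^ 2) →
    0 ≤ (∑ i, ∑ j, ∫ᵛ x, c₂ i j x ∂•(S.mStress i j)) + ∫ᵛ x, c₃ x ∂•S.mPot

lemma restrict_cyl_eq_prod : (volume : Measure (ℝ × Sp d)).restrict (cyl T Ω)
      = (volume.restrict (Ioo 0 T)).prod (volume.restrict Ω) := by
  rw [cyl, Measure.volume_eq_prod, Measure.prod_restrict]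

lemma ae_ae_of_ae_cyl {p : ℝ × Sp d → Prop} (h : ∀ᵐ z ∂(volume.restrict (cyl T Ω)), p z) :
    ∀ᵐ t ∂(volume.restrict (Ioo 0 T)), ∀ᵐ x ∂(volume.restrict Ω), p (t, x) := by
  rw [restrict_cyl_eq_prod] at h
  exact Measure.ae_ae_of_ae_prod h

lemma ae_integrableOn_of_cyl {g : ℝ × Sp d → ℝ} (h : Integrable g (volume.restrict (cyl T Ω))) :
    ∀ᵐ t ∂(volume.restrict (Ioo 0 T)), IntegrableOn (fun x => g (t, x)) Ω := by
  rw [restrict_cyl_eq_prod] at h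
  exact h.prod_right_ae

variable {V W ψ : Sp d → ℝ} {S₀ : MVState d} {S : ℝ → MVState d}

lemma IsDissipativeMVSolution.isFiniteEnergyYoung (hΩ : IsBoundedSmoothDomain Ω)
    (hS : IsDissipativeMVSolution T Ω V W ψ S₀ S) :
    IsFiniteEnergyYoung T Ω (fun t => (S t).ν) := by
  obtain ⟨z, hz, ⟨C, hC⟩, hgen, -⟩ := hS.generated
  exact isFiniteEnergyYoung_of_generates hΩ hS.young hC hz hgen

lemma IsDissipativeMVSolution.ae_isRegularState (hΩ : IsBoundedSmoothDomain Ω)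
    (hS : IsDissipativeMVSolution T Ω V W ψ S₀ S) :
    ∀ᵐ t ∂(volume.restrict (Ioo 0 T)), IsRegularState Ω (S t) := by
  have hν := hS.isFiniteEnergyYoung hΩ
  obtain ⟨z, hz, ⟨C, hC⟩, hgen, cRho, cMom, cConv, cKin, cPot, cStress⟩ := hS.generated
  obtain ⟨-, -, hfield, -⟩ := hS.field_gradient
  have hfincyl : IsFiniteMeasure (volume.restrict (cyl T Ω)) :=
    ⟨by rw [Measure.restrict_apply_univ]; exact volume_cyl_lt_top hΩ⟩
  have hkin := ae_forall_sum_concentration_nonneg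
    (ι := Unit ⊕ Fin d ⊕ (Fin d × Fin d) ⊕ Unit) hΩ hν hC hz hgen
    (f := Sum.elim (fun _ => fRho) (Sum.elim fMom (Sum.elim (fun q => fConv q.1 q.2)
      fun _ => fKin)))
    (m := Sum.elim (fun _ t => (S t).mRho) (Sum.elim (fun i t => (S t).mMom i)
      (Sum.elim (fun q t => (S t).mConv q.1 q.2) fun _ t => (S t).mKin)))
    (by rintro (_ | _ | _ | _)
        · exact continuous_fRho
        · exact continuous_fMom _
        · exact continuous_fConv _ _
        · exact continuous_fKin)
    (by rintro (_ | _ | _ | _)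
        · exact abs_fRho_le
        · exact abs_fMom_le _
        · exact abs_fConv_le _ _
        · exact abs_fKin_le)
    (by rintro (_ | _ | _ | _)
        · exact hS.mRho_mem.1
        · exact hS.mMom_mem _
        · exact hS.mConv_mem _ _
        · exact hS.mKin_mem.1)
    (by rintro (_ | _ | _ | _)
        · exact cRho
        · exact cMom _
        · exact cConv _ _
        · exact cKin)
  have hpot := ae_forall_sum_concentration_nonneg
    (ι := (Fin d × Fin d) ⊕ Unit) hΩ hν hC hz hgen
    (f := Sum.elim (fun q => fStress q.1 q.2) fun _ => fPot)
    (m := Sum.elim (fun q t => (S t).mStress q.1 q.2) fun _ t => (S t).mPot)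
    (by rintro (_ | _)
        · exact continuous_fStress _ _
        · exact continuous_fPot)
    (by rintro (_ | _)
        · exact abs_fStress_le _ _
        · exact abs_fPot_le)
    (by rintro (_ | _)
        · exact hS.mStress_mem _ _
        · exact hS.mPot_mem.1)
    (by rintro (_ | _)
        · exact cStress _ _
        · exact cPot)
  have hI : ∀ {f : Phase d → ℝ}, Continuous f → (∀ y, |f y| ≤ fEnergy y) →
      ∀ᵐ t ∂(volume.restrict (Ioo 0 T)), IntegrableOn (fun x => ∫ y, f y ∂((S t).ν x)) Ω :=
    fun hf hb => ae_integrableOn_of_cyl (hν.integrable hf hb)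
  filter_upwards [hkin, hpot, ae_ae_of_ae_cyl hν.integrable_energy, ae_ae_of_ae_cyl hν.param.mass_le,
    hI continuous_fRho abs_fRho_le, ae_all_iff.2 fun i => hI (continuous_fMom i) (abs_fMom_le i),
    ae_all_iff.2 fun i => ae_all_iff.2 fun j => hI (continuous_fConv i j) (abs_fConv_le i j),
    hI continuous_fKin abs_fKin_le, hI continuous_fPot abs_fPot_le,
    ae_all_iff.2 fun i => ae_all_iff.2 fun j => hI (continuous_fStress i j) (abs_fStress_le i j),
    ae_all_iff.2 fun i => ae_integrableOn_of_cyl ((hfield i).integrable (by norm_num)),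
    hS.mRho_mem.1.carried, ae_all_iff.2 fun i => (hS.mMom_mem i).carried,
    ae_all_iff.2 fun i => ae_all_iff.2 fun j => (hS.mConv_mem i j).carried,
    hS.mKin_mem.1.carried, hS.mPot_mem.1.carried,
    ae_all_iff.2 fun i => ae_all_iff.2 fun j => (hS.mStress_mem i j).carried]
    with t h1 h2 h3 h4 i1 i2 i3 i4 i5 i6 h5 c1 c2 c3 c4 c5 c6
  refine ⟨h4, h3, ?_, h5, c1, c2, c3, c4, c5, c6, ?_, ?_⟩
  · rintro f (rfl | ⟨i, rfl⟩ | ⟨i, j, rfl⟩ | rfl | rfl | ⟨i, j, rfl⟩)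
    exacts [i1, i2 i, i3 i j, i4, i5, i6 i j]
  · intro c₀ c₁ c₂ c₃ k0 k1 k2 k3 hpos
    have := h1 (Sum.elim (fun _ => c₀) (Sum.elim c₁ (Sum.elim (fun q => c₂ q.1 q.2) fun _ => c₃)))
      (by rintro (_ | _ | _ | _)
          · exact k0
          · exact k1 _
          · exact k2 _ _
          · exact k3)
      (fun x hx y => by
        simp only [Fintype.sum_sum_type, Sum.elim_inl, Sum.elim_inr, Finset.univ_unique,
          Finset.sum_singleton, Fintype.sum_prod_type]
        have e := mul_nonneg (NNReal.coe_nonneg y.1.1) (hpos x hx y.1.2)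
        refine e.trans_eq ?_
        simp only [fRho, fMom, fConv, fKin, mul_add, mul_sum, ← add_assoc]
        congr 1
        · congr 1
          · congr 1
            · ring
            · exact sum_congr rfl fun i _ => by ring
          · exact sum_congr rfl fun i _ => sum_congr rfl fun j _ => by ring
        · ring)
    simpa only [Fintype.sum_sum_type, Sum.elim_inl, Sum.elim_inr, Finset.univ_unique,
      Finset.sum_singleton, Fintype.sum_prod_type, ← add_assoc] using this
  · intro c₂ c₃ k2 k3 hpos
    have := h2 (Sum.elim (fun q => c₂ q.1 q.2) fun _ => c₃)
      (by rintro (_ | _)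
          · exact k2 _ _
          · exact k3)
      (fun x hx y => by
        simp only [Fintype.sum_sum_type, Sum.elim_inl, Sum.elim_inr, Finset.univ_unique,
          Finset.sum_singleton, Fintype.sum_prod_type]
        exact hpos x hx y.2)
    simpa only [Fintype.sum_sum_type, Sum.elim_inl, Sum.elim_inr, Finset.univ_unique,
      Finset.sum_singleton, Fintype.sum_prod_type] using this

lemma integrable_add_sum_add_sum_add {α : Type*} [MeasurableSpace α] {μ : Measure α}
    {a g : α → ℝ} {b : Fin d → α → ℝ} {e : Fin d → Fin d → α → ℝ} (ha : Integrable a μ)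
    (hb : ∀ i, Integrable (b i) μ) (he : ∀ i j, Integrable (e i j) μ) (hg : Integrable g μ) :
    Integrable (fun x => a x + (∑ i, b i x) + (∑ i, ∑ j, e i j x) + g x) μ ∧
    ∫ x, (a x + (∑ i, b i x) + (∑ i, ∑ j, e i j x) + g x) ∂μ
      = (∫ x, a x ∂μ) + (∑ i, ∫ x, b i x ∂μ) + (∑ i, ∑ j, ∫ x, e i j x ∂μ) + ∫ x, g x ∂μ := by
  have i1 : Integrable (fun x => ∑ i, b i x) μ := integrable_finsetSum _ fun i _ => hb i
  have i2' : ∀ i, Integrable (fun x => ∑ j, e i j x) μ := fun i =>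
    integrable_finsetSum _ fun j _ => he i j
  have i2 : Integrable (fun x => ∑ i, ∑ j, e i j x) μ := integrable_finsetSum _ fun i _ => i2' i
  have i3 : Integrable (fun x => a x + ∑ i, b i x) μ := ha.add i1
  have i4 : Integrable (fun x => a x + (∑ i, b i x) + ∑ i, ∑ j, e i j x) μ := i3.add i2
  refine ⟨i4.add hg, ?_⟩
  rw [integral_add i4 hg, integral_add i3 i2, integral_add ha i1,
    integral_finsetSum _ fun i _ => hb i, integral_finsetSum _ fun i _ => i2' i]
  congr 2
  exact sum_congr rfl fun i _ => integral_finsetSum _ fun j _ => he i j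

section Bar

variable {ν : Sp d → Measure (Phase d)} {f : Phase d → ℝ} {m : SignedMeasure (Sp d)}
  {φ g : Sp d → ℝ}

variable (hΩ : IsBoundedSmoothDomain Ω)

include hΩ

lemma ae_mem_closure :
    ∀ᵐ x ∂(volume.restrict Ω), x ∈ closure Ω := by
  filter_upwards [ae_restrict_mem hΩ.isOpen.measurableSet] with x hx using subset_closure hx

lemma carried_withDensityᵥ (g : Sp d → ℝ) :
    SignedMeasure.totalVariation ((volume.restrict Ω).withDensityᵥ g) (closure Ω)ᶜ = 0 :=
  totalVariation_withDensityᵥ_compl (ae_mem_closure hΩ) isClosed_closure.measurableSet _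

lemma carried_bar (hm : m.totalVariation (closure Ω)ᶜ = 0) :
    (bar Ω ν f m).totalVariation (closure Ω)ᶜ = 0 :=
  totalVariation_add_compl (carried_withDensityᵥ hΩ _) hm

lemma signedIntegral_density (hg : IntegrableOn g Ω)
    (hφ : ContinuousOn φ (closure Ω)) :
    ∫ᵛ x, φ x ∂•((volume.restrict Ω).withDensityᵥ g) = ∫ x in Ω, φ x * g x := by
  obtain ⟨C, -, hC⟩ := hΩ.exists_bound hφ
  refine signedIntegral_withDensityᵥ hg
    ((hφ.mono subset_closure).aestronglyMeasurable hΩ.isOpen.measurableSet) ⟨C, ?_⟩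
  filter_upwards [ae_mem_closure hΩ] with x hx using hC x hx

lemma signedIntegral_bar
    (hf : IntegrableOn (fun x => ∫ y, f y ∂(ν x)) Ω) (hm : m.totalVariation (closure Ω)ᶜ = 0)
    (hφ : ContinuousOn φ (closure Ω)) :
    ∫ᵛ x, φ x ∂•(bar Ω ν f m) = (∫ x in Ω, φ x * ∫ y, f y ∂(ν x)) + ∫ᵛ x, φ x ∂•m := by
  rw [bar, signedIntegral_add_measure hΩ.isCompact_closure (carried_withDensityᵥ hΩ _) hm hφ,
    signedIntegral_density hΩ hf hφ]

end Bar

namespace IsRegularState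

variable {S : MVState d} {c₀ c₃ : Sp d → ℝ} {c₁ : Fin d → Sp d → ℝ} {c₂ : Fin d → Fin d → Sp d → ℝ}
  {φ : Sp d → ℝ} {c : ℝ}

variable (h : IsRegularState Ω S) (hΩ : IsBoundedSmoothDomain Ω)

include h hΩ

omit hΩ in
lemma integrableOn_fRho :
    IntegrableOn (fun x => ∫ y, fRho y ∂(S.ν x)) Ω := h.integrableOn _ (by simp)
omit hΩ in
lemma integrableOn_fMom (i : Fin d) :
    IntegrableOn (fun x => ∫ y, fMom i y ∂(S.ν x)) Ω := h.integrableOn _ (by simp)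
omit hΩ in
lemma integrableOn_fConv (i j : Fin d) : IntegrableOn (fun x => ∫ y, fConv i j y ∂(S.ν x)) Ω :=
  h.integrableOn _ (Or.inr (Or.inr (Or.inl ⟨i, j, rfl⟩)))
omit hΩ in
lemma integrableOn_fKin :
    IntegrableOn (fun x => ∫ y, fKin y ∂(S.ν x)) Ω := h.integrableOn _ (by simp)
omit hΩ in
lemma integrableOn_fPot :
    IntegrableOn (fun x => ∫ y, fPot y ∂(S.ν x)) Ω := h.integrableOn _ (by simp)
omit hΩ in
lemma integrableOn_fStress (i j : Fin d) :
    IntegrableOn (fun x => ∫ y, fStress i j y ∂(S.ν x)) Ω :=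
  h.integrableOn _ (Or.inr (Or.inr (Or.inr (Or.inr (Or.inr ⟨i, j, rfl⟩)))))

lemma carried_rho : (S.rho Ω).totalVariation (closure Ω)ᶜ = 0 := carried_bar hΩ h.carried_mRho
lemma carried_mom (i : Fin d) :
    (S.mom Ω i).totalVariation (closure Ω)ᶜ = 0 := carried_bar hΩ (h.carried_mMom i)
lemma carried_kin : (S.kin Ω).totalVariation (closure Ω)ᶜ = 0 := carried_bar hΩ h.carried_mKin
lemma carried_pot : (S.pot Ω).totalVariation (closure Ω)ᶜ = 0 := carried_bar hΩ h.carried_mPot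

variable (h0 : ContinuousOn c₀ (closure Ω)) (h1 : ∀ i, ContinuousOn (c₁ i) (closure Ω))
  (h2 : ∀ i j, ContinuousOn (c₂ i j) (closure Ω)) (h3 : ContinuousOn c₃ (closure Ω))

include h0 h1 h2 h3

/-- A quadratic polynomial in `v` integrated with respect to the kinetic part of the Young
measure. -/
lemma sum_integral_kin : IntegrableOn (fun x => ∫ y, y.1.1 * (c₀ x + (∑ i, c₁ i x * y.1.2 i)
      + (∑ i, ∑ j, c₂ i j x * (y.1.2 i * y.1.2 j)) + c₃ x * ‖y.1.2‖ ^ 2) ∂(S.ν x)) Ω ∧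
    (∫ x in Ω, c₀ x * ∫ y, fRho y ∂(S.ν x)) + (∑ i, ∫ x in Ω, c₁ i x * ∫ y, fMom i y ∂(S.ν x))
      + (∑ i, ∑ j, ∫ x in Ω, c₂ i j x * ∫ y, fConv i j y ∂(S.ν x))
      + (∫ x in Ω, c₃ x * ∫ y, fKin y ∂(S.ν x))
    = ∫ x in Ω, ∫ y, y.1.1 * (c₀ x + (∑ i, c₁ i x * y.1.2 i)
      + (∑ i, ∑ j, c₂ i j x * (y.1.2 i * y.1.2 j)) + c₃ x * ‖y.1.2‖ ^ 2) ∂(S.ν x) := by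
  have hI : ∀ {g φ : Sp d → ℝ}, IntegrableOn g Ω → ContinuousOn φ (closure Ω) →
      IntegrableOn (fun x => φ x * g x) Ω := fun hg hφ =>
    (hΩ.integrableOn_mul hg hφ).congr
      (ae_of_all _ fun x => mul_comm _ _)
  have j0 := hI h.integrableOn_fRho h0
  have j1 := fun i => hI (h.integrableOn_fMom i) (h1 i)
  have j2 := fun i j => hI (h.integrableOn_fConv i j) (h2 i j)
  have j3 := hI h.integrableOn_fKin h3
  obtain ⟨q1, q2⟩ := integrable_add_sum_add_sum_add j0 j1 j2 j3
  refine (fun hae => ⟨q1.congr hae, by rw [← q2]; exact integral_congr_ae hae⟩) ?_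
  filter_upwards [h.integrable_energy] with x hx
  have hJ : ∀ {f : Phase d → ℝ} (c : ℝ), Continuous f → (∀ y, |f y| ≤ fEnergy y) →
      Integrable (fun y => c * f y) (S.ν x) := fun c hf hb =>
    (hx.mono' hf.aestronglyMeasurable (ae_of_all _ hb)).const_mul c
  have k0 := hJ (c₀ x) continuous_fRho abs_fRho_le
  have k1 := fun i => hJ (c₁ i x) (continuous_fMom i) (abs_fMom_le i)
  have k2 := fun i j => hJ (c₂ i j x) (continuous_fConv i j) (abs_fConv_le i j)
  have k3 := hJ (c₃ x) continuous_fKin abs_fKin_le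
  beta_reduce
  simp only [← integral_const_mul]
  rw [← (integrable_add_sum_add_sum_add k0 k1 k2 k3).2]
  refine integral_congr_ae (ae_of_all _ fun y => ?_)
  simp only [fRho, fMom, fConv, fKin, mul_add, mul_sum]
  congr 1
  · congr 1
    · congr 1
      · ring
      · exact sum_congr rfl fun i _ => by ring
    · exact sum_congr rfl fun i _ => sum_congr rfl fun j _ => by ring
  · ring

/-- The barred quantities integrate quadratic polynomials in `v`, weighted by the density, as the
sum of the oscillation and the concentration parts. -/
lemma sum_bar_kin : (∫ᵛ x, c₀ x ∂•(S.rho Ω)) + (∑ i, ∫ᵛ x, c₁ i x ∂•(S.mom Ω i))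
      + (∑ i, ∑ j, ∫ᵛ x, c₂ i j x ∂•(S.conv Ω i j)) + (∫ᵛ x, c₃ x ∂•(S.kin Ω))
    = (∫ x in Ω, ∫ y, y.1.1 * (c₀ x + (∑ i, c₁ i x * y.1.2 i)
      + (∑ i, ∑ j, c₂ i j x * (y.1.2 i * y.1.2 j)) + c₃ x * ‖y.1.2‖ ^ 2) ∂(S.ν x))
      + ((∫ᵛ x, c₀ x ∂•S.mRho) + (∑ i, ∫ᵛ x, c₁ i x ∂•(S.mMom i))
      + (∑ i, ∑ j, ∫ᵛ x, c₂ i j x ∂•(S.mConv i j)) + ∫ᵛ x, c₃ x ∂•S.mKin) := by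
  rw [← (h.sum_integral_kin hΩ h0 h1 h2 h3).2, MVState.rho, MVState.kin,
    signedIntegral_bar hΩ h.integrableOn_fRho h.carried_mRho h0,
    signedIntegral_bar hΩ h.integrableOn_fKin h.carried_mKin h3]
  have e1 : ∀ i, ∫ᵛ x, c₁ i x ∂•(S.mom Ω i) = _ := fun i =>
    signedIntegral_bar hΩ (h.integrableOn_fMom i) (h.carried_mMom i) (h1 i)
  have e2 : ∀ i j, ∫ᵛ x, c₂ i j x ∂•(S.conv Ω i j) = _ := fun i j =>
    signedIntegral_bar hΩ (h.integrableOn_fConv i j) (h.carried_mConv i j) (h2 i j)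
  simp_rw [e1, e2, sum_add_distrib]
  ring

lemma kin_bar_nonneg
    (hpos : ∀ x ∈ closure Ω, ∀ v : Sp d, 0 ≤ c₀ x + (∑ i, c₁ i x * v i)
      + (∑ i, ∑ j, c₂ i j x * (v i * v j)) + c₃ x * ‖v‖ ^ 2) :
    0 ≤ (∫ᵛ x, c₀ x ∂•(S.rho Ω)) + (∑ i, ∫ᵛ x, c₁ i x ∂•(S.mom Ω i))
      + (∑ i, ∑ j, ∫ᵛ x, c₂ i j x ∂•(S.conv Ω i j)) + ∫ᵛ x, c₃ x ∂•(S.kin Ω) := by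
  rw [h.sum_bar_kin hΩ h0 h1 h2 h3]
  refine add_nonneg (integral_nonneg_of_ae ?_) (h.kin_nonneg c₀ c₁ c₂ c₃ h0 h1 h2 h3 hpos)
  filter_upwards [ae_mem_closure hΩ] with x hx
  exact integral_nonneg fun y => mul_nonneg (NNReal.coe_nonneg _) (hpos x hx _)

omit hΩ h0 h1 h2 h3 in
lemma integrable_coord :
    ∀ᵐ x ∂(volume.restrict Ω), IsFiniteMeasure (S.ν x) ∧
      ∀ i, Integrable (fun y : Phase d => y.2 i) (S.ν x) := by
  filter_upwards [h.integrable_energy, h.mass_le] with x hx hm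
  have hf : IsFiniteMeasure (S.ν x) := ⟨hm.trans_lt ENNReal.one_lt_top⟩
  refine ⟨hf, fun i => (hx.add (integrable_const 1)).mono'
    (by fun_prop) (ae_of_all _ fun y => ?_)⟩
  have h1 := sq_coord_le y.2 i
  have h2 := abs_fPot_le y
  rw [abs_of_nonneg (fPot_nonneg y), fPot] at h2
  rw [Real.norm_eq_abs, abs_le, Pi.add_apply]
  constructor <;> nlinarith [sq_nonneg (y.2 i + 1), sq_nonneg (y.2 i - 1)]

/-- A quadratic polynomial in `F` integrated with respect to the Young measure. Since the latter
may have lost mass, the constant term comes with a non-negative correction. -/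
lemma sum_bar_pot : IntegrableOn (fun x => (∫ y, (c₀ x + (∑ i, c₁ i x * y.2 i)
      + (∑ i, ∑ j, c₂ i j x * (y.2 i * y.2 j)) + c₃ x * ‖y.2‖ ^ 2) ∂(S.ν x))
        + c₀ x * (1 - (S.ν x).real univ)) Ω ∧
    (∫ x in Ω, c₀ x) + (∑ i, ∫ x in Ω, c₁ i x * S.field i x)
      + (∑ i, ∑ j, ∫ᵛ x, c₂ i j x ∂•(S.stress Ω i j)) + (∫ᵛ x, c₃ x ∂•(S.pot Ω))
    = (∫ x in Ω, ((∫ y, (c₀ x + (∑ i, c₁ i x * y.2 i)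
      + (∑ i, ∑ j, c₂ i j x * (y.2 i * y.2 j)) + c₃ x * ‖y.2‖ ^ 2) ∂(S.ν x))
        + c₀ x * (1 - (S.ν x).real univ)))
      + ((∑ i, ∑ j, ∫ᵛ x, c₂ i j x ∂•(S.mStress i j)) + ∫ᵛ x, c₃ x ∂•S.mPot) := by
  have hI : ∀ {g φ : Sp d → ℝ}, IntegrableOn g Ω → ContinuousOn φ (closure Ω) →
      IntegrableOn (fun x => φ x * g x) Ω := fun hg hφ =>
    (hΩ.integrableOn_mul hg hφ).congr
      (ae_of_all _ fun x => mul_comm _ _)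
  have j0 : IntegrableOn c₀ Ω := hΩ.integrableOn h0
  have j1 := fun i => hI (h.integrableOn_field i) (h1 i)
  have j2 := fun i j => hI (h.integrableOn_fStress i j) (h2 i j)
  have j3 := hI h.integrableOn_fPot h3
  have e2 : ∀ i j, ∫ᵛ x, c₂ i j x ∂•(S.stress Ω i j) = _ := fun i j =>
    signedIntegral_bar hΩ (h.integrableOn_fStress i j) (h.carried_mStress i j) (h2 i j)
  have hae : (fun x => c₀ x + (∑ i, c₁ i x * S.field i x)
      + (∑ i, ∑ j, c₂ i j x * ∫ y, fStress i j y ∂(S.ν x)) + c₃ x * ∫ y, fPot y ∂(S.ν x))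
      =ᵐ[volume.restrict Ω] fun x => (∫ y, (c₀ x + (∑ i, c₁ i x * y.2 i)
      + (∑ i, ∑ j, c₂ i j x * (y.2 i * y.2 j)) + c₃ x * ‖y.2‖ ^ 2) ∂(S.ν x))
        + c₀ x * (1 - (S.ν x).real univ) := by
    filter_upwards [h.integrable_energy, h.integrable_coord] with x hx ⟨hfin, hxi⟩
    have hJ : ∀ {f : Phase d → ℝ} (c : ℝ), Continuous f → (∀ y, |f y| ≤ fEnergy y) →
        Integrable (fun y => c * f y) (S.ν x) := fun c hf hb =>
      (hx.mono' hf.aestronglyMeasurable (ae_of_all _ hb)).const_mul c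
    have k0 : Integrable (fun _ : Phase d => c₀ x) (S.ν x) := integrable_const _
    have k1 := fun i => (hxi i).const_mul (c₁ i x)
    have k2 : ∀ i j, Integrable (fun y : Phase d => c₂ i j x * (y.2 i * y.2 j)) (S.ν x) :=
      fun i j => hJ (c₂ i j x) (continuous_fStress i j) (abs_fStress_le i j)
    have k3 : Integrable (fun y : Phase d => c₃ x * ‖y.2‖ ^ 2) (S.ν x) :=
      hJ (c₃ x) continuous_fPot abs_fPot_le
    rw [(integrable_add_sum_add_sum_add k0 k1 k2 k3).2]
    simp_rw [integral_const_mul, integral_const, smul_eq_mul]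
    simp only [MVState.field, fStress, fPot]
    ring
  obtain ⟨jj, ej⟩ := integrable_add_sum_add_sum_add j0 j1 j2 j3
  refine ⟨jj.congr hae, ?_⟩
  rw [← integral_congr_ae hae, MVState.pot,
    signedIntegral_bar hΩ h.integrableOn_fPot h.carried_mPot h3]
  rw [ej]
  simp_rw [e2, sum_add_distrib]
  ring

omit h hΩ h0 h1 h2 h3 in
/-- The homogeneous part of a non-negative quadratic polynomial is non-negative. -/
lemma quadratic_part_nonneg {a b q : ℝ} (h : ∀ l : ℝ, 0 ≤ a + l * b + l ^ 2 * q) : 0 ≤ q := by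
  by_contra hq
  rw [not_le] at hq
  have h1 := h ((|a| + |b| + 1) / -q)
  have h2 := h (-((|a| + |b| + 1) / -q))
  have h3 := h (2 * (1 + (|a| + 1) / -q))
  have h4 := h (-(2 * (1 + (|a| + 1) / -q)))
  set t := 2 * (1 + (|a| + 1) / -q)
  have ht : 2 ≤ t := by
    have : 0 ≤ (|a| + 1) / -q := div_nonneg (by positivity) (by linarith)
    simp only [t]; linarith
  have ht2 : t * -q = 2 * (-q + (|a| + 1)) := by
    simp only [t]; rw [mul_assoc, add_mul, div_mul_cancel₀ _ (by linarith)]; ring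
  nlinarith [le_abs_self a, abs_nonneg a]

lemma pot_bar_nonneg
    (hpos : ∀ x ∈ closure Ω, ∀ F : Sp d, 0 ≤ c₀ x + (∑ i, c₁ i x * F i)
      + (∑ i, ∑ j, c₂ i j x * (F i * F j)) + c₃ x * ‖F‖ ^ 2) :
    0 ≤ (∫ x in Ω, c₀ x) + (∑ i, ∫ x in Ω, c₁ i x * S.field i x)
      + (∑ i, ∑ j, ∫ᵛ x, c₂ i j x ∂•(S.stress Ω i j)) + ∫ᵛ x, c₃ x ∂•(S.pot Ω) := by
  rw [(h.sum_bar_pot hΩ h0 h1 h2 h3).2]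
  refine add_nonneg (integral_nonneg_of_ae ?_) (h.pot_nonneg c₂ c₃ h2 h3 fun x hx F => ?_)
  · filter_upwards [ae_mem_closure hΩ, h.mass_le] with x hx hm
    refine add_nonneg (integral_nonneg fun y => hpos x hx _) (mul_nonneg ?_ ?_)
    · simpa using hpos x hx 0
    · rw [sub_nonneg]; exact ENNReal.toReal_le_of_le_ofReal zero_le_one (by simpa using hm)
  · refine quadratic_part_nonneg (a := c₀ x) (b := ∑ i, c₁ i x * F i) fun l => ?_
    refine (hpos x hx (l • F)).trans_eq ?_
    have e1 : ∑ i, c₁ i x * (l • F) i = l * ∑ i, c₁ i x * F i := by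
      rw [mul_sum]
      exact sum_congr rfl fun i _ => by simp; ring
    have e2 : ∑ i, ∑ j, c₂ i j x * ((l • F) i * (l • F) j)
        = l ^ 2 * ∑ i, ∑ j, c₂ i j x * (F i * F j) := by
      simp_rw [mul_sum]
      exact sum_congr rfl fun i _ => sum_congr rfl fun j _ => by simp; ring
    rw [e1, e2, norm_smul, mul_pow, Real.norm_eq_abs, sq_abs]
    ring

end IsRegularState

end RegularState

/-! ### The field terms at a fixed time -/

section FieldTerms

variable {d : ℕ} {Ω : Set (Sp d)} {f g : Sp d → ℝ} {x : Sp d}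

variable {G c : Fin d → Sp d → ℝ}

variable (hΩ : IsBoundedSmoothDomain Ω) (hf : ContDiffOn ℝ 1 f (closure Ω))
  (hG : ∀ i, IntegrableOn (G i) Ω) (hg : ContDiffOn ℝ 1 g (closure Ω))
  (hc : ∀ i, ContinuousOn (c i) (closure Ω))

include hΩ hf hG hg hc

omit hΩ hG hg hc in
lemma differentiableWithinAt_closure (hx : x ∈ closure Ω) :
    DifferentiableWithinAt ℝ f (closure Ω) x := hf.differentiableOn (by simp) x hx

omit hG hc in
lemma pdOn_mul (i : Fin d) (hx : x ∈ closure Ω) :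
    pdOn Ω (fun y => f y * g y) i x = pdOn Ω f i x * g x + f x * pdOn Ω g i x := by
  rw [pdOn, fderivWithin_fun_mul (uniqueDiffOn_closure hΩ x hx)
    (differentiableWithinAt_closure hf hx) (differentiableWithinAt_closure hg hx)]
  simp [pdOn]; ring

omit hG hc in
lemma pdOn_sub (i : Fin d) (hx : x ∈ closure Ω) :
    pdOn Ω (fun y => f y - g y) i x = pdOn Ω f i x - pdOn Ω g i x := by
  rw [pdOn, fderivWithin_fun_sub (uniqueDiffOn_closure hΩ x hx)
    (differentiableWithinAt_closure hf hx) (differentiableWithinAt_closure hg hx)]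
  simp [pdOn]

omit hf hG hg hc in
lemma pdOn_sum {ι : Type*} {s : Finset ι} {F : ι → Sp d → ℝ}
    (hF : ∀ k ∈ s, ContDiffOn ℝ 1 (F k) (closure Ω)) (i : Fin d) (hx : x ∈ closure Ω) :
    pdOn Ω (fun y => ∑ k ∈ s, F k y) i x = ∑ k ∈ s, pdOn Ω (F k) i x := by
  rw [pdOn, fderivWithin_fun_sum (uniqueDiffOn_closure hΩ x hx)
    fun k hk => differentiableWithinAt_closure (hF k hk) hx]
  simp [pdOn]

omit hf hG hg hc in
lemma pdOn_const_mul (c : ℝ)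
    (hf : ContDiffOn ℝ 1 f (closure Ω)) (i : Fin d) (hx : x ∈ closure Ω) :
    pdOn Ω (fun y => c * f y) i x = c * pdOn Ω f i x := by
  rw [pdOn_mul hΩ contDiffOn_const hf i hx]
  simp [pdOn]

omit hf hg in
/-- A sum of products of integrable functions and functions continuous up to the boundary. -/
lemma integral_sum_mul : ∑ i, ∫ x in Ω, G i x * c i x = ∫ x in Ω, ∑ i, G i x * c i x :=
  (integral_finsetSum _ fun i _ => hΩ.integrableOn_mul (hG i) (hc i)).symm

omit hf hg in
lemma integrableOn_sum_mul : IntegrableOn (fun x => ∑ i, G i x * c i x) Ω :=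
  integrable_finsetSum _ fun i _ => hΩ.integrableOn_mul (hG i) (hc i)

omit hf hG hg hc in
/-- The divergence theorem for tangential fields. -/
lemma integral_div_eq_zero {X : Sp d → Sp d}
    (hX : ContDiffOn ℝ 1 X (closure Ω)) (hXt : IsTangential Ω X) :
    ∫ x in Ω, ∑ i, pdOn Ω (fun y => X y i) i x = 0 := by
  have h := (isWeakGradient_pdOn hΩ (θ := fun _ => 1) contDiffOn_const).integral_tangential hΩ
    (hΩ.integrableOn continuousOn_const)
    (fun i => hΩ.integrableOn (continuousOn_pdOn hΩ contDiffOn_const i))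
    hX hXt
  have h0 : ∀ (i : Fin d) (x : Sp d), pdOn Ω (fun _ => (1 : ℝ)) i x = 0 := by
    intro i x; simp [pdOn]
  simp only [h0, zero_mul, integral_zero, sum_const_zero, one_mul] at h
  linarith

omit hf hG hg hc in
lemma setIntegral_linear_identity {f₁ f₂ f₃ f₄ f₅ f₆ f₇ : Sp d → ℝ}
    (h₁ : IntegrableOn f₁ Ω) (h₂ : IntegrableOn f₂ Ω)
    (h₃ : IntegrableOn f₃ Ω) (h₄ : IntegrableOn f₄ Ω) (h₅ : IntegrableOn f₅ Ω)
    (h₆ : IntegrableOn f₆ Ω) (h₇ : IntegrableOn f₇ Ω)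
    (h : ∀ x ∈ Ω, f₁ x - f₂ x - f₃ x - f₄ x + f₅ x = f₆ x + f₇ x) :
    (∫ x in Ω, f₁ x) - (∫ x in Ω, f₂ x) - (∫ x in Ω, f₃ x) - (∫ x in Ω, f₄ x) + (∫ x in Ω, f₅ x)
      = (∫ x in Ω, f₆ x) + ∫ x in Ω, f₇ x := by
  have i1 : IntegrableOn (fun x => f₁ x - f₂ x) Ω := h₁.sub h₂
  have i2 : IntegrableOn (fun x => f₁ x - f₂ x - f₃ x) Ω := i1.sub h₃
  have i3 : IntegrableOn (fun x => f₁ x - f₂ x - f₃ x - f₄ x) Ω := i2.sub h₄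
  rw [← integral_sub h₁ h₂, ← integral_sub i1 h₃, ← integral_sub i2 h₄, ← integral_add i3 h₅,
    ← integral_add h₆ h₇]
  exact setIntegral_congr_fun hΩ.isOpen.measurableSet h

omit hΩ hf hG hg hc in
/-- The pointwise algebra behind `integral_field_terms`: `A i j = ∂ⱼaᵢ`, `D i j = ∂ⱼUᵢ`. -/
lemma field_terms_algebra (A D : Fin d → Fin d → ℝ) (a U G : Fin d → ℝ)
    (hA : ∀ i j, A i j = A j i) :
    (∑ i, G i * (U i * ∑ j, A j j)) - (∑ i, a i * U i * ∑ j, A j j)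
      - (∑ i, G i * ∑ j, (A j i * U j + a j * D j i))
      - (∑ i, G i * ∑ j, (A j j * U i + a j * D i j - (D j j * a i + U j * A i j)))
      + (∑ i, ((∑ j, (A j i * U j + a j * D j i)) * a i + (∑ j, a j * U j) * A i i
          - ((∑ j, a j * A j i) * U i + (∑ j, a j * a j) / 2 * D i i)))
    = (∑ i, ∑ j, (a i * a j * D i j - a i ^ 2 * D j j / 2))
      + ∑ i, G i * ∑ j, (a i * D j j - a j * D i j - a j * D j i) := by
  have h1 : (∑ i, G i * (U i * ∑ j, A j j)) - (∑ i, G i * ∑ j, (A j i * U j + a j * D j i))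
      - (∑ i, G i * ∑ j, (A j j * U i + a j * D i j - (D j j * a i + U j * A i j)))
      = ∑ i, G i * ∑ j, (a i * D j j - a j * D i j - a j * D j i) := by
    rw [← sum_sub_distrib, ← sum_sub_distrib]
    refine sum_congr rfl fun i _ => ?_
    rw [← mul_sub, ← mul_sub, mul_sum, ← sum_sub_distrib, ← sum_sub_distrib]
    congr 1
    refine sum_congr rfl fun j _ => ?_
    rw [hA j i]; ring
  have s1 : ∑ i, ∑ j, a j * D j i * a i = ∑ i, ∑ j, a i * a j * D i j := by
    rw [Finset.sum_comm]
    exact sum_congr rfl fun i _ => sum_congr rfl fun j _ => by ring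
  have s2 : ∑ i, ∑ j, a j * U j * A i i = ∑ i, ∑ j, a i * U i * A j j := Finset.sum_comm
  have s3 : ∑ i, ∑ j, a j * A j i * U i = ∑ i, ∑ j, A j i * U j * a i := by
    rw [Finset.sum_comm]
    exact sum_congr rfl fun i _ => sum_congr rfl fun j _ => by rw [hA i j]; ring
  have s4 : ∑ i, ∑ j, a j * a j * (D i i / 2) = ∑ i, ∑ j, a i ^ 2 * D j j / 2 := by
    rw [Finset.sum_comm]
    exact sum_congr rfl fun i _ => sum_congr rfl fun j _ => by ring
  have h2 : (∑ i, ((∑ j, (A j i * U j + a j * D j i)) * a i + (∑ j, a j * U j) * A i i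
          - ((∑ j, a j * A j i) * U i + (∑ j, a j * a j) / 2 * D i i)))
      = (∑ i, a i * U i * ∑ j, A j j) + ∑ i, ∑ j, (a i * a j * D i j - a i ^ 2 * D j j / 2) := by
    have e : ∀ i, (∑ j, (A j i * U j + a j * D j i)) * a i + (∑ j, a j * U j) * A i i
          - ((∑ j, a j * A j i) * U i + (∑ j, a j * a j) / 2 * D i i)
        = (∑ j, A j i * U j * a i) + (∑ j, a j * D j i * a i) + (∑ j, a j * U j * A i i)
          - (∑ j, a j * A j i * U i) - ∑ j, a j * a j * (D i i / 2) := by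
      intro i
      rw [sum_add_distrib, add_mul]
      simp_rw [sum_mul, Finset.sum_div, sum_mul]
      have : ∑ j, a j * a j / 2 * D i i = ∑ j, a j * a j * (D i i / 2) :=
        sum_congr rfl fun j _ => by ring
      rw [this]; ring
    simp_rw [e, sum_sub_distrib, sum_add_distrib, s1, s2, s3, s4, mul_sum]
    ring
  rw [h2, ← h1]; ring

omit hf hG hg hc in
/-- Cancellation in the field terms of the relative energy balance: given a weak gradient `G` and a
smooth field `a` with symmetric derivative, both tangential fields `a` and `U` turn the
expression `∫ div a (G - a)·U - G·∇(a·U)` into the linear part of a quadratic form in `G - a`. -/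
lemma integral_field_terms {Ψ : Sp d → ℝ}
    {G : Fin d → Sp d → ℝ} (hG : IsWeakGradient Ω Ψ G) (hGi : ∀ i, IntegrableOn (G i) Ω)
    {a U : Sp d → Sp d} (ha : ContDiffOn ℝ 1 a (closure Ω)) (hU : ContDiffOn ℝ 1 U (closure Ω))
    (hat : IsTangential Ω a) (hUt : IsTangential Ω U)
    (hess : ∀ x ∈ closure Ω, ∀ i j, pdOn Ω (fun y => a y i) j x = pdOn Ω (fun y => a y j) i x) :
    (∑ i, ∫ x in Ω, G i x * (U x i * ∑ j, pdOn Ω (fun y => a y j) j x))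
      - (∫ x in Ω, ∑ i, a x i * U x i * ∑ j, pdOn Ω (fun y => a y j) j x)
      - (∑ i, ∫ x in Ω, G i x * pdOn Ω (fun y => ∑ j, a y j * U y j) i x)
    = (∫ x in Ω, ∑ i, ∑ j, (a x i * a x j * pdOn Ω (fun y => U y i) j x
          - a x i ^ 2 * pdOn Ω (fun y => U y j) j x / 2))
      + ∑ i, ∫ x in Ω, G i x * ∑ j, (a x i * pdOn Ω (fun y => U y j) j x
          - a x j * pdOn Ω (fun y => U y i) j x - a x j * pdOn Ω (fun y => U y j) i x) := by
  have hai := contDiffOn_coord ha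
  have hUi := contDiffOn_coord hU
  have haU : ContDiffOn ℝ 1 (fun y => ∑ j, a y j * U y j) (closure Ω) :=
    ContDiffOn.sum fun j _ => (hai j).mul (hUi j)
  have cA : ∀ i j, ContinuousOn (fun x => pdOn Ω (fun y => a y i) j x) (closure Ω) := fun i j =>
    continuousOn_pdOn hΩ (hai i) j
  have cD : ∀ i j, ContinuousOn (fun x => pdOn Ω (fun y => U y i) j x) (closure Ω) := fun i j =>
    continuousOn_pdOn hΩ (hUi i) j
  have ca : ∀ i, ContinuousOn (fun x => a x i) (closure Ω) := fun i => (hai i).continuousOn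
  have cU : ∀ i, ContinuousOn (fun x => U x i) (closure Ω) := fun i => (hUi i).continuousOn
  have cS : ContinuousOn (fun x => ∑ j, pdOn Ω (fun y => a y j) j x) (closure Ω) :=
    continuousOn_finsetSum _ fun j _ => cA j j
  have hanti := hG.integral_div_antisymm hΩ hGi ha hU hat hUt
  have cX : ∀ i j, ContDiffOn ℝ 1 (fun y => a y j * U y i - U y j * a y i) (closure Ω) := fun i j =>
    ((hai j).mul (hUi i)).sub ((hUi j).mul (hai i))
  have e1 : ∀ i, ∑ j, ∫ x in Ω, G i x * pdOn Ω (fun y => a y j * U y i - U y j * a y i) j x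
      = ∫ x in Ω, G i x * ∑ j, pdOn Ω (fun y => a y j * U y i - U y j * a y i) j x := by
    intro i
    simp_rw [mul_sum]
    exact (integral_finsetSum _ fun j _ => hΩ.integrableOn_mul (hGi i)
      (continuousOn_pdOn hΩ (cX i j) j)).symm
  simp_rw [e1] at hanti
  -- The tangential field `(a·U) a - |a|²/2 U` has integral zero divergence.
  let Y : Sp d → Sp d := fun x => (∑ j, a x j * U x j) • a x - ((∑ j, a x j * a x j) / 2) • U x
  have haa : ContDiffOn ℝ 1 (fun y => (∑ j, a y j * a y j) / 2) (closure Ω) :=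
    (ContDiffOn.sum fun j _ => (hai j).mul (hai j)).div_const 2
  have hY : ContDiffOn ℝ 1 Y (closure Ω) := (haU.smul ha).sub (haa.smul hU)
  have hYt : IsTangential Ω Y := by
    intro x hx n hn
    show inner ℝ ((∑ j, a x j * U x j) • a x - ((∑ j, a x j * a x j) / 2) • U x) n = 0
    rw [inner_sub_left, real_inner_smul_left, real_inner_smul_left, hat x hx n hn, hUt x hx n hn]
    simp
  have hdiv := integral_div_eq_zero hΩ hY hYt
  have cYd : ContinuousOn (fun x => ∑ i, pdOn Ω (fun y => Y y i) i x) (closure Ω) :=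
    continuousOn_finsetSum _ fun i _ => continuousOn_pdOn hΩ (contDiffOn_coord hY i) i
  have k1 : ∀ i, ContinuousOn (fun x => U x i * ∑ j, pdOn Ω (fun y => a y j) j x) (closure Ω) :=
    fun i => (cU i).fun_mul cS
  have k2 : ∀ i, ContinuousOn (fun x => pdOn Ω (fun y => ∑ j, a y j * U y j) i x) (closure Ω) :=
    fun i => continuousOn_pdOn hΩ haU i
  have k3 : ∀ i, ContinuousOn
      (fun x => ∑ j, pdOn Ω (fun y => a y j * U y i - U y j * a y i) j x) (closure Ω) :=
    fun i => continuousOn_finsetSum _ fun j _ => continuousOn_pdOn hΩ (cX i j) j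
  have k4 : ∀ i, ContinuousOn (fun x => ∑ j, (a x i * pdOn Ω (fun y => U y j) j x
      - a x j * pdOn Ω (fun y => U y i) j x - a x j * pdOn Ω (fun y => U y j) i x))
      (closure Ω) := fun i => continuousOn_finsetSum _ fun j _ =>
    (((ca i).fun_mul (cD j j)).fun_sub ((ca j).fun_mul (cD i j))).fun_sub ((ca j).fun_mul (cD j i))
  have k5 : ContinuousOn (fun x => ∑ i, a x i * U x i * ∑ j, pdOn Ω (fun y => a y j) j x)
      (closure Ω) := continuousOn_finsetSum _ fun i _ => ((ca i).fun_mul (cU i)).fun_mul cS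
  have k6 : ContinuousOn (fun x => ∑ i, ∑ j, (a x i * a x j * pdOn Ω (fun y => U y i) j x
      - a x i ^ 2 * pdOn Ω (fun y => U y j) j x / 2)) (closure Ω) :=
    continuousOn_finsetSum _ fun i _ => continuousOn_finsetSum _ fun j _ =>
      (((ca i).fun_mul (ca j)).fun_mul (cD i j)).fun_sub
        ((((ca i).pow 2).fun_mul (cD j j)).div_const 2)
  rw [integral_sum_mul hΩ hGi k1, integral_sum_mul hΩ hGi k2, integral_sum_mul hΩ hGi k4]
  rw [integral_sum_mul hΩ hGi k3] at hanti
  have i1 := integrableOn_sum_mul hΩ hGi k1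
  have i2 := integrableOn_sum_mul hΩ hGi k2
  have i3 := integrableOn_sum_mul hΩ hGi k3
  have i4 := integrableOn_sum_mul hΩ hGi k4
  have i5 := hΩ.integrableOn k5
  have i6 := hΩ.integrableOn k6
  have iY := hΩ.integrableOn cYd
  have key := setIntegral_linear_identity hΩ i1 i5 i2 i3 iY i6 i4 ?_
  · rw [hanti, hdiv] at key
    linarith
  · intro x hxΩ
    have hx : x ∈ closure Ω := subset_closure hxΩ
    have p1 : ∀ i, pdOn Ω (fun y => ∑ j, a y j * U y j) i x
        = ∑ j, (pdOn Ω (fun y => a y j) i x * U x j + a x j * pdOn Ω (fun y => U y j) i x) := by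
      intro i
      rw [pdOn_sum hΩ (fun j _ => (hai j).mul (hUi j)) i hx]
      exact sum_congr rfl fun j _ => pdOn_mul hΩ (hai j) (hUi j) i hx
    have p2 : ∀ i j, pdOn Ω (fun y => a y j * U y i - U y j * a y i) j x
        = pdOn Ω (fun y => a y j) j x * U x i + a x j * pdOn Ω (fun y => U y i) j x
          - (pdOn Ω (fun y => U y j) j x * a x i + U x j * pdOn Ω (fun y => a y i) j x) := by
      intro i j
      rw [pdOn_sub hΩ ((hai j).mul (hUi i)) ((hUi j).mul (hai i)) j hx,
        pdOn_mul hΩ (hai j) (hUi i) j hx, pdOn_mul hΩ (hUi j) (hai i) j hx]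
    have p3 : ∀ i, pdOn Ω (fun y => Y y i) i x
        = (∑ j, (pdOn Ω (fun y => a y j) i x * U x j + a x j * pdOn Ω (fun y => U y j) i x)) * a x i
          + (∑ j, a x j * U x j) * pdOn Ω (fun y => a y i) i x
          - ((∑ j, a x j * pdOn Ω (fun y => a y j) i x) * U x i
            + (∑ j, a x j * a x j) / 2 * pdOn Ω (fun y => U y i) i x) := by
      intro i
      have e : (fun y => Y y i) = fun y => (∑ j, a y j * U y j) * a y i
          - (2⁻¹ * ∑ j, a y j * a y j) * U y i := by
        ext y; simp [Y]; left; ring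
      have haa' : ContDiffOn ℝ 1 (fun y => ∑ j, a y j * a y j) (closure Ω) :=
        ContDiffOn.sum fun j _ => (hai j).mul (hai j)
      rw [e, pdOn_sub hΩ (haU.mul (hai i)) ((contDiffOn_const.mul haa').mul (hUi i)) i hx,
        pdOn_mul hΩ haU (hai i) i hx, pdOn_mul hΩ (contDiffOn_const.mul haa') (hUi i) i hx,
        pdOn_const_mul hΩ _ haa' i hx, p1, pdOn_sum hΩ (fun j _ => (hai j).mul (hai j)) i hx]
      have : ∑ j, pdOn Ω (fun y => a y j * a y j) i x
          = 2 * ∑ j, a x j * pdOn Ω (fun y => a y j) i x := by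
        rw [mul_sum]
        refine sum_congr rfl fun j _ => ?_
        rw [pdOn_mul hΩ (hai j) (hai j) i hx]; ring
      rw [this]; ring
    simp only [p1, p2, p3]
    exact field_terms_algebra (fun i j => pdOn Ω (fun y => a y i) j x)
      (fun i j => pdOn Ω (fun y => U y i) j x) (fun i => a x i) (fun i => U x i) (fun i => G i x)
      (hess x hx)

end FieldTerms

/-! ### The relative energy at a fixed time -/

section RelativeEnergy

variable {d : ℕ} {Ω : Set (Sp d)} {S : MVState d} {U a : Sp d → Sp d}

variable {f : Sp d → ℝ} {C e : ℝ} {c : ℝ}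

/-- The relative kinetic energy `∫ ρ|u - U|²` of a measure-valued state. -/
def relKinetic (Ω : Set (Sp d)) (S : MVState d) (U : Sp d → Sp d) : ℝ :=
  (∫ᵛ x, ‖U x‖ ^ 2 ∂•(S.rho Ω)) + (∑ i, ∫ᵛ x, (-2 * U x i) ∂•(S.mom Ω i)) + S.kin Ω univ

/-- The relative field energy `∫ |∇Φ - a|²` of a measure-valued state. -/
def relField (Ω : Set (Sp d)) (S : MVState d) (a : Sp d → Sp d) : ℝ :=
  (∫ x in Ω, ‖a x‖ ^ 2) + (∑ i, ∫ x in Ω, (-2 * a x i) * S.field i x) + S.pot Ω univ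

lemma continuousOn_coord {s : Set (Sp d)} (hU : ContinuousOn U s) (i : Fin d) :
    ContinuousOn (fun x => U x i) s :=
  (EuclideanSpace.proj (𝕜 := ℝ) i : Sp d →L[ℝ] ℝ).continuous.comp_continuousOn hU

lemma norm_sub_sq_eq (v u : Sp d) : ‖v - u‖ ^ 2
    = ‖u‖ ^ 2 + (∑ i, -2 * u i * v i) + ‖v‖ ^ 2 := by
  simp only [EuclideanSpace.real_norm_sq_eq, ← sum_add_distrib]
  exact sum_congr rfl fun i _ => by simp; ring

variable {c₀ c₃ : Sp d → ℝ} {c₁ : Fin d → Sp d → ℝ} {c₂ : Fin d → Fin d → Sp d → ℝ}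

variable (h : IsRegularState Ω S) (hΩ : IsBoundedSmoothDomain Ω) (hU : ContinuousOn U (closure Ω))
  (ha : ContinuousOn a (closure Ω)) (hf : ContinuousOn f (closure Ω))
  (h0 : ContinuousOn c₀ (closure Ω)) (hc : ∀ x ∈ closure Ω, |f x| ≤ c)
  (h1 : ∀ i, ContinuousOn (c₁ i) (closure Ω)) (h2 : ∀ i j, ContinuousOn (c₂ i j) (closure Ω))

include h hΩ hU ha hf h0 hc h1 h2

omit ha hf hc in
/-- A quadratic polynomial in `v` dominated by `C|v - U|² + e` is integrated to at most
`C ∫ρ|u - U|² + e ∫ρ`. -/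
lemma IsRegularState.kin_bar_le (h3 : ContinuousOn c₃ (closure Ω))
    (hle : ∀ x ∈ closure Ω, ∀ v : Sp d, c₀ x + (∑ i, c₁ i x * v i)
      + (∑ i, ∑ j, c₂ i j x * (v i * v j)) + c₃ x * ‖v‖ ^ 2 ≤ C * ‖v - U x‖ ^ 2 + e) :
    (∫ᵛ x, c₀ x ∂•(S.rho Ω)) + (∑ i, ∫ᵛ x, c₁ i x ∂•(S.mom Ω i))
      + (∑ i, ∑ j, ∫ᵛ x, c₂ i j x ∂•(S.conv Ω i j)) + (∫ᵛ x, c₃ x ∂•(S.kin Ω))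
      ≤ C * relKinetic Ω S U + e * S.rho Ω univ := by
  have hK := hΩ.isCompact_closure
  have cUi := continuousOn_coord hU
  have cN : ContinuousOn (fun x => ‖U x‖ ^ 2) (closure Ω) := hU.norm.pow 2
  have := h.kin_bar_nonneg hΩ (c₀ := fun x => C * ‖U x‖ ^ 2 + e - c₀ x)
    (c₁ := fun i x => C * (-2 * U x i) - c₁ i x) (c₂ := fun i j x => -1 * c₂ i j x)
    (c₃ := fun x => C - c₃ x)
    (((continuousOn_const.fun_mul cN).fun_add continuousOn_const).fun_sub h0)
    (fun i => (continuousOn_const.fun_mul (continuousOn_const.fun_mul (cUi i))).fun_sub (h1 i))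
    (fun i j => continuousOn_const.fun_mul (h2 i j)) (continuousOn_const.fun_sub h3)
    (fun x hx v => by
      have := hle x hx v
      rw [norm_sub_sq_eq] at this
      simp_rw [sub_mul, mul_assoc, sum_sub_distrib, ← mul_sum]
      simp_rw [mul_assoc, ← mul_sum] at this
      linarith)
  have e1 : ∀ i, ∫ᵛ x, (C * (-2 * U x i) - c₁ i x) ∂•(S.mom Ω i)
      = C * (∫ᵛ x, (-2 * U x i) ∂•(S.mom Ω i)) - ∫ᵛ x, c₁ i x ∂•(S.mom Ω i) := fun i => by
    rw [signedIntegral_sub hK (h.carried_mom hΩ i)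
      (continuousOn_const.fun_mul (continuousOn_const.fun_mul (cUi i))) (h1 i),
      signedIntegral_const_mul C]
  have e3 : ∫ᵛ x, (C - c₃ x) ∂•(S.kin Ω) = C * S.kin Ω univ - ∫ᵛ x, c₃ x ∂•(S.kin Ω) := by
    rw [signedIntegral_sub hK (h.carried_kin hΩ) continuousOn_const h3,
      VectorMeasure.integral_const]
    simp
  have e0 : ∫ᵛ x, (C * ‖U x‖ ^ 2 + e - c₀ x) ∂•(S.rho Ω) = C * (∫ᵛ x, ‖U x‖ ^ 2 ∂•(S.rho Ω))
      + e * S.rho Ω univ - ∫ᵛ x, c₀ x ∂•(S.rho Ω) := by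
    rw [signedIntegral_sub hK (h.carried_rho hΩ)
      ((continuousOn_const.fun_mul cN).fun_add continuousOn_const) h0,
      signedIntegral_add hK (h.carried_rho hΩ) (continuousOn_const.fun_mul cN) continuousOn_const,
      signedIntegral_const_mul C, VectorMeasure.integral_const]
    simp
  simp_rw [e1, signedIntegral_const_mul (-1)] at this
  rw [e0, e3, sum_sub_distrib] at this
  simp_rw [← mul_sum] at this
  rw [relKinetic]
  linarith

omit hU hf hc in
/-- A quadratic polynomial in `F` dominated by `C|F - a|² + e` is integrated to at most
`C ∫|∇Φ - a|² + e|Ω|`. -/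
lemma IsRegularState.pot_bar_le (h3 : ContinuousOn c₃ (closure Ω))
    (hle : ∀ x ∈ closure Ω, ∀ v : Sp d, c₀ x + (∑ i, c₁ i x * v i)
      + (∑ i, ∑ j, c₂ i j x * (v i * v j)) + c₃ x * ‖v‖ ^ 2 ≤ C * ‖v - a x‖ ^ 2 + e) :
    (∫ x in Ω, c₀ x) + (∑ i, ∫ x in Ω, c₁ i x * S.field i x)
      + (∑ i, ∑ j, ∫ᵛ x, c₂ i j x ∂•(S.stress Ω i j)) + (∫ᵛ x, c₃ x ∂•(S.pot Ω))
      ≤ C * relField Ω S a + e * volume.real Ω := by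
  have hK := hΩ.isCompact_closure
  have cai := continuousOn_coord ha
  have cN : ContinuousOn (fun x => ‖a x‖ ^ 2) (closure Ω) := ha.norm.pow 2
  have := h.pot_bar_nonneg hΩ (c₀ := fun x => C * ‖a x‖ ^ 2 + e - c₀ x)
    (c₁ := fun i x => C * (-2 * a x i) - c₁ i x) (c₂ := fun i j x => -1 * c₂ i j x)
    (c₃ := fun x => C - c₃ x)
    (((continuousOn_const.fun_mul cN).fun_add continuousOn_const).fun_sub h0)
    (fun i => (continuousOn_const.fun_mul (continuousOn_const.fun_mul (cai i))).fun_sub (h1 i))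
    (fun i j => continuousOn_const.fun_mul (h2 i j)) (continuousOn_const.fun_sub h3)
    (fun x hx v => by
      have := hle x hx v
      rw [norm_sub_sq_eq] at this
      simp_rw [sub_mul, mul_assoc, sum_sub_distrib, ← mul_sum]
      simp_rw [mul_assoc, ← mul_sum] at this
      linarith)
  have hI : ∀ {φ : Sp d → ℝ} (i : Fin d), ContinuousOn φ (closure Ω) →
      IntegrableOn (fun x => φ x * S.field i x) Ω := fun i hφ =>
    (hΩ.integrableOn_mul (h.integrableOn_field i) hφ).congr
      (ae_of_all _ fun x => mul_comm _ _)
  have e1 : ∀ i, ∫ x in Ω, (C * (-2 * a x i) - c₁ i x) * S.field i x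
      = C * (∫ x in Ω, (-2 * a x i) * S.field i x) - ∫ x in Ω, c₁ i x * S.field i x := fun i => by
    simp_rw [sub_mul, mul_assoc C]
    rw [integral_sub ((hI i (continuousOn_const.fun_mul (cai i))).const_mul C) (hI i (h1 i)),
      integral_const_mul]
  have e3 : ∫ᵛ x, (C - c₃ x) ∂•(S.pot Ω) = C * S.pot Ω univ - ∫ᵛ x, c₃ x ∂•(S.pot Ω) := by
    rw [signedIntegral_sub hK (h.carried_pot hΩ) continuousOn_const h3,
      VectorMeasure.integral_const]
    simp
  have e0 : ∫ x in Ω, (C * ‖a x‖ ^ 2 + e - c₀ x) = C * (∫ x in Ω, ‖a x‖ ^ 2)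
      + e * volume.real Ω - ∫ x in Ω, c₀ x := by
    have i1 := hΩ.integrableOn cN
    have i2 : IntegrableOn (fun _ : Sp d => e) Ω := hΩ.integrableOn continuousOn_const
    have i3 : IntegrableOn (fun x => C * ‖a x‖ ^ 2 + e) Ω := (i1.const_mul C).add i2
    rw [integral_sub i3 (hΩ.integrableOn h0),
      integral_add (i1.const_mul C) i2, integral_const_mul, setIntegral_const, smul_eq_mul]
    ring
  simp_rw [e1, signedIntegral_const_mul (-1)] at this
  rw [e0, e3, sum_sub_distrib] at this
  simp_rw [← mul_sum] at this
  rw [relField]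
  linarith

omit h hΩ hU ha hf h0 hc h1 h2 in
lemma signedIntegral_zero (μ : SignedMeasure (Sp d)) : ∫ᵛ _, (0 : ℝ) ∂•μ = 0 := by
  rw [VectorMeasure.integral_const]; simp

omit hU ha hf h0 hc h1 h2 in
lemma IsRegularState.rho_univ_nonneg :
    0 ≤ S.rho Ω univ := by
  have := h.kin_bar_le hΩ (U := fun _ => 0) (c₀ := fun _ => 0) (c₁ := fun _ _ => 0)
    (c₂ := fun _ _ _ => 0) (c₃ := fun _ => 0) (C := 0) (e := 1) continuousOn_const continuousOn_const
    (fun _ => continuousOn_const) (fun _ _ => continuousOn_const) continuousOn_const (by simp)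
  simpa [signedIntegral_zero] using this

omit ha hf h0 hc h1 h2 in
lemma IsRegularState.relKinetic_nonneg : 0 ≤ relKinetic Ω S U := by
  have := h.kin_bar_le hΩ (U := U) (c₀ := fun _ => 0) (c₁ := fun _ _ => 0)
    (c₂ := fun _ _ _ => 0) (c₃ := fun _ => 0) (C := 1) (e := 0) hU continuousOn_const
    (fun _ => continuousOn_const) (fun _ _ => continuousOn_const) continuousOn_const
    (fun x _ v => by simp)
  simpa [signedIntegral_zero] using this

omit hU hf h0 hc h1 h2 in
lemma IsRegularState.relField_nonneg : 0 ≤ relField Ω S a := by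
  have := h.pot_bar_le hΩ (a := a) (c₀ := fun _ => 0) (c₁ := fun _ _ => 0)
    (c₂ := fun _ _ _ => 0) (c₃ := fun _ => 0) (C := 1) (e := 0) ha continuousOn_const
    (fun _ => continuousOn_const) (fun _ _ => continuousOn_const) continuousOn_const
    (fun x _ v => by simp)
  simpa [signedIntegral_zero] using this

omit h hΩ hU ha hf h0 hc h1 h2 in
lemma sq_le_of_forall_two_mul_le {x A B : ℝ} (h : ∀ l : ℝ, 2 * l * x ≤ A + l ^ 2 * B) :
    x ^ 2 ≤ A * B := by
  have := discrim_le_zero (a := B) (b := -2 * x) (c := A) fun l => by linarith [h l]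
  rw [discrim] at this
  linarith

omit hU ha h0 h1 h2 in
lemma abs_signedIntegral_rho_le :
    |∫ᵛ x, f x ∂•(S.rho Ω)| ≤ c * S.rho Ω univ := by
  have key : ∀ l : ℝ, |l| ≤ 1 → l * ∫ᵛ x, f x ∂•(S.rho Ω) ≤ c * S.rho Ω univ := by
    intro l hl
    have := h.kin_bar_le hΩ (U := fun _ => 0) (c₀ := fun x => l * f x) (c₁ := fun _ _ => 0)
      (c₂ := fun _ _ _ => 0) (c₃ := fun _ => 0) (C := 0) (e := c) continuousOn_const
      (continuousOn_const.fun_mul hf)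
      (fun _ => continuousOn_const) (fun _ _ => continuousOn_const) continuousOn_const
      (fun x hx v => by
        simp only [zero_mul, sum_const_zero, add_zero, zero_add]
        refine (le_abs_self _).trans ?_
        rw [abs_mul]
        exact (mul_le_of_le_one_left (abs_nonneg _) hl).trans (hc x hx))
    simpa [signedIntegral_zero, signedIntegral_const_mul] using this
  rw [abs_le']
  constructor
  · simpa using key 1 (by simp)
  · simpa using key (-1) (by simp)

omit ha h0 h1 h2 in
/-- The relative momentum `ρ(u - U)` is dominated by the square root of the relative kinetic
energy. -/
lemma IsRegularState.sq_relMomentum_le (i : Fin d) :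
    ((∫ᵛ x, f x ∂•(S.mom Ω i)) - ∫ᵛ x, f x * U x i ∂•(S.rho Ω)) ^ 2
      ≤ relKinetic Ω S U * (c ^ 2 * S.rho Ω univ) := by
  refine sq_le_of_forall_two_mul_le fun l => ?_
  have cUi := continuousOn_coord hU
  have := h.kin_bar_le hΩ (U := U) (c₀ := fun x => -2 * l * (f x * U x i))
    (c₁ := fun j x => if j = i then 2 * l * f x else 0)
    (c₂ := fun _ _ _ => 0) (c₃ := fun _ => 0) (C := 1) (e := l ^ 2 * c ^ 2) hU
    (continuousOn_const.fun_mul (hf.fun_mul (cUi i)))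
    (fun j => by
      split_ifs
      · exact continuousOn_const.fun_mul hf
      · exact continuousOn_const) (fun _ _ => continuousOn_const) continuousOn_const
    (fun x hx v => by
      have h1 := sq_coord_le (v - U x) i
      have h2 : f x ^ 2 ≤ c ^ 2 := sq_le_sq' (abs_le.1 (hc x hx)).1 (abs_le.1 (hc x hx)).2
      have h3 := mul_le_mul_of_nonneg_left h2 (sq_nonneg l)
      simp only [zero_mul, sum_const_zero, add_zero, ite_mul, Finset.sum_ite_eq',
        Finset.mem_univ, if_true]
      simp only [PiLp.sub_apply] at h1
      nlinarith [sq_nonneg (v i - U x i - l * f x)])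
  have e : ∀ j, ∫ᵛ x, (if j = i then 2 * l * f x else 0) ∂•(S.mom Ω j)
      = if j = i then 2 * l * ∫ᵛ x, f x ∂•(S.mom Ω j) else 0 := by
    intro j
    split_ifs
    · exact signedIntegral_const_mul _ _ _
    · exact signedIntegral_zero _
  simp only [e, signedIntegral_zero, sum_const_zero, add_zero, Finset.sum_ite_eq',
    Finset.mem_univ, if_true, signedIntegral_const_mul, one_mul] at this
  linarith

omit hU hf h0 hc h1 h2 in
/-- The relative field is dominated by the square root of the relative field energy. -/
lemma IsRegularState.sq_relField_le {X : Fin d → Sp d → ℝ} {L : ℝ}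
    (hX : ∀ i, ContinuousOn (X i) (closure Ω)) (hL : ∀ x ∈ closure Ω, ∑ i, X i x ^ 2 ≤ L) :
    ((∑ i, ∫ x in Ω, X i x * S.field i x) - ∫ x in Ω, ∑ i, X i x * a x i) ^ 2
      ≤ relField Ω S a * (L * volume.real Ω) := by
  refine sq_le_of_forall_two_mul_le fun l => ?_
  have cai := continuousOn_coord ha
  have := h.pot_bar_le hΩ (a := a) (c₀ := fun x => -2 * l * ∑ i, X i x * a x i)
    (c₁ := fun i x => 2 * l * X i x)
    (c₂ := fun _ _ _ => 0) (c₃ := fun _ => 0) (C := 1) (e := l ^ 2 * L) ha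
    (continuousOn_const.fun_mul (continuousOn_finsetSum _ fun i _ => (hX i).fun_mul (cai i)))
    (fun i => continuousOn_const.fun_mul (hX i))
    (fun _ _ => continuousOn_const) continuousOn_const
    (fun x hx v => by
      have h1 := mul_le_mul_of_nonneg_left (hL x hx) (sq_nonneg l)
      have h2 : 0 ≤ ∑ i, (v i - a x i - l * X i x) ^ 2 := Finset.sum_nonneg fun i _ => sq_nonneg _
      have h3 : ∑ i, (v i - a x i - l * X i x) ^ 2 = ‖v - a x‖ ^ 2
          - ((∑ i, 2 * l * X i x * v i) + (-2 * l * ∑ i, X i x * a x i))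
          + l ^ 2 * ∑ i, X i x ^ 2 := by
        rw [EuclideanSpace.real_norm_sq_eq, mul_sum, mul_sum,
          ← sum_add_distrib, ← sum_sub_distrib, ← sum_add_distrib]
        exact sum_congr rfl fun i _ => by simp; ring
      simp only [zero_mul, sum_const_zero, add_zero]
      linarith)
  simp only [signedIntegral_zero, sum_const_zero, add_zero, integral_const_mul,
    mul_assoc (2 * l), one_mul] at this
  rw [← mul_sum] at this
  linarith

end RelativeEnergy

/-! ### The rate of change of the relative energy -/

section Rate

variable {d : ℕ} {Ω : Set (Sp d)} {V W ψ : Sp d → ℝ} {M : ℝ} {S : MVState d} {r : Sp d → ℝ}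
  {U Ut a at' : Sp d → Sp d} {Φt : Sp d → ℝ}

/-- What a strong solution says at a fixed time: `r`, `U`, `a` are density, velocity and field,
`Ut`, `at'` are the time derivatives of velocity and field, and `Φt` is that of the potential. -/
structure IsSnapshot (Ω : Set (Sp d)) (V W ψ : Sp d → ℝ) (M : ℝ) (r : Sp d → ℝ)
    (U Ut a at' : Sp d → Sp d) (Φt : Sp d → ℝ) : Prop where
  density : ContinuousOn r (closure Ω)
  velocity : ContDiffOn ℝ 1 U (closure Ω)
  velocity_t : ContinuousOn Ut (closure Ω)
  field : ContDiffOn ℝ 1 a (closure Ω)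
  field_t : ContinuousOn at' (closure Ω)
  potential_t : ContDiffOn ℝ 1 Φt (closure Ω)
  velocity_tangential : IsTangential Ω U
  field_tangential : IsTangential Ω a
  hess : ∀ x ∈ closure Ω, ∀ i j, pdOn Ω (fun y => a y i) j x = pdOn Ω (fun y => a y j) i x
  momentum : ∀ x ∈ closure Ω, ∀ i,
    Ut x i = - (∑ j, U x j * pdOn Ω (fun y => U y i) j x) - a x i - pd V i x
      - (∫ y in Ω, pd W i (x - y) * r y)
      + ((∫ y in Ω, ψ (x - y) * U y i * r y) - U x i * ∫ y in Ω, ψ (x - y) * r y)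
  poisson : ∀ x ∈ closure Ω, ∑ i, pdOn Ω (fun y => a y i) i x = M - r x
  pd_potential_t : ∀ x ∈ closure Ω, ∀ i, pdOn Ω Φt i x = at' x i
  field_rate : ∀ (Ψ : Sp d → ℝ) (G : Fin d → Sp d → ℝ), IsWeakGradient Ω Ψ G → IntegrableOn Ψ Ω →
    (∀ i, IntegrableOn (G i) Ω) →
    ∑ i, ∫ x in Ω, G i x * at' x i = ∑ i, ∫ x in Ω, G i x * (r x * U x i)
  potential : ∃ Φ : Sp d → ℝ, IsWeakGradient Ω Φ (fun i x => a x i) ∧ IntegrableOn Φ Ω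

/-- The right-hand side of the relative energy balance at a fixed time, as it results from the
energy inequality and from testing the momentum equation with `U` and the continuity equation
with `|U|²/2 - V - Φ`. -/
def relRate (Ω : Set (Sp d)) (V W ψ : Sp d → ℝ) (M : ℝ) (S : MVState d)
    (U Ut a at' : Sp d → Sp d) (Φt : Sp d → ℝ) : ℝ :=
  - S.dissipation Ω ψ - (∑ i, ∫ᵛ x, (∫ᵛ y, pd W i (x - y) ∂•(S.rho Ω)) ∂•(S.mom Ω i))
    - S.momentumRHS Ω V W ψ M U Ut
    + ((∫ᵛ x, ((∑ i, U x i * Ut x i) - Φt x) ∂•(S.rho Ω))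
      + ∑ i, ∫ᵛ x, ((∑ j, U x j * pdOn Ω (fun y => U y j) i x) - pd V i x - a x i) ∂•(S.mom Ω i))
    + (M * (∫ x in Ω, Φt x) + ∫ x in Ω, ∑ i, a x i * at' x i)

/-- The Poisson equation of a measure-valued state. -/
def IsPoissonState (Ω : Set (Sp d)) (M : ℝ) (S : MVState d) : Prop :=
  ∀ θ : Sp d → ℝ, ContDiffOn ℝ 1 θ (closure Ω) →
    ∫ x in Ω, ∑ i, S.field i x * pdOn Ω θ i x
      = (∫ᵛ x, θ x ∂•(S.rho Ω)) - M * ∫ x in Ω, θ x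

lemma IsSnapshot.integral_density (hΩ : IsBoundedSmoothDomain Ω)
    (hs : IsSnapshot Ω V W ψ M r U Ut a at' Φt) {θ : Sp d → ℝ}
    (hθ : ContDiffOn ℝ 1 θ (closure Ω)) :
    ∫ x in Ω, θ x * r x = M * (∫ x in Ω, θ x) + ∫ x in Ω, ∑ i, pdOn Ω θ i x * a x i := by
  have hai := contDiffOn_coord hs.field
  have h := (isWeakGradient_pdOn hΩ hθ).integral_tangential hΩ
    (hΩ.integrableOn hθ.continuousOn)
    (fun i => hΩ.integrableOn (continuousOn_pdOn hΩ hθ i))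
    hs.field hs.field_tangential
  have hi := fun i => hΩ.integrableOn (continuousOn_pdOn hΩ hθ i)
  rw [integral_sum_mul hΩ hi fun i => (hai i).continuousOn] at h
  rw [h, ← integral_const_mul, ← integral_neg, ← integral_add]
  · refine setIntegral_congr_fun hΩ.isOpen.measurableSet fun x hx => ?_
    simp only [hs.poisson x (subset_closure hx)]
    ring
  · exact (hΩ.integrableOn hθ.continuousOn).const_mul M
  · exact (hΩ.integrableOn (hθ.continuousOn.fun_mul
      (continuousOn_finsetSum _ fun i _ => continuousOn_pdOn hΩ (hai i) i))).neg

/-- The relative density is dominated by the square root of the relative field energy, in the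
dual of `C¹`. -/
lemma IsSnapshot.sq_relDensity_le (hΩ : IsBoundedSmoothDomain Ω)
    (hs : IsSnapshot Ω V W ψ M r U Ut a at' Φt) (h : IsRegularState Ω S) (hP : IsPoissonState Ω M S)
    {θ : Sp d → ℝ} (hθ : ContDiffOn ℝ 1 θ (closure Ω)) {L : ℝ}
    (hL : ∀ x ∈ closure Ω, ∀ i, |pdOn Ω θ i x| ≤ L) :
    ((∫ᵛ x, θ x ∂•(S.rho Ω)) - ∫ x in Ω, θ x * r x) ^ 2
      ≤ relField Ω S a * (d * L ^ 2 * volume.real Ω) := by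
  have := h.sq_relField_le hΩ hs.field.continuousOn (X := fun i => pdOn Ω θ i) (L := d * L ^ 2)
    (continuousOn_pdOn hΩ hθ) fun x hx => by
      calc ∑ i, pdOn Ω θ i x ^ 2 ≤ ∑ _i : Fin d, L ^ 2 := Finset.sum_le_sum fun i _ =>
            sq_le_sq' (abs_le.1 (hL x hx i)).1 (abs_le.1 (hL x hx i)).2
        _ = d * L ^ 2 := by simp
  have e := hP θ hθ
  rw [← integral_sum_mul hΩ h.integrableOn_field (continuousOn_pdOn hΩ hθ)] at e
  simp_rw [mul_comm (pdOn Ω θ _ _) (S.field _ _)] at this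
  rw [e] at this
  rw [hs.integral_density hΩ hθ]
  refine le_trans (le_of_eq ?_) this
  ring

lemma field_polynomial (D : Fin d → Fin d → ℝ) (a F : Sp d) :
    (∑ i, ∑ j, (a i * a j * D i j - a i ^ 2 * D j j / 2))
      + (∑ i, (∑ j, (a i * D j j - a j * D i j - a j * D j i)) * F i)
      + (∑ i, ∑ j, D i j * (F i * F j)) + (-(1 / 2) * ∑ j, D j j) * ‖F‖ ^ 2
    = (∑ i, ∑ j, D i j * ((F - a) i * (F - a) j)) - (∑ j, D j j) / 2 * ‖F - a‖ ^ 2 := by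
  have s1 : ∑ i, ∑ j, a j * D j i * F i = ∑ i, ∑ j, a i * D i j * F j := Finset.sum_comm
  have e1 : ∀ i, (∑ j, (a i * D j j - a j * D i j - a j * D j i)) * F i
      = (a i * F i) * (∑ j, D j j) - (∑ j, a j * D i j * F i) - ∑ j, a j * D j i * F i := by
    intro i
    rw [sum_mul, mul_sum, ← sum_sub_distrib, ← sum_sub_distrib]
    exact sum_congr rfl fun j _ => by ring
  have e2 : ∑ i, ∑ j, D i j * ((F - a) i * (F - a) j) = (∑ i, ∑ j, D i j * (F i * F j))
      - (∑ i, ∑ j, a j * D i j * F i) - (∑ i, ∑ j, a i * D i j * F j)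
      + ∑ i, ∑ j, a i * a j * D i j := by
    simp_rw [← sum_sub_distrib, ← sum_add_distrib]
    exact sum_congr rfl fun i _ => sum_congr rfl fun j _ => by simp; ring
  have e3 : ∑ i, ∑ j, a i ^ 2 * D j j / 2 = (∑ i, a i ^ 2) * (∑ j, D j j) / 2 := by
    rw [Finset.sum_mul_sum, Finset.sum_div]
    exact sum_congr rfl fun i _ => by rw [Finset.sum_div]
  have e4 : ‖F - a‖ ^ 2 = (∑ i, F i ^ 2) - 2 * (∑ i, a i * F i) + ∑ i, a i ^ 2 := by
    rw [EuclideanSpace.real_norm_sq_eq, mul_sum, ← sum_sub_distrib, ← sum_add_distrib]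
    exact sum_congr rfl fun i _ => by simp; ring
  simp_rw [e1, sum_sub_distrib, s1, e2, e3, e4, ← sum_mul, EuclideanSpace.real_norm_sq_eq]
  ring

lemma kinetic_polynomial (D : Fin d → Fin d → ℝ) (h : Fin d → ℝ) (p : ℝ) (u v : Sp d) :
    (∑ i, u i * (- h i - p * u i - ∑ j, u j * D i j))
      + (∑ i, (h i + 2 * p * u i + (∑ j, u j * D i j) + ∑ j, u j * D j i) * v i)
      + (∑ i, ∑ j, - D i j * (v i * v j)) + (-p) * ‖v‖ ^ 2
    = - p * ‖v - u‖ ^ 2 - (∑ i, ∑ j, D i j * ((v - u) i * (v - u) j)) + ∑ i, h i * (v - u) i := by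
  have s1 : ∑ i, ∑ j, u j * D j i * v i = ∑ i, ∑ j, u i * D i j * v j := Finset.sum_comm
  have e2 : ∑ i, ∑ j, D i j * ((v - u) i * (v - u) j) = (∑ i, ∑ j, D i j * (v i * v j))
      - (∑ i, ∑ j, u j * D i j * v i) - (∑ i, ∑ j, u i * D i j * v j)
      + ∑ i, ∑ j, u i * (u j * D i j) := by
    simp_rw [← sum_sub_distrib, ← sum_add_distrib]
    exact sum_congr rfl fun i _ => sum_congr rfl fun j _ => by simp; ring
  have e4 : ‖v - u‖ ^ 2 = (∑ i, v i ^ 2) - 2 * (∑ i, u i * v i) + ∑ i, u i * u i := by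
    rw [EuclideanSpace.real_norm_sq_eq, mul_sum, ← sum_sub_distrib, ← sum_add_distrib]
    exact sum_congr rfl fun i _ => by simp; ring
  have e5 : ∑ i, h i * (v - u) i = (∑ i, h i * v i) - ∑ i, h i * u i := by
    rw [← sum_sub_distrib]
    exact sum_congr rfl fun i _ => by simp; ring
  have e6 : ∀ i, u i * (- h i - p * u i - ∑ j, u j * D i j)
      = - (h i * u i) - p * (u i * u i) - ∑ j, u i * (u j * D i j) := by
    intro i; rw [← mul_sum]; ring
  have e7 : ∀ i, (h i + 2 * p * u i + (∑ j, u j * D i j) + ∑ j, u j * D j i) * v i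
      = h i * v i + 2 * p * (u i * v i) + (∑ j, u j * D i j * v i) + ∑ j, u j * D j i * v i := by
    intro i; rw [← sum_mul, ← sum_mul]; ring
  have f1 : ∑ i, p * (u i * u i) = p * ∑ i, u i * u i := (mul_sum _ _ _).symm
  have f2 : ∑ i, 2 * p * (u i * v i) = 2 * p * ∑ i, u i * v i := (mul_sum _ _ _).symm
  simp_rw [e6, e7, e2, e4, e5, sum_sub_distrib, sum_add_distrib, s1, neg_mul,
    Finset.sum_neg_distrib, f1, f2, EuclideanSpace.real_norm_sq_eq]
  ring

lemma abs_sum_mul_mul_le {D : Fin d → Fin d → ℝ} {B : ℝ} (hD : ∀ i j, |D i j| ≤ B) (w : Sp d) :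
    |∑ i, ∑ j, D i j * (w i * w j)| ≤ d * (d * B) * ‖w‖ ^ 2 := by
  calc |∑ i, ∑ j, D i j * (w i * w j)| ≤ ∑ i, ∑ j, |D i j * (w i * w j)| :=
        (Finset.abs_sum_le_sum_abs _ _).trans (Finset.sum_le_sum fun i _ =>
          Finset.abs_sum_le_sum_abs _ _)
    _ ≤ ∑ _i : Fin d, ∑ _j : Fin d, B * ‖w‖ ^ 2 := by
        refine Finset.sum_le_sum fun i _ => Finset.sum_le_sum fun j _ => ?_
        rw [abs_mul]
        exact mul_le_mul (hD i j) (abs_mul_coord_le w i j) (abs_nonneg _)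
          ((abs_nonneg _).trans (hD i j))
    _ = d * (d * B) * ‖w‖ ^ 2 := by simp; ring

lemma abs_sum_diag_le {D : Fin d → Fin d → ℝ} {B : ℝ} (hD : ∀ i j, |D i j| ≤ B) :
    |∑ j, D j j| ≤ d * B := by
  refine (Finset.abs_sum_le_sum_abs _ _).trans ((Finset.sum_le_sum fun j _ => hD j j).trans ?_)
  simp

/-- The field terms of the relative energy balance form a quadratic expression in `∇Φ - a`. -/
lemma fieldRate_le (hΩ : IsBoundedSmoothDomain Ω)
    (hs : IsSnapshot Ω V W ψ M r U Ut a at' Φt) (h : IsRegularState Ω S) (hP : IsPoissonState Ω M S)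
    {Ψ : Sp d → ℝ} (hG : IsWeakGradient Ω Ψ S.field) (hΨ : IntegrableOn Ψ Ω) {B : ℝ}
    (hB : ∀ x ∈ closure Ω, ∀ i j, |pdOn Ω (fun y => U y i) j x| ≤ B) :
    - (∫ᵛ x, (∑ i, pdOn Ω (fun y => U y i) i x) ∂•(S.pot Ω)) / 2
      + (∑ i, ∑ j, ∫ᵛ x, pdOn Ω (fun y => U y i) j x ∂•(S.stress Ω i j))
      + M * (∫ x in Ω, ∑ i, S.field i x * U x i)
      - (∫ᵛ x, (∑ i, a x i * U x i) ∂•(S.rho Ω)) - (∫ᵛ x, Φt x ∂•(S.rho Ω))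
      + (M * (∫ x in Ω, Φt x) + ∫ x in Ω, ∑ i, a x i * at' x i)
    ≤ (d * (d * B) + d * B / 2) * relField Ω S a := by
  have hai := contDiffOn_coord hs.field
  have hUi := contDiffOn_coord hs.velocity
  have ca := fun i => (hai i).continuousOn
  have cU := fun i => (hUi i).continuousOn
  have cat := continuousOn_coord hs.field_t
  have cA : ∀ i j, ContinuousOn (fun x => pdOn Ω (fun y => a y i) j x) (closure Ω) := fun i j =>
    continuousOn_pdOn hΩ (hai i) j
  have cD : ∀ i j, ContinuousOn (fun x => pdOn Ω (fun y => U y i) j x) (closure Ω) := fun i j =>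
    continuousOn_pdOn hΩ (hUi i) j
  have cS : ContinuousOn (fun x => ∑ j, pdOn Ω (fun y => a y j) j x) (closure Ω) :=
    continuousOn_finsetSum _ fun j _ => cA j j
  have haU : ContDiffOn ℝ 1 (fun y => ∑ j, a y j * U y j) (closure Ω) :=
    ContDiffOn.sum fun j _ => (hai j).mul (hUi j)
  have iG := h.integrableOn_field
  have ia : ∀ i, IntegrableOn (fun x => a x i) Ω := fun i =>
    hΩ.integrableOn (ca i)
  -- The Poisson equation tested with `∂ₜΦ` and with `a·U`.
  have p1 := hP Φt hs.potential_t
  have p2 := hP _ haU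
  have e1 : ∫ x in Ω, ∑ i, S.field i x * pdOn Ω Φt i x
      = ∑ i, ∫ x in Ω, S.field i x * (r x * U x i) := by
    rw [← hs.field_rate Ψ _ hG hΨ iG, integral_sum_mul hΩ iG cat]
    refine setIntegral_congr_fun hΩ.isOpen.measurableSet fun x hx => ?_
    exact sum_congr rfl fun i _ => by rw [hs.pd_potential_t x (subset_closure hx)]
  obtain ⟨Φ, hΦ, hΦi⟩ := hs.potential
  have e2 : ∫ x in Ω, ∑ i, a x i * at' x i = ∑ i, ∫ x in Ω, a x i * (r x * U x i) := by
    rw [← hs.field_rate Φ _ hΦ hΦi ia, integral_sum_mul hΩ ia cat]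
  have e3 : M * (∫ x in Ω, ∑ i, S.field i x * U x i)
      - ∑ i, ∫ x in Ω, S.field i x * (r x * U x i)
      = ∑ i, ∫ x in Ω, S.field i x * (U x i * ∑ j, pdOn Ω (fun y => a y j) j x) := by
    rw [← integral_sum_mul hΩ iG cU, mul_sum, ← sum_sub_distrib]
    refine sum_congr rfl fun i _ => ?_
    rw [← integral_const_mul, ← integral_sub]
    · refine setIntegral_congr_fun hΩ.isOpen.measurableSet fun x hx => ?_
      simp only [hs.poisson x (subset_closure hx)]
      ring
    · exact (hΩ.integrableOn_mul (iG i) (cU i)).const_mul M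
    · exact hΩ.integrableOn_mul (iG i) (hs.density.fun_mul (cU i))
  have e4 : M * (∫ x in Ω, ∑ i, a x i * U x i) - ∑ i, ∫ x in Ω, a x i * (r x * U x i)
      = ∫ x in Ω, ∑ i, a x i * U x i * ∑ j, pdOn Ω (fun y => a y j) j x := by
    rw [integral_sum_mul hΩ ia fun i => hs.density.fun_mul (cU i), ← integral_const_mul,
      ← integral_sub]
    · refine setIntegral_congr_fun hΩ.isOpen.measurableSet fun x hx => ?_
      simp only [hs.poisson x (subset_closure hx)]
      rw [mul_sum, ← sum_sub_distrib]
      exact sum_congr rfl fun i _ => by ring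
    · exact (hΩ.integrableOn haU.continuousOn).const_mul M
    · exact integrableOn_sum_mul hΩ ia fun i => hs.density.fun_mul (cU i)
  have e5 := integral_field_terms hΩ hG iG hs.field hs.velocity hs.field_tangential
    hs.velocity_tangential hs.hess
  rw [integral_sum_mul hΩ iG (continuousOn_pdOn hΩ haU)] at e5
  -- The quadratic form in `∇Φ - a`.
  have k4 : ∀ i, ContinuousOn (fun x => ∑ j, (a x i * pdOn Ω (fun y => U y j) j x
      - a x j * pdOn Ω (fun y => U y i) j x - a x j * pdOn Ω (fun y => U y j) i x))
      (closure Ω) := fun i => continuousOn_finsetSum _ fun j _ =>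
    (((ca i).fun_mul (cD j j)).fun_sub ((ca j).fun_mul (cD i j))).fun_sub ((ca j).fun_mul (cD j i))
  have k6 : ContinuousOn (fun x => ∑ i, ∑ j, (a x i * a x j * pdOn Ω (fun y => U y i) j x
      - a x i ^ 2 * pdOn Ω (fun y => U y j) j x / 2)) (closure Ω) :=
    continuousOn_finsetSum _ fun i _ => continuousOn_finsetSum _ fun j _ =>
      (((ca i).fun_mul (ca j)).fun_mul (cD i j)).fun_sub
        ((((ca i).pow 2).fun_mul (cD j j)).div_const 2)
  have key := h.pot_bar_le hΩ hs.field.continuousOn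
    (c₃ := fun x => -(1 / 2) * ∑ j, pdOn Ω (fun y => U y j) j x)
    (C := d * (d * B) + d * B / 2) (e := 0) k6 k4 cD
    (continuousOn_const.fun_mul (continuousOn_finsetSum _ fun j _ => cD j j))
    (fun x hx F => by
      rw [field_polynomial (fun i j => pdOn Ω (fun y => U y i) j x) (a x) F]
      have q1 := abs_le.1 (abs_sum_mul_mul_le (hB x hx) (F - a x))
      have q2 := abs_le.1 (abs_sum_diag_le (hB x hx))
      have q3 := sq_nonneg ‖F - a x‖
      nlinarith)
  rw [signedIntegral_const_mul] at key
  simp_rw [mul_comm (∑ j, _) (S.field _ _)] at key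
  linarith

end Rate

section Kernels

variable {d : ℕ} {Ω : Set (Sp d)} {k : Sp d → ℝ}

lemma exists_kernel_bound (hΩ : IsBoundedSmoothDomain Ω) (hk : Continuous k) :
    ∃ c, 0 ≤ c ∧ ∀ x ∈ closure Ω, ∀ y ∈ closure Ω, |k (x - y)| ≤ c := by
  have hK := hΩ.isCompact_closure
  obtain ⟨c, hc⟩ := (hK.prod hK).exists_bound_of_continuousOn
    (f := fun p : Sp d × Sp d => k (p.1 - p.2)) (by fun_prop)
  exact ⟨max c 0, le_max_right _ _, fun x hx y hy => (hc (x, y) ⟨hx, hy⟩).trans (le_max_left _ _)⟩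

lemma exists_kernel_bound_pd (hΩ : IsBoundedSmoothDomain Ω) (hk : ContDiff ℝ 1 k) :
    ∃ c, 0 ≤ c ∧ ∀ i, ∀ x ∈ closure Ω, ∀ y ∈ closure Ω, |pd k i (x - y)| ≤ c := by
  choose c hc0 hc using fun i => exists_kernel_bound hΩ (continuous_pd hk i)
  refine ⟨∑ i, c i, Finset.sum_nonneg fun i _ => hc0 i, fun i x hx y hy => ?_⟩
  exact (hc i x hx y hy).trans (Finset.single_le_sum (fun i _ => hc0 i) (Finset.mem_univ i))

lemma contDiff_pd {n m : ℕ∞ω} (hk : ContDiff ℝ n k) (hmn : m + 1 ≤ n) (i : Fin d) :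
    ContDiff ℝ m (pd k i) :=
  (hk.fderiv_right hmn).clm_apply contDiff_const

lemma pdOn_eq_pd_of_differentiableAt (hΩ : IsBoundedSmoothDomain Ω) {x : Sp d}
    (hx : x ∈ closure Ω) (hk : DifferentiableAt ℝ k x) (i : Fin d) : pdOn Ω k i x = pd k i x := by
  rw [pdOn, pd, fderivWithin_eq_fderiv (uniqueDiffOn_closure hΩ x hx) hk]

lemma contDiff_kernel {n : ℕ∞ω} (hk : ContDiff ℝ n k) (x : Sp d) :
    ContDiff ℝ n fun y => k (x - y) := hk.comp (contDiff_const.sub contDiff_id)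

lemma pd_kernel (hk : ContDiff ℝ 1 k) (x y : Sp d) (i : Fin d) :
    pd (fun z => k (x - z)) i y = - pd k i (x - y) := by
  have h1 : HasFDerivAt (fun z : Sp d => x - z) (-ContinuousLinearMap.id ℝ (Sp d)) y :=
    (hasFDerivAt_id y).const_sub x
  have h2 := ((hk.differentiable (by simp)) (x - y)).hasFDerivAt.comp y h1
  rw [pd, show (fun z => k (x - z)) = k ∘ fun z => x - z from rfl, h2.fderiv]
  simp [pd]

lemma pdOn_kernel (hΩ : IsBoundedSmoothDomain Ω) (hk : ContDiff ℝ 1 k) (x : Sp d) {y : Sp d}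
    (hy : y ∈ closure Ω) (i : Fin d) :
    pdOn Ω (fun z => k (x - z)) i y = - pd k i (x - y) := by
  rw [pdOn_eq_pd_of_differentiableAt hΩ hy
    ((contDiff_kernel hk x).differentiable (by simp) y), pd_kernel hk]

lemma continuousOn_convolution (hΩ : IsBoundedSmoothDomain Ω) {μ : SignedMeasure (Sp d)}
    (hμ : μ.totalVariation (closure Ω)ᶜ = 0) (hk : Continuous k) :
    ContinuousOn (fun x => ∫ᵛ y, k (x - y) ∂•μ) (closure Ω) :=
  continuousOn_signedIntegral hμ hΩ.isCompact_closure (by fun_prop)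

end Kernels

section Rate

variable {d : ℕ} {Ω : Set (Sp d)} {V W ψ : Sp d → ℝ} {M : ℝ} {S : MVState d} {r : Sp d → ℝ}
  {U Ut a at' : Sp d → Sp d} {Φt : Sp d → ℝ}

/-- The force by which density and momentum of the state differ from those of the strong
solution, in the alignment and interaction terms. -/
def relForce (Ω : Set (Sp d)) (W ψ : Sp d → ℝ) (S : MVState d) (r : Sp d → ℝ) (U : Sp d → Sp d)
    (i : Fin d) (x : Sp d) : ℝ :=
  ((∫ᵛ y, ψ (x - y) ∂•(S.mom Ω i)) - ∫ᵛ y, ψ (x - y) * U y i ∂•(S.rho Ω))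
    + ((∫ᵛ y, ψ (x - y) * U y i ∂•(S.rho Ω)) - ∫ y in Ω, ψ (x - y) * U y i * r y)
    - U x i * ((∫ᵛ y, ψ (x - y) ∂•(S.rho Ω)) - ∫ y in Ω, ψ (x - y) * r y)
    - ((∫ᵛ y, pd W i (x - y) ∂•(S.rho Ω)) - ∫ y in Ω, pd W i (x - y) * r y)

lemma sq_relForce_le (hΩ : IsBoundedSmoothDomain Ω) (hW : ContDiff ℝ ∞ W) (hψ : ContDiff ℝ ∞ ψ)
    (B R₁ : ℝ) : ∃ C, 0 ≤ C ∧ ∀ {V : Sp d → ℝ} {M : ℝ} {S : MVState d} {r : Sp d → ℝ}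
      {U Ut a at' : Sp d → Sp d} {Φt : Sp d → ℝ}, IsSnapshot Ω V W ψ M r U Ut a at' Φt →
      IsRegularState Ω S → IsPoissonState Ω M S → S.rho Ω univ ≤ R₁ →
      (∀ x ∈ closure Ω, ∀ i, |U x i| ≤ B) →
      (∀ x ∈ closure Ω, ∀ i j, |pdOn Ω (fun y => U y i) j x| ≤ B) →
      ∀ x ∈ closure Ω, ∀ i, relForce Ω W ψ S r U i x ^ 2
        ≤ C * (relKinetic Ω S U + relField Ω S a) := by
  have hψ1 : ContDiff ℝ 1 ψ := hψ.of_le (by simp)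
  have hW1 : ∀ i, ContDiff ℝ 1 (pd W i) := fun i =>
    contDiff_pd (hW.of_le (m := 2) ENat.LEInfty.out) one_add_one_eq_two.le i
  obtain ⟨c, hc0, hc⟩ := exists_kernel_bound hΩ hψ.continuous
  obtain ⟨c', hc'0, hc'⟩ := exists_kernel_bound_pd hΩ hψ1
  choose cW' hcW'0 hcW' using fun i => exists_kernel_bound_pd hΩ (hW1 i)
  obtain ⟨cW, hcW0, hcW⟩ : ∃ cW, 0 ≤ cW ∧ ∀ i j, ∀ x ∈ closure Ω, ∀ y ∈ closure Ω,
      |pd (pd W i) j (x - y)| ≤ cW := by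
    refine ⟨∑ i, cW' i, Finset.sum_nonneg fun i _ => hcW'0 i, fun i j x hx y hy => ?_⟩
    exact (hcW' i j x hx y hy).trans
      (Finset.single_le_sum (fun i _ => hcW'0 i) (Finset.mem_univ i))
  set E : ℝ → ℝ := fun L => d * L ^ 2 * volume.real Ω
  have hE : ∀ L, 0 ≤ E L := fun L => by positivity
  refine ⟨4 * (c ^ 2 * |R₁| + (E (c' * B + c * B) + (B ^ 2 * E c' + E cW))), by
    have := hE (c' * B + c * B); have := hE c'; have := hE cW; positivity, ?_⟩
  intro V M S r U Ut a at' Φt hs h hP hR hB hBD x hx i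
  have hUi := contDiffOn_coord hs.velocity
  have hκ := h.relKinetic_nonneg hΩ hs.velocity.continuousOn
  have hπ := h.relField_nonneg hΩ hs.field.continuousOn
  have hR0 := h.rho_univ_nonneg hΩ
  have hψx : ContDiffOn ℝ 1 (fun y => ψ (x - y)) (closure Ω) := (contDiff_kernel hψ1 x).contDiffOn
  have q1 := h.sq_relMomentum_le hΩ hs.velocity.continuousOn hψx.continuousOn (hc x hx) i
  have q2 := hs.sq_relDensity_le hΩ h hP (hψx.mul (hUi i)) (L := c' * B + c * B) fun y hy j => by
    rw [pdOn_mul hΩ hψx (hUi i) j hy, pdOn_kernel hΩ hψ1 x hy]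
    refine (abs_add_le _ _).trans (add_le_add ?_ ?_)
    · rw [abs_mul, abs_neg]
      exact mul_le_mul (hc' j x hx y hy) (hB y hy i) (abs_nonneg _) hc'0
    · rw [abs_mul]
      exact mul_le_mul (hc x hx y hy) (hBD y hy i j) (abs_nonneg _) hc0
  have q3 := hs.sq_relDensity_le hΩ h hP hψx (L := c') fun y hy j => by
    rw [pdOn_kernel hΩ hψ1 x hy, abs_neg]; exact hc' j x hx y hy
  have q4 := hs.sq_relDensity_le hΩ h hP (contDiff_kernel (hW1 i) x).contDiffOn (L := cW)
    fun y hy j => by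
      rw [pdOn_kernel hΩ (hW1 i) x hy, abs_neg]; exact hcW i j x hx y hy
  rw [relForce]
  set n1 := (∫ᵛ y, ψ (x - y) ∂•(S.mom Ω i)) - ∫ᵛ y, ψ (x - y) * U y i ∂•(S.rho Ω)
  set n2 := (∫ᵛ y, ψ (x - y) * U y i ∂•(S.rho Ω)) - ∫ y in Ω, ψ (x - y) * U y i * r y
  set n3 := (∫ᵛ y, ψ (x - y) ∂•(S.rho Ω)) - ∫ y in Ω, ψ (x - y) * r y
  set n4 := (∫ᵛ y, pd W i (x - y) ∂•(S.rho Ω)) - ∫ y in Ω, pd W i (x - y) * r y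
  change n2 ^ 2 ≤ relField Ω S a * E (c' * B + c * B) at q2
  change n3 ^ 2 ≤ relField Ω S a * E c' at q3
  change n4 ^ 2 ≤ relField Ω S a * E cW at q4
  have s0 : (n1 + n2 - U x i * n3 - n4) ^ 2 ≤ 4 * (n1 ^ 2 + n2 ^ 2 + (U x i * n3) ^ 2 + n4 ^ 2) := by
    nlinarith [sq_nonneg (n1 - n2), sq_nonneg (n1 + U x i * n3), sq_nonneg (n1 + n4),
      sq_nonneg (n2 + U x i * n3), sq_nonneg (n2 + n4), sq_nonneg (U x i * n3 - n4)]
  have s1 : n1 ^ 2 ≤ (relKinetic Ω S U + relField Ω S a) * (c ^ 2 * |R₁|) := by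
    refine q1.trans (mul_le_mul (by linarith) ?_ (by positivity) (by linarith))
    exact mul_le_mul_of_nonneg_left (hR.trans (le_abs_self _)) (sq_nonneg _)
  have s3 : (U x i * n3) ^ 2 ≤ B ^ 2 * (relField Ω S a * E c') := by
    rw [mul_pow]
    exact mul_le_mul (sq_le_sq' (abs_le.1 (hB x hx i)).1 (abs_le.1 (hB x hx i)).2) q3
      (sq_nonneg _) (sq_nonneg _)
  have hm : ∀ e : ℝ, 0 ≤ e → relField Ω S a * e ≤ (relKinetic Ω S U + relField Ω S a) * e :=
    fun e he => mul_le_mul_of_nonneg_right (by linarith) he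
  have m2 := hm _ (hE (c' * B + c * B))
  have m3 := mul_le_mul_of_nonneg_left (hm _ (hE c')) (sq_nonneg B)
  have m4 := hm _ (hE cW)
  refine s0.trans ?_
  nlinarith

/-- The kinetic and interaction terms of the relative energy balance form a quadratic expression
in `u - U`, up to the action of the relative force. -/
lemma kinRate_eq (hΩ : IsBoundedSmoothDomain Ω)
    (hW : ContDiff ℝ ∞ W) (hψ : ContDiff ℝ ∞ ψ) (hV : ContDiff ℝ ∞ V)
    (hs : IsSnapshot Ω V W ψ M r U Ut a at' Φt) (h : IsRegularState Ω S) :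
    relRate Ω V W ψ M S U Ut a at' Φt
      = (∫ᵛ x, (∑ i, U x i * (- relForce Ω W ψ S r U i x
              - (∫ᵛ y, ψ (x - y) ∂•(S.rho Ω)) * U x i
              - ∑ j, U x j * pdOn Ω (fun y => U y i) j x)) ∂•(S.rho Ω))
        + (∑ i, ∫ᵛ x, (relForce Ω W ψ S r U i x + 2 * (∫ᵛ y, ψ (x - y) ∂•(S.rho Ω)) * U x i
              + (∑ j, U x j * pdOn Ω (fun y => U y i) j x)
              + ∑ j, U x j * pdOn Ω (fun y => U y j) i x) ∂•(S.mom Ω i))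
        + (∑ i, ∑ j, ∫ᵛ x, - pdOn Ω (fun y => U y i) j x ∂•(S.conv Ω i j))
        + (∫ᵛ x, -(∫ᵛ y, ψ (x - y) ∂•(S.rho Ω)) ∂•(S.kin Ω))
        + (- (∫ᵛ x, (∑ i, pdOn Ω (fun y => U y i) i x) ∂•(S.pot Ω)) / 2
      + (∑ i, ∑ j, ∫ᵛ x, pdOn Ω (fun y => U y i) j x ∂•(S.stress Ω i j))
      + M * (∫ x in Ω, ∑ i, S.field i x * U x i)
      - (∫ᵛ x, (∑ i, a x i * U x i) ∂•(S.rho Ω)) - (∫ᵛ x, Φt x ∂•(S.rho Ω))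
      + (M * (∫ x in Ω, Φt x) + ∫ x in Ω, ∑ i, a x i * at' x i)) := by
  have hK := hΩ.isCompact_closure
  have hUi := contDiffOn_coord hs.velocity
  have ca := continuousOn_coord hs.field.continuousOn
  have cU := fun i => (hUi i).continuousOn
  have cUt := continuousOn_coord hs.velocity_t
  have cΦ := hs.potential_t.continuousOn
  have cD : ∀ i j, ContinuousOn (fun x => pdOn Ω (fun y => U y i) j x) (closure Ω) := fun i j =>
    continuousOn_pdOn hΩ (hUi i) j
  have cV : ∀ i, ContinuousOn (fun x => pd V i x) (closure Ω) := fun i =>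
    (continuous_pd (hV.of_le (by simp)) i).continuousOn
  have hcR := h.carried_rho hΩ
  have hcJ := h.carried_mom hΩ
  set w : Fin d → Sp d → ℝ := fun i x => ∫ᵛ y, pd W i (x - y) ∂•(S.rho Ω)
  set q : Fin d → Sp d → ℝ := fun i x => ∫ᵛ y, ψ (x - y) ∂•(S.mom Ω i)
  set p : Sp d → ℝ := fun x => ∫ᵛ y, ψ (x - y) ∂•(S.rho Ω)
  have cw : ∀ i, ContinuousOn (w i) (closure Ω) := fun i =>
    continuousOn_convolution hΩ hcR (continuous_pd (hW.of_le (by simp)) i)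
  have cq : ∀ i, ContinuousOn (q i) (closure Ω) := fun i =>
    continuousOn_convolution hΩ (hcJ i) hψ.continuous
  have cp : ContinuousOn p (closure Ω) := continuousOn_convolution hΩ hcR hψ.continuous
  have hforce : ∀ x ∈ closure Ω, ∀ i, relForce Ω W ψ S r U i x
      = q i x - w i x - Ut x i - p x * U x i - (∑ j, U x j * pdOn Ω (fun y => U y i) j x)
        - pd V i x - a x i := by
    intro x hx i
    rw [hs.momentum x hx i, relForce]
    ring
  -- The coefficients of the density.
  have e0 : ∫ᵛ x, (∑ i, U x i * (- relForce Ω W ψ S r U i x - p x * U x i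
        - ∑ j, U x j * pdOn Ω (fun y => U y i) j x)) ∂•(S.rho Ω)
      = (∫ᵛ x, ((∑ i, U x i * Ut x i) - Φt x) ∂•(S.rho Ω)) + (∫ᵛ x, Φt x ∂•(S.rho Ω))
        + (∫ᵛ x, (∑ i, pd V i x * U x i) ∂•(S.rho Ω))
        + (∫ᵛ x, (∑ i, a x i * U x i) ∂•(S.rho Ω))
        + (∑ i, ∫ᵛ x, (w i x * U x i) ∂•(S.rho Ω)) - ∑ i, ∫ᵛ x, (q i x * U x i) ∂•(S.rho Ω) := by
    have c1 : ContinuousOn (fun x => (∑ i, U x i * Ut x i) - Φt x) (closure Ω) :=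
      (continuousOn_finsetSum _ fun i _ => (cU i).fun_mul (cUt i)).fun_sub cΦ
    have c2 : ContinuousOn (fun x => ∑ i, pd V i x * U x i) (closure Ω) :=
      continuousOn_finsetSum _ fun i _ => (cV i).fun_mul (cU i)
    have c3 : ContinuousOn (fun x => ∑ i, a x i * U x i) (closure Ω) :=
      continuousOn_finsetSum _ fun i _ => (ca i).fun_mul (cU i)
    have c4 : ContinuousOn (fun x => ∑ i, w i x * U x i) (closure Ω) :=
      continuousOn_finsetSum _ fun i _ => (cw i).fun_mul (cU i)
    have c5 : ContinuousOn (fun x => ∑ i, q i x * U x i) (closure Ω) :=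
      continuousOn_finsetSum _ fun i _ => (cq i).fun_mul (cU i)
    rw [← signedIntegral_finsetSum _ hK hcR fun i _ => (cw i).fun_mul (cU i),
      ← signedIntegral_finsetSum _ hK hcR fun i _ => (cq i).fun_mul (cU i),
      ← signedIntegral_add hK hcR c1 cΦ, ← signedIntegral_add hK hcR (c1.fun_add cΦ) c2,
      ← signedIntegral_add hK hcR ((c1.fun_add cΦ).fun_add c2) c3,
      ← signedIntegral_add hK hcR (((c1.fun_add cΦ).fun_add c2).fun_add c3) c4,
      ← signedIntegral_sub hK hcR ((((c1.fun_add cΦ).fun_add c2).fun_add c3).fun_add c4) c5]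
    refine signedIntegral_congr hcR fun x hx => ?_
    simp only [sub_add_cancel, ← sum_add_distrib, ← sum_sub_distrib]
    refine sum_congr rfl fun i _ => ?_
    rw [hforce x hx i]
    ring
  -- The coefficients of the momentum.
  have e1 : ∀ i, ∫ᵛ x, (relForce Ω W ψ S r U i x + 2 * p x * U x i
        + (∑ j, U x j * pdOn Ω (fun y => U y i) j x)
        + ∑ j, U x j * pdOn Ω (fun y => U y j) i x) ∂•(S.mom Ω i)
      = (∫ᵛ x, ((∑ j, U x j * pdOn Ω (fun y => U y j) i x) - pd V i x - a x i) ∂•(S.mom Ω i))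
        + (∫ᵛ x, q i x ∂•(S.mom Ω i)) + (∫ᵛ x, (p x * U x i) ∂•(S.mom Ω i))
        - (∫ᵛ x, w i x ∂•(S.mom Ω i)) - ∫ᵛ x, Ut x i ∂•(S.mom Ω i) := by
    intro i
    have c1 : ContinuousOn (fun x => (∑ j, U x j * pdOn Ω (fun y => U y j) i x) - pd V i x - a x i)
        (closure Ω) := ((continuousOn_finsetSum _ fun j _ => (cU j).fun_mul (cD j i)).fun_sub
          (cV i)).fun_sub (ca i)
    have c2 := c1.fun_add (cq i)
    have c3 := c2.fun_add (cp.fun_mul (cU i))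
    have c4 := c3.fun_sub (cw i)
    rw [← signedIntegral_add hK (hcJ i) c1 (cq i),
      ← signedIntegral_add hK (hcJ i) c2 (cp.fun_mul (cU i)),
      ← signedIntegral_sub hK (hcJ i) c3 (cw i), ← signedIntegral_sub hK (hcJ i) c4 (cUt i)]
    refine signedIntegral_congr (hcJ i) fun x hx => ?_
    simp only [hforce x hx i]
    ring
  have e2 : ∀ i j, ∫ᵛ x, - pdOn Ω (fun y => U y i) j x ∂•(S.conv Ω i j)
      = - ∫ᵛ x, pdOn Ω (fun y => U y i) j x ∂•(S.conv Ω i j) := fun i j => by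
    simp_rw [neg_eq_neg_one_mul (pdOn _ _ _ _)]
    rw [signedIntegral_const_mul]; ring
  have e3 : ∫ᵛ x, - p x ∂•(S.kin Ω) = - ∫ᵛ x, p x ∂•(S.kin Ω) := by
    simp_rw [neg_eq_neg_one_mul (p _)]
    rw [signedIntegral_const_mul]; ring
  simp only [p, q, w] at e0 e1 e3
  rw [e0, e3]
  simp only [e1, e2, sum_sub_distrib, sum_add_distrib, Finset.sum_neg_distrib]
  rw [relRate, MVState.dissipation, MVState.momentumRHS]
  ring

/-- The rate of change of the relative energy is controlled by the relative energy. -/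
lemma relRate_le (hΩ : IsBoundedSmoothDomain Ω) (hV : ContDiff ℝ ∞ V) (hW : ContDiff ℝ ∞ W)
    (hψ : ContDiff ℝ ∞ ψ) {B : ℝ} (hB0 : 0 ≤ B) (R₁ : ℝ) :
    ∃ C, 0 ≤ C ∧ ∀ {M : ℝ} {S : MVState d} {r : Sp d → ℝ}
      {U Ut a at' : Sp d → Sp d} {Φt Ψ : Sp d → ℝ}, IsSnapshot Ω V W ψ M r U Ut a at' Φt →
      IsRegularState Ω S → IsPoissonState Ω M S → IsWeakGradient Ω Ψ S.field →
      IntegrableOn Ψ Ω → S.rho Ω univ ≤ R₁ → (∀ x ∈ closure Ω, ∀ i, |U x i| ≤ B) →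
      (∀ x ∈ closure Ω, ∀ i j, |pdOn Ω (fun y => U y i) j x| ≤ B) →
      relRate Ω V W ψ M S U Ut a at' Φt ≤ C * (relKinetic Ω S U + relField Ω S a) := by
  obtain ⟨c, hc0, hc⟩ := exists_kernel_bound hΩ hψ.continuous
  obtain ⟨C, hC0, hC⟩ := sq_relForce_le hΩ hW hψ B R₁
  refine ⟨(c * |R₁| + d * (d * B) + 1) + d * (C * |R₁|) + (d * (d * B) + d * B / 2),
    by positivity, ?_⟩
  intro M S r U Ut a at' Φt Ψ hs h hP hG hΨ hR hB hBD
  have hκ := h.relKinetic_nonneg hΩ hs.velocity.continuousOn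
  have hπ := h.relField_nonneg hΩ hs.field.continuousOn
  have hR0 := h.rho_univ_nonneg hΩ
  have hRa : S.rho Ω univ ≤ |R₁| := hR.trans (le_abs_self _)
  have hH := fun x hx i => hC hs h hP hR hB hBD x hx i
  set H := relKinetic Ω S U + relField Ω S a with hHdef
  have hH0 : 0 ≤ H := add_nonneg hκ hπ
  rw [kinRate_eq hΩ hW hψ hV hs h]
  have hfield := fieldRate_le hΩ hs h hP hG hΨ hBD
  have hUi := contDiffOn_coord hs.velocity
  have ca := continuousOn_coord hs.field.continuousOn
  have cU := fun i => (hUi i).continuousOn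
  have cUt := continuousOn_coord hs.velocity_t
  have cD : ∀ i j, ContinuousOn (fun x => pdOn Ω (fun y => U y i) j x) (closure Ω) := fun i j =>
    continuousOn_pdOn hΩ (hUi i) j
  have cV : ∀ i, ContinuousOn (fun x => pd V i x) (closure Ω) := fun i =>
    (continuous_pd (hV.of_le (by simp)) i).continuousOn
  have cp : ContinuousOn (fun x => ∫ᵛ y, ψ (x - y) ∂•(S.rho Ω)) (closure Ω) :=
    continuousOn_convolution hΩ (h.carried_rho hΩ) hψ.continuous
  have cF : ∀ i, ContinuousOn (relForce Ω W ψ S r U i) (closure Ω) := by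
    intro i
    have : ContinuousOn (fun x => (∫ᵛ y, ψ (x - y) ∂•(S.mom Ω i))
        - (∫ᵛ y, pd W i (x - y) ∂•(S.rho Ω)) - Ut x i - (∫ᵛ y, ψ (x - y) ∂•(S.rho Ω)) * U x i
        - (∑ j, U x j * pdOn Ω (fun y => U y i) j x) - pd V i x - a x i) (closure Ω) :=
      ((((((continuousOn_convolution hΩ (h.carried_mom hΩ i) hψ.continuous).fun_sub
        (continuousOn_convolution hΩ (h.carried_rho hΩ)
          (continuous_pd (hW.of_le (by simp)) i))).fun_sub (cUt i)).fun_sub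
        (cp.fun_mul (cU i))).fun_sub
        (continuousOn_finsetSum _ fun j _ => (cU j).fun_mul (cD i j))).fun_sub (cV i)).fun_sub (ca i)
    refine this.congr fun x hx => ?_
    beta_reduce
    rw [hs.momentum x hx i, relForce]
    ring
  have key := h.kin_bar_le hΩ (U := U)
    (c₀ := fun x => ∑ i, U x i * (- relForce Ω W ψ S r U i x
              - (∫ᵛ y, ψ (x - y) ∂•(S.rho Ω)) * U x i
              - ∑ j, U x j * pdOn Ω (fun y => U y i) j x))
    (c₁ := fun i x => relForce Ω W ψ S r U i x + 2 * (∫ᵛ y, ψ (x - y) ∂•(S.rho Ω)) * U x i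
              + (∑ j, U x j * pdOn Ω (fun y => U y i) j x)
              + ∑ j, U x j * pdOn Ω (fun y => U y j) i x)
    (c₂ := fun i j x => - pdOn Ω (fun y => U y i) j x)
    (c₃ := fun x => -(∫ᵛ y, ψ (x - y) ∂•(S.rho Ω)))
    (C := c * |R₁| + d * (d * B) + 1) (e := d * (C * H)) hs.velocity.continuousOn
    (continuousOn_finsetSum _ fun i _ => (cU i).fun_mul (((cF i).fun_neg.fun_sub
      (cp.fun_mul (cU i))).fun_sub (continuousOn_finsetSum _ fun j _ => (cU j).fun_mul (cD i j))))
    (fun i => (((cF i).fun_add ((continuousOn_const.fun_mul cp).fun_mul (cU i))).fun_add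
      (continuousOn_finsetSum _ fun j _ => (cU j).fun_mul (cD i j))).fun_add
      (continuousOn_finsetSum _ fun j _ => (cU j).fun_mul (cD j i)))
    (fun i j => (cD i j).fun_neg) cp.fun_neg
    (fun x hx v => by
      rw [kinetic_polynomial (fun i j => pdOn Ω (fun y => U y i) j x)
        (fun i => relForce Ω W ψ S r U i x) _ (U x) v]
      have q1 := abs_le.1 (abs_sum_mul_mul_le (hBD x hx) (v - U x))
      have q2 : |∫ᵛ y, ψ (x - y) ∂•(S.rho Ω)| ≤ c * |R₁| :=
        (abs_signedIntegral_rho_le h hΩ (contDiff_kernel hψ x).continuous.continuousOn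
          (hc x hx)).trans (mul_le_mul_of_nonneg_left hRa hc0)
      have q3 : ∑ i, relForce Ω W ψ S r U i x * (v - U x) i ≤ ‖v - U x‖ ^ 2 + d * (C * H) := by
        have : ∀ i, relForce Ω W ψ S r U i x * (v - U x) i ≤ (v - U x) i ^ 2 + C * H := by
          intro i
          have := hH x hx i
          nlinarith [sq_nonneg (relForce Ω W ψ S r U i x - 2 * (v - U x) i),
            sq_nonneg (relForce Ω W ψ S r U i x)]
        refine (Finset.sum_le_sum fun i _ => this i).trans ?_
        rw [sum_add_distrib, EuclideanSpace.real_norm_sq_eq]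
        simp
      have q4 := mul_le_mul_of_nonneg_right (abs_le.1 q2).1 (sq_nonneg ‖v - U x‖)
      linarith)
  have t1 : d * (C * H) * S.rho Ω univ ≤ d * (C * |R₁|) * H := by
    have : d * (C * H) * S.rho Ω univ ≤ d * (C * H) * |R₁| :=
      mul_le_mul_of_nonneg_left hRa (by positivity)
    linarith
  have t2 : (c * |R₁| + d * (d * B) + 1) * relKinetic Ω S U
      ≤ (c * |R₁| + d * (d * B) + 1) * H :=
    mul_le_mul_of_nonneg_left (by linarith) (by positivity)
  have t3 : (d * (d * B) + d * B / 2) * relField Ω S a ≤ (d * (d * B) + d * B / 2) * H :=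
    mul_le_mul_of_nonneg_left (by linarith) (by positivity)
  refine (add_le_add key hfield).trans ?_
  linarith

end Rate

/-! ### Functions that are smooth up to the boundary of the space-time cylinder -/

section Slab

variable {d : ℕ} {Ω : Set (Sp d)} {T : ℝ} {f : ℝ → Sp d → ℝ} {t : ℝ} {x : Sp d}

variable {F : ℝ × Sp d → ℝ} {w : Sp d → ℝ}

/-- The set `[0,T) × closure Ω` on which strong solutions live. -/
def slab (T : ℝ) (Ω : Set (Sp d)) : Set (ℝ × Sp d) := Ico 0 T ×ˢ closure Ω

/-- Time derivative of a function on `[0,T) × closure Ω`, one-sided at the boundary. -/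
def dT (T : ℝ) (Ω : Set (Sp d)) (f : ℝ → Sp d → ℝ) (t : ℝ) (x : Sp d) : ℝ :=
  fderivWithin ℝ (fun p : ℝ × Sp d => f p.1 p.2) (slab T Ω) (t, x) (1, 0)

variable (hT : 0 < T) (hΩ : IsBoundedSmoothDomain Ω) (hF : ContinuousOn F (slab T Ω))
  (hf : ContDiffOn ℝ 1 (fun p : ℝ × Sp d => f p.1 p.2) (slab T Ω))

include hT hΩ hF hf

omit hT hF hf in
lemma uniqueDiffOn_slab : UniqueDiffOn ℝ (slab T Ω) :=
  (uniqueDiffOn_Ico 0 T).prod (uniqueDiffOn_closure hΩ)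

omit hΩ hF hf in
lemma slab_subset_closure_cyl : slab T Ω ⊆ closure (cyl T Ω) := by
  rw [cyl, closure_prod_eq, closure_Ioo hT.ne]
  exact prod_mono Ico_subset_Icc_self le_rfl

omit hT hΩ hF hf in
lemma cyl_subset_slab : cyl T Ω ⊆ slab T Ω := prod_mono Ioo_subset_Ico_self subset_closure

omit hΩ hF hf in
/-- Identities that hold in the open cylinder extend to `[0,T) × closure Ω` by continuity. -/
lemma eqOn_slab_of_cyl {F G : ℝ × Sp d → ℝ} (hF : ContinuousOn F (slab T Ω))
    (hG : ContinuousOn G (slab T Ω)) (h : ∀ t ∈ Ioo 0 T, ∀ x ∈ Ω, F (t, x) = G (t, x)) :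
    EqOn F G (slab T Ω) :=
  EqOn.of_subset_closure (s := cyl T Ω) (fun p hp => h p.1 hp.1 p.2 hp.2) hF hG cyl_subset_slab
    (slab_subset_closure_cyl hT)

omit hF hf in
lemma slab_subset_closure_interior : slab T Ω ⊆ closure (interior (slab T Ω)) :=
  (slab_subset_closure_cyl hT).trans (closure_mono
    (interior_maximal cyl_subset_slab (isOpen_Ioo.prod hΩ.isOpen)))

omit hT hΩ hF hf in
lemma contDiffOn_slice {E : Type*} [NormedAddCommGroup E] [NormedSpace ℝ E] {n : ℕ∞ω}
    {f : ℝ → Sp d → E} (hf : ContDiffOn ℝ n (fun p : ℝ × Sp d => f p.1 p.2) (slab T Ω))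
    (ht : t ∈ Ico 0 T) : ContDiffOn ℝ n (f t) (closure Ω) :=
  hf.comp (contDiffOn_const.prodMk contDiffOn_id) fun _ hx => ⟨ht, hx⟩

omit hT hF in
lemma pdOn_slice (ht : t ∈ Ico 0 T)
    (hx : x ∈ closure Ω) (i : Fin d) : pdOn Ω (f t) i x
      = fderivWithin ℝ (fun p : ℝ × Sp d => f p.1 p.2) (slab T Ω) (t, x)
          (0, EuclideanSpace.single i 1) := by
  have h1 := ((hf.differentiableOn (by simp)) (t, x) ⟨ht, hx⟩).hasFDerivWithinAt
  have h2 : HasFDerivWithinAt (fun y : Sp d => (t, y)) (ContinuousLinearMap.inr ℝ ℝ (Sp d))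
      (closure Ω) x := (hasFDerivAt_prodMk_right t x).hasFDerivWithinAt
  have h3 := HasFDerivWithinAt.comp x h1 h2 fun y hy => (⟨ht, hy⟩ : (t, y) ∈ slab T Ω)
  rw [pdOn, show f t = (fun p : ℝ × Sp d => f p.1 p.2) ∘ fun y => (t, y) from rfl,
    h3.fderivWithin (uniqueDiffOn_closure hΩ x hx)]
  simp

omit hT hΩ hF in
lemma hasDerivAt_slice (ht : t ∈ Ioo 0 T)
    (hx : x ∈ closure Ω) : HasDerivAt (fun s => f s x) (dT T Ω f t x) t := by
  have h1 := ((hf.differentiableOn (by simp)) (t, x) ⟨Ioo_subset_Ico_self ht, hx⟩).hasFDerivWithinAt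
  have h2 : HasFDerivWithinAt (fun s : ℝ => (s, x)) (ContinuousLinearMap.inl ℝ ℝ (Sp d))
      (Ico 0 T) t := (hasFDerivAt_prodMk_left t x).hasFDerivWithinAt
  have h3 := HasFDerivWithinAt.comp t h1 h2 fun s hs => (⟨hs, hx⟩ : (s, x) ∈ slab T Ω)
  have h4 : HasDerivAt (fun s => f s x) _ t := (h3.hasFDerivAt (Ico_mem_nhds ht.1 ht.2)).hasDerivAt
  convert h4 using 1
  simp [dT]

omit hT hF in
lemma continuousOn_fderivWithin_slab (v : ℝ × Sp d) :
    ContinuousOn (fun p => fderivWithin ℝ (fun p : ℝ × Sp d => f p.1 p.2) (slab T Ω) p v)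
      (slab T Ω) :=
  (hf.continuousOn_fderivWithin (uniqueDiffOn_slab hΩ) le_rfl).clm_apply continuousOn_const

omit hT hF in
lemma continuousOn_dT : ContinuousOn (fun p : ℝ × Sp d => dT T Ω f p.1 p.2) (slab T Ω) :=
  continuousOn_fderivWithin_slab hΩ hf _

omit hT hF in
lemma continuousOn_pdOn_slab (i : Fin d) :
    ContinuousOn (fun p : ℝ × Sp d => pdOn Ω (f p.1) i p.2) (slab T Ω) :=
  (continuousOn_fderivWithin_slab hΩ hf _).congr fun _ hp => pdOn_slice hΩ hf hp.1 hp.2 i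

omit hT hF hf in
/-- First derivatives of a `C²` function on the slab are `C¹`. -/
lemma contDiffOn_fderivWithin_slab
    (hf : ContDiffOn ℝ 2 (fun p : ℝ × Sp d => f p.1 p.2) (slab T Ω)) (v : ℝ × Sp d) :
    ContDiffOn ℝ 1 (fun p => fderivWithin ℝ (fun p : ℝ × Sp d => f p.1 p.2) (slab T Ω) p v)
      (slab T Ω) :=
  (hf.fderivWithin (uniqueDiffOn_slab hΩ) one_add_one_eq_two.le).clm_apply contDiffOn_const

omit hT hF hf in
lemma contDiffOn_pdOn_slab
    (hf : ContDiffOn ℝ 2 (fun p : ℝ × Sp d => f p.1 p.2) (slab T Ω)) (i : Fin d) :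
    ContDiffOn ℝ 1 (fun p : ℝ × Sp d => pdOn Ω (f p.1) i p.2) (slab T Ω) :=
  (contDiffOn_fderivWithin_slab hΩ hf _).congr fun _ hp =>
    pdOn_slice hΩ (hf.of_le (by norm_num)) hp.1 hp.2 i

omit hT hF hf in
lemma contDiffOn_dT
    (hf : ContDiffOn ℝ 2 (fun p : ℝ × Sp d => f p.1 p.2) (slab T Ω)) :
    ContDiffOn ℝ 1 (fun p : ℝ × Sp d => dT T Ω f p.1 p.2) (slab T Ω) :=
  contDiffOn_fderivWithin_slab hΩ hf _

omit hF hf in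
/-- Mixed second derivatives commute up to the boundary. -/
lemma fderivWithin_slab_comm
    (hf : ContDiffOn ℝ 2 (fun p : ℝ × Sp d => f p.1 p.2) (slab T Ω)) {p : ℝ × Sp d}
    (hp : p ∈ slab T Ω) (v w : ℝ × Sp d) :
    fderivWithin ℝ (fun q => fderivWithin ℝ (fun p : ℝ × Sp d => f p.1 p.2) (slab T Ω) q v)
        (slab T Ω) p w
      = fderivWithin ℝ (fun q => fderivWithin ℝ (fun p : ℝ × Sp d => f p.1 p.2) (slab T Ω) q w)
        (slab T Ω) p v := by
  have hu := uniqueDiffOn_slab (T := T) hΩ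
  have hd : DifferentiableWithinAt ℝ (fderivWithin ℝ (fun p : ℝ × Sp d => f p.1 p.2) (slab T Ω))
      (slab T Ω) p :=
    (hf.fderivWithin hu one_add_one_eq_two.le).differentiableOn (by simp) p hp
  have hsymm := (hf p hp).isSymmSndFDerivWithinAt (by simp) hu
    (slab_subset_closure_interior hT hΩ hp) hp
  have e : ∀ v w : ℝ × Sp d, fderivWithin ℝ
      (fun q => fderivWithin ℝ (fun p : ℝ × Sp d => f p.1 p.2) (slab T Ω) q v) (slab T Ω) p w
      = fderivWithin ℝ (fderivWithin ℝ (fun p : ℝ × Sp d => f p.1 p.2) (slab T Ω))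
        (slab T Ω) p w v := by
    intro v w
    rw [fderivWithin_clm_apply (hu p hp) hd (differentiableWithinAt_const v)]
    simp
  rw [e, e]
  exact hsymm w v

omit hF hf in
lemma pdOn_pdOn_comm
    (hf : ContDiffOn ℝ 2 (fun p : ℝ × Sp d => f p.1 p.2) (slab T Ω)) (ht : t ∈ Ico 0 T)
    (hx : x ∈ closure Ω) (i j : Fin d) :
    pdOn Ω (pdOn Ω (f t) i) j x = pdOn Ω (pdOn Ω (f t) j) i x := by
  have hf1 := hf.of_le (m := 1) (by norm_num)
  have e : ∀ i j, pdOn Ω (pdOn Ω (f t) i) j x = fderivWithin ℝ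
      (fun q => fderivWithin ℝ (fun p : ℝ × Sp d => f p.1 p.2) (slab T Ω) q
        (0, EuclideanSpace.single i 1)) (slab T Ω) (t, x) (0, EuclideanSpace.single j 1) := by
    intro i j
    rw [pdOn_slice (f := fun s y => pdOn Ω (f s) i y) hΩ (contDiffOn_pdOn_slab hΩ hf i) ht hx j]
    congr 1
    exact fderivWithin_congr (fun q hq => pdOn_slice hΩ hf1 hq.1 hq.2 i)
      (pdOn_slice hΩ hf1 ht hx i)
  rw [e, e, fderivWithin_slab_comm hT hΩ hf ⟨ht, hx⟩]

omit hF hf in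
lemma pdOn_dT
    (hf : ContDiffOn ℝ 2 (fun p : ℝ × Sp d => f p.1 p.2) (slab T Ω)) (ht : t ∈ Ico 0 T)
    (hx : x ∈ closure Ω) (i : Fin d) :
    pdOn Ω (dT T Ω f t) i x = dT T Ω (fun s y => pdOn Ω (f s) i y) t x := by
  have hf1 := hf.of_le (m := 1) (by norm_num)
  rw [pdOn_slice hΩ (contDiffOn_dT hΩ hf) ht hx i, dT]
  have e : fderivWithin ℝ (fun p : ℝ × Sp d => pdOn Ω (f p.1) i p.2) (slab T Ω) (t, x)
      = fderivWithin ℝ (fun q => fderivWithin ℝ (fun p : ℝ × Sp d => f p.1 p.2) (slab T Ω) q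
        (0, EuclideanSpace.single i 1)) (slab T Ω) (t, x) :=
    fderivWithin_congr (fun q hq => pdOn_slice hΩ hf1 hq.1 hq.2 i) (pdOn_slice hΩ hf1 ht hx i)
  rw [e]
  exact fderivWithin_slab_comm hT hΩ hf ⟨ht, hx⟩ _ _

/-! Integrals over `Ω` depending on a parameter. -/

omit hT hf in
lemma exists_bound_slab {T₁ : ℝ} (hT₁ : T₁ < T) :
    ∃ C, 0 ≤ C ∧ ∀ t ∈ Icc 0 T₁, ∀ x ∈ closure Ω, |F (t, x)| ≤ C := by
  obtain ⟨C, hC⟩ := (isCompact_Icc.prod hΩ.isCompact_closure).exists_bound_of_continuousOn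
    (hF.mono (prod_mono (fun t ht => ⟨ht.1, ht.2.trans_lt hT₁⟩ : Icc 0 T₁ ⊆ Ico 0 T) le_rfl))
  exact ⟨max C 0, le_max_right _ _, fun t ht x hx => (hC (t, x) ⟨ht, hx⟩).trans (le_max_left _ _)⟩

omit hT hΩ hf in
lemma continuousOn_slab_slice
    (ht : t ∈ Ico 0 T) : ContinuousOn (fun x => F (t, x)) (closure Ω) :=
  hF.comp (Continuous.prodMk_right t).continuousOn fun _ hx => ⟨ht, hx⟩

omit hT hΩ hf in
lemma continuousOn_slab_slice_left
    (hx : x ∈ closure Ω) : ContinuousOn (fun t => F (t, x)) (Ico 0 T) :=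
  hF.comp (Continuous.prodMk_left x).continuousOn fun _ ht => ⟨ht, hx⟩

omit hT hf in
/-- Integrals against a function continuous on the slab depend continuously on time, and so do
those with a kernel that depends on a space variable. -/
lemma continuousOn_slab_integral_kernel {k : Sp d → ℝ} (hk : Continuous k) :
    ContinuousOn (fun p : ℝ × Sp d => ∫ y in Ω, k (p.2 - y) * F (p.1, y)) (slab T Ω) := by
  obtain ⟨c, hc0, hc⟩ := exists_kernel_bound hΩ hk
  intro p hp
  obtain ⟨T₁, h1, h2⟩ := exists_between hp.1.2
  obtain ⟨C, hC0, hC⟩ := exists_bound_slab hΩ hF h2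
  have hnear : ∀ᶠ q in 𝓝[slab T Ω] p, q ∈ slab T Ω ∧ q.1 ∈ Icc 0 T₁ := by
    have h3 : ∀ᶠ q in 𝓝[slab T Ω] p, q.1 < T₁ :=
      (continuous_fst.tendsto p).mono_left nhdsWithin_le_nhds (Iio_mem_nhds h1)
    filter_upwards [h3, self_mem_nhdsWithin] with q hq hqs using ⟨hqs, hqs.1.1, hq.le⟩
  refine continuousWithinAt_of_dominated (bound := fun _ => c * C) ?_ ?_
    (integrable_const_iff.2 (Or.inr ⟨by
      rw [Measure.restrict_apply_univ]; exact hΩ.isBounded.measure_lt_top⟩)) ?_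
  · filter_upwards [hnear] with q hq
    exact (((hk.comp (continuous_const.sub continuous_id)).continuousOn.fun_mul
      (continuousOn_slab_slice hF hq.1.1)).mono subset_closure).aestronglyMeasurable
        hΩ.isOpen.measurableSet
  · filter_upwards [hnear] with q hq
    filter_upwards [ae_mem_closure hΩ] with y hy
    rw [Real.norm_eq_abs, abs_mul]
    exact mul_le_mul (hc _ hq.1.2 y hy) (hC _ hq.2 y hy) (abs_nonneg _) hc0
  · filter_upwards [ae_mem_closure hΩ] with y hy
    refine ContinuousWithinAt.mul ?_ ?_
    · exact (hk.comp (continuous_snd.sub continuous_const)).continuousWithinAt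
    · exact (hF (p.1, y) ⟨hp.1, hy⟩).comp (f := fun q : ℝ × Sp d => (q.1, y)) (by fun_prop)
        fun q hq => ⟨hq.1, hy⟩

omit hT hf in
lemma continuousOn_slab_integral_weight (hw : IntegrableOn w Ω) :
    ContinuousOn (fun t => ∫ y in Ω, w y * F (t, y)) (Ico 0 T) := by
  intro t ht
  obtain ⟨T₁, h1, h2⟩ := exists_between ht.2
  obtain ⟨C, hC0, hC⟩ := exists_bound_slab hΩ hF h2
  have hnear : ∀ᶠ s in 𝓝[Ico 0 T] t, s ∈ Ico 0 T ∧ s ∈ Icc 0 T₁ := by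
    have h3 : ∀ᶠ s in 𝓝[Ico 0 T] t, s < T₁ := nhdsWithin_le_nhds (Iio_mem_nhds h1)
    filter_upwards [h3, self_mem_nhdsWithin] with q hq hqs using ⟨hqs, hqs.1, hq.le⟩
  refine continuousWithinAt_of_dominated (bound := fun y => |w y| * C) ?_ ?_
    (hw.abs.mul_const C) ?_
  · filter_upwards [hnear] with s hs
    exact (hΩ.integrableOn_mul hw
      (continuousOn_slab_slice hF hs.1)).aestronglyMeasurable
  · filter_upwards [hnear] with s hs
    filter_upwards [ae_mem_closure hΩ] with y hy
    rw [Real.norm_eq_abs, abs_mul]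
    exact mul_le_mul_of_nonneg_left (hC _ hs.2 y hy) (abs_nonneg _)
  · filter_upwards [ae_mem_closure hΩ] with y hy
    exact continuousWithinAt_const.mul (continuousOn_slab_slice_left hF hy t ht)

omit hT hF in
/-- Differentiation of a weighted integral over `Ω` in time. -/
lemma hasDerivAt_integral_weight
    (hw : IntegrableOn w Ω) (ht : t ∈ Ioo 0 T) :
    HasDerivAt (fun s => ∫ y in Ω, w y * f s y) (∫ y in Ω, w y * dT T Ω f t y) t := by
  obtain ⟨T₁, h1, h2⟩ := exists_between ht.2
  have hd := continuousOn_dT hΩ hf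
  obtain ⟨C, hC0, hC⟩ := exists_bound_slab hΩ hd h2
  have hI : ∀ s ∈ Ioo 0 T₁, s ∈ Ioo 0 T := fun s hs => ⟨hs.1, hs.2.trans h2⟩
  refine (hasDerivAt_integral_of_dominated_loc_of_deriv_le (s := Ioo 0 T₁)
    (bound := fun y => |w y| * C) (F := fun s y => w y * f s y)
    (F' := fun s y => w y * dT T Ω f s y) (Ioo_mem_nhds ht.1 h1) ?_ ?_ ?_ ?_
    (hw.abs.mul_const C) ?_).2
  · filter_upwards [Ioo_mem_nhds ht.1 ht.2] with s hs
    exact (hΩ.integrableOn_mul hw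
      (continuousOn_slab_slice hf.continuousOn (Ioo_subset_Ico_self hs))).aestronglyMeasurable
  · exact hΩ.integrableOn_mul hw
      (continuousOn_slab_slice hf.continuousOn (Ioo_subset_Ico_self ht))
  · exact (hΩ.integrableOn_mul hw
      (continuousOn_slab_slice hd (Ioo_subset_Ico_self ht))).aestronglyMeasurable
  · filter_upwards [ae_mem_closure hΩ] with y hy s hs
    rw [Real.norm_eq_abs, abs_mul]
    exact mul_le_mul_of_nonneg_left (hC _ ⟨hs.1.le, hs.2.le⟩ y hy) (abs_nonneg _)
  · filter_upwards [ae_mem_closure hΩ] with y hy s hs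
    exact (hasDerivAt_slice hf (hI s hs) hy).const_mul (w y)

end Slab

/-! ### Differentiability of convolutions -/

section Convolution

variable {d : ℕ} {K : Set (Sp d)} {k : Sp d → ℝ}

variable {m : Measure (Sp d)} {w : Sp d → ℝ} {μ : SignedMeasure (Sp d)}

variable (hK : IsCompact K) (hμ : μ.totalVariation Kᶜ = 0) (hm : ∀ᵐ y ∂m, y ∈ K)
  (hw : Integrable w m) (hk : ContDiff ℝ 1 k)

include hK hμ hm hw hk

omit hμ in
lemma hasFDerivAt_integral_kernel (x : Sp d) :
    HasFDerivAt (fun z => ∫ y, w y * k (z - y) ∂m) (∫ y, w y • fderiv ℝ k (x - y) ∂m) x ∧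
      ContinuousAt (fun z => ∫ y, w y • fderiv ℝ k (z - y) ∂m) x := by
  have hc : Continuous fun p : Sp d × Sp d => fderiv ℝ k (p.1 - p.2) :=
    (hk.continuous_fderiv (by simp)).comp (continuous_fst.sub continuous_snd)
  obtain ⟨C, hC⟩ := ((isCompact_closedBall x 1).prod hK).exists_bound_of_continuousOn
    hc.continuousOn
  have hb : ∀ z ∈ Metric.ball x 1, ∀ᵐ y ∂m, ‖w y • fderiv ℝ k (z - y)‖ ≤ |w y| * C := by
    intro z hz
    filter_upwards [hm] with y hy
    rw [norm_smul, Real.norm_eq_abs]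
    exact mul_le_mul_of_nonneg_left (hC (z, y) ⟨Metric.ball_subset_closedBall hz, hy⟩)
      (abs_nonneg _)
  have hmeas : ∀ z, AEStronglyMeasurable (fun y => w y • fderiv ℝ k (z - y)) m := fun z =>
    hw.aestronglyMeasurable.smul
      (hc.comp (Continuous.prodMk_right z)).stronglyMeasurable.aestronglyMeasurable
  constructor
  · refine hasFDerivAt_integral_of_dominated_of_fderiv_le (s := Metric.ball x 1)
      (bound := fun y => |w y| * C) (F' := fun z y => w y • fderiv ℝ k (z - y))
      (Metric.ball_mem_nhds x one_pos) ?_ ?_ (hmeas x) ?_ (hw.abs.mul_const C) ?_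
    · exact Eventually.of_forall fun z => hw.aestronglyMeasurable.mul
        (hk.continuous.comp (continuous_const.sub continuous_id)).aestronglyMeasurable
    · have hc2 : Continuous fun y => k (x - y) :=
        hk.continuous.comp (continuous_const.sub continuous_id)
      obtain ⟨B, hB⟩ := hK.exists_bound_of_continuousOn hc2.continuousOn
      refine (hw.abs.mul_const B).mono' (hw.aestronglyMeasurable.mul hc2.aestronglyMeasurable) ?_
      filter_upwards [hm] with y hy
      rw [norm_mul, Real.norm_eq_abs]
      exact mul_le_mul_of_nonneg_left (hB y hy) (abs_nonneg _)
    · filter_upwards [hm] with y hy z hz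
      rw [norm_smul, Real.norm_eq_abs]
      exact mul_le_mul_of_nonneg_left (hC (z, y) ⟨Metric.ball_subset_closedBall hz, hy⟩)
        (abs_nonneg _)
    · refine Eventually.of_forall fun y z _ => ?_
      have h1 : HasFDerivAt (fun z => k (z - y)) (fderiv ℝ k (z - y)) z :=
        ((hk.differentiable (by simp)) (z - y)).hasFDerivAt.comp z (hasFDerivAt_sub_const y)
      simpa [smul_eq_mul] using h1.const_mul (w y)
  · refine continuousAt_of_dominated (bound := fun y => |w y| * C)
      (Eventually.of_forall hmeas) ?_ (hw.abs.mul_const C) ?_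
    · filter_upwards [Metric.ball_mem_nhds x one_pos] with z hz using hb z hz
    · exact Eventually.of_forall fun y =>
        ((hc.comp (Continuous.prodMk_left y)).continuousAt).const_smul (w y)

omit hμ in
lemma contDiff_integral_kernel : ContDiff ℝ 1 fun z => ∫ y, w y * k (z - y) ∂m :=
  contDiff_one_iff_hasFDerivAt.2 ⟨_, continuous_iff_continuousAt.2 fun x =>
    (hasFDerivAt_integral_kernel hK hm hw hk x).2, fun x =>
      (hasFDerivAt_integral_kernel hK hm hw hk x).1⟩

omit hμ in
lemma pd_integral_kernel (i : Fin d)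
    (x : Sp d) : pd (fun z => ∫ y, w y * k (z - y) ∂m) i x = ∫ y, w y * pd k i (x - y) ∂m := by
  rw [pd, (hasFDerivAt_integral_kernel hK hm hw hk x).1.fderiv, ContinuousLinearMap.integral_apply]
  · rfl
  · have hc : Continuous fun y => fderiv ℝ k (x - y) :=
      (hk.continuous_fderiv (by simp)).comp (continuous_const.sub continuous_id)
    obtain ⟨B, hB⟩ := hK.exists_bound_of_continuousOn hc.continuousOn
    refine (hw.abs.mul_const B).mono' (hw.aestronglyMeasurable.smul
      hc.stronglyMeasurable.aestronglyMeasurable) ?_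
    filter_upwards [hm] with y hy
    rw [norm_smul, Real.norm_eq_abs]
    exact mul_le_mul_of_nonneg_left (hB y hy) (abs_nonneg _)


omit hK hm hw hk in
lemma ae_mem_posPart_negPart :
    (∀ᵐ y ∂μ.toJordanDecomposition.posPart, y ∈ K) ∧
      ∀ᵐ y ∂μ.toJordanDecomposition.negPart, y ∈ K := by
  rw [SignedMeasure.totalVariation, Measure.add_apply, add_eq_zero] at hμ
  exact hμ

omit hm hw hk in
lemma signedIntegral_kernel_eq
    (hk : Continuous k) : (fun z => ∫ᵛ y, k (z - y) ∂•μ)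
      = fun z => (∫ y, (1 : ℝ) * k (z - y) ∂μ.toJordanDecomposition.posPart)
        - ∫ y, (1 : ℝ) * k (z - y) ∂μ.toJordanDecomposition.negPart := by
  funext z
  simp only [one_mul]
  exact signedIntegral_eq_sub (integrable_of_carried hK hμ
    (hk.comp (continuous_const.sub continuous_id)).continuousOn)

omit hm hw in
lemma contDiff_signedIntegral_kernel : ContDiff ℝ 1 fun z => ∫ᵛ y, k (z - y) ∂•μ := by
  rw [signedIntegral_kernel_eq hK hμ hk.continuous]
  exact (contDiff_integral_kernel hK (ae_mem_posPart_negPart hμ).1 (integrable_const 1) hk).sub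
    (contDiff_integral_kernel hK (ae_mem_posPart_negPart hμ).2 (integrable_const 1) hk)

omit hm hw in
lemma pd_signedIntegral_kernel (i : Fin d) (x : Sp d) :
    pd (fun z => ∫ᵛ y, k (z - y) ∂•μ) i x = ∫ᵛ y, pd k i (x - y) ∂•μ := by
  have h1 := ae_mem_posPart_negPart hμ
  rw [congrFun (signedIntegral_kernel_eq hK hμ (continuous_pd hk i)) x,
    ← pd_integral_kernel hK h1.1 (integrable_const 1) hk,
    ← pd_integral_kernel hK h1.2 (integrable_const 1) hk,
    signedIntegral_kernel_eq hK hμ hk.continuous, pd, fderiv_fun_sub]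
  · rfl
  · exact (contDiff_integral_kernel hK h1.1 (integrable_const 1) hk).differentiable (by simp) x
  · exact (contDiff_integral_kernel hK h1.2 (integrable_const 1) hk).differentiable (by simp) x

end Convolution

/-! ### Strong solutions up to the boundary -/

section StrongSolution

variable {d : ℕ} {Ω : Set (Sp d)} {T : ℝ} {V W ψ : Sp d → ℝ} {r : ℝ → Sp d → ℝ}
  {U : ℝ → Sp d → Sp d} {Φ : ℝ → Sp d → ℝ} {t : ℝ} {x : Sp d}

/-- Time derivative of the velocity, one-sided at the boundary. -/
def velocityRate (T : ℝ) (Ω : Set (Sp d)) (U : ℝ → Sp d → Sp d) (t : ℝ) (x : Sp d) : Sp d :=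
  WithLp.toLp 2 fun i => dT T Ω (fun s y => U s y i) t x

/-- Time derivative of the field `∇Φ`, one-sided at the boundary. -/
def gradRate (T : ℝ) (Ω : Set (Sp d)) (Φ : ℝ → Sp d → ℝ) (t : ℝ) (x : Sp d) : Sp d :=
  WithLp.toLp 2 fun i => dT T Ω (fun s y => pdOn Ω (Φ s) i y) t x

variable (h : IsStrongSolution T Ω V W ψ r U Φ) (hΩ : IsBoundedSmoothDomain Ω) (hT : 0 < T)
  (ht : t ∈ Ico 0 T)

include h hΩ hT ht

omit h hT ht in
lemma pd_congr_of_eqOn {f g : Sp d → ℝ} (h : EqOn f g Ω)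
    (hx : x ∈ Ω) (i : Fin d) : pd f i x = pd g i x := by
  rw [pd, pd, (h.eventuallyEq_of_mem (hΩ.isOpen.mem_nhds hx)).fderiv_eq]

omit h hΩ ht in
lemma isTangential_of_Ioo {X : ℝ → Sp d → Sp d}
    (hX : ContinuousOn (fun p : ℝ × Sp d => X p.1 p.2) (slab T Ω))
    (h : ∀ t ∈ Ioo 0 T, IsTangential Ω (X t)) (ht : t ∈ Ico 0 T) : IsTangential Ω (X t) := by
  intro x hx n hn
  have hc : ContinuousOn (fun s => inner ℝ (X s x) n) (Ico 0 T) :=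
    ContinuousOn.inner (hX.comp (f := fun s : ℝ => (s, x)) (by fun_prop)
      fun s hs => ⟨hs, frontier_subset_closure hx⟩) continuousOn_const
  have : EqOn (fun s => inner ℝ (X s x) n) (fun _ => 0) (Ico 0 T) :=
    EqOn.of_subset_closure (s := Ioo 0 T) (fun s hs => h s hs x hx n hn) hc continuousOn_const
      Ioo_subset_Ico_self (by rw [closure_Ioo hT.ne]; exact Ico_subset_Icc_self)
  exact this ht

omit h hΩ hT ht in
lemma contDiffOn_coord_slab {n : ℕ∞ω}
    (hU : ContDiffOn ℝ n (fun p : ℝ × Sp d => U p.1 p.2) (slab T Ω)) (i : Fin d) :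
    ContDiffOn ℝ n (fun p : ℝ × Sp d => U p.1 p.2 i) (slab T Ω) :=
  contDiffOn_euclidean.1 hU i

omit h hΩ hT ht in
/-- A function that is continuous on `[0,T)` and has vanishing derivative in the interior is
constant. -/
lemma eq_zero_value_of_hasDerivAt {f : ℝ → ℝ} (hf : ContinuousOn f (Ico 0 T))
    (h : ∀ t ∈ Ioo 0 T, HasDerivAt f 0 t) (ht : t ∈ Ico 0 T) : f t = f 0 := by
  rcases ht.1.eq_or_lt with rfl | h0
  · rfl
  · obtain ⟨c, _, hc⟩ := exists_hasDerivAt_eq_slope f (fun _ => 0) h0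
      (hf.mono fun s hs => ⟨hs.1, hs.2.trans_lt ht.2⟩)
      fun s hs => h s ⟨hs.1, hs.2.trans ht.2⟩
    have := (eq_div_iff (sub_ne_zero.2 h0.ne')).1 hc
    linarith

namespace IsStrongSolution

omit hΩ hT ht in
lemma velocity_coord (i : Fin d) : ContDiffOn ℝ 1 (fun p : ℝ × Sp d => U p.1 p.2 i) (slab T Ω) :=
  contDiffOn_coord_slab h.velocity_C1 i

omit hΩ hT ht in
lemma flux (i : Fin d) :
    ContDiffOn ℝ 1 (fun p : ℝ × Sp d => r p.1 p.2 * U p.1 p.2 i) (slab T Ω) :=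
  ContDiffOn.mul h.density_C1 (h.velocity_coord i)

omit hT ht in
lemma contDiffOn_field : ContDiffOn ℝ 1 (fun p : ℝ × Sp d => gradOn Ω (Φ p.1) p.2) (slab T Ω) :=
  contDiffOn_euclidean.2 fun i => contDiffOn_pdOn_slab hΩ h.potential_C2 i

omit hΩ in
lemma velocity_tangential_Ico : IsTangential Ω (U t) :=
  isTangential_of_Ioo hT h.velocity_C1.continuousOn h.velocity_tangential ht

lemma field_tangential_Ico : IsTangential Ω (gradOn Ω (Φ t)) :=
  isTangential_of_Ioo (X := fun s => gradOn Ω (Φ s)) hT (h.contDiffOn_field hΩ).continuousOn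
    h.field_tangential ht

/-- The continuity equation up to the boundary. -/
lemma continuity_slab (hx : x ∈ closure Ω) :
    dT T Ω r t x = - ∑ j, pdOn Ω (fun y => r t y * U t y j) j x := by
  refine eqOn_slab_of_cyl (F := fun p => dT T Ω r p.1 p.2)
    (G := fun p => - ∑ j, pdOn Ω (fun y => r p.1 y * U p.1 y j) j p.2) hT
    (continuousOn_dT hΩ h.density_C1)
    (continuousOn_finsetSum _ fun j _ => continuousOn_pdOn_slab (f := fun s y => r s y * U s y j)
      hΩ (h.flux j) j).neg
    (fun t ht x hx => ?_) (show (t, x) ∈ slab T Ω from ⟨ht, hx⟩)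
  have := h.continuity t ht x hx
  rw [(hasDerivAt_slice h.density_C1 ht (subset_closure hx)).deriv] at this
  simp only [pdOn_eq_pd hΩ _ _ hx]
  linarith

/-- The total mass is conserved. -/
lemma integral_density_eq : ∫ y in Ω, r t y = ∫ y in Ω, r 0 y := by
  have h1 : IntegrableOn (fun _ : Sp d => (1 : ℝ)) Ω := hΩ.integrableOn continuousOn_const
  have hc := continuousOn_slab_integral_weight hΩ h.density_C1.continuousOn h1
  simp only [one_mul] at hc
  refine eq_zero_value_of_hasDerivAt hc (fun s hs => ?_) ht
  have hd := hasDerivAt_integral_weight hΩ h.density_C1 h1 hs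
  simp only [one_mul] at hd
  convert hd using 1
  have hs' := Ioo_subset_Ico_self hs
  rw [setIntegral_congr_fun hΩ.isOpen.measurableSet fun x hx =>
    h.continuity_slab hΩ hT hs' (subset_closure hx), integral_neg]
  have ht' : IsTangential Ω fun y => r s y • U s y := fun x hx n hn => by
    rw [inner_smul_left, h.velocity_tangential s hs x hx n hn, mul_zero]
  have := integral_div_eq_zero hΩ (X := fun y => r s y • U s y)
    (contDiffOn_slice (f := fun s y => r s y • U s y) (h.density_C1.smul h.velocity_C1) hs') ht'
  simp only [PiLp.smul_apply, smul_eq_mul] at this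
  rw [this, neg_zero]

/-- The Poisson equation up to the boundary, with the initial average. -/
lemma poisson_slab (hx : x ∈ closure Ω) :
    ∑ i, pdOn Ω (pdOn Ω (Φ t) i) i x = (∫ y in Ω, r 0 y) / volume.real Ω - r t x := by
  refine eqOn_slab_of_cyl (F := fun p => ∑ i, pdOn Ω (pdOn Ω (Φ p.1) i) i p.2)
    (G := fun p => (∫ y in Ω, r 0 y) / volume.real Ω - r p.1 p.2) hT
    (continuousOn_finsetSum _ fun j _ => continuousOn_pdOn_slab (f := fun s y => pdOn Ω (Φ s) j y)
      hΩ (contDiffOn_pdOn_slab hΩ h.potential_C2 j) j)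
    (continuousOn_const.sub h.density_C1.continuousOn)
    (fun t ht x hx => ?_) (show (t, x) ∈ slab T Ω from ⟨ht, hx⟩)
  have := h.poisson t ht x hx
  rw [h.integral_density_eq hΩ hT (Ioo_subset_Ico_self ht)] at this
  have e : ∀ i, pdOn Ω (pdOn Ω (Φ t) i) i x = pd (pd (Φ t) i) i x := fun i => by
    rw [pdOn_eq_pd hΩ _ _ hx]
    exact pd_congr_of_eqOn hΩ (fun y hy => pdOn_eq_pd hΩ _ _ hy) hx i
  simp only [e]
  linarith

omit hT ht in
/-- The momentum equation in nonconservative form, up to the boundary. -/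
lemma momentum_slab
    (hV : ContDiff ℝ ∞ V) (hW : ContDiff ℝ ∞ W) (hψ : ContDiff ℝ ∞ ψ)
    (hT : 0 < T) (ht : t ∈ Ico 0 T) (hx : x ∈ closure Ω) (i : Fin d) :
    dT T Ω (fun s y => U s y i) t x
      = - (∑ j, U t x j * pdOn Ω (fun y => U t y i) j x) - pdOn Ω (Φ t) i x - pd V i x
      - (∫ y in Ω, pd W i (x - y) * r t y)
      + ((∫ y in Ω, ψ (x - y) * (U t y i * r t y)) - U t x i * ∫ y in Ω, ψ (x - y) * r t y) := by
  have hV1 := hV.of_le (m := 1) (by simp)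
  have hW1 := hW.of_le (m := 1) (by simp)
  have cU := fun j => (h.velocity_coord j).continuousOn
  refine eqOn_slab_of_cyl (F := fun p => dT T Ω (fun s y => U s y i) p.1 p.2)
    (G := fun p => - (∑ j, U p.1 p.2 j * pdOn Ω (fun y => U p.1 y i) j p.2) - pdOn Ω (Φ p.1) i p.2
      - pd V i p.2 - (∫ y in Ω, pd W i (p.2 - y) * r p.1 y)
      + ((∫ y in Ω, ψ (p.2 - y) * (U p.1 y i * r p.1 y))
        - U p.1 p.2 i * ∫ y in Ω, ψ (p.2 - y) * r p.1 y)) hT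
    (continuousOn_dT hΩ (h.velocity_coord i))
    ((((((continuousOn_finsetSum _ fun j _ => (cU j).fun_mul
      (continuousOn_pdOn_slab (f := fun s y => U s y i) hΩ (h.velocity_coord i) j)).fun_neg).fun_sub
      (continuousOn_pdOn_slab hΩ (h.potential_C2.of_le (by norm_num)) i)).fun_sub
      ((continuous_pd hV1 i).comp continuous_snd).continuousOn).fun_sub
      (continuousOn_slab_integral_kernel hΩ h.density_C1.continuousOn (continuous_pd hW1 i))).fun_add
      ((continuousOn_slab_integral_kernel (F := fun q => U q.1 q.2 i * r q.1 q.2) hΩ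
        ((cU i).fun_mul h.density_C1.continuousOn) hψ.continuous).fun_sub ((cU i).fun_mul
        (continuousOn_slab_integral_kernel hΩ h.density_C1.continuousOn hψ.continuous))))
    (fun t ht x hx => ?_) (show (t, x) ∈ slab T Ω from ⟨ht, hx⟩)
  have ht' := Ioo_subset_Ico_self ht
  have hx' := subset_closure hx
  have hm := h.momentum t ht x hx i
  have hcont := h.continuity_slab hΩ hT ht' hx'
  have hr : ContDiffOn ℝ 1 (r t) (closure Ω) := contDiffOn_slice h.density_C1 ht'
  have hUi : ∀ j, ContDiffOn ℝ 1 (fun y => U t y j) (closure Ω) := fun j =>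
    contDiffOn_slice (f := fun s y => U s y j) (h.velocity_coord j) ht'
  have e1 : deriv (fun s => r s x * U s x i) t
      = dT T Ω r t x * U t x i + r t x * dT T Ω (fun s y => U s y i) t x :=
    ((hasDerivAt_slice h.density_C1 ht hx').mul
      (hasDerivAt_slice (f := fun s y => U s y i) (h.velocity_coord i) ht hx')).deriv
  have e2 : ∀ j, pd (fun y => r t y * U t y i * U t y j) j x
      = U t x i * pdOn Ω (fun y => r t y * U t y j) j x
        + r t x * (U t x j * pdOn Ω (fun y => U t y i) j x) := by
    intro j
    have e : (fun y => r t y * U t y i * U t y j)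
        = fun y => U t y i * (r t y * U t y j) := by funext y; ring
    rw [e, pd_mul (differentiableAt_of_contDiffOn hΩ (hUi i) hx)
      (differentiableAt_of_contDiffOn hΩ (hr.mul (hUi j)) hx), pdOn_eq_pd hΩ _ _ hx,
      pdOn_eq_pd hΩ _ _ hx]
    ring
  have e3 : pd (fun z => ∫ y in Ω, W (z - y) * r t y) i x = ∫ y in Ω, pd W i (x - y) * r t y := by
    have := pd_integral_kernel hΩ.isCompact_closure (ae_mem_closure hΩ)
      (hΩ.integrableOn hr.continuousOn) hW1 i x
    simp only [mul_comm (r t _)] at this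
    exact this
  have cψ : ContinuousOn (fun y => ψ (x - y)) (closure Ω) :=
    (contDiff_kernel hψ x).continuous.continuousOn
  have e4 : ∫ y in Ω, ψ (x - y) * r t y * (U t y i - U t x i)
      = (∫ y in Ω, ψ (x - y) * (U t y i * r t y)) - U t x i * ∫ y in Ω, ψ (x - y) * r t y := by
    rw [← integral_const_mul, ← integral_sub]
    · exact integral_congr_ae (Eventually.of_forall fun y => by beta_reduce; ring)
    · exact hΩ.integrableOn
        (cψ.fun_mul ((hUi i).continuousOn.fun_mul hr.continuousOn))
    · exact hΩ.integrableOn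
        (continuousOn_const.fun_mul (cψ.fun_mul hr.continuousOn))
  rw [e1, e3, e4, sum_congr rfl fun j _ => e2 j, sum_add_distrib, ← mul_sum,
    ← mul_sum, hcont, ← pdOn_eq_pd hΩ _ _ hx] at hm
  refine mul_left_cancel₀ (h.density_pos t ht' x hx').ne' ?_
  linear_combination hm

end IsStrongSolution

end StrongSolution

section StrongSnapshot

variable {d : ℕ} {Ω : Set (Sp d)} {T : ℝ} {V W ψ : Sp d → ℝ} {r : ℝ → Sp d → ℝ}
  {U : ℝ → Sp d → Sp d} {Φ : ℝ → Sp d → ℝ} {t : ℝ} {x : Sp d}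

variable (h : IsStrongSolution T Ω V W ψ r U Φ) (hΩ : IsBoundedSmoothDomain Ω)

include h hΩ

namespace IsStrongSolution

/-- The projection of `∂ₜ∇Φ` to gradient fields is that of `rU`: by the Poisson and the continuity
equation, both have the same divergence. -/
lemma field_rate (hT : 0 < T) (ht : t ∈ Ioo 0 T) {Ψ : Sp d → ℝ} {G : Fin d → Sp d → ℝ}
    (hG : IsWeakGradient Ω Ψ G) (hΨ : IntegrableOn Ψ Ω) (hGi : ∀ i, IntegrableOn (G i) Ω) :
    ∑ i, ∫ x in Ω, G i x * gradRate T Ω Φ t x i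
      = ∑ i, ∫ x in Ω, G i x * (r t x * U t x i) := by
  have ht' := Ioo_subset_Ico_self ht
  have h1 : HasDerivAt (fun s => ∑ i, ∫ x in Ω, G i x * pdOn Ω (Φ s) i x)
      (∑ i, ∫ x in Ω, G i x * gradRate T Ω Φ t x i) t :=
    HasDerivAt.fun_sum fun i _ => hasDerivAt_integral_weight (f := fun s y => pdOn Ω (Φ s) i y) hΩ
      (contDiffOn_pdOn_slab hΩ h.potential_C2 i) (hGi i) ht
  set M := (∫ y in Ω, r 0 y) / volume.real Ω
  have h2 : HasDerivAt (fun s => (∫ x in Ω, Ψ x * r s x) - M * ∫ x in Ω, Ψ x)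
      (∫ x in Ω, Ψ x * dT T Ω r t x) t :=
    (hasDerivAt_integral_weight hΩ h.density_C1 hΨ ht).sub_const _
  have e : (fun s => ∑ i, ∫ x in Ω, G i x * pdOn Ω (Φ s) i x) =ᶠ[𝓝 t]
      fun s => (∫ x in Ω, Ψ x * r s x) - M * ∫ x in Ω, Ψ x := by
    filter_upwards [Ioo_mem_nhds ht.1 ht.2] with s hs
    have hs' := Ioo_subset_Ico_self hs
    have := hG.integral_tangential hΩ hΨ hGi
      (contDiffOn_slice (f := fun s => gradOn Ω (Φ s)) (h.contDiffOn_field hΩ) hs')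
      (h.field_tangential_Ico hΩ hT hs')
    have hr : ContDiffOn ℝ 1 (r s) (closure Ω) := contDiffOn_slice h.density_C1 hs'
    rw [← integral_const_mul, ← integral_sub (hΩ.integrableOn_mul hΨ
      hr.continuousOn) (hΨ.const_mul M)]
    refine this.trans ?_
    rw [← integral_neg]
    refine setIntegral_congr_fun hΩ.isOpen.measurableSet fun x hx => ?_
    have := h.poisson_slab hΩ hT hs' (subset_closure hx)
    simp only [gradOn]
    rw [show (∑ i, pdOn Ω (fun y => pdOn Ω (Φ s) i y) i x) = M - r s x from this]
    ring
  rw [h1.unique (h2.congr_of_eventuallyEq e)]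
  have ht'' : IsTangential Ω fun y => r t y • U t y := fun x hx n hn => by
    rw [inner_smul_left, h.velocity_tangential t ht x hx n hn, mul_zero]
  have := hG.integral_tangential hΩ hΨ hGi (X := fun y => r t y • U t y)
    (contDiffOn_slice (f := fun s y => r s y • U s y) (h.density_C1.smul h.velocity_C1) ht') ht''
  simp only [PiLp.smul_apply, smul_eq_mul] at this
  rw [this, ← integral_neg]
  refine setIntegral_congr_fun hΩ.isOpen.measurableSet fun x hx => ?_
  simp only [h.continuity_slab hΩ hT ht' (subset_closure hx)]
  ring

lemma isWeakGradient (ht : t ∈ Ico 0 T) :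
    IsWeakGradient Ω (Φ t) (fun i x => gradOn Ω (Φ t) x i) :=
  isWeakGradient_pdOn hΩ ((contDiffOn_slice h.potential_C2 ht).of_le (by norm_num))

lemma integrableOn_potential (ht : t ∈ Ico 0 T) : IntegrableOn (Φ t) Ω :=
  hΩ.integrableOn (contDiffOn_slice h.potential_C2 ht).continuousOn

lemma isSnapshot (hV : ContDiff ℝ ∞ V) (hW : ContDiff ℝ ∞ W) (hψ : ContDiff ℝ ∞ ψ) (hT : 0 < T)
    (ht : t ∈ Ioo 0 T) :
    IsSnapshot Ω V W ψ ((∫ y in Ω, r 0 y) / volume.real Ω) (r t) (U t) (velocityRate T Ω U t)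
      (gradOn Ω (Φ t)) (gradRate T Ω Φ t) (dT T Ω Φ t) := by
  have ht' := Ioo_subset_Ico_self ht
  exact
  { density := (contDiffOn_slice h.density_C1 ht').continuousOn
    velocity := contDiffOn_slice h.velocity_C1 ht'
    velocity_t := (PiLp.continuous_toLp 2 _).comp_continuousOn (continuousOn_pi.2 fun i =>
      continuousOn_slab_slice (F := fun p => dT T Ω (fun s y => U s y i) p.1 p.2)
        (continuousOn_dT hΩ (h.velocity_coord i)) ht')
    field := contDiffOn_slice (f := fun s => gradOn Ω (Φ s)) (h.contDiffOn_field hΩ) ht'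
    field_t := (PiLp.continuous_toLp 2 _).comp_continuousOn (continuousOn_pi.2 fun i =>
      continuousOn_slab_slice (F := fun p => dT T Ω (fun s y => pdOn Ω (Φ s) i y) p.1 p.2)
        (continuousOn_dT hΩ (contDiffOn_pdOn_slab hΩ h.potential_C2 i)) ht')
    potential_t := contDiffOn_slice (contDiffOn_dT hΩ h.potential_C2) ht'
    velocity_tangential := h.velocity_tangential t ht
    field_tangential := h.field_tangential t ht
    hess := fun x hx i j => pdOn_pdOn_comm hT hΩ h.potential_C2 ht' hx i j
    momentum := fun x hx i => by
      have := h.momentum_slab hΩ hV hW hψ hT ht' hx i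
      simp only [mul_assoc]
      exact this
    poisson := fun x hx => h.poisson_slab hΩ hT ht' hx
    pd_potential_t := fun x hx i => pdOn_dT hT hΩ h.potential_C2 ht' hx i
    field_rate := fun Ψ G hG hΨ hGi => h.field_rate hΩ hT ht hG hΨ hGi
    potential := ⟨Φ t, h.isWeakGradient hΩ ht', h.integrableOn_potential hΩ ht'⟩ }

omit h hΩ in
/-- The function `M ∫ Φ + ½ ∫ |∇Φ|²` of time. -/
def fieldPotential (Ω : Set (Sp d)) (r : ℝ → Sp d → ℝ) (Φ : ℝ → Sp d → ℝ) (t : ℝ) : ℝ :=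
  (∫ y in Ω, r 0 y) / volume.real Ω * (∫ x in Ω, Φ t x)
    + (∫ x in Ω, ‖gradOn Ω (Φ t) x‖ ^ 2) / 2

lemma continuousOn_fieldPotential : ContinuousOn (fieldPotential Ω r Φ) (Ico 0 T) := by
  have h1 : IntegrableOn (fun _ : Sp d => (1 : ℝ)) Ω := hΩ.integrableOn continuousOn_const
  have c1 := continuousOn_slab_integral_weight hΩ h.potential_C2.continuousOn h1
  have c2 := continuousOn_slab_integral_weight (F := fun p => ‖gradOn Ω (Φ p.1) p.2‖ ^ 2) hΩ
    ((h.contDiffOn_field hΩ).continuousOn.norm.pow 2) h1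
  simp only [one_mul] at c1 c2
  exact (continuousOn_const.mul c1).add (c2.div_const 2)

lemma hasDerivAt_fieldPotential (ht : t ∈ Ioo 0 T) : HasDerivAt (fieldPotential Ω r Φ)
      ((∫ y in Ω, r 0 y) / volume.real Ω * (∫ x in Ω, dT T Ω Φ t x)
        + ∫ x in Ω, ∑ i, gradOn Ω (Φ t) x i * gradRate T Ω Φ t x i) t := by
  have h1 : IntegrableOn (fun _ : Sp d => (1 : ℝ)) Ω := hΩ.integrableOn continuousOn_const
  have d1 := hasDerivAt_integral_weight hΩ (h.potential_C2.of_le (by norm_num)) h1 ht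
  have hsq : ContDiffOn ℝ 1 (fun p : ℝ × Sp d => ‖gradOn Ω (Φ p.1) p.2‖ ^ 2) (slab T Ω) :=
    (h.contDiffOn_field hΩ).norm_sq ℝ
  have d2 := hasDerivAt_integral_weight (f := fun s x => ‖gradOn Ω (Φ s) x‖ ^ 2) hΩ hsq h1 ht
  simp only [one_mul] at d1 d2
  have e : ∀ x ∈ Ω, dT T Ω (fun s x => ‖gradOn Ω (Φ s) x‖ ^ 2) t x
      = 2 * ∑ i, gradOn Ω (Φ t) x i * gradRate T Ω Φ t x i := by
    intro x hx
    have hx' := subset_closure hx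
    refine (hasDerivAt_slice (f := fun s x => ‖gradOn Ω (Φ s) x‖ ^ 2) hsq ht hx').unique ?_
    simp only [EuclideanSpace.real_norm_sq_eq, mul_sum]
    refine HasDerivAt.fun_sum fun i _ => ?_
    refine ((hasDerivAt_slice (f := fun s y => pdOn Ω (Φ s) i y)
      (contDiffOn_pdOn_slab hΩ h.potential_C2 i) ht hx').fun_pow 2).congr_deriv ?_
    simp only [gradOn, gradRate]
    ring
  rw [setIntegral_congr_fun hΩ.isOpen.measurableSet e, integral_const_mul] at d2
  exact ((d1.const_mul ((∫ y in Ω, r 0 y) / volume.real Ω)).add (d2.div_const 2)).congr_deriv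
    (by ring)

lemma continuousOn_deriv_fieldPotential : ContinuousOn (fun t =>
      (∫ y in Ω, r 0 y) / volume.real Ω * (∫ x in Ω, dT T Ω Φ t x)
        + ∫ x in Ω, ∑ i, gradOn Ω (Φ t) x i * gradRate T Ω Φ t x i) (Ico 0 T) := by
  have h1 : IntegrableOn (fun _ : Sp d => (1 : ℝ)) Ω := hΩ.integrableOn continuousOn_const
  have c1 := continuousOn_slab_integral_weight hΩ
    (continuousOn_dT hΩ (h.potential_C2.of_le (by norm_num))) h1
  have c2 := continuousOn_slab_integral_weight
    (F := fun p => ∑ i, gradOn Ω (Φ p.1) p.2 i * gradRate T Ω Φ p.1 p.2 i) hΩ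
    (continuousOn_finsetSum _ fun i _ => (contDiffOn_pdOn_slab hΩ h.potential_C2 i).continuousOn.mul
      (continuousOn_dT (f := fun s y => pdOn Ω (Φ s) i y) hΩ
        (contDiffOn_pdOn_slab hΩ h.potential_C2 i))) h1
  simp only [one_mul] at c1 c2
  exact (continuousOn_const.mul c1).add c2

lemma fieldPotential_sub {τ : ℝ} (hτ : τ ∈ Ioo 0 T) :
    IntegrableOn (fun t => (∫ y in Ω, r 0 y) / volume.real Ω * (∫ x in Ω, dT T Ω Φ t x)
        + ∫ x in Ω, ∑ i, gradOn Ω (Φ t) x i * gradRate T Ω Φ t x i) (Ioo 0 τ) ∧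
    ∫ t in Ioo 0 τ, ((∫ y in Ω, r 0 y) / volume.real Ω * (∫ x in Ω, dT T Ω Φ t x)
        + ∫ x in Ω, ∑ i, gradOn Ω (Φ t) x i * gradRate T Ω Φ t x i)
      = fieldPotential Ω r Φ τ - fieldPotential Ω r Φ 0 := by
  have hs : Icc 0 τ ⊆ Ico 0 T := fun s hs => ⟨hs.1, hs.2.trans_lt hτ.2⟩
  have hc := (h.continuousOn_deriv_fieldPotential hΩ).mono hs
  refine ⟨(hc.integrableOn_compact isCompact_Icc).mono_set Ioo_subset_Icc_self, ?_⟩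
  rw [← integral_Ioc_eq_integral_Ioo, ← intervalIntegral.integral_of_le hτ.1.le]
  refine intervalIntegral.integral_eq_sub_of_hasDerivAt_of_le hτ.1.le
    ((h.continuousOn_fieldPotential hΩ).mono hs)
    (fun t ht => h.hasDerivAt_fieldPotential hΩ ⟨ht.1, ht.2.trans hτ.2⟩) ?_
  exact ContinuousOn.intervalIntegrable (by rwa [uIcc_of_le hτ.1.le])

/-- The energy identity of the Poisson equation. -/
lemma integral_density_potential (hT : 0 < T) (ht : t ∈ Ico 0 T) :
    ∫ x in Ω, ‖gradOn Ω (Φ t) x‖ ^ 2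
      = (∫ x in Ω, Φ t x * r t x) - (∫ y in Ω, r 0 y) / volume.real Ω * ∫ x in Ω, Φ t x := by
  have hr : ContDiffOn ℝ 1 (r t) (closure Ω) := contDiffOn_slice h.density_C1 ht
  have hΦ := h.integrableOn_potential hΩ ht
  have ha : ContDiffOn ℝ 1 (gradOn Ω (Φ t)) (closure Ω) :=
    contDiffOn_slice (f := fun s => gradOn Ω (Φ s)) (h.contDiffOn_field hΩ) ht
  have ca := fun i => (contDiffOn_coord ha i).continuousOn
  have ia := fun i => hΩ.integrableOn (ca i)
  have := (h.isWeakGradient hΩ ht).integral_tangential hΩ hΦ ia ha (h.field_tangential_Ico hΩ hT ht)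
  rw [integral_sum_mul hΩ ia ca] at this
  simp only [EuclideanSpace.real_norm_sq_eq]
  simp only [sq]
  rw [this, ← integral_const_mul, ← integral_sub (hΩ.integrableOn_mul hΦ
    hr.continuousOn) (hΦ.const_mul _), ← integral_neg]
  refine setIntegral_congr_fun hΩ.isOpen.measurableSet fun x hx => ?_
  have := h.poisson_slab hΩ hT ht (subset_closure hx)
  simp only [gradOn]
  rw [show (∑ i, pdOn Ω (fun y => pdOn Ω (Φ t) i y) i x) = _ from this]
  ring

end IsStrongSolution

end StrongSnapshot

/-! ### Bounds for the barred measures -/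

section Bounds

variable {d : ℕ} {Ω : Set (Sp d)} {S : MVState d} {U : Sp d → Sp d} {f : Sp d → ℝ} {c : ℝ}

lemma signedIntegral_neg (f : Sp d → ℝ) (μ : SignedMeasure (Sp d)) :
    ∫ᵛ x, -f x ∂•μ = -∫ᵛ x, f x ∂•μ := by
  simp_rw [neg_eq_neg_one_mul (f _), signedIntegral_const_mul]
  ring

lemma signedIntegral_ite (p : Prop) [Decidable p] (f : Sp d → ℝ) (μ : SignedMeasure (Sp d)) :
    ∫ᵛ x, (if p then f x else 0) ∂•μ = if p then ∫ᵛ x, f x ∂•μ else 0 := by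
  split_ifs
  · rfl
  · exact signedIntegral_zero _

lemma continuousOn_ite_const (p : Prop) [Decidable p] {K : Set (Sp d)} (hf : ContinuousOn f K) :
    ContinuousOn (fun x => if p then f x else 0) K := by
  split_ifs
  · exact hf
  · exact continuousOn_const

lemma abs_le_of_forall_neg {P : (Sp d → ℝ) → Prop} {F : (Sp d → ℝ) → ℝ} {b : ℝ}
    (h : ∀ f, P f → F f ≤ b) (hP : ∀ f, P f → P fun x => -f x)
    (hF : ∀ f, P f → F (fun x => -f x) = -F f) (hf : P f) : |F f| ≤ b :=
  abs_le.2 ⟨by have := h _ (hP f hf); rw [hF f hf] at this; linarith, h f hf⟩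

variable (h : IsRegularState Ω S) (hΩ : IsBoundedSmoothDomain Ω) (hU : ContinuousOn U (closure Ω))
  (hf : ContinuousOn f (closure Ω)) (hc : ∀ x ∈ closure Ω, |f x| ≤ c)

include h hΩ hU hf hc

lemma IsRegularState.abs_relConv_le (i j : Fin d) :
    |(∫ᵛ x, f x ∂•(S.conv Ω i j)) - (∫ᵛ x, f x * U x j ∂•(S.mom Ω i))
      - (∫ᵛ x, f x * U x i ∂•(S.mom Ω j)) + ∫ᵛ x, f x * (U x i * U x j) ∂•(S.rho Ω)|
      ≤ c * relKinetic Ω S U := by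
  have cUi := continuousOn_coord hU
  refine abs_le_of_forall_neg (P := fun f => ContinuousOn f (closure Ω) ∧
      ∀ x ∈ closure Ω, |f x| ≤ c)
    (F := fun f => (∫ᵛ x, f x ∂•(S.conv Ω i j)) - (∫ᵛ x, f x * U x j ∂•(S.mom Ω i))
      - (∫ᵛ x, f x * U x i ∂•(S.mom Ω j)) + ∫ᵛ x, f x * (U x i * U x j) ∂•(S.rho Ω))
    (fun f ⟨hf, hc⟩ => ?_) (fun f ⟨hf, hc⟩ => ⟨hf.fun_neg, fun x hx => by
      rw [abs_neg]; exact hc x hx⟩) (fun f _ => ?_) ⟨hf, hc⟩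
  · have c1 : ∀ k, ContinuousOn (fun x => if k = i then -(f x * U x j) else 0) (closure Ω) :=
      fun k => continuousOn_ite_const _ (hf.fun_mul (cUi j)).fun_neg
    have c2 : ∀ k, ContinuousOn (fun x => if k = j then -(f x * U x i) else 0) (closure Ω) :=
      fun k => continuousOn_ite_const _ (hf.fun_mul (cUi i)).fun_neg
    have := h.kin_bar_le hΩ (U := U) (c₀ := fun x => f x * (U x i * U x j))
      (c₁ := fun k x => (if k = i then -(f x * U x j) else 0)
        + if k = j then -(f x * U x i) else 0)
      (c₂ := fun k l x => if k = i then (if l = j then f x else 0) else 0) (c₃ := fun _ => 0)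
      (C := c) (e := 0) hU
      (hf.fun_mul ((cUi i).fun_mul (cUi j))) (fun k => (c1 k).fun_add (c2 k))
      (fun k l => continuousOn_ite_const _ (continuousOn_ite_const _ hf)) continuousOn_const
      (fun x hx v => by
        have h1 := abs_mul_coord_le (v - U x) i j
        have h2 := (abs_le.1 ((abs_mul _ _).trans_le
          (mul_le_mul (hc x hx) h1 (abs_nonneg _) ((abs_nonneg _).trans (hc x hx))))).2
        simp only [add_mul, ite_mul, zero_mul, sum_add_distrib, Finset.sum_ite_eq',
          Finset.mem_univ, if_true, add_zero, Finset.sum_ite_irrel, sum_const_zero]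
        simp only [PiLp.sub_apply] at h2
        linarith)
    have e : ∀ k, ∫ᵛ x, ((if k = i then -(f x * U x j) else 0)
        + if k = j then -(f x * U x i) else 0) ∂•(S.mom Ω k)
        = (if k = i then -∫ᵛ x, f x * U x j ∂•(S.mom Ω k) else 0)
          + if k = j then -∫ᵛ x, f x * U x i ∂•(S.mom Ω k) else 0 := by
      intro k
      rw [signedIntegral_add hΩ.isCompact_closure (h.carried_mom hΩ k) (c1 k) (c2 k),
        signedIntegral_ite, signedIntegral_ite, signedIntegral_neg, signedIntegral_neg]
    simp only [e, signedIntegral_ite, signedIntegral_zero, sum_add_distrib,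
      Finset.sum_ite_eq', Finset.mem_univ, if_true, add_zero, zero_mul, Finset.sum_ite_irrel,
      sum_const_zero] at this
    linarith
  · simp only [neg_mul, signedIntegral_neg]
    ring

lemma IsRegularState.abs_relKin_le :
    |(∫ᵛ x, f x * ‖U x‖ ^ 2 ∂•(S.rho Ω)) + (∑ i, ∫ᵛ x, f x * (-2 * U x i) ∂•(S.mom Ω i))
      + ∫ᵛ x, f x ∂•(S.kin Ω)| ≤ c * relKinetic Ω S U := by
  have cUi := continuousOn_coord hU
  refine abs_le_of_forall_neg (P := fun f => ContinuousOn f (closure Ω) ∧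
      ∀ x ∈ closure Ω, |f x| ≤ c)
    (F := fun f => (∫ᵛ x, f x * ‖U x‖ ^ 2 ∂•(S.rho Ω))
      + (∑ i, ∫ᵛ x, f x * (-2 * U x i) ∂•(S.mom Ω i)) + ∫ᵛ x, f x ∂•(S.kin Ω))
    (fun f ⟨hf, hc⟩ => ?_) (fun f ⟨hf, hc⟩ => ⟨hf.fun_neg, fun x hx => by
      rw [abs_neg]; exact hc x hx⟩) (fun f _ => ?_) ⟨hf, hc⟩
  · have := h.kin_bar_le hΩ (U := U) (c₀ := fun x => f x * ‖U x‖ ^ 2)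
      (c₁ := fun i x => f x * (-2 * U x i)) (c₂ := fun _ _ _ => 0) (c₃ := f) (C := c) (e := 0) hU
      (hf.fun_mul (hU.norm.pow 2)) (fun k => hf.fun_mul (continuousOn_const.fun_mul (cUi k)))
      (fun _ _ => continuousOn_const) hf (fun x hx v => by
        have h1 := mul_le_mul_of_nonneg_right (abs_le.1 (hc x hx)).2 (sq_nonneg ‖v - U x‖)
        have e := norm_sub_sq_eq v (U x)
        rw [add_zero]
        refine le_trans (le_of_eq ?_) h1
        rw [e, mul_add, mul_add, mul_sum]
        simp only [zero_mul, sum_const_zero, add_zero, mul_assoc])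
    simpa only [signedIntegral_zero, sum_const_zero, add_zero, zero_mul] using this
  · simp only [neg_mul, signedIntegral_neg, Finset.sum_neg_distrib]
    ring

omit h hΩ hU hf hc in
lemma relKinetic_zero (S : MVState d) : relKinetic Ω S (fun _ => 0) = S.kin Ω univ := by
  simp [relKinetic]

omit h hΩ hU hf hc in
lemma relField_zero (S : MVState d) : relField Ω S (fun _ => 0) = S.pot Ω univ := by
  simp [relField]

omit hU in
lemma IsRegularState.abs_conv_le (i j : Fin d) :
    |∫ᵛ x, f x ∂•(S.conv Ω i j)| ≤ c * S.kin Ω univ := by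
  have := h.abs_relConv_le hΩ (U := fun _ => 0) continuousOn_const hf hc i j
  simpa [signedIntegral_zero, relKinetic_zero] using this

omit hU in
lemma IsRegularState.abs_kin_le :
    |∫ᵛ x, f x ∂•(S.kin Ω)| ≤ c * S.kin Ω univ := by
  have := h.abs_relKin_le hΩ (U := fun _ => 0) continuousOn_const hf hc
  simpa [signedIntegral_zero, relKinetic_zero] using this

omit hU in
lemma IsRegularState.sq_mom_le (i : Fin d) :
    (∫ᵛ x, f x ∂•(S.mom Ω i)) ^ 2 ≤ S.kin Ω univ * (c ^ 2 * S.rho Ω univ) := by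
  have := h.sq_relMomentum_le hΩ (U := fun _ => 0) continuousOn_const hf hc i
  simpa [signedIntegral_zero, relKinetic_zero] using this

omit hU in
lemma IsRegularState.abs_pot_le :
    |∫ᵛ x, f x ∂•(S.pot Ω)| ≤ c * S.pot Ω univ := by
  refine abs_le_of_forall_neg (P := fun f => ContinuousOn f (closure Ω) ∧
      ∀ x ∈ closure Ω, |f x| ≤ c) (F := fun f => ∫ᵛ x, f x ∂•(S.pot Ω))
    (fun f ⟨hf, hc⟩ => ?_) (fun f ⟨hf, hc⟩ => ⟨hf.fun_neg, fun x hx => by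
      rw [abs_neg]; exact hc x hx⟩) (fun f _ => signedIntegral_neg _ _) ⟨hf, hc⟩
  have := h.pot_bar_le hΩ (a := fun _ => 0) (c₀ := fun _ => 0) (c₁ := fun _ _ => 0)
    (c₂ := fun _ _ _ => 0) (c₃ := f) (C := c) (e := 0) continuousOn_const continuousOn_const
    (fun _ => continuousOn_const) (fun _ _ => continuousOn_const) hf (fun x hx v => by
      simpa using mul_le_mul_of_nonneg_right (abs_le.1 (hc x hx)).2 (sq_nonneg ‖v‖))
  simpa [relField_zero, signedIntegral_zero] using this

omit hU in
lemma IsRegularState.abs_stress_le (i j : Fin d) :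
    |∫ᵛ x, f x ∂•(S.stress Ω i j)| ≤ c * S.pot Ω univ := by
  refine abs_le_of_forall_neg (P := fun f => ContinuousOn f (closure Ω) ∧
      ∀ x ∈ closure Ω, |f x| ≤ c) (F := fun f => ∫ᵛ x, f x ∂•(S.stress Ω i j))
    (fun f ⟨hf, hc⟩ => ?_) (fun f ⟨hf, hc⟩ => ⟨hf.fun_neg, fun x hx => by
      rw [abs_neg]; exact hc x hx⟩) (fun f _ => signedIntegral_neg _ _) ⟨hf, hc⟩
  have := h.pot_bar_le hΩ (a := fun _ => 0) (c₀ := fun _ => 0) (c₁ := fun _ _ => 0)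
    (c₂ := fun k l x => if k = i then (if l = j then f x else 0) else 0) (c₃ := fun _ => 0)
    (C := c) (e := 0) continuousOn_const continuousOn_const
    (fun _ => continuousOn_const)
    (fun k l => continuousOn_ite_const _ (continuousOn_ite_const _ hf)) continuousOn_const
    (fun x hx v => by
      have h2 := (abs_le.1 ((abs_mul _ _).trans_le (mul_le_mul (hc x hx) (abs_mul_coord_le v i j)
        (abs_nonneg _) ((abs_nonneg _).trans (hc x hx))))).2
      simpa [ite_mul, Finset.sum_ite_irrel] using h2)
  simpa [relField_zero, signedIntegral_zero, signedIntegral_ite, Finset.sum_ite_irrel] using this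

omit h hΩ hU hf hc in
/-- An upper bound for all the barred measures at once. -/
def totalSize (Ω : Set (Sp d)) (S : MVState d) : ℝ :=
  S.rho Ω univ + S.kin Ω univ + S.pot Ω univ + volume.real Ω

omit hU hf hc in
lemma IsRegularState.kin_univ_nonneg :
    0 ≤ S.kin Ω univ := by
  rw [← relKinetic_zero]; exact h.relKinetic_nonneg hΩ continuousOn_const

omit hU hf hc in
lemma IsRegularState.pot_univ_nonneg :
    0 ≤ S.pot Ω univ := by
  rw [← relField_zero]; exact h.relField_nonneg hΩ continuousOn_const

omit hU hf hc in
lemma IsRegularState.size_bounds :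
    0 ≤ totalSize Ω S ∧ S.rho Ω univ ≤ totalSize Ω S ∧ S.kin Ω univ ≤ totalSize Ω S ∧
      S.pot Ω univ ≤ totalSize Ω S := by
  have h1 := h.rho_univ_nonneg hΩ
  have h2 := h.kin_univ_nonneg hΩ
  have h3 := h.pot_univ_nonneg hΩ
  have h4 : 0 ≤ volume.real Ω := measureReal_nonneg
  rw [totalSize]
  refine ⟨?_, ?_, ?_, ?_⟩ <;> linarith

omit hU hc in
lemma IsRegularState.abs_mom_le (hc0 : 0 ≤ c) (hc : ∀ x ∈ closure Ω, |f x| ≤ c)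
    (i : Fin d) : |∫ᵛ x, f x ∂•(S.mom Ω i)| ≤ c * totalSize Ω S := by
  obtain ⟨e0, e1, e2, e3⟩ := h.size_bounds hΩ
  refine abs_le_of_sq_le_sq ?_ (mul_nonneg hc0 e0)
  refine (h.sq_mom_le hΩ hf hc i).trans ?_
  have := mul_le_mul e2 e1 (h.rho_univ_nonneg hΩ) e0
  nlinarith [mul_le_mul_of_nonneg_left this (sq_nonneg c)]

omit hU hf hc in
/-- Alignment terms are linear in the kinetic energy. -/
lemma IsRegularState.abs_mom_mom_le
    {k : Sp d → ℝ} (hk : Continuous k) (hc : ∀ x ∈ closure Ω, ∀ y ∈ closure Ω, |k (x - y)| ≤ c)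
    (hc0 : 0 ≤ c) (i : Fin d) :
    |∫ᵛ x, (∫ᵛ y, k (x - y) ∂•(S.mom Ω i)) ∂•(S.mom Ω i)|
      ≤ c * S.rho Ω univ * S.kin Ω univ := by
  have e1 := h.rho_univ_nonneg hΩ
  have e2 := h.kin_univ_nonneg hΩ
  refine abs_le_of_sq_le_sq ?_ (by positivity)
  have h1 : ∀ x ∈ closure Ω, |∫ᵛ y, k (x - y) ∂•(S.mom Ω i)|
      ≤ Real.sqrt (S.kin Ω univ * (c ^ 2 * S.rho Ω univ)) := fun x hx =>
    Real.abs_le_sqrt (h.sq_mom_le hΩ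
      (hk.comp (continuous_const.sub continuous_id)).continuousOn (hc x hx) i)
  have := h.sq_mom_le hΩ (continuousOn_convolution hΩ (h.carried_mom hΩ i) hk) h1 i
  rw [Real.sq_sqrt (by positivity)] at this
  refine this.trans (le_of_eq ?_)
  ring

end Bounds

/-! ### Integrability in time -/

section FamilyIntegrals

variable {d : ℕ} {Ω : Set (Sp d)} {T T₁ : ℝ} {l : Measure ℝ} {μ ν : ℝ → SignedMeasure (Sp d)}
  {e e' : ℝ → ℝ} {K : Set (Sp d)}

variable {F : ℝ × Sp d → ℝ} {k : Sp d → ℝ}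

lemma EquicontOn.mul {F G : ℝ → Sp d → ℝ} (hK : IsCompact K) (hF : EquicontOn l K F)
    (hG : EquicontOn l K G) : EquicontOn l K fun t x => F t x * G t x := by
  obtain ⟨b, hb⟩ := id hF
  obtain ⟨b', hb'⟩ := id hG
  -- the modulus of a product involves the suprema of the factors
  let s : (ℝ → Sp d → ℝ) → ℝ → ℝ := fun F t => sSup ((fun x => |F t x|) '' K)
  have hs : ∀ F : ℝ → Sp d → ℝ, EquicontOn l K F → ∀ᵐ t ∂l, ∀ x ∈ K, |F t x| ≤ s F t := by
    intro F hF
    filter_upwards [hF.ae_continuousOn] with t ht x hx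
    exact le_csSup (hK.image_of_continuousOn ht.abs).bddAbove (mem_image_of_mem _ hx)
  refine ⟨fun t => s F t * b' t + b t * s G t, fun ε hε => ?_⟩
  obtain ⟨δ, hδ, h⟩ := hb ε hε
  obtain ⟨δ', hδ', h'⟩ := hb' ε hε
  refine ⟨min δ δ', lt_min hδ hδ', ?_⟩
  filter_upwards [h, h', hs F hF, hs G hG] with t h1 h2 h3 h4 x hx y hy hxy
  have e1 := h1 x hx y hy (hxy.trans_le (min_le_left _ _))
  have e2 := h2 x hx y hy (hxy.trans_le (min_le_right _ _))
  calc |F t x * G t x - F t y * G t y|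
      = |F t x * (G t x - G t y) + (F t x - F t y) * G t y| := by ring_nf
    _ ≤ |F t x| * |G t x - G t y| + |F t x - F t y| * |G t y| := by
        rw [← abs_mul, ← abs_mul]; exact abs_add_le _ _
    _ ≤ s F t * (b' t * ε) + b t * ε * s G t :=
        add_le_add (mul_le_mul (h3 x hx) e2 (abs_nonneg _) ((abs_nonneg _).trans (h3 x hx)))
          (mul_le_mul e1 (h4 y hy) (abs_nonneg _) ((abs_nonneg _).trans e1))
    _ = (s F t * b' t + b t * s G t) * ε := by ring

/-- The signed measures `μ t` act on continuous functions with norm at most `e t`. -/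
def DominatedBy (l : Measure ℝ) (K : Set (Sp d)) (μ : ℝ → SignedMeasure (Sp d)) (e : ℝ → ℝ) :
    Prop :=
  ∀ᵐ t ∂l, ∀ (f : Sp d → ℝ) (c : ℝ), ContinuousOn f K → 0 ≤ c → (∀ x ∈ K, |f x| ≤ c) →
    |∫ᵛ x, f x ∂•(μ t)| ≤ c * e t

variable (hΩ : IsBoundedSmoothDomain Ω) (hT₁ : T₁ < T)
  (hμ : IsCarriedFamily (volume.restrict (Ioo 0 T₁)) (closure Ω) μ)
  (hν : IsCarriedFamily (volume.restrict (Ioo 0 T₁)) (closure Ω) ν)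
  (hμe : DominatedBy (volume.restrict (Ioo 0 T₁)) (closure Ω) μ e)
  (hνe : DominatedBy (volume.restrict (Ioo 0 T₁)) (closure Ω) ν e')
  (he' : ∀ᵐ t ∂(volume.restrict (Ioo 0 T₁)), 0 ≤ e' t)
  (he : IntegrableOn (fun t => e t * e' t) (Ioo 0 T₁))

include hΩ hT₁ hμ hν hμe hνe he' he

omit hT₁ hμ hν hμe hνe he' he in
lemma equicontOn_slab
    (hF : ContinuousOn F (slab T Ω)) (hT₁ : T₁ < T) :
    EquicontOn (volume.restrict (Ioo 0 T₁)) (closure Ω) fun t x => F (t, x) := by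
  have hs : Icc 0 T₁ ×ˢ closure Ω ⊆ slab T Ω :=
    prod_mono (fun t ht => ⟨ht.1, ht.2.trans_lt hT₁⟩) le_rfl
  have hu := (isCompact_Icc.prod hΩ.isCompact_closure).uniformContinuousOn_of_continuous
    (hF.mono hs)
  refine ⟨fun _ => 1, fun ε hε => ?_⟩
  obtain ⟨δ, hδ, h⟩ := Metric.uniformContinuousOn_iff.1 hu ε hε
  refine ⟨δ, hδ, (ae_restrict_mem measurableSet_Ioo).mono fun t ht x hx y hy hxy => ?_⟩
  have ht' := Ioo_subset_Icc_self ht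
  rw [one_mul, ← Real.dist_eq]
  exact (h (t, x) ⟨ht', hx⟩ (t, y) ⟨ht', hy⟩ (by simpa [Prod.dist_eq] using hxy)).le

omit hΩ hT₁ hμ hν hμe hνe he' he in
lemma aestronglyMeasurable_slab (hF : ContinuousOn F (slab T Ω))
    (hT₁ : T₁ < T) {x : Sp d} (hx : x ∈ closure Ω) :
    AEStronglyMeasurable (fun t => F (t, x)) (volume.restrict (Ioo 0 T₁)) :=
  ((continuousOn_slab_slice_left hF hx).mono fun _ ht => ⟨ht.1.le, ht.2.trans hT₁⟩)
    |>.aestronglyMeasurable measurableSet_Ioo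

omit hT₁ hμ hν hμe hνe he' he in
lemma equicontOn_convolution
    (hν : IsCarriedFamily l (closure Ω) ν) (hk : Continuous k) :
    EquicontOn l (closure Ω) fun t x => ∫ᵛ y, k (x - y) ∂•(ν t) := by
  have hc : Continuous fun p : Sp d × Sp d => k (p.1 - p.2) :=
    hk.comp (continuous_fst.sub continuous_snd)
  refine hν.equicontOn_integral hΩ.isCompact_closure (F := fun _ x y => k (x - y))
    (fun ε hε => ?_) (Eventually.of_forall fun _ x _ =>
      (hc.comp (Continuous.prodMk_right x)).continuousOn)
  have hu := (hΩ.isCompact_closure.prod hΩ.isCompact_closure).uniformContinuousOn_of_continuous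
    hc.continuousOn
  obtain ⟨δ, hδ, h⟩ := Metric.uniformContinuousOn_iff.1 hu ε hε
  refine ⟨δ, hδ, Eventually.of_forall fun _ x hx x' hx' hxx y hy => ?_⟩
  rw [← Real.dist_eq]
  exact (h (x, y) ⟨hx, hy⟩ (x', y) ⟨hx', hy⟩ (by simpa [Prod.dist_eq] using hxx)).le

omit hν hνe he' he in
lemma integrable_integral_slab
    (he : IntegrableOn e (Ioo 0 T₁)) (hF : ContinuousOn F (slab T Ω)) :
    IntegrableOn (fun t => ∫ᵛ x, F (t, x) ∂•(μ t)) (Ioo 0 T₁) := by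
  obtain ⟨C, hC0, hC⟩ := exists_bound_slab hΩ hF hT₁
  refine Integrable.mono' (g := fun t => C * e t) (he.const_mul C)
    (hμ.aestronglyMeasurable_integral hΩ.isCompact_closure (equicontOn_slab hΩ hF hT₁)
      fun _ hx => aestronglyMeasurable_slab hF hT₁ hx) ?_
  filter_upwards [hμe, ae_restrict_mem measurableSet_Ioo] with t ht htI
  exact ht _ C (continuousOn_slab_slice hF ⟨htI.1.le, htI.2.trans hT₁⟩) hC0
    (hC t (Ioo_subset_Icc_self htI))

omit hμe hνe he' he in
lemma aestronglyMeasurable_integral_convolution_mul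
    (hk : Continuous k) (hF : ContinuousOn F (slab T Ω)) :
    AEStronglyMeasurable (fun t => ∫ᵛ x, (∫ᵛ y, k (x - y) ∂•(ν t)) * F (t, x) ∂•(μ t))
      (volume.restrict (Ioo 0 T₁)) :=
  hμ.aestronglyMeasurable_integral hΩ.isCompact_closure
    ((equicontOn_convolution hΩ hν hk).mul hΩ.isCompact_closure (equicontOn_slab hΩ hF hT₁))
    fun _ hx => (hν.measurable _ (hk.comp (continuous_const.sub continuous_id)).continuousOn).mul
      (aestronglyMeasurable_slab hF hT₁ hx)

lemma integrable_integral_convolution_mul (hk : Continuous k) (hF : ContinuousOn F (slab T Ω)) :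
    IntegrableOn (fun t => ∫ᵛ x, (∫ᵛ y, k (x - y) ∂•(ν t)) * F (t, x) ∂•(μ t)) (Ioo 0 T₁) := by
  obtain ⟨C, hC0, hC⟩ := exists_bound_slab hΩ hF hT₁
  obtain ⟨c, hc0, hc⟩ := exists_kernel_bound hΩ hk
  refine Integrable.mono' (g := fun t => c * C * (e t * e' t)) (he.const_mul _)
    (aestronglyMeasurable_integral_convolution_mul hΩ hT₁ hμ hν hk hF) ?_
  filter_upwards [hμe, hνe, he', hν.carried, ae_restrict_mem measurableSet_Ioo] with
    t h1 h2 h3 h4 htI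
  have := h1 (fun x => (∫ᵛ y, k (x - y) ∂•(ν t)) * F (t, x)) (c * e' t * C)
    ((continuousOn_convolution hΩ h4 hk).fun_mul
      (continuousOn_slab_slice hF ⟨htI.1.le, htI.2.trans hT₁⟩)) (by positivity) fun x hx => by
      rw [abs_mul]
      exact mul_le_mul (h2 _ c (hk.comp (continuous_const.sub continuous_id)).continuousOn hc0
        (hc x hx)) (hC t (Ioo_subset_Icc_self htI) x hx) (abs_nonneg _) (by positivity)
  exact this.trans (le_of_eq (by ring))

/-- The case without a weight. -/
lemma integrable_integral_convolution (hk : Continuous k) :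
    IntegrableOn (fun t => ∫ᵛ x, (∫ᵛ y, k (x - y) ∂•(ν t)) ∂•(μ t)) (Ioo 0 T₁) := by
  have := integrable_integral_convolution_mul hΩ hT₁ hμ hν hμe hνe he' he hk
    (F := fun _ => 1) continuousOn_const
  simpa only [mul_one] using this

end FamilyIntegrals

section SolutionIntegrals

variable {d : ℕ} {Ω : Set (Sp d)} {T T₁ : ℝ} {V W ψ : Sp d → ℝ} {S₀ : MVState d}
  {S : ℝ → MVState d}

variable {μ : ℝ → SignedMeasure (Sp d)} {l l' : Measure ℝ} {K : Set (Sp d)}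

lemma IsCarriedFamily.mono (h : IsCarriedFamily l K μ) (hl : l' ≤ l) : IsCarriedFamily l' K μ :=
  ⟨ae_mono hl h.carried, fun φ hφ => (h.measurable φ hφ).mono_measure hl⟩

variable (hS : IsDissipativeMVSolution T Ω V W ψ S₀ S) (hΩ : IsBoundedSmoothDomain Ω)

include hS hΩ

omit hS in
lemma integrable_setIntegral_mul {g : ℝ × Sp d → ℝ}
    (hg : Integrable g (volume.restrict (cyl T Ω))) {φ : Sp d → ℝ}
    (hφ : ContinuousOn φ (closure Ω)) :
    IntegrableOn (fun t => ∫ x in Ω, φ x * g (t, x)) (Ioo 0 T) := by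
  obtain ⟨C, hC0, hC⟩ := hΩ.exists_bound hφ
  have h : Integrable (fun p : ℝ × Sp d => φ p.2 * g p) (volume.restrict (cyl T Ω)) := by
    refine hg.bdd_mul (c := C) ?_ ?_
    · exact (hφ.comp continuousOn_snd fun p hp => subset_closure hp.2).aestronglyMeasurable
        (measurableSet_cyl hΩ)
    · exact (ae_restrict_mem (measurableSet_cyl hΩ)).mono fun p hp =>
        hC p.2 (subset_closure hp.2)
  rw [restrict_cyl_eq_prod] at h
  exact h.integral_prod_left

omit hS in
lemma isCarriedFamily_bar {ν : ℝ → Sp d → Measure (Phase d)}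
    (hν : IsFiniteEnergyYoung T Ω ν) {f : Phase d → ℝ} (hf : Continuous f)
    (hb : ∀ y, |f y| ≤ fEnergy y) {m : ℝ → SignedMeasure (Sp d)} (hm : IsMeasureFamily T Ω m) :
    IsCarriedFamily (volume.restrict (Ioo 0 T)) (closure Ω) (fun t => bar Ω (ν t) f (m t)) ∧
      IntegrableOn (fun t => bar Ω (ν t) f (m t) univ) (Ioo 0 T) := by
  have hi := ae_integrableOn_of_cyl (hν.integrable hf hb)
  have he : ∀ φ : Sp d → ℝ, ContinuousOn φ (closure Ω) →
      (fun t => (∫ x in Ω, φ x * ∫ y, f y ∂(ν t x)) + ∫ᵛ x, φ x ∂•(m t))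
        =ᵐ[volume.restrict (Ioo 0 T)] fun t => ∫ᵛ x, φ x ∂•(bar Ω (ν t) f (m t)) := by
    intro φ hφ
    filter_upwards [hi, hm.carried] with t ht1 ht2
    exact (signedIntegral_bar hΩ ht1 ht2 hφ).symm
  have h1 := fun φ hφ => integrable_setIntegral_mul hΩ (hν.integrable hf hb) (φ := φ) hφ
  refine ⟨⟨hm.carried.mono fun t ht => carried_bar hΩ ht, fun φ hφ => ?_⟩, ?_⟩
  · exact ((h1 φ hφ).aestronglyMeasurable.add (hm.isCarriedFamily.measurable φ hφ)).congr (he φ hφ)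
  · have h2 : IntegrableOn (fun t => ∫ᵛ _, (1 : ℝ) ∂•(m t)) (Ioo 0 T) := by
      obtain ⟨C, hC0, hC⟩ := hm.ae_abs_integral_le
      refine Integrable.mono' (integrable_const (C * 1))
        (hm.isCarriedFamily.measurable _ continuousOn_const) (hC.mono fun t ht => ?_)
      exact ht (fun _ => 1) 1 zero_le_one fun x _ => by simp
    have := ((h1 _ continuousOn_const).add h2).congr (he (fun _ => 1) continuousOn_const)
    simp only [signedIntegral_one] at this
    exact this

omit hS hΩ in
lemma DominatedBy.mono
    {e : ℝ → ℝ} (h : DominatedBy l K μ e) (hl : l' ≤ l) : DominatedBy l' K μ e :=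
  ae_mono hl h

namespace IsDissipativeMVSolution

lemma family_rho :
    IsCarriedFamily (volume.restrict (Ioo 0 T)) (closure Ω) (fun t => (S t).rho Ω) :=
  (isCarriedFamily_bar hΩ (hS.isFiniteEnergyYoung hΩ) continuous_fRho abs_fRho_le hS.mRho_mem.1).1

lemma family_mom (i : Fin d) :
    IsCarriedFamily (volume.restrict (Ioo 0 T)) (closure Ω) (fun t => (S t).mom Ω i) :=
  (isCarriedFamily_bar hΩ (hS.isFiniteEnergyYoung hΩ) (continuous_fMom i) (abs_fMom_le i)
    (hS.mMom_mem i)).1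

lemma family_conv (i j : Fin d) :
    IsCarriedFamily (volume.restrict (Ioo 0 T)) (closure Ω) (fun t => (S t).conv Ω i j) :=
  (isCarriedFamily_bar hΩ (hS.isFiniteEnergyYoung hΩ) (continuous_fConv i j) (abs_fConv_le i j)
    (hS.mConv_mem i j)).1

lemma family_kin :
    IsCarriedFamily (volume.restrict (Ioo 0 T)) (closure Ω) (fun t => (S t).kin Ω) :=
  (isCarriedFamily_bar hΩ (hS.isFiniteEnergyYoung hΩ) continuous_fKin abs_fKin_le hS.mKin_mem.1).1

lemma family_pot :
    IsCarriedFamily (volume.restrict (Ioo 0 T)) (closure Ω) (fun t => (S t).pot Ω) :=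
  (isCarriedFamily_bar hΩ (hS.isFiniteEnergyYoung hΩ) continuous_fPot abs_fPot_le hS.mPot_mem.1).1

lemma family_stress (i j : Fin d) :
    IsCarriedFamily (volume.restrict (Ioo 0 T)) (closure Ω) (fun t => (S t).stress Ω i j) :=
  (isCarriedFamily_bar hΩ (hS.isFiniteEnergyYoung hΩ) (continuous_fStress i j) (abs_fStress_le i j)
    (hS.mStress_mem i j)).1

lemma integrableOn_totalSize : IntegrableOn (fun t => totalSize Ω (S t)) (Ioo 0 T) := by
  have h := hS.isFiniteEnergyYoung hΩ
  exact (((isCarriedFamily_bar hΩ h continuous_fRho abs_fRho_le hS.mRho_mem.1).2.add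
    (isCarriedFamily_bar hΩ h continuous_fKin abs_fKin_le hS.mKin_mem.1).2).add
    (isCarriedFamily_bar hΩ h continuous_fPot abs_fPot_le hS.mPot_mem.1).2).add
    (integrable_const (volume.real Ω))

omit hΩ in
/-- The total mass of a measure-valued solution is conserved. -/
lemma ae_rho_univ :
    ∀ᵐ t ∂(volume.restrict (Ioo 0 T)), (S t).rho Ω univ = S₀.rho Ω univ := by
  filter_upwards [hS.continuity] with τ hτ
  have := hτ (fun _ _ => 1) contDiffOn_const
  simp only [signedIntegral_one] at this
  have e : ∀ t, derivWithin (fun _ : ℝ => (1 : ℝ)) (Icc 0 T) t = 0 := fun t => by simp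
  have e' : ∀ i x, pdOn Ω (fun _ => (1 : ℝ)) i x = 0 := fun i x => by simp [pdOn]
  simp only [e, e', signedIntegral_zero, sum_const_zero, add_zero, integral_zero] at this
  linarith

lemma dominated : DominatedBy (volume.restrict (Ioo 0 T)) (closure Ω) (fun t => (S t).rho Ω)
      (fun _ => S₀.rho Ω univ) ∧
    (∀ i, DominatedBy (volume.restrict (Ioo 0 T)) (closure Ω) (fun t => (S t).mom Ω i)
      (fun t => totalSize Ω (S t))) ∧
    (∀ i j, DominatedBy (volume.restrict (Ioo 0 T)) (closure Ω) (fun t => (S t).conv Ω i j)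
      (fun t => totalSize Ω (S t))) ∧
    DominatedBy (volume.restrict (Ioo 0 T)) (closure Ω) (fun t => (S t).kin Ω)
      (fun t => totalSize Ω (S t)) ∧
    DominatedBy (volume.restrict (Ioo 0 T)) (closure Ω) (fun t => (S t).pot Ω)
      (fun t => totalSize Ω (S t)) ∧
    ∀ i j, DominatedBy (volume.restrict (Ioo 0 T)) (closure Ω) (fun t => (S t).stress Ω i j)
      (fun t => totalSize Ω (S t)) := by
  have hr := hS.ae_isRegularState hΩ
  refine ⟨?_, fun i => ?_, fun i j => ?_, ?_, ?_, fun i j => ?_⟩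
  · filter_upwards [hr, hS.ae_rho_univ] with t h h1 f c hf hc0 hc
    rw [← h1]
    exact abs_signedIntegral_rho_le h hΩ hf hc
  all_goals filter_upwards [hr] with t h f c hf hc0 hc
  · exact h.abs_mom_le hΩ hf hc0 hc i
  · exact (h.abs_conv_le hΩ hf hc i j).trans
      (mul_le_mul_of_nonneg_left (h.size_bounds hΩ).2.2.1 hc0)
  · exact (h.abs_kin_le hΩ hf hc).trans
      (mul_le_mul_of_nonneg_left (h.size_bounds hΩ).2.2.1 hc0)
  · exact (h.abs_pot_le hΩ hf hc).trans
      (mul_le_mul_of_nonneg_left (h.size_bounds hΩ).2.2.2 hc0)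
  · exact (h.abs_stress_le hΩ hf hc i j).trans
      (mul_le_mul_of_nonneg_left (h.size_bounds hΩ).2.2.2 hc0)

end IsDissipativeMVSolution

end SolutionIntegrals

section RateIntegrals

variable {d : ℕ} {Ω : Set (Sp d)} {T T₁ : ℝ} {V W ψ : Sp d → ℝ} {S₀ : MVState d}
  {S : ℝ → MVState d}

variable {G : Fin d → ℝ × Sp d → ℝ}

variable (hS : IsDissipativeMVSolution T Ω V W ψ S₀ S) (hΩ : IsBoundedSmoothDomain Ω) (hT₁ : T₁ < T)

include hS hΩ hT₁

namespace IsDissipativeMVSolution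

/-- All barred measures are measurable in time and dominated by an integrable function of time. -/
lemma family_data :
    (∀ᵐ t ∂(volume.restrict (Ioo 0 T₁)), 0 ≤ S₀.rho Ω univ ∧ 0 ≤ totalSize Ω (S t)) ∧
    IntegrableOn (fun t => totalSize Ω (S t)) (Ioo 0 T₁) ∧
    (IsCarriedFamily (volume.restrict (Ioo 0 T₁)) (closure Ω) (fun t => (S t).rho Ω) ∧
      DominatedBy (volume.restrict (Ioo 0 T₁)) (closure Ω) (fun t => (S t).rho Ω)
        (fun _ => S₀.rho Ω univ)) ∧
    (∀ i, IsCarriedFamily (volume.restrict (Ioo 0 T₁)) (closure Ω) (fun t => (S t).mom Ω i) ∧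
      DominatedBy (volume.restrict (Ioo 0 T₁)) (closure Ω) (fun t => (S t).mom Ω i)
        (fun t => totalSize Ω (S t))) ∧
    (∀ i j, IsCarriedFamily (volume.restrict (Ioo 0 T₁)) (closure Ω) (fun t => (S t).conv Ω i j) ∧
      DominatedBy (volume.restrict (Ioo 0 T₁)) (closure Ω) (fun t => (S t).conv Ω i j)
        (fun t => totalSize Ω (S t))) ∧
    (IsCarriedFamily (volume.restrict (Ioo 0 T₁)) (closure Ω) (fun t => (S t).kin Ω) ∧
      DominatedBy (volume.restrict (Ioo 0 T₁)) (closure Ω) (fun t => (S t).kin Ω)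
        (fun t => totalSize Ω (S t))) ∧
    (IsCarriedFamily (volume.restrict (Ioo 0 T₁)) (closure Ω) (fun t => (S t).pot Ω) ∧
      DominatedBy (volume.restrict (Ioo 0 T₁)) (closure Ω) (fun t => (S t).pot Ω)
        (fun t => totalSize Ω (S t))) ∧
    ∀ i j, IsCarriedFamily (volume.restrict (Ioo 0 T₁)) (closure Ω) (fun t => (S t).stress Ω i j) ∧
      DominatedBy (volume.restrict (Ioo 0 T₁)) (closure Ω) (fun t => (S t).stress Ω i j)
        (fun t => totalSize Ω (S t)) := by
  have hsub : Ioo 0 T₁ ⊆ Ioo 0 T := Ioo_subset_Ioo_right hT₁.le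
  have hl : volume.restrict (Ioo 0 T₁) ≤ volume.restrict (Ioo 0 T) :=
    Measure.restrict_mono hsub le_rfl
  obtain ⟨d1, d2, d3, d4, d5, d6⟩ := hS.dominated hΩ
  refine ⟨ae_mono hl ?_, (hS.integrableOn_totalSize hΩ).mono_set hsub,
    ⟨(hS.family_rho hΩ).mono hl, d1.mono hl⟩, fun i => ⟨(hS.family_mom hΩ i).mono hl, (d2 i).mono hl⟩,
    fun i j => ⟨(hS.family_conv hΩ i j).mono hl, (d3 i j).mono hl⟩,
    ⟨(hS.family_kin hΩ).mono hl, d4.mono hl⟩, ⟨(hS.family_pot hΩ).mono hl, d5.mono hl⟩,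
    fun i j => ⟨(hS.family_stress hΩ i j).mono hl, (d6 i j).mono hl⟩⟩
  filter_upwards [hS.ae_isRegularState hΩ, hS.ae_rho_univ] with t h1 h2
  rw [← h2]
  exact ⟨h1.rho_univ_nonneg hΩ, (h1.size_bounds hΩ).1⟩

omit hT₁ in
lemma integrable_dissipation (hψ : ContDiff ℝ ∞ ψ) (hT₁ : T₁ < T) :
    IntegrableOn (fun t => (S t).dissipation Ω ψ) (Ioo 0 T₁) := by
  obtain ⟨h0, hsize, ⟨r1, r2⟩, hm, _, ⟨k1, k2⟩, _, _⟩ := hS.family_data hΩ hT₁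
  have i1 := integrable_integral_convolution hΩ hT₁ k1 r1 k2 r2 (h0.mono fun t h => h.1)
    (hsize.mul_const _) hψ.continuous
  refine i1.sub (integrable_finsetSum _ fun i _ => ?_)
  obtain ⟨c, hc0, hc⟩ := exists_kernel_bound hΩ hψ.continuous
  have hmeas := aestronglyMeasurable_integral_convolution_mul hΩ hT₁ (hm i).1 (hm i).1
    hψ.continuous (F := fun _ => 1) continuousOn_const
  simp only [mul_one] at hmeas
  refine Integrable.mono' (hsize.const_mul (c * S₀.rho Ω univ)) hmeas ?_
  have hl : volume.restrict (Ioo 0 T₁) ≤ volume.restrict (Ioo 0 T) :=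
    Measure.restrict_mono (Ioo_subset_Ioo_right hT₁.le) le_rfl
  filter_upwards [ae_mono hl (hS.ae_isRegularState hΩ), ae_mono hl hS.ae_rho_univ, h0] with t h1 h2 h3
  refine (h1.abs_mom_mom_le hΩ hψ.continuous hc hc0 i).trans ?_
  rw [h2]
  exact mul_le_mul_of_nonneg_left (h1.size_bounds hΩ).2.2.1 (mul_nonneg hc0 h3.1)

lemma integrable_mom_convolution {k : Fin d → Sp d → ℝ} (hk : ∀ i, Continuous (k i)) :
    IntegrableOn (fun t => ∑ i, ∫ᵛ x, (∫ᵛ y, k i (x - y) ∂•((S t).rho Ω)) ∂•((S t).mom Ω i))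
      (Ioo 0 T₁) := by
  obtain ⟨h0, hsize, ⟨r1, r2⟩, hm, _⟩ := hS.family_data hΩ hT₁
  exact integrable_finsetSum _ fun i _ => integrable_integral_convolution hΩ hT₁ (hm i).1 r1
    (hm i).2 r2 (h0.mono fun t h => h.1) (hsize.mul_const _) (hk i)

lemma integrable_rho_mom {F : ℝ × Sp d → ℝ} (hF : ContinuousOn F (slab T Ω))
    (hG : ∀ i, ContinuousOn (G i) (slab T Ω)) :
    IntegrableOn (fun t => (∫ᵛ x, F (t, x) ∂•((S t).rho Ω))
      + ∑ i, ∫ᵛ x, G i (t, x) ∂•((S t).mom Ω i)) (Ioo 0 T₁) := by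
  obtain ⟨_, hsize, ⟨r1, r2⟩, hm, _⟩ := hS.family_data hΩ hT₁
  exact (integrable_integral_slab hΩ hT₁ r1 r2 (integrable_const _) hF).add
    (integrable_finsetSum _ fun i _ =>
      integrable_integral_slab hΩ hT₁ (hm i).1 (hm i).2 hsize (hG i))

lemma integrable_field (hG : ∀ i, ContinuousOn (G i) (slab T Ω)) :
    IntegrableOn (fun t => ∫ x in Ω, ∑ i, (S t).field i x * G i (t, x)) (Ioo 0 T₁) := by
  obtain ⟨_, _, hfield, _⟩ := hS.field_gradient
  have : IsFiniteMeasure (volume.restrict (cyl T Ω)) :=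
    ⟨by rw [Measure.restrict_apply_univ]; exact volume_cyl_lt_top hΩ⟩
  have hsub : cyl T₁ Ω ⊆ cyl T Ω := prod_mono (Ioo_subset_Ioo_right hT₁.le) le_rfl
  have h : Integrable (fun p : ℝ × Sp d => ∑ i, (S p.1).field i p.2 * G i p)
      (volume.restrict (cyl T₁ Ω)) := by
    refine integrable_finsetSum _ fun i _ => ?_
    obtain ⟨C, hC0, hC⟩ := exists_bound_slab hΩ (hG i) hT₁
    have h1 : Integrable (fun p : ℝ × Sp d => (S p.1).field i p.2) (volume.restrict (cyl T₁ Ω)) :=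
      IntegrableOn.mono_set (s := cyl T₁ Ω) ((hfield i).integrable (by norm_num)) hsub
    refine h1.mul_bdd (c := C) ?_ ?_
    · exact ((hG i).mono (hsub.trans cyl_subset_slab)).aestronglyMeasurable (measurableSet_cyl hΩ)
    · exact (ae_restrict_mem (measurableSet_cyl hΩ)).mono fun p hp =>
        hC p.1 (Ioo_subset_Icc_self hp.1) p.2 (subset_closure hp.2)
  rw [restrict_cyl_eq_prod] at h
  exact h.integral_prod_left

omit hT₁ in
lemma integrable_momentumRHS (hV : ContDiff ℝ ∞ V) (hW : ContDiff ℝ ∞ W)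
    (hψ : ContDiff ℝ ∞ ψ) (hT₁ : T₁ < T) (M : ℝ) {X X' : ℝ → Sp d → Sp d}
    (hX : ContDiffOn ℝ 1 (fun p : ℝ × Sp d => X p.1 p.2) (slab T Ω))
    (hX' : ∀ i, ContinuousOn (fun p : ℝ × Sp d => X' p.1 p.2 i) (slab T Ω)) :
    IntegrableOn (fun t => (S t).momentumRHS Ω V W ψ M (X t) (X' t)) (Ioo 0 T₁) := by
  obtain ⟨h0, hsize, ⟨r1, r2⟩, hm, hc, _, ⟨p1, p2⟩, hs⟩ := hS.family_data hΩ hT₁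
  have h0r := h0.mono fun t h => h.1
  have h0s := h0.mono fun t h => h.2
  have hXi := contDiffOn_coord_slab hX
  have cX := fun i => (hXi i).continuousOn
  have cD : ∀ i j, ContinuousOn (fun p : ℝ × Sp d => pdOn Ω (fun y => X p.1 y i) j p.2)
      (slab T Ω) := fun i j => continuousOn_pdOn_slab (f := fun t y => X t y i) hΩ (hXi i) j
  have hV1 := hV.of_le (m := 1) (by simp)
  have hW1 := hW.of_le (m := 1) (by simp)
  have cr : IntegrableOn (fun _ : ℝ => S₀.rho Ω univ) (Ioo 0 T₁) := integrable_const _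
  have i1 := integrable_finsetSum Finset.univ fun i _ =>
    integrable_integral_slab hΩ hT₁ (hm i).1 (hm i).2 hsize (hX' i)
  have i2 := integrable_finsetSum Finset.univ fun i _ => integrable_finsetSum Finset.univ
    fun j _ => integrable_integral_slab hΩ hT₁ (hc i j).1 (hc i j).2 hsize (cD i j)
  have i3 := integrable_integral_slab hΩ hT₁ r1 r2 cr
    (F := fun p => ∑ i, pd V i p.2 * X p.1 p.2 i) (continuousOn_finsetSum _ fun i _ =>
      ((continuous_pd hV1 i).comp continuous_snd).continuousOn.fun_mul (cX i))
  have i4 := integrable_integral_slab hΩ hT₁ p1 p2 hsize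
    (F := fun p => ∑ i, pdOn Ω (fun y => X p.1 y i) i p.2) (continuousOn_finsetSum _ fun i _ =>
      cD i i)
  have i5 := integrable_finsetSum Finset.univ fun i _ => integrable_finsetSum Finset.univ
    fun j _ => integrable_integral_slab hΩ hT₁ (hs i j).1 (hs i j).2 hsize (cD i j)
  have i6 := hS.integrable_field hΩ hT₁ (G := fun i p => X p.1 p.2 i) cX
  have i7 := integrable_finsetSum Finset.univ fun i _ => integrable_integral_convolution_mul hΩ hT₁
    r1 r1 r2 r2 h0r (cr.mul_const _) (continuous_pd hW1 i) (cX i)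
  have i8 := integrable_finsetSum Finset.univ fun i _ => integrable_integral_convolution_mul hΩ hT₁
    r1 (hm i).1 r2 (hm i).2 h0s (hsize.const_mul _) hψ.continuous (cX i)
  have i9 := integrable_finsetSum Finset.univ fun i _ => integrable_integral_convolution_mul hΩ hT₁
    (hm i).1 r1 (hm i).2 r2 h0r (hsize.mul_const _) hψ.continuous (cX i)
  exact (((((((i1.add i2).sub i3).add (i4.div_const 2)).sub i5).sub (i6.const_mul M)).sub i7).add
    i8).sub i9

end IsDissipativeMVSolution

end RateIntegrals

/-! ### The interaction energy -/

section Interaction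

lemma exists_mem_halving {h : ℝ → ℝ} {A : Set ℝ} {a b : ℝ} (hab : a ≤ b)
    (hA : ∀ u v, a ≤ u → u < v → v ≤ b → (A ∩ Ioo u v).Nonempty) (hh : ContinuousOn h (Icc a b))
    (hlt : h a < h b) : ∃ m ∈ A, m ∈ Ioo a b ∧ h m - h a ≤ 3 / 4 * (h b - h a)
      ∧ h b - h m ≤ 3 / 4 * (h b - h a) := by
  obtain ⟨m, hm, hm'⟩ := intermediate_value_Ioo hab hh (show (h a + h b) / 2 ∈ Ioo (h a) (h b) from
    ⟨by linarith, by linarith⟩)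
  have hcont : ContinuousAt h m := hh.continuousAt (Icc_mem_nhds hm.1 hm.2)
  have hev : ∀ᶠ s in 𝓝 m, s ∈ Ioo a b ∧
      h s ∈ Ioo (h a + (h b - h a) / 4) (h a + 3 / 4 * (h b - h a)) :=
    Eventually.and (Ioo_mem_nhds hm.1 hm.2)
      (hcont.eventually (Ioo_mem_nhds (by linarith) (by linarith)))
  obtain ⟨u, v, huv, hsub⟩ := mem_nhds_iff_exists_Ioo_subset.1 hev
  obtain ⟨s, hs, hs'⟩ := hA (max a u) (min b v) (le_max_left _ _)
    (max_lt (lt_min (hm.1.trans hm.2) (hm.1.trans huv.2)) (lt_min (huv.1.trans hm.2)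
      (huv.1.trans huv.2))) (min_le_left _ _)
  obtain ⟨h1, h2⟩ := hsub ⟨(le_max_right _ _).trans_lt hs'.1, hs'.2.trans_le (min_le_right _ _)⟩
  exact ⟨s, hs, h1, by linarith [h2.2], by linarith [h2.1]⟩

/-- A function whose increments are quadratically small with respect to those of a continuous
monotone function is constant. Only increments between points of a dense set are used. -/
lemma eq_of_abs_sub_le_sq {G h : ℝ → ℝ} {A : Set ℝ} {a b C : ℝ} (hab : a ≤ b) (ha : a ∈ A)
    (hb : b ∈ A) (hA : ∀ u v, a ≤ u → u < v → v ≤ b → (A ∩ Ioo u v).Nonempty)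
    (hh : ContinuousOn h (Icc a b)) (hmono : MonotoneOn h (Icc a b))
    (H : ∀ u ∈ A, ∀ v ∈ A, a ≤ u → u ≤ v → v ≤ b → |G v - G u| ≤ C * (h v - h u) ^ 2) (hC : 0 ≤ C) :
    G b = G a := by
  -- if both parts have at most 3/4 of the increment of `h`, the sum of their squares is at most
  -- `(9 + 1) / 16` of its square
  have key : ∀ n : ℕ, ∀ u ∈ A, ∀ v ∈ A, a ≤ u → u ≤ v → v ≤ b →
      |G v - G u| ≤ C * (5 / 8) ^ n * (h v - h u) ^ 2 := by
    intro n
    induction n with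
    | zero => simpa using H
    | succ n ih =>
      intro u hu v hv hau huv hvb
      have hle := hmono ⟨hau, huv.trans hvb⟩ ⟨hau.trans huv, hvb⟩ huv
      rcases hle.eq_or_lt with heq | hlt
      · have := H u hu v hv hau huv hvb
        rw [heq, sub_self] at this ⊢
        simpa using this
      · obtain ⟨m, hm, hmI, e1, e2⟩ := exists_mem_halving huv
          (fun u' v' h1 h2 h3 => hA u' v' (hau.trans h1) h2 (h3.trans hvb))
          (hh.mono (Icc_subset_Icc hau hvb)) hlt
        have i1 := ih u hu m hm hau hmI.1.le (hmI.2.le.trans hvb)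
        have i2 := ih m hm v hv (hau.trans hmI.1.le) hmI.2.le hvb
        have i3 := abs_sub_le (G v) (G m) (G u)
        have hq : (h m - h u) ^ 2 + (h v - h m) ^ 2 ≤ 5 / 8 * (h v - h u) ^ 2 := by
          nlinarith [mul_nonneg (sub_nonneg.2 e1) (sub_nonneg.2 e2)]
        have hp : 0 ≤ C * (5 / 8 : ℝ) ^ n := by positivity
        have := mul_le_mul_of_nonneg_left hq hp
        rw [pow_succ]
        linarith
  have hlim : Tendsto (fun n : ℕ => C * (5 / 8) ^ n * (h b - h a) ^ 2) atTop (𝓝 0) := by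
    have := ((tendsto_pow_atTop_nhds_zero_of_lt_one (r := (5 / 8 : ℝ)) (by norm_num)
      (by norm_num)).const_mul C).mul_const ((h b - h a) ^ 2)
    simpa using this
  have := ge_of_tendsto' hlim fun n => key n a ha b hb le_rfl hab le_rfl
  exact sub_eq_zero.1 (abs_nonpos_iff.1 this)

variable {d : ℕ} {Ω : Set (Sp d)} {T T₁ : ℝ} {V W ψ : Sp d → ℝ} {S₀ : MVState d}
  {S : ℝ → MVState d}

variable {a b : ℝ} {η : Sp d → ℝ}

/-- The barred density as a function of time, including the initial time. -/
def densityPath (Ω : Set (Sp d)) (S₀ : MVState d) (S : ℝ → MVState d) (t : ℝ) :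
    SignedMeasure (Sp d) :=
  if t = 0 then S₀.rho Ω else (S t).rho Ω

/-- The weak time derivative of `∫ η dρ`. -/
def fluxPairing (Ω : Set (Sp d)) (S : ℝ → MVState d) (η : Sp d → ℝ) (t : ℝ) : ℝ :=
  ∑ i, ∫ᵛ x, pdOn Ω η i x ∂•((S t).mom Ω i)

namespace IsDissipativeMVSolution

lemma intervalIntegrable_of_Ioo {f : ℝ → ℝ} (hf : IntegrableOn f (Ioo 0 T₁))
    (ha : 0 ≤ a) (hab : a ≤ b) (hb : b ≤ T₁) : IntervalIntegrable f volume a b := by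
  rw [intervalIntegrable_iff_integrableOn_Ioo_of_le hab]
  exact hf.mono_set (Ioo_subset_Ioo ha hb)

lemma intervalIntegrable_fluxPairing
    (hS : IsDissipativeMVSolution T Ω V W ψ S₀ S) (hΩ : IsBoundedSmoothDomain Ω) (hT₁ : T₁ < T)
    (hη : ContDiffOn ℝ 1 η (closure Ω)) (ha : 0 ≤ a) (hab : a ≤ b) (hb : b ≤ T₁) :
    IntervalIntegrable (fluxPairing Ω S η) volume a b := by
  have := hS.integrable_rho_mom hΩ hT₁ (F := fun _ => 0) (G := fun i p => pdOn Ω η i p.2)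
    continuousOn_const fun i => (continuousOn_pdOn hΩ hη i).comp continuousOn_snd fun p hp => hp.2
  simp only [signedIntegral_zero, zero_add] at this
  exact intervalIntegrable_of_Ioo this ha hab hb

/-- The times at which the continuity equation holds for stationary test functions. -/
def continuityTimes (Ω : Set (Sp d)) (S₀ : MVState d) (S : ℝ → MVState d) : Set ℝ :=
  {τ | (densityPath Ω S₀ S τ).totalVariation (closure Ω)ᶜ = 0 ∧
    ∀ η : Sp d → ℝ, ContDiffOn ℝ 1 η (closure Ω) →
      (∫ᵛ x, η x ∂•(densityPath Ω S₀ S τ)) - (∫ᵛ x, η x ∂•(S₀.rho Ω))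
        = ∫ t in 0..τ, fluxPairing Ω S η t}

variable (hS : IsDissipativeMVSolution T Ω V W ψ S₀ S) (hΩ : IsBoundedSmoothDomain Ω) (hT₁ : T₁ < T)
  (ha : a ∈ continuityTimes Ω S₀ S) (hb : b ∈ continuityTimes Ω S₀ S)

include hS hΩ hT₁ ha hb

omit hT₁ ha hb in
lemma ae_mem_continuityTimes :
    ∀ᵐ τ ∂(volume.restrict (Ioo 0 T)), τ ∈ continuityTimes Ω S₀ S := by
  filter_upwards [hS.continuity, (hS.family_rho hΩ).carried, ae_restrict_mem measurableSet_Ioo]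
    with τ h1 h2 h3
  have e : densityPath Ω S₀ S τ = (S τ).rho Ω := if_neg h3.1.ne'
  refine ⟨by rw [e]; exact h2, fun η hη => ?_⟩
  have hc : ContDiffOn ℝ 1 (fun p : ℝ × Sp d => η p.2) (Icc 0 T ×ˢ closure Ω) :=
    hη.comp contDiffOn_snd fun p hp => hp.2
  have := h1 (fun _ => η) hc
  simp only [derivWithin_fun_const, Pi.zero_apply, signedIntegral_zero, zero_add] at this
  rw [e, this, intervalIntegral.integral_of_le h3.1.le, integral_Ioc_eq_integral_Ioo]
  rfl

lemma density_increment (ha0 : 0 ≤ a) (hab : a ≤ b) (hb1 : b ≤ T₁)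
    (hη : ContDiffOn ℝ 1 η (closure Ω)) :
    (∫ᵛ x, η x ∂•(densityPath Ω S₀ S b)) - (∫ᵛ x, η x ∂•(densityPath Ω S₀ S a))
      = ∫ t in a..b, fluxPairing Ω S η t := by
  rw [← intervalIntegral.integral_interval_sub_left
    (hS.intervalIntegrable_fluxPairing hΩ hT₁ hη le_rfl (ha0.trans hab) hb1)
    (hS.intervalIntegrable_fluxPairing hΩ hT₁ hη le_rfl ha0 (hab.trans hb1)),
    ← hb.2 η hη, ← ha.2 η hη]
  ring

omit ha hb in
lemma intervalIntegrable_totalSize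
    (ha0 : 0 ≤ a) (hab : a ≤ b) (hb1 : b ≤ T₁) :
    IntervalIntegrable (fun t => totalSize Ω (S t)) volume a b :=
  intervalIntegrable_of_Ioo ((hS.integrableOn_totalSize hΩ).mono_set
    (Ioo_subset_Ioo_right hT₁.le)) ha0 hab hb1

omit hS hΩ ha hb in
/-- Properties of almost all times carry over to subintervals. -/
lemma ae_of_ae_restrict {P : ℝ → Prop}
    (h : ∀ᵐ t ∂(volume.restrict (Ioo 0 T)), P t) (ha0 : 0 ≤ a) (hb1 : b ≤ T₁) :
    ∀ᵐ t, t ∈ Ioc a b → P t := by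
  filter_upwards [(ae_restrict_iff' measurableSet_Ioo).1 h] with t ht hI
  exact ht ⟨ha0.trans_lt hI.1, (hI.2.trans hb1).trans_lt hT₁⟩

lemma abs_kernel_increment_le (ha0 : 0 ≤ a) (hab : a ≤ b) (hb1 : b ≤ T₁) {k : Sp d → ℝ}
    (hk : ContDiff ℝ 1 k) {c : ℝ} (hc0 : 0 ≤ c)
    (hc : ∀ i, ∀ x ∈ closure Ω, ∀ y ∈ closure Ω, |pd k i (x - y)| ≤ c) {x : Sp d}
    (hx : x ∈ closure Ω) :
    |(∫ᵛ y, k (x - y) ∂•(densityPath Ω S₀ S b)) - ∫ᵛ y, k (x - y) ∂•(densityPath Ω S₀ S a)|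
      ≤ d * c * ∫ t in a..b, totalSize Ω (S t) := by
  have hη : ContDiffOn ℝ 1 (fun y => k (x - y)) (closure Ω) := (contDiff_kernel hk x).contDiffOn
  rw [hS.density_increment hΩ hT₁ ha hb ha0 hab hb1 hη, ← intervalIntegral.integral_const_mul,
    ← Real.norm_eq_abs]
  refine intervalIntegral.norm_integral_le_of_norm_le hab ?_
    ((hS.intervalIntegrable_totalSize hΩ hT₁ ha0 hab hb1).const_mul _)
  filter_upwards [ae_of_ae_restrict hT₁ (hS.ae_isRegularState hΩ) ha0 hb1] with t ht hI
  have hreg := ht hI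
  refine (Finset.abs_sum_le_sum_abs _ _).trans ((Finset.sum_le_sum fun i _ =>
    hreg.abs_mom_le hΩ (continuousOn_pdOn hΩ hη i) hc0 (fun y hy => ?_) i).trans (le_of_eq ?_))
  · rw [pdOn_kernel hΩ hk x hy i, abs_neg]
    exact hc i x hx y hy
  · simp [mul_assoc]

omit hT₁ ha hb in
/-- The balance of the interaction energy. The density is only weakly differentiable in time, but
its increments are controlled by the integrable function `totalSize`, so that the remainder in the
product rule is quadratic. -/
lemma interaction_balance (hW : ContDiff ℝ ∞ W) (hW_symm : ∀ x, W (-x) = W x)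
    (hS₀ : (S₀.rho Ω).totalVariation (closure Ω)ᶜ = 0) (hT₁ : T₁ < T) :
    ∀ᵐ τ ∂(volume.restrict (Ioo 0 T₁)),
      (∫ᵛ x, (∫ᵛ y, W (x - y) ∂•((S τ).rho Ω)) ∂•((S τ).rho Ω)) / 2
        - (∫ᵛ x, (∫ᵛ y, W (x - y) ∂•(S₀.rho Ω)) ∂•(S₀.rho Ω)) / 2
      = ∫ t in Ioo 0 τ, ∑ i, ∫ᵛ x, (∫ᵛ y, pd W i (x - y) ∂•((S t).rho Ω)) ∂•((S t).mom Ω i) := by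
  have hK := hΩ.isCompact_closure
  have hW1 := hW.of_le (m := 1) (by simp)
  have hpW : ∀ i, ContDiff ℝ 1 (pd W i) := fun i =>
    contDiff_pd hW (one_add_one_eq_two.le.trans ENat.LEInfty.out) i
  choose c hc0 hc using fun i => exists_kernel_bound_pd hΩ (hpW i)
  set c₂ := ∑ i, c i
  have hc₂0 : 0 ≤ c₂ := Finset.sum_nonneg fun i _ => hc0 i
  have hc₂ : ∀ i, ∀ j, ∀ x ∈ closure Ω, ∀ y ∈ closure Ω, |pd (pd W i) j (x - y)| ≤ c₂ :=
    fun i j x hx y hy => (hc i j x hx y hy).trans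
      (Finset.single_le_sum (fun i _ => hc0 i) (Finset.mem_univ i))
  set R := densityPath Ω S₀ S with hR
  set A := continuityTimes Ω S₀ S with hA
  have h0A : (0 : ℝ) ∈ A := ⟨by simpa [hR, densityPath] using hS₀, fun η _ => by
    simp [densityPath]⟩
  set h : ℝ → ℝ := fun τ => ∫ t in 0..τ, totalSize Ω (S t) with hh
  set P : ℝ → ℝ := fun t =>
    ∑ i, ∫ᵛ x, (∫ᵛ y, pd W i (x - y) ∂•((S t).rho Ω)) ∂•((S t).mom Ω i) with hP
  have hPi : IntegrableOn P (Ioo 0 T₁) :=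
    hS.integrable_mom_convolution hΩ hT₁ fun i => (hpW i).continuous
  set G : ℝ → ℝ := fun τ => (∫ᵛ x, (∫ᵛ y, W (x - y) ∂•(R τ)) ∂•(R τ)) - 2 * ∫ t in 0..τ, P t
    with hG
  have hsize : ∀ {a b : ℝ}, 0 ≤ a → a ≤ b → b ≤ T₁ → h b - h a = ∫ t in a..b, totalSize Ω (S t) :=
    fun ha hab hb => intervalIntegral.integral_interval_sub_left
      (hS.intervalIntegrable_totalSize hΩ hT₁ le_rfl (ha.trans hab) hb)
      (hS.intervalIntegrable_totalSize hΩ hT₁ le_rfl ha (hab.trans hb))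
  have hmono : ∀ {a b : ℝ}, 0 ≤ a → a ≤ b → b ≤ T₁ → h a ≤ h b := by
    intro a b ha hab hb
    rw [← sub_nonneg, hsize ha hab hb]
    refine intervalIntegral.integral_nonneg_of_ae_restrict hab ?_
    rw [EventuallyLE, ← restrict_Ioc_eq_restrict_Icc, ae_restrict_iff' measurableSet_Ioc]
    filter_upwards [ae_of_ae_restrict hT₁ (hS.ae_isRegularState hΩ) ha hb] with t ht hI
    exact ((ht hI).size_bounds hΩ).1
  have key : ∀ a ∈ A, ∀ b ∈ A, 0 ≤ a → a ≤ b → b ≤ T₁ →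
      |G b - G a| ≤ (d * (2 * (d * c₂))) * (h b - h a) ^ 2 := by
    intro a ha b hb ha0 hab hb1
    have hconv : ∀ τ ∈ A, ContDiff ℝ 1 fun z => ∫ᵛ y, W (z - y) ∂•(R τ) := fun τ hτ =>
      contDiff_signedIntegral_kernel hK hτ.1 hW1
    have hη : ContDiff ℝ 1 fun z => (∫ᵛ y, W (z - y) ∂•(R b)) + ∫ᵛ y, W (z - y) ∂•(R a) :=
      (hconv b hb).add (hconv a ha)
    have e1 := hS.density_increment hΩ hT₁ ha hb ha0 hab hb1 hη.contDiffOn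
    have cc := fun τ hτ => (hconv τ hτ).continuous.continuousOn (s := closure Ω)
    have hsymm : ∫ᵛ x, (∫ᵛ y, W (x - y) ∂•(R a)) ∂•(R b)
        = ∫ᵛ x, (∫ᵛ y, W (x - y) ∂•(R b)) ∂•(R a) := by
      rw [signedIntegral_comm hb.1 ha.1 hK (F := fun x y => W (x - y))
        (hW.continuous.comp (continuous_fst.sub continuous_snd)).continuousOn]
      simp_rw [fun x y : Sp d => show W (x - y) = W (y - x) by rw [← hW_symm, neg_sub]]
      rfl
    rw [signedIntegral_add hK hb.1 (cc b hb) (cc a ha),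
      signedIntegral_add hK ha.1 (cc b hb) (cc a ha), hsymm] at e1
    have e2 : G b - G a = ∫ t in a..b, (fluxPairing Ω S
        (fun z => (∫ᵛ y, W (z - y) ∂•(R b)) + ∫ᵛ y, W (z - y) ∂•(R a)) t - 2 * P t) := by
      rw [intervalIntegral.integral_sub (hS.intervalIntegrable_fluxPairing hΩ hT₁ hη.contDiffOn
        ha0 hab hb1) ((intervalIntegrable_of_Ioo hPi ha0 hab hb1).const_mul 2), ← e1,
        intervalIntegral.integral_const_mul, ← intervalIntegral.integral_interval_sub_left
        (intervalIntegrable_of_Ioo hPi le_rfl (ha0.trans hab) hb1)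
        (intervalIntegrable_of_Ioo hPi le_rfl ha0 (hab.trans hb1))]
      simp only [hG]
      ring
    rw [e2, sq, ← mul_assoc]
    nth_rewrite 2 [hsize ha0 hab hb1]
    rw [← intervalIntegral.integral_const_mul, ← Real.norm_eq_abs]
    refine intervalIntegral.norm_integral_le_of_norm_le hab ?_
      ((hS.intervalIntegrable_totalSize hΩ hT₁ ha0 hab hb1).const_mul _)
    filter_upwards [ae_of_ae_restrict hT₁ (hS.ae_isRegularState hΩ) ha0 hb1,
      ae_of_ae_restrict hT₁ (hS.ae_mem_continuityTimes hΩ) ha0 hb1] with t ht1 ht2 hI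
    have hreg := ht1 hI
    have htA := ht2 hI
    have hRt : R t = (S t).rho Ω := if_neg (ha0.trans_lt hI.1).ne'
    have ht0 := ha0.trans hI.1.le
    have hpair : fluxPairing Ω S
        (fun z => (∫ᵛ y, W (z - y) ∂•(R b)) + ∫ᵛ y, W (z - y) ∂•(R a)) t - 2 * P t
        = ∑ i, ∫ᵛ x, (((∫ᵛ y, pd W i (x - y) ∂•(R b)) - ∫ᵛ y, pd W i (x - y) ∂•(R t))
          + ((∫ᵛ y, pd W i (x - y) ∂•(R a)) - ∫ᵛ y, pd W i (x - y) ∂•(R t)))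
          ∂•((S t).mom Ω i) := by
      rw [fluxPairing, hP, mul_sum, ← sum_sub_distrib]
      refine sum_congr rfl fun i _ => ?_
      have cp := fun τ hτ => (contDiff_signedIntegral_kernel hK (μ := R τ) hτ (hpW i)).continuous
        |>.continuousOn (s := closure Ω)
      rw [← hRt, ← signedIntegral_const_mul, ← signedIntegral_sub hK (hreg.carried_mom hΩ i)
        (continuousOn_pdOn hΩ hη.contDiffOn i) (continuousOn_const.fun_mul (cp t htA.1))]
      refine signedIntegral_congr (hreg.carried_mom hΩ i) fun x hx => ?_
      have hd := fun τ hτ => ((hconv τ hτ).differentiable (by simp)) x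
      have : pd (fun z => (∫ᵛ y, W (z - y) ∂•(R b)) + ∫ᵛ y, W (z - y) ∂•(R a)) i x
          = (∫ᵛ y, pd W i (x - y) ∂•(R b)) + ∫ᵛ y, pd W i (x - y) ∂•(R a) := by
        rw [← pd_signedIntegral_kernel hK hb.1 hW1, ← pd_signedIntegral_kernel hK ha.1 hW1, pd,
          fderiv_fun_add (hd b hb) (hd a ha)]
        rfl
      beta_reduce
      rw [pdOn_eq_pd_of_differentiableAt hΩ hx ((hη.differentiable (by simp)) x), this]
      ring
    rw [hpair]
    have hinc : ∀ i, ∀ x ∈ closure Ω,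
        |((∫ᵛ y, pd W i (x - y) ∂•(R b)) - ∫ᵛ y, pd W i (x - y) ∂•(R t))
          + ((∫ᵛ y, pd W i (x - y) ∂•(R a)) - ∫ᵛ y, pd W i (x - y) ∂•(R t))|
        ≤ 2 * (d * c₂) * (h b - h a) := by
      intro i x hx
      have i1 := hS.abs_kernel_increment_le hΩ hT₁ htA hb ht0 hI.2 hb1 (hpW i) hc₂0 (hc₂ i) hx
      have i2 := hS.abs_kernel_increment_le hΩ hT₁ ha htA ha0 hI.1.le (hI.2.trans hb1) (hpW i) hc₂0
        (hc₂ i) hx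
      rw [← hsize ht0 hI.2 hb1] at i1
      rw [← hsize ha0 hI.1.le (hI.2.trans hb1), abs_sub_comm] at i2
      have i3 := mul_le_mul_of_nonneg_left (hmono ha0 hI.1.le (hI.2.trans hb1))
        (show 0 ≤ (d : ℝ) * c₂ by positivity)
      have i4 := mul_le_mul_of_nonneg_left (hmono ht0 hI.2 hb1)
        (show 0 ≤ (d : ℝ) * c₂ by positivity)
      refine (abs_add_le _ _).trans ((add_le_add i1 i2).trans ?_)
      nlinarith
    have hnn : 0 ≤ 2 * (d * c₂) * (h b - h a) :=
      mul_nonneg (by positivity) (sub_nonneg.2 (hmono ha0 hab hb1))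
    refine (Finset.abs_sum_le_sum_abs _ _).trans ((Finset.sum_le_sum fun i _ =>
      hreg.abs_mom_le hΩ ?_ hnn (hinc i) i).trans (le_of_eq ?_))
    · have cp := fun τ hτ => (contDiff_signedIntegral_kernel hK (μ := R τ) hτ (hpW i)).continuous
        |>.continuousOn (s := closure Ω)
      exact ((cp b hb.1).fun_sub (cp t htA.1)).fun_add ((cp a ha.1).fun_sub (cp t htA.1))
    · simp
      ring
  have hsub : volume.restrict (Ioo 0 T₁) ≤ volume.restrict (Ioo 0 T) :=
    Measure.restrict_mono (Ioo_subset_Ioo_right hT₁.le) le_rfl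
  filter_upwards [ae_mono hsub (hS.ae_mem_continuityTimes hΩ), ae_restrict_mem measurableSet_Ioo]
    with τ hτ hτI
  have hdense : ∀ u v, 0 ≤ u → u < v → v ≤ τ → (A ∩ Ioo u v).Nonempty := by
    intro u v hu huv hv
    by_contra hne
    have hz : ∀ᵐ t ∂(volume.restrict (Ioo u v)), t ∈ A :=
      ae_mono (Measure.restrict_mono (Ioo_subset_Ioo hu ((hv.trans hτI.2.le).trans hT₁.le)) le_rfl)
        (hS.ae_mem_continuityTimes hΩ)
    have hne' : (volume.restrict (Ioo u v)) ≠ 0 := by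
      rw [Ne, Measure.restrict_eq_zero, Real.volume_Ioo]
      simp [huv]
    have : (ae (volume.restrict (Ioo u v))).NeBot := ae_neBot.2 hne'
    obtain ⟨t, h1, h2⟩ := (hz.and (ae_restrict_mem measurableSet_Ioo)).exists
    exact hne ⟨t, h1, h2⟩
  have hfin := eq_of_abs_sub_le_sq (G := G) (h := h) hτI.1.le h0A hτ hdense
    (intervalIntegral.continuousOn_primitive_interval' (hS.intervalIntegrable_totalSize hΩ hT₁ le_rfl
      hτI.1.le hτI.2.le) left_mem_uIcc |>.mono (by rw [uIcc_of_le hτI.1.le]))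
    (fun u hu v hv huv => hmono hu.1 huv (hv.2.trans hτI.2.le))
    (fun u hu v hv h1 h2 h3 => key u hu v hv h1 h2 (h3.trans hτI.2.le)) (by positivity)
  have hRτ : R τ = (S τ).rho Ω := if_neg hτI.1.ne'
  have hR0 : R 0 = S₀.rho Ω := if_pos rfl
  simp only [hG, hRτ, hR0, intervalIntegral.integral_same] at hfin
  rw [← integral_Ioc_eq_integral_Ioo, ← intervalIntegral.integral_of_le hτI.1.le]
  linarith

end IsDissipativeMVSolution

end Interaction

/-! ### Test functions, initial state and Gronwall's inequality -/

section Gronwall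

/-- Gronwall's inequality for integrable functions. -/
lemma ae_nonpos_of_le_integral {H : ℝ → ℝ} {C T : ℝ} (hC : 0 ≤ C)
    (hH : IntegrableOn H (Ioo 0 T)) (h0 : ∀ᵐ t ∂(volume.restrict (Ioo 0 T)), 0 ≤ H t)
    (h : ∀ᵐ t ∂(volume.restrict (Ioo 0 T)), H t ≤ C * ∫ s in Ioo 0 t, H s) :
    ∀ᵐ t ∂(volume.restrict (Ioo 0 T)), H t ≤ 0 := by
  set H' := indicator (Ioo 0 T) H
  have hi : Integrable H' := (integrable_indicator_iff measurableSet_Ioo).2 hH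
  have hnn : ∀ᵐ t, 0 ≤ H' t := by
    filter_upwards [(ae_restrict_iff' measurableSet_Ioo).1 h0] with t ht
    by_cases hs : t ∈ Ioo 0 T
    · simp only [H', indicator_of_mem hs]; exact ht hs
    · simp only [H', indicator_of_notMem hs]; exact le_rfl
  set p : ℝ → ℝ := fun τ => ∫ t in 0..τ, H' t
  have hp : Continuous p := intervalIntegral.continuous_primitive (fun _ _ => hi.intervalIntegrable) 0
  have hp0 : ∀ τ, 0 ≤ τ → 0 ≤ p τ := fun τ hτ =>
    intervalIntegral.integral_nonneg_of_ae hτ hnn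
  have hpe : ∀ τ ∈ Ioo 0 T, p τ = ∫ s in Ioo 0 τ, H s := by
    intro τ hτ
    simp only [p]
    rw [intervalIntegral.integral_of_le hτ.1.le, integral_Ioc_eq_integral_Ioo]
    exact setIntegral_congr_fun measurableSet_Ioo fun s hs =>
      indicator_of_mem (s := Ioo 0 T) ⟨hs.1, hs.2.trans hτ.2⟩ H
  have hle : ∀ᵐ t, 0 ≤ t → H' t ≤ C * p t := by
    filter_upwards [(ae_restrict_iff' measurableSet_Ioo).1 h] with t ht ht0
    by_cases hs : t ∈ Ioo 0 T
    · simp only [H', indicator_of_mem hs]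
      rw [hpe t hs]
      exact ht hs
    · simp only [H', indicator_of_notMem hs]
      exact mul_nonneg hC (hp0 t ht0)
  set g : ℝ → ℝ := fun τ => ∫ t in 0..τ, p t
  have hg : ∀ τ, HasDerivAt g (p τ) τ := fun τ => (hp.integral_hasStrictDerivAt 0 τ).hasDerivAt
  have hg0 : ∀ τ, 0 ≤ τ → 0 ≤ g τ := fun τ hτ =>
    intervalIntegral.integral_nonneg hτ fun s hs => hp0 s hs.1
  have hpg : ∀ τ, 0 ≤ τ → p τ ≤ C * g τ := by
    intro τ hτ
    simp only [p, g]
    rw [← intervalIntegral.integral_const_mul]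
    refine intervalIntegral.integral_mono_ae_restrict hτ hi.intervalIntegrable
      ((hp.const_mul C).intervalIntegrable _ _) ?_
    filter_upwards [ae_restrict_of_ae hle, ae_restrict_mem measurableSet_Icc] with t ht hI
      using ht hI.1
  have hgz : ∀ τ ∈ Icc 0 T, g τ = 0 := by
    intro τ hτ
    have := norm_le_gronwallBound_of_norm_deriv_right_le (f := g) (f' := p) (δ := 0) (K := C)
      (ε := 0) (a := 0) (b := T) (fun s _ => (hg s).continuousAt.continuousWithinAt)
      (fun s _ => (hg s).hasDerivWithinAt) (by simp [g]) (fun s hs => by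
        rw [Real.norm_of_nonneg (hp0 s hs.1), Real.norm_of_nonneg (hg0 s hs.1), add_zero]
        exact hpg s hs.1) τ hτ
    rw [gronwallBound_ε0_δ0] at this
    exact norm_le_zero_iff.1 this
  filter_upwards [h, ae_restrict_mem measurableSet_Ioo] with t ht htI
  have h1 := hpg t htI.1.le
  rw [hgz t (Ioo_subset_Icc_self htI), mul_zero, hpe t htI] at h1
  exact ht.trans (mul_nonpos_of_nonneg_of_nonpos hC h1)

end Gronwall

section TimeCut

variable {d : ℕ} {Ω : Set (Sp d)} {T T₁ : ℝ}

/-- A smooth change of time that keeps `[0,T₁]` fixed and maps `[0,T]` into `[0,T)`: it turns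
functions on `[0,T)` into admissible test functions. -/
lemma exists_timeCut (hT₁0 : 0 < T₁) (hT₁ : T₁ < T) :
    ∃ s : ℝ → ℝ, ContDiff ℝ ∞ s ∧ (∀ t ≤ T₁, s t = t) ∧ ∀ t ∈ Icc 0 T, s t ∈ Ico 0 T := by
  obtain ⟨T₂, h1, h2⟩ := exists_between hT₁
  have h21 : 0 < T₂ - T₁ := sub_pos.2 h1
  refine ⟨fun t => t * Real.smoothTransition ((T₂ - t) / (T₂ - T₁)), ?_, fun t ht => ?_,
    fun t ht => ?_⟩
  · exact contDiff_id.mul (Real.smoothTransition.contDiff.comp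
      ((contDiff_const.sub contDiff_id).div_const _))
  · beta_reduce
    rw [Real.smoothTransition.one_of_one_le, mul_one]
    rw [one_le_div h21]
    linarith
  · refine ⟨mul_nonneg ht.1 (Real.smoothTransition.nonneg _), ?_⟩
    beta_reduce
    rcases le_or_gt T₂ t with h | h
    · rw [Real.smoothTransition.zero_of_nonpos (div_nonpos_of_nonpos_of_nonneg (by linarith) h21.le),
        mul_zero]
      exact hT₁0.trans hT₁
    · exact (mul_le_of_le_one_right ht.1 (Real.smoothTransition.le_one _)).trans_lt (h.trans h2)

lemma contDiffOn_timeCut {E : Type*} [NormedAddCommGroup E] [NormedSpace ℝ E] {s : ℝ → ℝ}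
    (hs : ContDiff ℝ ∞ s) (hs' : ∀ t ∈ Icc 0 T, s t ∈ Ico 0 T) {f : ℝ → Sp d → E}
    (hf : ContDiffOn ℝ 1 (fun p : ℝ × Sp d => f p.1 p.2) (slab T Ω)) :
    ContDiffOn ℝ 1 (fun p : ℝ × Sp d => f (s p.1) p.2) (Icc 0 T ×ˢ closure Ω) :=
  hf.comp (f := fun p : ℝ × Sp d => (s p.1, p.2)) (((hs.of_le (by simp)).comp contDiff_fst).prodMk
    contDiff_snd).contDiffOn fun p hp => ⟨hs' p.1 hp.1, hp.2⟩

lemma hasDerivWithinAt_timeCut (hT₁ : T₁ < T) {s : ℝ → ℝ} (hs : ∀ t ≤ T₁, s t = t)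
    {f : ℝ → Sp d → ℝ} (hf : ContDiffOn ℝ 1 (fun p : ℝ × Sp d => f p.1 p.2) (slab T Ω)) {t : ℝ}
    (ht : t ∈ Ioo 0 T₁) {x : Sp d} (hx : x ∈ closure Ω) :
    HasDerivWithinAt (fun τ => f (s τ) x) (dT T Ω f t x) (Icc 0 T) t := by
  refine ((hasDerivAt_slice hf ⟨ht.1, ht.2.trans hT₁⟩ hx).congr_of_eventuallyEq
    ?_).hasDerivWithinAt
  filter_upwards [Iio_mem_nhds ht.2] with τ hτ
  rw [hs τ (le_of_lt hτ)]

end TimeCut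

section InitialState

variable {d : ℕ} {Ω : Set (Sp d)} {S₀ : MVState d} {r : Sp d → ℝ} {U a : Sp d → Sp d}

lemma bar_dirac {ν : Sp d → Measure (Phase d)} {y : Sp d → Phase d}
    (hν : ∀ᵐ x ∂(volume.restrict Ω), ν x = Measure.dirac (y x)) (f : Phase d → ℝ) :
    bar Ω ν f 0 = (volume.restrict Ω).withDensityᵥ fun x => f (y x) := by
  rw [bar, add_zero]
  refine WithDensityᵥEq.congr_ae (hν.mono fun x hx => ?_)
  simp only [hx, integral_dirac]

/-- The barred quantities of an initial state without concentrations. -/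
lemma initial_bar (hΩ : IsBoundedSmoothDomain Ω) (hS₀ : S₀.NoConcentration)
    (hr : ∀ x ∈ closure Ω, 0 < r x)
    (hν₀ : ∀ᵐ x ∂(volume.restrict Ω), S₀.ν x = Measure.dirac ((Real.toNNReal (r x), U x), a x)) :
    S₀.rho Ω = (volume.restrict Ω).withDensityᵥ r ∧
    (∀ i, S₀.mom Ω i = (volume.restrict Ω).withDensityᵥ fun x => r x * U x i) ∧
    S₀.kin Ω = (volume.restrict Ω).withDensityᵥ (fun x => r x * ‖U x‖ ^ 2) ∧
    S₀.pot Ω = (volume.restrict Ω).withDensityᵥ (fun x => ‖a x‖ ^ 2) := by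
  obtain ⟨h1, h2, _, h4, h5, _⟩ := hS₀
  have hp := (ae_mem_closure hΩ).mono fun x hx => Real.coe_toNNReal (r x) (hr x hx).le
  refine ⟨?_, fun i => ?_, ?_, ?_⟩
  · rw [MVState.rho, h1, bar_dirac hν₀]
    exact WithDensityᵥEq.congr_ae (hp.mono fun x hx => by simp only [fRho, hx])
  · rw [MVState.mom, h2, Pi.zero_apply, bar_dirac hν₀]
    exact WithDensityᵥEq.congr_ae (hp.mono fun x hx => by simp only [fMom, hx])
  · rw [MVState.kin, h4, bar_dirac hν₀]
    exact WithDensityᵥEq.congr_ae (hp.mono fun x hx => by simp only [fKin, hx])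
  · rw [MVState.pot, h5, bar_dirac hν₀]
    rfl

lemma withDensityᵥ_univ (hΩ : IsBoundedSmoothDomain Ω) {g : Sp d → ℝ} (hg : IntegrableOn g Ω) :
    (volume.restrict Ω).withDensityᵥ g univ = ∫ x in Ω, g x := by
  rw [← signedIntegral_one, signedIntegral_density hΩ hg continuousOn_const]
  simp only [one_mul]

end InitialState

/-! ### The relative energy inequality -/

section RelativeEnergy

variable {d : ℕ} {Ω : Set (Sp d)} {T T₁ : ℝ} {V W ψ : Sp d → ℝ} {r : ℝ → Sp d → ℝ}
  {U : ℝ → Sp d → Sp d} {Φ : ℝ → Sp d → ℝ} {S₀ : MVState d} {S : ℝ → MVState d} {t : ℝ} {x : Sp d}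

variable (h : IsStrongSolution T Ω V W ψ r U Φ) (hΩ : IsBoundedSmoothDomain Ω) (hV : ContDiff ℝ ∞ V)
  (hT : 0 < T) (hT₁0 : 0 < T₁) (hT₁ : T₁ < T) (hS₀ : S₀.NoConcentration)
  (hS : IsDissipativeMVSolution T Ω V W ψ S₀ S)
  (hν₀ : ∀ᵐ x ∂(volume.restrict Ω),
    S₀.ν x = Measure.dirac ((Real.toNNReal (r 0 x), U 0 x), gradOn Ω (Φ 0) x))

include h hΩ hV hT hT₁0 hT₁ hS₀ hS hν₀

omit h hΩ hV hT hT₁0 hT₁ hS₀ hS hν₀ in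
/-- The test function `|U|²/2 - V - Φ` in the continuity equation. -/
def testPotential (V : Sp d → ℝ) (U : ℝ → Sp d → Sp d) (Φ : ℝ → Sp d → ℝ) (t : ℝ) (x : Sp d) : ℝ :=
  (1 / 2) * (∑ j, U t x j * U t x j) - V x - Φ t x

omit h hΩ hV hT hT₁0 hT₁ hS₀ hS hν₀ in
/-- The relative energy, up to a factor two. -/
def relEnergy (Ω : Set (Sp d)) (S : ℝ → MVState d) (U : ℝ → Sp d → Sp d) (Φ : ℝ → Sp d → ℝ)
    (t : ℝ) : ℝ :=
  relKinetic Ω (S t) (U t) + relField Ω (S t) (gradOn Ω (Φ t))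

namespace IsStrongSolution

omit hΩ hT hT₁0 hT₁ hS₀ hS hν₀ in
lemma contDiffOn_testPotential :
    ContDiffOn ℝ 1 (fun p : ℝ × Sp d => testPotential V U Φ p.1 p.2) (slab T Ω) :=
  ((contDiffOn_const.mul (ContDiffOn.sum fun j _ => (h.velocity_coord j).mul
    (h.velocity_coord j))).sub ((hV.of_le (by simp)).comp contDiff_snd).contDiffOn).sub
    (h.potential_C2.of_le (by norm_num))

omit hΩ hT hT₁0 hT₁ hS₀ hS hν₀ in
lemma dT_testPotential
    (ht : t ∈ Ioo 0 T) (hx : x ∈ closure Ω) : dT T Ω (testPotential V U Φ) t x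
      = (∑ i, U t x i * velocityRate T Ω U t x i) - dT T Ω Φ t x := by
  refine (hasDerivAt_slice (h.contDiffOn_testPotential hV) ht hx).unique ?_
  have h1 := fun j => hasDerivAt_slice (f := fun s y => U s y j) (h.velocity_coord j) ht hx
  refine ((((HasDerivAt.fun_sum fun j _ => (h1 j).mul (h1 j)).const_mul (1 / 2)).sub_const
    (V x)).sub (hasDerivAt_slice (h.potential_C2.of_le (by norm_num)) ht hx)).congr_deriv ?_
  rw [mul_sum]
  congr 1
  exact sum_congr rfl fun j _ => by simp only [velocityRate]; ring

omit hT hT₁0 hT₁ hS₀ hS hν₀ in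
lemma pdOn_testPotential (ht : t ∈ Ico 0 T) (hx : x ∈ closure Ω) (i : Fin d) :
    pdOn Ω (testPotential V U Φ t) i x = (∑ j, U t x j * pdOn Ω (fun y => U t y j) i x)
      - pd V i x - gradOn Ω (Φ t) x i := by
  have hU : ∀ j, ContDiffOn ℝ 1 (fun y => U t y j) (closure Ω) := fun j =>
    contDiffOn_slice (f := fun s y => U s y j) (h.velocity_coord j) ht
  have hΦ : ContDiffOn ℝ 1 (Φ t) (closure Ω) :=
    contDiffOn_slice (h.potential_C2.of_le (by norm_num)) ht
  have hV1 : ContDiff ℝ 1 V := hV.of_le (by simp)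
  have h1 : ContDiffOn ℝ 1 (fun y => ∑ j, U t y j * U t y j) (closure Ω) :=
    ContDiffOn.sum fun j _ => (hU j).mul (hU j)
  rw [show testPotential V U Φ t
      = fun y => (1 / 2) * (∑ j, U t y j * U t y j) - V y - Φ t y from rfl,
    pdOn_sub hΩ ((contDiffOn_const.mul h1).sub hV1.contDiffOn) hΦ i hx,
    pdOn_sub hΩ (contDiffOn_const.mul h1) hV1.contDiffOn i hx, pdOn_const_mul hΩ _ h1 i hx,
    pdOn_sum hΩ (fun j _ => (hU j).mul (hU j)) i hx,
    pdOn_eq_pd_of_differentiableAt hΩ hx (hV1.differentiable (by simp) x), mul_sum]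
  congr 2
  exact sum_congr rfl fun j _ => by rw [pdOn_mul hΩ (hU j) (hU j) i hx]; ring

omit hT hT₁0 hT₁ hS₀ hS hν₀ in
/-- The relative energy in terms of the energy and of the quantities whose evolution is known from
the equations. -/
lemma relEnergy_eq (ht : t ∈ Ico 0 T) (hreg : IsRegularState Ω (S t))
    (hP : IsPoissonState Ω ((∫ y in Ω, r 0 y) / volume.real Ω) (S t)) :
    relEnergy Ω S U Φ t / 2 = (S t).energy Ω V W
      - (∫ᵛ x, (∫ᵛ y, W (x - y) ∂•((S t).rho Ω)) ∂•((S t).rho Ω)) / 2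
      - (∑ i, ∫ᵛ x, U t x i ∂•((S t).mom Ω i))
      + (∫ᵛ x, testPotential V U Φ t x ∂•((S t).rho Ω)) + fieldPotential Ω r Φ t := by
  have hK := hΩ.isCompact_closure
  have hρ := hreg.carried_rho hΩ
  have hU := fun j => (contDiffOn_slice (f := fun s y => U s y j) (h.velocity_coord j) ht)
    |>.continuousOn
  have hΦ : ContDiffOn ℝ 1 (Φ t) (closure Ω) :=
    contDiffOn_slice (h.potential_C2.of_le (by norm_num)) ht
  have c1 : ContinuousOn (fun y => ∑ j, U t y j * U t y j) (closure Ω) :=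
    continuousOn_finsetSum _ fun j _ => (hU j).fun_mul (hU j)
  have e1 : ∫ᵛ x, testPotential V U Φ t x ∂•((S t).rho Ω)
      = (1 / 2) * (∫ᵛ x, (∑ j, U t x j * U t x j) ∂•((S t).rho Ω)) - (∫ᵛ x, V x ∂•((S t).rho Ω))
        - ∫ᵛ x, Φ t x ∂•((S t).rho Ω) := by
    rw [← signedIntegral_const_mul, ← signedIntegral_sub hK hρ (continuousOn_const.fun_mul c1)
      hV.continuous.continuousOn, ← signedIntegral_sub hK hρ ((continuousOn_const.fun_mul c1).fun_sub
      hV.continuous.continuousOn) hΦ.continuousOn]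
    rfl
  have e2 : ∫ᵛ x, ‖U t x‖ ^ 2 ∂•((S t).rho Ω)
      = ∫ᵛ x, (∑ j, U t x j * U t x j) ∂•((S t).rho Ω) := by
    simp only [EuclideanSpace.real_norm_sq_eq]
    simp only [sq]
  have e3 := hP (Φ t) hΦ
  rw [← integral_sum_mul hΩ hreg.integrableOn_field (continuousOn_pdOn hΩ hΦ)] at e3
  have e4 : ∀ i, ∫ x in Ω, -2 * gradOn Ω (Φ t) x i * (S t).field i x
      = -2 * ∫ x in Ω, (S t).field i x * pdOn Ω (Φ t) i x := fun i => by
    rw [← integral_const_mul]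
    exact integral_congr_ae (Eventually.of_forall fun x => by simp only [gradOn]; ring)
  rw [relEnergy, relKinetic, relField, MVState.energy, fieldPotential, e1, e2]
  simp only [e4, signedIntegral_const_mul, ← mul_sum, e3]
  ring

omit hT₁0 hT₁ hS in
/-- At the initial time the relative energy vanishes. -/
lemma initial_relEnergy :
    S₀.energy Ω V W - (∫ᵛ x, (∫ᵛ y, W (x - y) ∂•(S₀.rho Ω)) ∂•(S₀.rho Ω)) / 2
      - (∑ i, ∫ᵛ x, U 0 x i ∂•(S₀.mom Ω i))
      + (∫ᵛ x, testPotential V U Φ 0 x ∂•(S₀.rho Ω)) + fieldPotential Ω r Φ 0 = 0 := by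
  have h0 : (0 : ℝ) ∈ Ico 0 T := ⟨le_rfl, hT⟩
  obtain ⟨b1, b2, b3, b4⟩ := initial_bar hΩ hS₀ (fun x hx => h.density_pos 0 h0 x hx) hν₀
  have cr : ContinuousOn (r 0) (closure Ω) := (contDiffOn_slice h.density_C1 h0).continuousOn
  have cU : ContinuousOn (U 0) (closure Ω) := (contDiffOn_slice h.velocity_C1 h0).continuousOn
  have cUi := continuousOn_coord cU
  have ca : ContinuousOn (gradOn Ω (Φ 0)) (closure Ω) :=
    (contDiffOn_slice (f := fun s => gradOn Ω (Φ s)) (h.contDiffOn_field hΩ) h0).continuousOn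
  have cη : ContinuousOn (testPotential V U Φ 0) (closure Ω) :=
    (contDiffOn_slice (h.contDiffOn_testPotential hV) h0).continuousOn
  have cΦ : ContinuousOn (Φ 0) (closure Ω) := (contDiffOn_slice h.potential_C2 h0).continuousOn
  have int : ∀ {f : Sp d → ℝ}, ContinuousOn f (closure Ω) → IntegrableOn f Ω := fun hf =>
    hΩ.integrableOn hf
  have cN : ContinuousOn (fun x => ‖U 0 x‖ ^ 2) (closure Ω) := cU.norm.pow 2
  have caN : ContinuousOn (fun x => ‖gradOn Ω (Φ 0) x‖ ^ 2) (closure Ω) := ca.norm.pow 2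
  have hpot := h.integral_density_potential hΩ hT h0
  rw [MVState.energy, fieldPotential, b3, b4, withDensityᵥ_univ hΩ (int (cr.fun_mul cN)),
    withDensityᵥ_univ hΩ (int caN), b1, signedIntegral_density hΩ (int cr) cη,
    signedIntegral_density hΩ (int cr) hV.continuous.continuousOn]
  have e1 : ∀ i, ∫ᵛ x, U 0 x i ∂•(S₀.mom Ω i) = ∫ x in Ω, U 0 x i * (r 0 x * U 0 x i) := fun i => by
    rw [b2 i, signedIntegral_density hΩ (int (cr.fun_mul (cUi i))) (cUi i)]
  have e2 : ∑ i, ∫ x in Ω, U 0 x i * (r 0 x * U 0 x i) = ∫ x in Ω, r 0 x * ‖U 0 x‖ ^ 2 := by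
    rw [← integral_finsetSum _ fun i _ => int ((cUi i).fun_mul (cr.fun_mul (cUi i)))]
    refine integral_congr_ae (Eventually.of_forall fun x => ?_)
    simp only [EuclideanSpace.real_norm_sq_eq, mul_sum]
    exact sum_congr rfl fun i _ => by ring
  have e3 : ∫ x in Ω, testPotential V U Φ 0 x * r 0 x
      = (1 / 2) * (∫ x in Ω, r 0 x * ‖U 0 x‖ ^ 2) - (∫ x in Ω, V x * r 0 x)
        - ∫ x in Ω, Φ 0 x * r 0 x := by
    rw [← integral_const_mul, ← integral_sub (int (continuousOn_const.fun_mul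
      (cr.fun_mul cN))) (int (hV.continuous.continuousOn.fun_mul cr)),
      ← integral_sub (int ((continuousOn_const.fun_mul (cr.fun_mul cN)).fun_sub
      (hV.continuous.continuousOn.fun_mul cr))) (int (cΦ.fun_mul cr))]
    refine integral_congr_ae (Eventually.of_forall fun x => ?_)
    simp only [testPotential, EuclideanSpace.real_norm_sq_eq, ← sq]
    ring
  simp only [e1]
  rw [e2, e3, hpot]
  ring

omit hV hT₁0 hT₁ hS in
lemma initial_avg :
    S₀.avg Ω = (∫ y in Ω, r 0 y) / volume.real Ω ∧
      (S₀.rho Ω).totalVariation (closure Ω)ᶜ = 0 := by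
  have h0 : (0 : ℝ) ∈ Ico 0 T := ⟨le_rfl, hT⟩
  have b1 := (initial_bar hΩ hS₀ (fun x hx => h.density_pos 0 h0 x hx) hν₀).1
  rw [MVState.avg, b1, withDensityᵥ_univ hΩ (hΩ.integrableOn
    (contDiffOn_slice h.density_C1 h0).continuousOn)]
  exact ⟨rfl, carried_withDensityᵥ hΩ _⟩

omit h hΩ hV hT hT₁0 hT₁ hS₀ hS hν₀ in
/-- The rate of change of the relative energy at time `t`. -/
def rateAt (T : ℝ) (Ω : Set (Sp d)) (V W ψ : Sp d → ℝ) (r : ℝ → Sp d → ℝ) (U : ℝ → Sp d → Sp d)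
    (Φ : ℝ → Sp d → ℝ) (S : ℝ → MVState d) (t : ℝ) : ℝ :=
  relRate Ω V W ψ ((∫ y in Ω, r 0 y) / volume.real Ω) (S t) (U t) (velocityRate T Ω U t)
    (gradOn Ω (Φ t)) (gradRate T Ω Φ t) (dT T Ω Φ t)

omit hV hT hS₀ hν₀ in
/-- Testing the momentum equation with the velocity of the strong solution. -/
lemma momentum_test :
    ∀ᵐ τ ∂(volume.restrict (Ioo 0 T₁)),
      (∑ i, ∫ᵛ x, U τ x i ∂•((S τ).mom Ω i)) - (∑ i, ∫ᵛ x, U 0 x i ∂•(S₀.mom Ω i))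
        = ∫ t in Ioo 0 τ, (S t).momentumRHS Ω V W ψ (S₀.avg Ω) (U t) (velocityRate T Ω U t) := by
  obtain ⟨s, hs, hs1, hs2⟩ := exists_timeCut hT₁0 hT₁
  have hl : volume.restrict (Ioo 0 T₁) ≤ volume.restrict (Ioo 0 T) :=
    Measure.restrict_mono (Ioo_subset_Ioo_right hT₁.le) le_rfl
  filter_upwards [ae_mono hl hS.momentum, ae_restrict_mem measurableSet_Ioo] with τ hτ hτI
  have := hτ (fun t => U (s t)) (contDiffOn_timeCut hs hs2 h.velocity_C1) fun t ht =>
    h.velocity_tangential_Ico (hT₁0.trans hT₁) (hs2 t ht)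
  rw [hs1 τ hτI.2.le, hs1 0 hT₁0.le] at this
  rw [this]
  refine setIntegral_congr_ae measurableSet_Ioo ?_
  filter_upwards [(ae_restrict_iff' measurableSet_Ioo).1 (hS.ae_isRegularState hΩ)] with t hreg ht
  have ht1 : t < T₁ := ht.2.trans hτI.2
  have hreg := hreg ⟨ht.1, ht1.trans hT₁⟩
  rw [MVState.momentumRHS, MVState.momentumRHS, hs1 t ht1.le]
  congr 8
  refine sum_congr rfl fun i _ => signedIntegral_congr (hreg.carried_mom hΩ i) fun x hx => ?_
  have hd : HasDerivWithinAt (fun τ => U (s τ) x) (velocityRate T Ω U t x) (Icc 0 T) t :=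
    (hasFDerivWithinAt_euclidean (𝕜 := ℝ)).2 fun j =>
      hasDerivWithinAt_timeCut (f := fun s y => U s y j) hT₁ hs1
      (h.velocity_coord j) ⟨ht.1, ht1⟩ hx
  beta_reduce
  rw [hd.derivWithin (uniqueDiffOn_Icc (hT₁0.trans hT₁) t ⟨ht.1.le, (ht1.trans hT₁).le⟩)]

omit hT hS₀ hν₀ in
/-- Testing the continuity equation with `|U|²/2 - V - Φ`. -/
lemma continuity_test :
    ∀ᵐ τ ∂(volume.restrict (Ioo 0 T₁)),
      (∫ᵛ x, testPotential V U Φ τ x ∂•((S τ).rho Ω)) - (∫ᵛ x, testPotential V U Φ 0 x ∂•(S₀.rho Ω))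
        = ∫ t in Ioo 0 τ, ((∫ᵛ x, dT T Ω (testPotential V U Φ) t x ∂•((S t).rho Ω))
          + ∑ i, ∫ᵛ x, pdOn Ω (testPotential V U Φ t) i x ∂•((S t).mom Ω i)) := by
  obtain ⟨s, hs, hs1, hs2⟩ := exists_timeCut hT₁0 hT₁
  have hη := h.contDiffOn_testPotential hV
  have hl : volume.restrict (Ioo 0 T₁) ≤ volume.restrict (Ioo 0 T) :=
    Measure.restrict_mono (Ioo_subset_Ioo_right hT₁.le) le_rfl
  filter_upwards [ae_mono hl hS.continuity, ae_restrict_mem measurableSet_Ioo] with τ hτ hτI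
  have := hτ (fun t => testPotential V U Φ (s t)) (contDiffOn_timeCut hs hs2 hη)
  rw [hs1 τ hτI.2.le, hs1 0 hT₁0.le] at this
  rw [this]
  refine setIntegral_congr_ae measurableSet_Ioo ?_
  filter_upwards [(ae_restrict_iff' measurableSet_Ioo).1 (hS.ae_isRegularState hΩ)] with t hreg ht
  have ht1 : t < T₁ := ht.2.trans hτI.2
  have hreg := hreg ⟨ht.1, ht1.trans hT₁⟩
  rw [hs1 t ht1.le]
  congr 1
  refine signedIntegral_congr (hreg.carried_rho hΩ) fun x hx => ?_
  exact (hasDerivWithinAt_timeCut hT₁ hs1 hη ⟨ht.1, ht1⟩ hx).derivWithin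
    (uniqueDiffOn_Icc (hT₁0.trans hT₁) t ⟨ht.1.le, (ht1.trans hT₁).le⟩)

omit hT hT₁0 hT₁ hS₀ hS hν₀ in
/-- The relative energy inequality. -/
lemma relEnergy_le (hW : ContDiff ℝ ∞ W) (hψ : ContDiff ℝ ∞ ψ)
    (hW_symm : ∀ x, W (-x) = W x) (hT₁0 : 0 < T₁) (hT₁ : T₁ < T)
    (hS : IsDissipativeMVSolution T Ω V W ψ S₀ S) (hS₀ : S₀.NoConcentration)
    (hν₀ : ∀ᵐ x ∂(volume.restrict Ω),
      S₀.ν x = Measure.dirac ((Real.toNNReal (r 0 x), U 0 x), gradOn Ω (Φ 0) x)) :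
    IntegrableOn (rateAt T Ω V W ψ r U Φ S) (Ioo 0 T₁) ∧
    ∀ᵐ τ ∂(volume.restrict (Ioo 0 T₁)),
      relEnergy Ω S U Φ τ / 2 ≤ ∫ t in Ioo 0 τ, rateAt T Ω V W ψ r U Φ S t := by
  have hT := hT₁0.trans hT₁
  obtain ⟨havg, hcar⟩ := h.initial_avg hΩ hT hS₀ hν₀
  have hl : volume.restrict (Ioo 0 T₁) ≤ volume.restrict (Ioo 0 T) :=
    Measure.restrict_mono (Ioo_subset_Ioo_right hT₁.le) le_rfl
  set M := (∫ y in Ω, r 0 y) / volume.real Ω with hM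
  have hη := h.contDiffOn_testPotential hV
  have i1 := hS.integrable_dissipation hΩ hψ hT₁
  have i2 := hS.integrable_mom_convolution hΩ hT₁ fun i => continuous_pd (hW.of_le (by simp)) i
  have i3 := hS.integrable_momentumRHS hΩ hV hW hψ hT₁ M h.velocity_C1
    (X' := velocityRate T Ω U) fun i => continuousOn_dT (f := fun s y => U s y i) hΩ
      (h.velocity_coord i)
  have i4 := hS.integrable_rho_mom hΩ hT₁ (F := fun p => dT T Ω (testPotential V U Φ) p.1 p.2)
    (G := fun i p => pdOn Ω (testPotential V U Φ p.1) i p.2) (continuousOn_dT hΩ hη)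
    fun i => continuousOn_pdOn_slab hΩ hη i
  have i5 := (h.fieldPotential_sub hΩ ⟨hT₁0, hT₁⟩).1
  have hsum := ((((i1.neg).sub i2).sub i3).add i4).add i5
  have heq : ∀ᵐ t ∂(volume.restrict (Ioo 0 T₁)), rateAt T Ω V W ψ r U Φ S t
      = - (S t).dissipation Ω ψ
        - (∑ i, ∫ᵛ x, (∫ᵛ y, pd W i (x - y) ∂•((S t).rho Ω)) ∂•((S t).mom Ω i))
        - (S t).momentumRHS Ω V W ψ M (U t) (velocityRate T Ω U t)
        + ((∫ᵛ x, dT T Ω (testPotential V U Φ) t x ∂•((S t).rho Ω))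
          + ∑ i, ∫ᵛ x, pdOn Ω (testPotential V U Φ t) i x ∂•((S t).mom Ω i))
        + (M * (∫ x in Ω, dT T Ω Φ t x)
          + ∫ x in Ω, ∑ i, gradOn Ω (Φ t) x i * gradRate T Ω Φ t x i) := by
    filter_upwards [ae_mono hl (hS.ae_isRegularState hΩ), ae_restrict_mem measurableSet_Ioo]
      with t hreg ht
    have htT : t ∈ Ioo 0 T := ⟨ht.1, ht.2.trans hT₁⟩
    rw [rateAt, relRate, signedIntegral_congr (hreg.carried_rho hΩ) fun x hx =>
      h.dT_testPotential hV htT hx, sum_congr rfl fun i _ => signedIntegral_congr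
      (hreg.carried_mom hΩ i) fun x hx => h.pdOn_testPotential hΩ hV (Ioo_subset_Ico_self htT) hx i]
  refine ⟨hsum.congr (heq.mono fun t ht => ht.symm), ?_⟩
  filter_upwards [ae_mono hl hS.energy_inequality, h.momentum_test hΩ hT₁0 hT₁ hS,
    h.continuity_test hΩ hV hT₁0 hT₁ hS, hS.interaction_balance hΩ hW hW_symm hcar hT₁,
    ae_mono hl hS.poisson, ae_mono hl (hS.ae_isRegularState hΩ),
    ae_restrict_mem measurableSet_Ioo] with τ t1 t2 t3 t4 t5 hreg hτ
  have hτT : τ ∈ Ioo 0 T := ⟨hτ.1, hτ.2.trans hT₁⟩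
  have hsub : Ioo 0 τ ⊆ Ioo 0 T₁ := Ioo_subset_Ioo_right hτ.2.le
  have e1 := h.relEnergy_eq (S := S) hΩ hV (Ioo_subset_Ico_self hτT) hreg
    (by rw [havg] at t5; exact t5)
  have e2 := h.initial_relEnergy hΩ hV hT hS₀ hν₀
  have e3 := (h.fieldPotential_sub hΩ hτT).2
  have j1 := i1.mono_set hsub
  have j2 := i2.mono_set hsub
  have j3 := i3.mono_set hsub
  have j4 : IntegrableOn (fun t => (∫ᵛ x, dT T Ω (testPotential V U Φ) t x ∂•((S t).rho Ω))
      + ∑ i, ∫ᵛ x, pdOn Ω (testPotential V U Φ t) i x ∂•((S t).mom Ω i)) (Ioo 0 τ) :=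
    i4.mono_set hsub
  have j5 := i5.mono_set hsub
  have k0 : IntegrableOn (fun t => - (S t).dissipation Ω ψ) (Ioo 0 τ) := j1.neg
  have k1 : IntegrableOn (fun t => - (S t).dissipation Ω ψ
      - ∑ i, ∫ᵛ x, (∫ᵛ y, pd W i (x - y) ∂•((S t).rho Ω)) ∂•((S t).mom Ω i)) (Ioo 0 τ) := k0.sub j2
  have k2 : IntegrableOn (fun t => - (S t).dissipation Ω ψ
      - (∑ i, ∫ᵛ x, (∫ᵛ y, pd W i (x - y) ∂•((S t).rho Ω)) ∂•((S t).mom Ω i))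
      - (S t).momentumRHS Ω V W ψ M (U t) (velocityRate T Ω U t)) (Ioo 0 τ) := k1.sub j3
  have k3 : IntegrableOn (fun t => - (S t).dissipation Ω ψ
      - (∑ i, ∫ᵛ x, (∫ᵛ y, pd W i (x - y) ∂•((S t).rho Ω)) ∂•((S t).mom Ω i))
      - (S t).momentumRHS Ω V W ψ M (U t) (velocityRate T Ω U t)
      + ((∫ᵛ x, dT T Ω (testPotential V U Φ) t x ∂•((S t).rho Ω))
        + ∑ i, ∫ᵛ x, pdOn Ω (testPotential V U Φ t) i x ∂•((S t).mom Ω i))) (Ioo 0 τ) := k2.add j4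
  rw [integral_congr_ae (ae_mono (Measure.restrict_mono hsub le_rfl) heq),
    integral_add k3 j5, integral_add k2 j4, integral_sub k1 j3, integral_sub k0 j2, integral_neg, e3,
    ← t3, ← t4]
  rw [havg] at t2
  rw [← t2]
  linarith

end IsStrongSolution

end RelativeEnergy

/-! ### The relative energy vanishes -/

namespace IsStrongSolution

variable {d : ℕ} {Ω : Set (Sp d)} {T T₁ : ℝ} {V W ψ : Sp d → ℝ} {r : ℝ → Sp d → ℝ}
  {U : ℝ → Sp d → Sp d} {Φ : ℝ → Sp d → ℝ} {S₀ : MVState d} {S : ℝ → MVState d}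

variable (h : IsStrongSolution T Ω V W ψ r U Φ) (hΩ : IsBoundedSmoothDomain Ω) (hV : ContDiff ℝ ∞ V)
  (hW : ContDiff ℝ ∞ W) (hψ : ContDiff ℝ ∞ ψ) (hW_symm : ∀ x, W (-x) = W x)

include h hΩ hV hW hψ hW_symm

omit hV hW hψ hW_symm in
lemma exists_velocity_bound (hT₁ : T₁ < T) :
    ∃ B, 0 ≤ B ∧ ∀ t ∈ Icc 0 T₁, ∀ x ∈ closure Ω, (∀ i, |U t x i| ≤ B) ∧
      ∀ i j, |pdOn Ω (fun y => U t y i) j x| ≤ B := by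
  have c1 : ContinuousOn (fun p : ℝ × Sp d => (∑ i, |U p.1 p.2 i|)
      + ∑ i, ∑ j, |pdOn Ω (fun y => U p.1 y i) j p.2|) (slab T Ω) :=
    (continuousOn_finsetSum _ fun i _ => (h.velocity_coord i).continuousOn.abs).add
      (continuousOn_finsetSum _ fun i _ => continuousOn_finsetSum _ fun j _ =>
        (continuousOn_pdOn_slab (f := fun s y => U s y i) hΩ (h.velocity_coord i) j).abs)
  obtain ⟨B, hB0, hB⟩ := exists_bound_slab hΩ c1 hT₁
  refine ⟨B, hB0, fun t ht x hx => ?_⟩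
  have h1 := (le_abs_self _).trans (hB t ht x hx)
  have h2 : 0 ≤ ∑ i, |U t x i| := Finset.sum_nonneg fun i _ => abs_nonneg _
  have h3 : ∀ i, 0 ≤ ∑ j, |pdOn Ω (fun y => U t y i) j x| := fun i =>
    Finset.sum_nonneg fun j _ => abs_nonneg _
  have h4 : 0 ≤ ∑ i, ∑ j, |pdOn Ω (fun y => U t y i) j x| := Finset.sum_nonneg fun i _ => h3 i
  refine ⟨fun i => ?_, fun i j => ?_⟩
  · have := Finset.single_le_sum (f := fun i => |U t x i|) (fun i _ => abs_nonneg _)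
      (Finset.mem_univ i)
    beta_reduce at this h1
    linarith
  · have e1 := Finset.single_le_sum (f := fun j => |pdOn Ω (fun y => U t y i) j x|)
      (fun i _ => abs_nonneg _) (Finset.mem_univ j)
    have e2 := Finset.single_le_sum (f := fun i => ∑ j, |pdOn Ω (fun y => U t y i) j x|)
      (fun i _ => h3 i) (Finset.mem_univ i)
    beta_reduce at e1 e2 h1
    linarith

omit hV hW hψ hW_symm in
lemma integrable_relEnergy
    (hT₁ : T₁ < T) (hS : IsDissipativeMVSolution T Ω V W ψ S₀ S) :
    IntegrableOn (relEnergy Ω S U Φ) (Ioo 0 T₁) := by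
  have hsub : Ioo 0 T₁ ⊆ Ioo 0 T := Ioo_subset_Ioo_right hT₁.le
  have hν := hS.isFiniteEnergyYoung hΩ
  have ca := fun i => (contDiffOn_pdOn_slab hΩ h.potential_C2 i).continuousOn
  have cN : ContinuousOn (fun p : ℝ × Sp d => ‖U p.1 p.2‖ ^ 2) (slab T Ω) :=
    h.velocity_C1.continuousOn.norm.pow 2
  have caN : ContinuousOn (fun p : ℝ × Sp d => ‖gradOn Ω (Φ p.1) p.2‖ ^ 2) (slab T Ω) :=
    (h.contDiffOn_field hΩ).continuousOn.norm.pow 2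
  have i1 := hS.integrable_rho_mom hΩ hT₁ cN (G := fun i p => -2 * U p.1 p.2 i)
    fun i => continuousOn_const.mul (h.velocity_coord i).continuousOn
  have i2 : IntegrableOn (fun t => (S t).kin Ω univ) (Ioo 0 T₁) :=
    (isCarriedFamily_bar hΩ hν continuous_fKin abs_fKin_le hS.mKin_mem.1).2.mono_set hsub
  have i3 : IntegrableOn (fun t => (S t).pot Ω univ) (Ioo 0 T₁) :=
    (isCarriedFamily_bar hΩ hν continuous_fPot abs_fPot_le hS.mPot_mem.1).2.mono_set hsub
  have i4 : IntegrableOn (fun t => ∫ x in Ω, 1 * ‖gradOn Ω (Φ t) x‖ ^ 2) (Ioo 0 T₁) :=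
    (((continuousOn_slab_integral_weight hΩ caN (w := fun _ => 1)
      (hΩ.integrableOn continuousOn_const)).mono
      (Icc_subset_Ico_right hT₁)).integrableOn_compact isCompact_Icc).mono_set Ioo_subset_Icc_self
  have i5 := hS.integrable_field hΩ hT₁ (G := fun i p => -2 * pdOn Ω (Φ p.1) i p.2)
    fun i => continuousOn_const.mul (ca i)
  refine ((i1.add i2).add ((i4.add i5).add i3)).congr ?_
  filter_upwards [ae_restrict_of_ae_restrict_of_subset hsub (hS.ae_isRegularState hΩ),
    ae_restrict_mem measurableSet_Ioo] with t hreg ht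
  have ht' : t ∈ Ico 0 T := ⟨ht.1.le, ht.2.trans hT₁⟩
  have e := integral_sum_mul hΩ (c := fun i x => -2 * pdOn Ω (Φ t) i x) hreg.integrableOn_field
    fun i => continuousOn_const.mul (continuousOn_slab_slice (ca i) ht')
  simp only [Pi.add_apply, relEnergy, relKinetic, relField, one_mul, ← e]
  congr 3
  exact sum_congr rfl fun i _ => by simp only [gradOn, mul_comm]

/-- Grönwall's inequality for the relative energy on `(0, T₁)` with `T₁ < T`, where the strong
solution is bounded together with its first derivatives. -/
lemma ae_relEnergy_nonpos_of_lt (hT₁0 : 0 < T₁) (hT₁ : T₁ < T)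
    (hS : IsDissipativeMVSolution T Ω V W ψ S₀ S) (hS₀ : S₀.NoConcentration)
    (hν₀ : ∀ᵐ x ∂(volume.restrict Ω),
      S₀.ν x = Measure.dirac ((Real.toNNReal (r 0 x), U 0 x), gradOn Ω (Φ 0) x)) :
    ∀ᵐ t ∂(volume.restrict (Ioo 0 T₁)), relEnergy Ω S U Φ t ≤ 0 := by
  have hT := hT₁0.trans hT₁
  have hsub : Ioo 0 T₁ ⊆ Ioo 0 T := Ioo_subset_Ioo_right hT₁.le
  obtain ⟨B, hB0, hB⟩ := h.exists_velocity_bound hΩ hT₁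
  obtain ⟨C, hC0, hC⟩ := relRate_le hΩ hV hW hψ hB0 (S₀.rho Ω univ)
  obtain ⟨i1, h1⟩ := h.relEnergy_le hΩ hV hW hψ hW_symm hT₁0 hT₁ hS hS₀ hν₀
  have i2 := h.integrable_relEnergy hΩ hT₁ hS
  obtain ⟨Ψ, hΨ, _, hG⟩ := hS.field_gradient
  have : IsFiniteMeasure (volume.restrict (cyl T Ω)) :=
    ⟨by rw [Measure.restrict_apply_univ]; exact volume_cyl_lt_top hΩ⟩
  have hΨ1 := ae_integrableOn_of_cyl (hΨ.integrable (by norm_num))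
  have hrate : ∀ᵐ t ∂(volume.restrict (Ioo 0 T₁)),
      rateAt T Ω V W ψ r U Φ S t ≤ C * relEnergy Ω S U Φ t := by
    filter_upwards [ae_restrict_of_ae_restrict_of_subset hsub (hS.ae_isRegularState hΩ),
      ae_restrict_of_ae_restrict_of_subset hsub hS.poisson,
      ae_restrict_of_ae_restrict_of_subset hsub hG,
      ae_restrict_of_ae_restrict_of_subset hsub hΨ1,
      ae_restrict_of_ae_restrict_of_subset hsub hS.ae_rho_univ,
      ae_restrict_mem measurableSet_Ioo] with t t1 t2 t3 t4 t5 ht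
    rw [(h.initial_avg hΩ hT hS₀ hν₀).1] at t2
    have hBt := hB t (Ioo_subset_Icc_self ht)
    exact hC (h.isSnapshot hΩ hV hW hψ hT (hsub ht)) t1 t2 t3 t4 t5.le
      (fun x hx => (hBt x hx).1) fun x hx => (hBt x hx).2
  refine ae_nonpos_of_le_integral (C := 2 * C) (by positivity) i2 ?_ ?_
  · filter_upwards [ae_restrict_of_ae_restrict_of_subset hsub (hS.ae_isRegularState hΩ),
      ae_restrict_mem measurableSet_Ioo] with t t1 ht
    have hs := h.isSnapshot hΩ hV hW hψ hT (hsub ht)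
    exact add_nonneg (t1.relKinetic_nonneg hΩ hs.velocity.continuousOn)
      (t1.relField_nonneg hΩ hs.field.continuousOn)
  · filter_upwards [h1, ae_restrict_mem measurableSet_Ioo] with τ t1 hτ
    have hsub' : Ioo 0 τ ⊆ Ioo 0 T₁ := Ioo_subset_Ioo_right hτ.2.le
    have := integral_mono_ae (i1.mono_set hsub') ((i2.mono_set hsub').const_mul C)
      (ae_restrict_of_ae_restrict_of_subset hsub' hrate)
    rw [integral_const_mul] at this
    linarith

/-- The relative energy of the measure-valued solution with respect to the strong solution
vanishes. -/
lemma ae_relEnergy_eq_zero (hT : 0 < T) (hS : IsDissipativeMVSolution T Ω V W ψ S₀ S)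
    (hS₀ : S₀.NoConcentration)
    (hν₀ : ∀ᵐ x ∂(volume.restrict Ω),
      S₀.ν x = Measure.dirac ((Real.toNNReal (r 0 x), U 0 x), gradOn Ω (Φ 0) x)) :
    ∀ᵐ t ∂(volume.restrict (Ioo 0 T)),
      relKinetic Ω (S t) (U t) = 0 ∧ relField Ω (S t) (gradOn Ω (Φ t)) = 0 := by
  have h1 : ∀ n : ℕ, ∀ᵐ t ∂(volume.restrict (Ioo 0 T)), t < T - T / (n + 2) →
      relEnergy Ω S U Φ t ≤ 0 := fun n => by
    have hn : (0 : ℝ) < n + 2 := by positivity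
    have h2 : T / (n + 2) < T := div_lt_self hT (by linarith [n.cast_nonneg (α := ℝ)])
    have h3 := h.ae_relEnergy_nonpos_of_lt hΩ hV hW hψ hW_symm (T₁ := T - T / (n + 2))
      (by linarith) (by linarith [div_pos hT hn]) hS hS₀ hν₀
    rw [ae_restrict_iff' measurableSet_Ioo] at h3 ⊢
    exact h3.mono fun t ht ht1 ht2 => ht ⟨ht1.1, ht2⟩
  filter_upwards [ae_all_iff.2 h1, hS.ae_isRegularState hΩ, ae_restrict_mem measurableSet_Ioo]
    with t t1 t2 ht
  obtain ⟨n, hn⟩ := exists_nat_gt (T / (T - t))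
  have hle : relEnergy Ω S U Φ t ≤ 0 := t1 n (by
    have hpos : 0 < T - t := sub_pos.2 ht.2
    have : T / (n + 2) < T - t := by
      rw [div_lt_iff₀ (by positivity)]
      rw [div_lt_iff₀ hpos] at hn
      nlinarith
    linarith)
  have hs := h.isSnapshot hΩ hV hW hψ hT ht
  have p1 := t2.relKinetic_nonneg hΩ hs.velocity.continuousOn
  have p2 := t2.relField_nonneg hΩ hs.field.continuousOn
  rw [relEnergy] at hle
  exact ⟨by linarith, by linarith⟩

end IsStrongSolution

/-! ### Identification of the state at a fixed time -/

section Identification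

variable {d : ℕ} {Ω : Set (Sp d)} {V W ψ : Sp d → ℝ} {M : ℝ} {S : MVState d} {r : Sp d → ℝ}
  {U Ut a at' : Sp d → Sp d} {Φt : Sp d → ℝ}

namespace IsRegularState

/-- Removing the oscillations leaves a regular state, whose barred quantities are the concentration
measures. -/
lemma concentration (h : IsRegularState Ω S) : IsRegularState Ω { S with ν := fun _ => 0 } where
  mass_le := by simp
  integrable_energy := ae_of_all _ fun _ => integrable_zero_measure
  integrableOn := by simp
  integrableOn_field := fun i => by
    change IntegrableOn (fun x => ∫ y, y.2 i ∂(0 : Measure (Phase d))) Ω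
    simp
  carried_mRho := h.carried_mRho
  carried_mMom := h.carried_mMom
  carried_mConv := h.carried_mConv
  carried_mKin := h.carried_mKin
  carried_mPot := h.carried_mPot
  carried_mStress := h.carried_mStress
  kin_nonneg := h.kin_nonneg
  pot_nonneg := h.pot_nonneg

/-- A vanishing relative field energy excludes oscillations and concentrations of the field. -/
lemma of_relField_eq_zero (h : IsRegularState Ω S) (hΩ : IsBoundedSmoothDomain Ω)
    (ha : ContinuousOn a (closure Ω)) (h0 : relField Ω S a = 0) :
    (∀ i j, S.mStress i j = 0) ∧ S.mPot = 0 ∧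
      ∀ᵐ x ∂(volume.restrict Ω), ∀ᵐ y ∂(S.ν x), y.2 = a x := by
  have cN : ContinuousOn (fun x => ‖a x‖ ^ 2) (closure Ω) := ha.norm.pow 2
  obtain ⟨q1, q2⟩ := h.sum_bar_pot hΩ (c₀ := fun x => ‖a x‖ ^ 2) (c₁ := fun i x => -2 * a x i)
    (c₂ := fun _ _ _ => 0) (c₃ := fun _ => 1) cN
    (fun i => continuousOn_const.mul (continuousOn_coord ha i)) (fun _ _ => continuousOn_const)
    continuousOn_const
  have key : ∀ x (y : Phase d), ‖a x‖ ^ 2 + (∑ i, -2 * a x i * y.2 i)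
      + (∑ i : Fin d, ∑ j : Fin d, (0 : ℝ) * (y.2 i * y.2 j)) + 1 * ‖y.2‖ ^ 2 = ‖y.2 - a x‖ ^ 2 :=
    fun x y => by rw [norm_sub_sq_eq]; simp
  simp only [key, signedIntegral_zero, signedIntegral_one, sum_const_zero, add_zero,
    zero_add] at q1 q2
  have hdef : relField Ω S a = (∫ x in Ω, ‖a x‖ ^ 2) + (∑ i, ∫ x in Ω, (-2 * a x i) * S.field i x)
    + S.pot Ω univ := rfl
  rw [← hdef, h0] at q2
  have hpos : ∀ᵐ x ∂(volume.restrict Ω), 0 ≤ (∫ y, ‖y.2 - a x‖ ^ 2 ∂(S.ν x))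
      + ‖a x‖ ^ 2 * (1 - (S.ν x).real univ) := by
    filter_upwards [h.mass_le] with x hx
    have : (S.ν x).real univ ≤ 1 := ENNReal.toReal_le_of_le_ofReal zero_le_one (by simpa using hx)
    exact add_nonneg (integral_nonneg fun y => by positivity)
      (mul_nonneg (by positivity) (by linarith))
  have hm : 0 ≤ S.mPot univ := by
    have := h.concentration.pot_univ_nonneg hΩ
    simpa [MVState.pot, bar, show (fun _ : Sp d => (0 : ℝ)) = 0 from rfl] using this
  have hI := integral_nonneg_of_ae hpos
  have hm0 : S.mPot univ = 0 := by linarith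
  have hI0 := (integral_eq_zero_iff_of_nonneg_ae hpos q1).1 (by linarith)
  refine ⟨fun i j => signedMeasure_ext fun f hf ⟨c, hc⟩ => ?_,
    signedMeasure_ext fun f hf ⟨c, hc⟩ => ?_, ?_⟩
  · have := h.concentration.abs_stress_le hΩ hf.continuousOn (fun x _ => hc x) i j
    simp only [MVState.pot, MVState.stress, bar, integral_zero_measure,
      show (fun _ : Sp d => (0 : ℝ)) = 0 from rfl, withDensityᵥ_zero, zero_add, hm0, mul_zero] at this
    simpa using this
  · have := h.concentration.abs_pot_le hΩ hf.continuousOn (fun x _ => hc x)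
    simp only [MVState.pot, bar, integral_zero_measure,
      show (fun _ : Sp d => (0 : ℝ)) = 0 from rfl, withDensityᵥ_zero, zero_add, hm0, mul_zero] at this
    simpa using this
  · filter_upwards [hI0, h.mass_le, h.integrable_energy] with x hx hmass hE
    have hfin : IsFiniteMeasure (S.ν x) := ⟨hmass.trans_lt ENNReal.one_lt_top⟩
    have hle : (S.ν x).real univ ≤ 1 :=
      ENNReal.toReal_le_of_le_ofReal zero_le_one (by simpa using hmass)
    have h1 : 0 ≤ ∫ y, ‖y.2 - a x‖ ^ 2 ∂(S.ν x) := integral_nonneg fun y => by positivity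
    have h2 : 0 ≤ ‖a x‖ ^ 2 * (1 - (S.ν x).real univ) := mul_nonneg (by positivity) (by linarith)
    have hx : (∫ y, ‖y.2 - a x‖ ^ 2 ∂(S.ν x)) + ‖a x‖ ^ 2 * (1 - (S.ν x).real univ) = 0 := hx
    have hint : Integrable (fun y : Phase d => ‖y.2 - a x‖ ^ 2) (S.ν x) := by
      refine ((hE.const_mul 2).add (integrable_const (2 * ‖a x‖ ^ 2))).mono'
        (by fun_prop) (ae_of_all _ fun y => ?_)
      rw [Real.norm_of_nonneg (by positivity)]
      have e1 := norm_sub_le y.2 (a x)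
      have e2 := (le_abs_self _).trans (abs_fPot_le y)
      simp only [fPot, Pi.add_apply] at e2 ⊢
      nlinarith [sq_nonneg (‖y.2‖ - ‖a x‖), norm_nonneg (y.2 - a x), norm_nonneg y.2,
        norm_nonneg (a x)]
    filter_upwards [(integral_eq_zero_iff_of_nonneg (fun y => by positivity) hint).1 (by linarith)]
      with y hy
    exact sub_eq_zero.1 (norm_eq_zero.1 (pow_eq_zero_iff two_ne_zero |>.1 hy))

/-- A vanishing relative kinetic energy excludes oscillations of the velocity away from vacuum. -/
lemma velocity_eq_of_relKinetic_eq_zero (h : IsRegularState Ω S) (hΩ : IsBoundedSmoothDomain Ω)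
    (hU : ContinuousOn U (closure Ω)) (h0 : relKinetic Ω S U = 0) :
    ∀ᵐ x ∂(volume.restrict Ω), ∀ᵐ y ∂(S.ν x), 0 < y.1.1 → y.1.2 = U x := by
  have cN : ContinuousOn (fun x => ‖U x‖ ^ 2) (closure Ω) := hU.norm.pow 2
  have cU := fun i => (continuousOn_const (c := (-2 : ℝ))).fun_mul (continuousOn_coord hU i)
  have cz : ∀ i j : Fin d, ContinuousOn (fun _ : Sp d => (0 : ℝ)) (closure Ω) :=
    fun _ _ => continuousOn_const
  have c1 : ContinuousOn (fun _ : Sp d => (1 : ℝ)) (closure Ω) := continuousOn_const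
  have key : ∀ x (v : Sp d), ‖U x‖ ^ 2 + (∑ i, -2 * U x i * v i)
      + (∑ i : Fin d, ∑ j : Fin d, (0 : ℝ) * (v i * v j)) + 1 * ‖v‖ ^ 2 = ‖v - U x‖ ^ 2 :=
    fun x v => by rw [norm_sub_sq_eq]; simp
  have q1 := (h.sum_integral_kin hΩ cN cU cz c1).1
  have q2 := h.sum_bar_kin hΩ cN cU cz c1
  have q3 := h.kin_nonneg _ _ _ _ cN cU cz c1 fun x _ v => by rw [key]; positivity
  simp only [key, signedIntegral_zero, signedIntegral_one, sum_const_zero, add_zero]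
    at q1 q2 q3
  have hdef : relKinetic Ω S U = (∫ᵛ x, ‖U x‖ ^ 2 ∂•(S.rho Ω))
    + (∑ i, ∫ᵛ x, (-2 * U x i) ∂•(S.mom Ω i)) + S.kin Ω univ := rfl
  rw [← hdef, h0] at q2
  have hpos : ∀ x, 0 ≤ ∫ y : Phase d, (y.1.1 : ℝ) * ‖y.1.2 - U x‖ ^ 2 ∂(S.ν x) := fun x =>
    integral_nonneg fun y => by positivity
  have hI : 0 ≤ ∫ x in Ω, ∫ y : Phase d, (y.1.1 : ℝ) * ‖y.1.2 - U x‖ ^ 2 ∂(S.ν x) :=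
    integral_nonneg hpos
  have hI0 := (integral_eq_zero_iff_of_nonneg hpos q1).1 (by linarith)
  filter_upwards [hI0, h.integrable_energy] with x hx hE
  have hint : Integrable (fun y : Phase d => (y.1.1 : ℝ) * ‖y.1.2 - U x‖ ^ 2) (S.ν x) := by
    refine (hE.const_mul (2 + 2 * ‖U x‖ ^ 2)).mono' (by fun_prop) (ae_of_all _ fun y => ?_)
    rw [Real.norm_of_nonneg (by positivity)]
    have e1 := norm_sub_le y.1.2 (U x)
    have e2 : ‖y.1.2 - U x‖ ^ 2 ≤ 2 * ‖y.1.2‖ ^ 2 + 2 * ‖U x‖ ^ 2 := by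
      nlinarith [sq_nonneg (‖y.1.2‖ - ‖U x‖), norm_nonneg (y.1.2 - U x), norm_nonneg y.1.2,
        norm_nonneg (U x)]
    have e3 := mul_le_mul_of_nonneg_left e2 (y.1.1.coe_nonneg)
    have e4 := fRho_nonneg y
    have e5 := fKin_nonneg y
    have e6 := fPot_nonneg y
    simp only [fEnergy, fRho, fKin, fPot] at e4 e5 e6 ⊢
    nlinarith [mul_nonneg (sq_nonneg ‖U x‖) e5, mul_nonneg (sq_nonneg ‖U x‖) e6]
  filter_upwards [(integral_eq_zero_iff_of_nonneg (fun y => by positivity) hint).1 hx] with y hy hs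
  have hs' : (y.1.1 : ℝ) ≠ 0 := by exact_mod_cast hs.ne'
  exact sub_eq_zero.1 (norm_eq_zero.1 (pow_eq_zero_iff two_ne_zero |>.1
    ((mul_eq_zero.1 hy).resolve_left hs')))

end IsRegularState

/-- A signed measure on `closure Ω` is determined by its values on `C¹` functions. -/
lemma signedMeasure_ext_of_contDiff (hΩ : IsBoundedSmoothDomain Ω) {μ ν : SignedMeasure (Sp d)}
    (hμ : μ.totalVariation (closure Ω)ᶜ = 0) (hν : ν.totalVariation (closure Ω)ᶜ = 0)
    (h : ∀ θ : Sp d → ℝ, ContDiff ℝ 1 θ → ∫ᵛ x, θ x ∂•μ = ∫ᵛ x, θ x ∂•ν) : μ = ν := by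
  have hK := hΩ.isCompact_closure
  refine signedMeasure_ext fun f hf _ => eq_of_forall_abs_sub_le
    (C := (μ.totalVariation univ).toReal + (ν.totalVariation univ).toReal) fun ε hε => ?_
  obtain ⟨g, hg, hgf⟩ := (mem_closure_iff_nhds_basis (nhds_basis_uniformity
    Metric.uniformity_basis_dist.compactConvergenceUniformity)).1
    (ContinuousMap.dense_setOfPred_contDiff (⟨f, hf⟩ : C(Sp d, ℝ))) (closure Ω, ε) ⟨hK, hε⟩
  have hb : ∀ x ∈ closure Ω, |f x - g x| ≤ ε := fun x hx => by
    have : dist (g x) (f x) < ε := hgf x hx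
    rw [dist_comm] at this
    exact this.le
  have hg : ContDiff ℝ ∞ g := hg
  have e1 := signedIntegral_sub hK hμ hf.continuousOn g.continuous.continuousOn
  have e2 := signedIntegral_sub hK hν hf.continuousOn g.continuous.continuousOn
  have b1 := abs_signedIntegral_le hμ hb
  have b2 := abs_signedIntegral_le hν hb
  rw [e1, h g (hg.of_le (by simp))] at b1
  rw [e2] at b2
  calc _ = |((∫ᵛ x, f x ∂•μ) - ∫ᵛ x, g x ∂•ν) - ((∫ᵛ x, f x ∂•ν) - ∫ᵛ x, g x ∂•ν)| := by
        congr 1; ring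
    _ ≤ _ := (abs_sub _ _).trans (by linarith)

/-- The barred quantities of a state whose relative energy vanishes. -/
lemma IsSnapshot.bar_eq (hs : IsSnapshot Ω V W ψ M r U Ut a at' Φt)
    (hΩ : IsBoundedSmoothDomain Ω) (h : IsRegularState Ω S) (hP : IsPoissonState Ω M S)
    (hk : relKinetic Ω S U = 0) (hf : relField Ω S a = 0) :
    S.rho Ω = (volume.restrict Ω).withDensityᵥ r ∧
    (∀ i, S.mom Ω i = (volume.restrict Ω).withDensityᵥ fun x => r x * U x i) ∧
    (∀ i j, S.conv Ω i j = (volume.restrict Ω).withDensityᵥ fun x => r x * (U x i * U x j)) ∧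
    S.kin Ω = (volume.restrict Ω).withDensityᵥ fun x => r x * ‖U x‖ ^ 2 := by
  have cr := hs.density
  have cU := continuousOn_coord hs.velocity.continuousOn
  have cN : ContinuousOn (fun x => ‖U x‖ ^ 2) (closure Ω) := hs.velocity.continuousOn.norm.pow 2
  have int : ∀ {f : Sp d → ℝ}, ContinuousOn f (closure Ω) → IntegrableOn f Ω := fun hf =>
    hΩ.integrableOn hf
  have hρ : S.rho Ω = (volume.restrict Ω).withDensityᵥ r := by
    refine signedMeasure_ext_of_contDiff hΩ (h.carried_rho hΩ) (carried_withDensityᵥ hΩ _)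
      fun θ hθ => ?_
    have cp : ContinuousOn (fun x => ∑ i, |pdOn Ω θ i x|) (closure Ω) :=
      continuousOn_finsetSum _ fun i _ => (continuousOn_pdOn hΩ hθ.contDiffOn i).abs
    obtain ⟨L, -, hL⟩ := hΩ.exists_bound cp
    have := hs.sq_relDensity_le hΩ h hP hθ.contDiffOn (L := L) fun x hx i =>
      (Finset.single_le_sum (f := fun i => |pdOn Ω θ i x|) (fun i _ => abs_nonneg _)
        (Finset.mem_univ i)).trans ((le_abs_self _).trans (hL x hx))
    rw [hf, zero_mul] at this
    rw [signedIntegral_density hΩ (int cr) hθ.continuous.continuousOn]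
    exact sub_eq_zero.1 (pow_eq_zero_iff two_ne_zero |>.1 (le_antisymm this (sq_nonneg _)))
  have hJ : ∀ i, S.mom Ω i = (volume.restrict Ω).withDensityᵥ fun x => r x * U x i := fun i => by
    refine signedMeasure_ext fun f hf ⟨c, hc⟩ => ?_
    have := h.sq_relMomentum_le hΩ hs.velocity.continuousOn hf.continuousOn (fun x _ => hc x) i
    rw [hk, zero_mul] at this
    rw [sub_eq_zero.1 (pow_eq_zero_iff two_ne_zero |>.1 (le_antisymm this (sq_nonneg _))), hρ,
      signedIntegral_density hΩ (int cr) (hf.continuousOn.fun_mul (cU i)),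
      signedIntegral_density hΩ (int (cr.fun_mul (cU i))) hf.continuousOn]
    exact integral_congr_ae (ae_of_all _ fun x => by ring)
  refine ⟨hρ, hJ, fun i j => ?_, ?_⟩
  · refine signedMeasure_ext fun f hf ⟨c, hc⟩ => ?_
    have := h.abs_relConv_le hΩ hs.velocity.continuousOn hf.continuousOn (fun x _ => hc x) i j
    have cij := cr.fun_mul ((cU i).fun_mul (cU j))
    have e1 : ∫ x in Ω, f x * U x j * (r x * U x i) = ∫ x in Ω, f x * (r x * (U x i * U x j)) :=
      integral_congr_ae (ae_of_all _ fun x => by ring)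
    have e2 : ∫ x in Ω, f x * U x i * (r x * U x j) = ∫ x in Ω, f x * (r x * (U x i * U x j)) :=
      integral_congr_ae (ae_of_all _ fun x => by ring)
    have e3 : ∫ x in Ω, f x * (U x i * U x j) * r x = ∫ x in Ω, f x * (r x * (U x i * U x j)) :=
      integral_congr_ae (ae_of_all _ fun x => by ring)
    rw [hk, mul_zero, hρ, hJ i, hJ j,
      signedIntegral_density hΩ (int (cr.fun_mul (cU i))) (hf.continuousOn.fun_mul (cU j)),
      signedIntegral_density hΩ (int (cr.fun_mul (cU j))) (hf.continuousOn.fun_mul (cU i)),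
      signedIntegral_density hΩ (int cr) (hf.continuousOn.fun_mul ((cU i).fun_mul (cU j))),
      e1, e2, e3] at this
    rw [signedIntegral_density hΩ (int cij) hf.continuousOn]
    linarith [abs_nonpos_iff.1 this]
  · refine signedMeasure_ext fun f hf ⟨c, hc⟩ => ?_
    have := h.abs_relKin_le hΩ hs.velocity.continuousOn hf.continuousOn (fun x _ => hc x)
    have cfU := fun i => hf.continuousOn (s := closure Ω) |>.fun_mul
      ((continuousOn_const (c := (-2 : ℝ))).fun_mul (cU i))
    have e1 : ∀ i, ∫ᵛ x, f x * (-2 * U x i) ∂•(S.mom Ω i)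
        = ∫ x in Ω, f x * (-2 * U x i) * (r x * U x i) := fun i => by
      rw [hJ i, signedIntegral_density hΩ (int (cr.fun_mul (cU i))) (cfU i)]
    have e2 : ∑ i, ∫ x in Ω, f x * (-2 * U x i) * (r x * U x i)
        = -2 * ∫ x in Ω, f x * (r x * ‖U x‖ ^ 2) := by
      rw [← integral_finsetSum _ fun i _ => int ((cfU i).fun_mul (cr.fun_mul (cU i))),
        ← integral_const_mul]
      refine integral_congr_ae (ae_of_all _ fun x => ?_)
      simp only [EuclideanSpace.real_norm_sq_eq, mul_sum]
      exact sum_congr rfl fun i _ => by ring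
    have e3 : ∫ x in Ω, f x * ‖U x‖ ^ 2 * r x = ∫ x in Ω, f x * (r x * ‖U x‖ ^ 2) :=
      integral_congr_ae (ae_of_all _ fun x => by ring)
    simp only [e1] at this
    rw [hk, mul_zero, e2, hρ, signedIntegral_density hΩ (int cr) (hf.continuousOn.fun_mul cN),
      e3] at this
    rw [signedIntegral_density hΩ (int (cr.fun_mul cN)) hf.continuousOn]
    linarith [abs_nonpos_iff.1 this]

/-- A concentration measure is absolutely continuous when the corresponding barred quantity is. -/
lemma absolutelyContinuous_of_bar_eq {ν : Sp d → Measure (Phase d)} {f : Phase d → ℝ}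
    {m : SignedMeasure (Sp d)} {g : Sp d → ℝ} (hf : IntegrableOn (fun x => ∫ y, f y ∂(ν x)) Ω)
    (hg : IntegrableOn g Ω) (h : bar Ω ν f m = (volume.restrict Ω).withDensityᵥ g) :
    m.totalVariation ≪ volume := by
  have hm : m = (volume.restrict Ω).withDensityᵥ (g - fun x => ∫ y, f y ∂(ν x)) := by
    rw [withDensityᵥ_sub hg hf, ← h, bar, add_sub_cancel_left]
  have := (SignedMeasure.absolutelyContinuous_ennreal_iff _ _).1
    (Measure.withDensityᵥ_absolutelyContinuous (volume.restrict Ω)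
      (g - fun x => ∫ y, f y ∂(ν x)))
  rw [← hm, VectorMeasure.ennrealToMeasure_toENNRealVectorMeasure] at this
  exact this.trans Measure.restrict_le_self.absolutelyContinuous

end Identification

/-! ### Disintegration of the Young measure -/

section Disintegration

lemma eq_prod_dirac_of_ae {α β : Type*} [MeasurableSpace α] [MeasurableSpace β]
    {μ : Measure (α × β)} [SFinite μ] {b : β} (h : ∀ᵐ y ∂μ, y.2 = b) :
    μ = (μ.map Prod.fst).prod (Measure.dirac b) := by
  rw [Measure.prod_dirac, Measure.map_map (by fun_prop) measurable_fst]
  conv_lhs => rw [← Measure.map_id (μ := μ)]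
  exact Measure.map_congr (h.mono fun y hy => Prod.ext rfl hy)

variable {d : ℕ} {Ω : Set (Sp d)} {T : ℝ} {ν : ℝ → Sp d → Measure (Phase d)}

lemma ae_cyl_eq_zero_of_ae_ae {g : ℝ × Sp d → ℝ}
    (hg : AEStronglyMeasurable g (volume.restrict (cyl T Ω)))
    (h : ∀ᵐ t ∂(volume.restrict (Ioo 0 T)), ∀ᵐ x ∂(volume.restrict Ω), g (t, x) = 0) :
    ∀ᵐ p ∂(volume.restrict (cyl T Ω)), g p = 0 := by
  have hms := measurableSet_eq_fun hg.stronglyMeasurable_mk.measurable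
    (measurable_const (a := (0 : ℝ)))
  have h1 : ∀ᵐ p ∂(volume.restrict (cyl T Ω)), hg.mk g p = 0 := by
    have h2 := Measure.ae_prod_iff_ae_ae (μ := volume.restrict (Ioo 0 T))
      (ν := volume.restrict Ω) hms
    rw [← restrict_cyl_eq_prod] at h2
    refine h2.2 ?_
    filter_upwards [h, ae_ae_of_ae_cyl hg.ae_eq_mk] with t t1 t2
    filter_upwards [t1, t2] with x x1 x2
    rw [← x2, x1]
  filter_upwards [h1, hg.ae_eq_mk] with p p1 p2
  rw [p2, p1]

/-- A nonnegative quadratic polynomial in a coefficient `c t x` which vanishes `ν t x`-almost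
everywhere for almost every `t` and almost every `x` does so for almost every `(t, x)`. The point is
the measurability in `(t, x)`. -/
lemma ae_cyl_ae_eq_zero (hν : IsParamMeasure T Ω ν) {f g h : Phase d → ℝ} (hf : Continuous f)
    (hg : Continuous g) (hh : Continuous h)
    (hi : ∀ᵐ p ∂(volume.restrict (cyl T Ω)), Integrable f (ν p.1 p.2) ∧
      Integrable g (ν p.1 p.2) ∧ Integrable h (ν p.1 p.2)) {c : ℝ × Sp d → ℝ}
    (hc : AEStronglyMeasurable c (volume.restrict (cyl T Ω)))
    (hpos : ∀ y (z : ℝ), 0 ≤ f y + z * g y + z ^ 2 * h y)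
    (h0 : ∀ᵐ t ∂(volume.restrict (Ioo 0 T)), ∀ᵐ x ∂(volume.restrict Ω), ∀ᵐ y ∂(ν t x),
      f y + c (t, x) * g y + c (t, x) ^ 2 * h y = 0) :
    ∀ᵐ p ∂(volume.restrict (cyl T Ω)), ∀ᵐ y ∂(ν p.1 p.2), f y + c p * g y + c p ^ 2 * h y = 0 := by
  have hmeas : AEStronglyMeasurable (fun p => (∫ y, f y ∂(ν p.1 p.2)) + c p * (∫ y, g y ∂(ν p.1 p.2))
      + c p ^ 2 * ∫ y, h y ∂(ν p.1 p.2)) (volume.restrict (cyl T Ω)) :=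
    ((hν.aestronglyMeasurable_integral hf (hi.mono fun p hp => hp.1)).add
      (hc.mul (hν.aestronglyMeasurable_integral hg (hi.mono fun p hp => hp.2.1)))).add
      ((hc.pow 2).mul (hν.aestronglyMeasurable_integral hh (hi.mono fun p hp => hp.2.2)))
  have hae : ∀ᵐ p ∂(volume.restrict (cyl T Ω)), (∫ y, f y ∂(ν p.1 p.2))
      + c p * (∫ y, g y ∂(ν p.1 p.2)) + c p ^ 2 * ∫ y, h y ∂(ν p.1 p.2)
      = ∫ y, (f y + c p * g y + c p ^ 2 * h y) ∂(ν p.1 p.2) := by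
    filter_upwards [hi] with p ⟨p1, p2, p3⟩
    have p12 : Integrable (fun y => f y + c p * g y) (ν p.1 p.2) := p1.add (p2.const_mul _)
    rw [integral_add p12 (p3.const_mul _), integral_add p1 (p2.const_mul _),
      integral_const_mul, integral_const_mul]
  have hz := ae_cyl_eq_zero_of_ae_ae hmeas (by
    filter_upwards [h0, ae_ae_of_ae_cyl hae] with t t1 t2
    filter_upwards [t1, t2] with x x1 x2
    rw [x2]
    exact integral_eq_zero_of_ae x1)
  filter_upwards [hz, hae, hi] with p p1 p2 ⟨p3, p4, p5⟩
  rw [p2] at p1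
  exact (integral_eq_zero_iff_of_nonneg (fun y => hpos y _)
    ((p3.add (p4.const_mul _)).add (p5.const_mul _))).1 p1

/-- The distribution of density and velocity. -/
lemma IsParamMeasure.map_fst (hν : IsParamMeasure T Ω ν) :
    IsParamMeasure T Ω fun t x => (ν t x).map Prod.fst where
  measurable f := by
    have : ∀ m : Measure (Phase d), ∫ z, f z ∂(m.map Prod.fst) = ∫ y, f y.1 ∂m := fun m =>
      integral_map measurable_fst.aemeasurable f.continuous.aestronglyMeasurable
    simp only [this]
    refine hν.aestronglyMeasurable_integral (f.continuous.comp continuous_fst) ?_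
    filter_upwards [hν.ae_isFiniteMeasure] with p hp
    exact (integrable_zeroAtInfty _ f).comp_measurable measurable_fst
  mass_le := hν.mass_le.mono fun p hp => by rwa [Measure.map_apply measurable_fst .univ]

/-- Extending by zero turns a function vanishing at infinity on `(0, ∞)` into a continuous function
on `[0, ∞)`. -/
lemma exists_continuous_extension (f : C₀(Ioi (0 : ℝ≥0), ℝ)) :
    ∃ F : ℝ≥0 → ℝ, Continuous F ∧ (∃ C, ∀ s, |F s| ≤ C) ∧ (∀ z : Ioi (0 : ℝ≥0), F z = f z) ∧
      F 0 = 0 := by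
  classical
  set F : ℝ≥0 → ℝ := fun s => if hs : 0 < s then f ⟨s, hs⟩ else 0 with hF
  have hval : ∀ z : Ioi (0 : ℝ≥0), F z = f z := fun z => dif_pos z.2
  have h0 : F 0 = 0 := dif_neg (lt_irrefl _)
  obtain ⟨C, hC⟩ : ∃ C, ∀ z, |f z| ≤ C := ⟨‖f.toBCF‖, fun z => f.toBCF.norm_coe_le_norm z⟩
  have hcont : Continuous F := by
    refine continuous_iff_continuousAt.2 fun s => ?_
    rcases eq_or_ne s 0 with rfl | hs
    · rw [ContinuousAt, h0, Metric.tendsto_nhds]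
      intro ε hε
      have hev := (Metric.tendsto_nhds.1 f.zero_at_infty') ε hε
      obtain ⟨K, hK, hKs⟩ := mem_cocompact.1 hev
      have hK' : IsCompact (Subtype.val '' K) := hK.image continuous_subtype_val
      have h1 : (Subtype.val '' K)ᶜ ∈ 𝓝 (0 : ℝ≥0) := hK'.isClosed.isOpen_compl.mem_nhds
        fun ⟨z, _, hz⟩ => (z.2 : (0 : ℝ≥0) < z).ne' hz
      filter_upwards [h1] with s hs
      rcases eq_or_ne s 0 with rfl | hs0
      · rwa [h0, dist_self]
      · have hpos : 0 < s := pos_iff_ne_zero.2 hs0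
        rw [hval ⟨s, hpos⟩]
        exact hKs fun hmem => hs ⟨_, hmem, rfl⟩
    · have hpos : 0 < s := pos_iff_ne_zero.2 hs
      refine (isOpen_Ioi.isOpenEmbedding_subtypeVal.continuousAt_iff (x := ⟨s, hpos⟩)).1 ?_
      rw [show F ∘ Subtype.val = f from funext hval]
      exact f.continuous.continuousAt
  refine ⟨F, hcont, ⟨C, fun s => ?_⟩, hval, h0⟩
  rcases eq_or_ne s 0 with rfl | hs
  · rw [h0, abs_zero]; exact (abs_nonneg _).trans (hC ⟨1, mem_Ioi.2 zero_lt_one⟩)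
  · rw [hval ⟨s, pos_iff_ne_zero.2 hs⟩]; exact hC _

/-- The distribution of the positive densities. -/
lemma IsParamMeasure.comap_density (hν : IsParamMeasure T Ω ν) : IsParamMeasure T Ω fun t x =>
    (((ν t x).map Prod.fst).map Prod.fst).comap (Subtype.val : Ioi (0 : ℝ≥0) → ℝ≥0) where
  measurable f := by
    obtain ⟨F, hF, ⟨C, hC⟩, hFf, hF0⟩ := exists_continuous_extension f
    have : ∀ m : Measure (Phase d), ∫ z, f z ∂(((m.map Prod.fst).map Prod.fst).comap
        (Subtype.val : Ioi (0 : ℝ≥0) → ℝ≥0)) = ∫ y, F y.1.1 ∂m := fun m => by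
      simp only [← hFf]
      rw [integral_subtype_comap measurableSet_Ioi, setIntegral_eq_integral_of_forall_compl_eq_zero,
        integral_map measurable_fst.aemeasurable hF.aestronglyMeasurable,
        integral_map measurable_fst.aemeasurable
          (show Continuous fun x : ℝ≥0 × Sp d => F x.1 from
            hF.comp continuous_fst).aestronglyMeasurable]
      intro s hs
      rw [mem_Ioi, pos_iff_ne_zero, not_not] at hs
      rw [hs, hF0]
    simp only [this]
    have hFc : Continuous fun y : Phase d => F y.1.1 := hF.comp (continuous_fst.comp continuous_fst)
    refine hν.aestronglyMeasurable_integral hFc ?_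
    filter_upwards [hν.ae_isFiniteMeasure] with p hp
    exact Integrable.of_bound hFc.aestronglyMeasurable C (ae_of_all _ fun y => hC _)
  mass_le := hν.map_fst.mass_le.mono fun p hp => by
    rw [comap_subtype_coe_apply measurableSet_Ioi, Measure.map_apply measurable_fst]
    · exact (measure_mono (subset_univ _)).trans hp
    · rw [image_univ, Subtype.range_coe]; exact measurableSet_Ioi

lemma restrict_eq_prod_dirac {d : ℕ} {m : Measure (ℝ≥0 × Sp d)} [SFinite m] {u : Sp d}
    (h : ∀ᵐ y ∂m, 0 < y.1 → y.2 = u) : m.restrict {y | 0 < y.1}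
      = (((m.map Prod.fst).comap (Subtype.val : Ioi (0 : ℝ≥0) → ℝ≥0)).map Subtype.val).prod
        (Measure.dirac u) := by
  rw [map_comap_subtype_coe measurableSet_Ioi, Measure.restrict_map measurable_fst measurableSet_Ioi]
  exact eq_prod_dirac_of_ae ((ae_restrict_iff' (measurable_fst measurableSet_Ioi)).2 h)

variable {V W ψ : Sp d → ℝ} {r : ℝ → Sp d → ℝ} {U : ℝ → Sp d → Sp d} {Φ : ℝ → Sp d → ℝ}
  {S₀ : MVState d} {S : ℝ → MVState d}

/-- When the relative energy vanishes, the Young measure is supported where the field agrees with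
that of the strong solution and, away from vacuum, so does the velocity. -/
lemma IsStrongSolution.ae_cyl_support (h : IsStrongSolution T Ω V W ψ r U Φ)
    (hΩ : IsBoundedSmoothDomain Ω) (hS : IsDissipativeMVSolution T Ω V W ψ S₀ S)
    (h0 : ∀ᵐ t ∂(volume.restrict (Ioo 0 T)),
      relKinetic Ω (S t) (U t) = 0 ∧ relField Ω (S t) (gradOn Ω (Φ t)) = 0) :
    ∀ᵐ p ∂(volume.restrict (cyl T Ω)), IsFiniteMeasure ((S p.1).ν p.2) ∧
      (∀ᵐ y ∂((S p.1).ν p.2), y.2 = gradOn Ω (Φ p.1) p.2) ∧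
      ∀ᵐ y ∂((S p.1).ν p.2), 0 < y.1.1 → y.1.2 = U p.1 p.2 := by
  have hν := hS.isFiniteEnergyYoung hΩ
  have hfin := hν.param.ae_isFiniteMeasure
  have hm : ∀ {c : ℝ × Sp d → ℝ}, ContinuousOn c (slab T Ω) →
      AEStronglyMeasurable c (volume.restrict (cyl T Ω)) := fun hc =>
    (hc.mono cyl_subset_slab).aestronglyMeasurable (measurableSet_cyl hΩ)
  have hF : ∀ i, ∀ᵐ p ∂(volume.restrict (cyl T Ω)), ∀ᵐ y ∂((S p.1).ν p.2),
      fStress i i y + gradOn Ω (Φ p.1) p.2 i * (-2 * y.2 i) + gradOn Ω (Φ p.1) p.2 i ^ 2 * 1 = 0 :=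
    fun i => by
    refine ae_cyl_ae_eq_zero (h := fun _ => 1) (g := fun y => -2 * y.2 i)
      (c := fun p => gradOn Ω (Φ p.1) p.2 i) hν.param
      (continuous_fStress i i) (by fun_prop) continuous_const ?_
      (hm (contDiffOn_pdOn_slab hΩ h.potential_C2 i).continuousOn)
      (fun y z => by simp only [fStress]; nlinarith [sq_nonneg (y.2 i - z)]) ?_
    · filter_upwards [hfin, hν.ae_integrable continuous_fPot abs_fPot_le,
        hν.ae_integrable (continuous_fStress i i) (abs_fStress_le i i)] with p p1 p2 p3
      refine ⟨p3, ?_, integrable_const _⟩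
      refine (p2.add (integrable_const 1)).mono' (by fun_prop) (ae_of_all _ fun y => ?_)
      have h1 := sq_coord_le y.2 i
      rw [Real.norm_eq_abs, abs_le, Pi.add_apply, fPot]
      constructor <;> nlinarith [sq_nonneg (y.2 i + 1), sq_nonneg (y.2 i - 1)]
    · filter_upwards [h0, hS.ae_isRegularState hΩ, ae_restrict_mem measurableSet_Ioo]
        with t t1 t2 ht
      have ca := (contDiffOn_slice (f := fun s => gradOn Ω (Φ s)) (h.contDiffOn_field hΩ)
        (Ioo_subset_Ico_self ht)).continuousOn
      filter_upwards [(t2.of_relField_eq_zero hΩ ca t1.2).2.2] with x hx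
      filter_upwards [hx] with y hy
      rw [fStress, hy]
      ring
  have hU : ∀ i, ∀ᵐ p ∂(volume.restrict (cyl T Ω)), ∀ᵐ y ∂((S p.1).ν p.2),
      fConv i i y + U p.1 p.2 i * (-2 * fMom i y) + U p.1 p.2 i ^ 2 * fRho y = 0 := fun i => by
    refine ae_cyl_ae_eq_zero (g := fun y => -2 * fMom i y) (c := fun p => U p.1 p.2 i) hν.param
      (continuous_fConv i i) (continuous_const.mul (continuous_fMom i)) continuous_fRho ?_
      (hm (h.velocity_coord i).continuousOn) (fun y z => ?_) ?_
    · filter_upwards [hν.ae_integrable continuous_fRho abs_fRho_le,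
        hν.ae_integrable (continuous_fMom i) (abs_fMom_le i),
        hν.ae_integrable (continuous_fConv i i) (abs_fConv_le i i)] with p p1 p2 p3
      exact ⟨p3, p2.const_mul _, p1⟩
    · have := mul_nonneg (fRho_nonneg y) (sq_nonneg (y.1.2 i - z))
      simp only [fConv, fMom, fRho] at this ⊢
      nlinarith
    · filter_upwards [h0, hS.ae_isRegularState hΩ, ae_restrict_mem measurableSet_Ioo]
        with t t1 t2 ht
      have cU := (contDiffOn_slice h.velocity_C1 (Ioo_subset_Ico_self ht)).continuousOn
      filter_upwards [t2.velocity_eq_of_relKinetic_eq_zero hΩ cU t1.1] with x hx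
      filter_upwards [hx] with y hy
      simp only [fConv, fMom, fRho]
      rcases eq_or_ne y.1.1 0 with hs | hs
      · simp [hs]
      · rw [hy (pos_iff_ne_zero.2 hs)]
        ring
  filter_upwards [hfin, ae_all_iff.2 hF, ae_all_iff.2 hU] with p p1 p2 p3
  refine ⟨p1, ?_, ?_⟩
  · filter_upwards [ae_all_iff.2 p2] with y hy
    ext i
    have := hy i
    rw [fStress] at this
    exact sub_eq_zero.1 (pow_eq_zero_iff two_ne_zero |>.1
      (by linear_combination this : (y.2 i - gradOn Ω (Φ p.1) p.2 i) ^ 2 = 0))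
  · filter_upwards [ae_all_iff.2 p3] with y hy hs
    ext i
    have := hy i
    simp only [fConv, fMom, fRho] at this
    have hs' : (y.1.1 : ℝ) ≠ 0 := by exact_mod_cast hs.ne'
    refine sub_eq_zero.1 (pow_eq_zero_iff two_ne_zero |>.1 ((mul_eq_zero.1
      (by linear_combination this : (y.1.1 : ℝ) * (y.1.2 i - U p.1 p.2 i) ^ 2 = 0)).resolve_left hs'))

end Disintegration

end EulerAlignment

end

theorem mainTheorem3 (d : ℕ) (hd₁ : 1 ≤ d) (hd₃ : d ≤ 3) (T : ℝ) (hT : 0 < T)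
    (Ω : Set (Sp d)) (hΩ : IsBoundedSmoothDomain Ω)
    (V W ψ : Sp d → ℝ) (hV : ContDiff ℝ ∞ V) (hW : ContDiff ℝ ∞ W) (hψ : ContDiff ℝ ∞ ψ)
    (hW_symm : ∀ x, W (-x) = W x) (hψ_symm : ∀ x, ψ (-x) = ψ x)
    (r : ℝ → Sp d → ℝ) (U : ℝ → Sp d → Sp d) (Φ : ℝ → Sp d → ℝ)
    (hstrong : IsStrongSolution T Ω V W ψ r U Φ)
    (S₀ : MVState d) (S : ℝ → MVState d)
    (hS : IsDissipativeMVSolution T Ω V W ψ S₀ S)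
    (hS₀ : S₀.NoConcentration)
    (hν₀ : ∀ᵐ x ∂(volume.restrict Ω),
      S₀.ν x = Measure.dirac ((Real.toNNReal (r 0 x), U 0 x), gradOn Ω (Φ 0) x)) :
    (∀ᵐ t ∂(volume.restrict (Ioo 0 T)),
      (∀ i j, (S t).mStress i j = 0) ∧ (S t).mPot = 0 ∧
      (S t).rho Ω = (volume.restrict Ω).withDensityᵥ (r t) ∧
      (∀ i, (S t).mom Ω i = (volume.restrict Ω).withDensityᵥ (fun x => r t x * U t x i)) ∧
      (∀ i j, (S t).conv Ω i j =
        (volume.restrict Ω).withDensityᵥ (fun x => r t x * (U t x i * U t x j))) ∧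
      (S t).kin Ω = (volume.restrict Ω).withDensityᵥ (fun x => r t x * ‖U t x‖ ^ 2) ∧
      (S t).mRho.totalVariation ≪ volume ∧
      (∀ i, ((S t).mMom i).totalVariation ≪ volume) ∧
      (∀ i j, ((S t).mConv i j).totalVariation ≪ volume) ∧
      (S t).mKin.totalVariation ≪ volume) ∧
    ∃ νb : ℝ → Sp d → Measure (ℝ≥0 × Sp d), IsParamMeasure T Ω νb ∧
      (∀ᵐ p ∂(volume.restrict (cyl T Ω)),
        (S p.1).ν p.2 = (νb p.1 p.2).prod (Measure.dirac (gradOn Ω (Φ p.1) p.2))) ∧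
      ∃ νbb : ℝ → Sp d → Measure (Ioi (0 : ℝ≥0)), IsParamMeasure T Ω νbb ∧
        ∀ᵐ p ∂(volume.restrict (cyl T Ω)),
          (νb p.1 p.2).restrict {y | 0 < y.1} =
            ((νbb p.1 p.2).map Subtype.val).prod (Measure.dirac (U p.1 p.2)) := by
  have h0 := hstrong.ae_relEnergy_eq_zero hΩ hV hW hψ hW_symm hT hS hS₀ hν₀
  have hν := hS.isFiniteEnergyYoung hΩ
  refine ⟨?_, fun t x => ((S t).ν x).map Prod.fst, hν.param.map_fst, ?_, _,
    hν.param.comap_density, ?_⟩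
  · filter_upwards [h0, hS.ae_isRegularState hΩ, hS.poisson, ae_restrict_mem measurableSet_Ioo]
      with t ⟨hk, hf⟩ hreg hP ht
    rw [(hstrong.initial_avg hΩ hT hS₀ hν₀).1] at hP
    have hs := hstrong.isSnapshot hΩ hV hW hψ hT ht
    have cr := hs.density
    have cU := continuousOn_coord hs.velocity.continuousOn
    have cN : ContinuousOn (fun x => ‖U t x‖ ^ 2) (closure Ω) :=
      hs.velocity.continuousOn.norm.pow 2
    obtain ⟨b1, b2, b3, b4⟩ := hs.bar_eq hΩ hreg hP hk hf
    obtain ⟨c1, c2, -⟩ := hreg.of_relField_eq_zero hΩ hs.field.continuousOn hf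
    exact ⟨c1, c2, b1, b2, b3, b4,
      absolutelyContinuous_of_bar_eq hreg.integrableOn_fRho
        (hΩ.integrableOn cr) b1,
      fun i => absolutelyContinuous_of_bar_eq (hreg.integrableOn_fMom i)
        (hΩ.integrableOn (cr.fun_mul (cU i))) (b2 i),
      fun i j => absolutelyContinuous_of_bar_eq (hreg.integrableOn_fConv i j)
        (hΩ.integrableOn (cr.fun_mul ((cU i).fun_mul (cU j)))) (b3 i j),
      absolutelyContinuous_of_bar_eq hreg.integrableOn_fKin
        (hΩ.integrableOn (cr.fun_mul cN)) b4⟩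
  · filter_upwards [hstrong.ae_cyl_support hΩ hS h0] with p ⟨hfin, hF, _⟩
    exact eq_prod_dirac_of_ae hF
  · filter_upwards [hstrong.ae_cyl_support hΩ hS h0] with p ⟨hfin, _, hU⟩
    refine restrict_eq_prod_dirac ((ae_map_iff measurable_fst.aemeasurable ?_).2 hU)
    have : {y : ℝ≥0 × Sp d | 0 < y.1 → y.2 = U p.1 p.2}
        = {y | 0 < y.1}ᶜ ∪ {y | y.2 = U p.1 p.2} := by
      ext y; simp only [mem_ofPred_eq, mem_union, mem_compl_iff]; tauto
    rw [this]
    exact (measurableSet_lt measurable_const measurable_fst).compl.union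
      (measurableSet_eq_fun measurable_snd measurable_const)
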